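/- Conventions. A finite 2-complex is a finite (Hausdorff) CW complex $K$ with no cells of dimension greater than 2, in which the boundary path of each 2-cell is a concatenation of finitely many paths, each of which is a homeomorphism onto a 1-cell (on the interior of the path, onto the open 1-cell); the empty concatenation, i.e. a constant path at a 0-cell, is allowed. The valence of a 1-cell is the total number of times the 2-cells of $K$ run over it. A point $x\in K$ is locally separating if it has a connected neighbourhood $U$ such that $U\setminus\{x\}$ is disconnected. A regularly embedded graph is a non-empty finite graph $\Gamma$ embedded in $K$ such that: (i) $\Gamma$ is disjoint from the 0-skeleton; (ii) its vertex set $V(\Gamma)$ is the intersection of $\Gamma$ with the 1-skeleton; (iii) for every 2-cell with characteristic map $i\colon D\to K$, $D$ a closed 2-disc, $i^{-1}(\Gamma)$ is a finite collection of disjoint properly embedded arcs in $D$ whose endpoints are precisely the points of $\partial D\cap i^{-1}(V(\Gamma))$. A regular cocycle is a regularly embedded graph with a transverse orientation of each arc in each 2-cell (a choice of one of the two sides of the arc), such that near each vertex of $\Gamma$ these transverse orientations all coincide, i.e. they all point in the same direction along the 1-cell that contains the vertex. A subset of $K$ is non-separating if its complement in $K$ is connected. Theorem 3.1. Let $K$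 be a finite connected 2-complex and let $n\ge 0$ be an integer. If $K$ contains $n$ pairwise disjoint regular cocycles whose union is non-separating, then $\pi_1(K)$ admits a surjective homomorphism onto the free group of rank $n$ (the free product of $n$ copies of $\mathbb Z$). Conversely, if $K$ has no locally separating points and no 1-cells of valence 1, and $\pi_1(K)$ admits a surjective homomorphism onto the free group of rank $n$, then $K$ contains $n$ pairwise disjoint regular cocycles whose union is non-separating. -/

import Mathlib

open Set Metric Topology

noncomputable section

namespace Lackenby

variable {X : Type*} [TopologicalSpace X]

/-- The boundary path of a 2-cell `d`, written as a concatenation of `length` paths, the `j`-th of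
which maps the open interval `(j, j+1)` homeomorphically onto the open 1-cell `edge j`.  (A continuous
bijection between open intervals is a homeomorphism, and it extends to the ends.)  `param` is a
parametrization by `[0, length]` of the boundary circle of the disc on which the characteristic map
of `d` is defined.  The empty concatenation is the constant path at a 0-cell. -/
structure BoundaryPath [CWComplex (univ : Set X)]
    (d : RelCWComplex.cell (univ : Set X) 2) where
  length : ℕ
  edge : Fin length → RelCWComplex.cell (univ : Set X) 1
  param : ℝ → (Fin 2 → ℝ)
  continuousOn_param : ContinuousOn param (Icc 0 (length : ℝ))
  param_closed : param length = param 0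
  bijOn_param : 0 < length → BijOn param (Ico 0 (length : ℝ)) (sphere 0 1)
  bijOn_edge : ∀ j : Fin length,
    BijOn (fun t => RelCWComplex.map (C := (univ : Set X)) 2 d (param t))
      (Ioo (j : ℝ) ((j : ℝ) + 1)) (RelCWComplex.openCell (C := (univ : Set X)) 1 (edge j))
  constant : length = 0 → ∃ v : RelCWComplex.cell (univ : Set X) 0,
    MapsTo (RelCWComplex.map (C := (univ : Set X)) 2 d) (sphere 0 1)
      (RelCWComplex.closedCell (C := (univ : Set X)) 0 v)

variable (X) in
/-- The CW structure on `X` is that of a finite 2-complex in which every 2-cell is attached along a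
concatenation of finitely many 1-cells. -/
structure FiniteTwoComplex [CWComplex (univ : Set X)] where
  finite : RelCWComplex.Finite (univ : Set X)
  isEmpty_cell : ∀ n : ℕ, 2 < n → IsEmpty (RelCWComplex.cell (univ : Set X) n)
  boundary : ∀ d : RelCWComplex.cell (univ : Set X) 2, BoundaryPath d

/-- The total number of times that the 2-cells run over the 1-cell `e`. -/
def FiniteTwoComplex.valence [CWComplex (univ : Set X)] (K : FiniteTwoComplex X)
    (e : RelCWComplex.cell (univ : Set X) 1) : ℕ :=
  Nat.card {p : Σ d : RelCWComplex.cell (univ : Set X) 2, Fin (K.boundary d).length //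
    (K.boundary p.1).edge p.2 = e}

/-- The point `x` has a connected neighbourhood `U` such that `U \ {x}` is disconnected. -/
def IsLocallySeparating (x : X) : Prop :=
  ∃ U ∈ 𝓝 x, IsConnected U ∧ ¬ IsPreconnected (U \ {x})

/-- The coordinate in `(-1, 1)` of a point of the open 1-cell `e`. -/
def edgeCoord [CWComplex (univ : Set X)] (e : RelCWComplex.cell (univ : Set X) 1) (x : X) : ℝ :=
  (RelCWComplex.map (C := (univ : Set X)) 1 e).symm x 0

variable (X) in
/-- A non-empty finite graph regularly embedded in a 2-complex.  Its vertices are its points on the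
1-skeleton, and its edges are the images of the arcs `arc d j`, so that `carrier` determines the
graph.  That the endpoints of the arcs in the disc of `d` are precisely the points of the boundary
circle lying over the vertices follows from `preimage_eq` and `arc_mem_sphere_iff`. -/
structure RegularGraph [CWComplex (univ : Set X)] where
  carrier : Set X
  nonempty : carrier.Nonempty
  disjoint_vertex : ∀ v : RelCWComplex.cell (univ : Set X) 0,
    Disjoint carrier (RelCWComplex.closedCell (C := (univ : Set X)) 0 v)
  finite_vertices : ∀ e : RelCWComplex.cell (univ : Set X) 1,
    (carrier ∩ RelCWComplex.openCell (C := (univ : Set X)) 1 e).Finite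
  numArcs : RelCWComplex.cell (univ : Set X) 2 → ℕ
  arc : ∀ d : RelCWComplex.cell (univ : Set X) 2, Fin (numArcs d) → C(unitInterval, Fin 2 → ℝ)
  arc_injective : ∀ d j, Function.Injective (arc d j)
  arc_disjoint : ∀ d, Pairwise fun j k => Disjoint (range (arc d j)) (range (arc d k))
  /-- the arcs are properly embedded -/
  arc_mem_sphere_iff : ∀ d j t, arc d j t ∈ sphere (0 : Fin 2 → ℝ) 1 ↔ t = 0 ∨ t = 1
  preimage_eq : ∀ d,
    closedBall 0 1 ∩ RelCWComplex.map (C := (univ : Set X)) 2 d ⁻¹' carrier =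
      ⋃ j, range (arc d j)

variable (X) in
/-- A regularly embedded graph with a transverse orientation.  A properly embedded arc in a disc has
two sides, the components of its complement; a transverse orientation of the arc is the choice
`posSide` of one of them, towards which it points.  At a vertex of the graph, lying on the open
1-cell `e`, the orientations coincide: there is a direction `dir` of `e` such that for every arc end
at this vertex, the positive side of the arc is where `e` goes in that direction. -/
structure RegularCocycle [CWComplex (univ : Set X)] extends RegularGraph X where
  posSide : ∀ d : RelCWComplex.cell (univ : Set X) 2, Fin (numArcs d) → Set (Fin 2 → ℝ)
  posSide_eq : ∀ d j, ∃ p ∈ closedBall 0 1 \ range (arc d j),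
    posSide d j = connectedComponentIn (closedBall 0 1 \ range (arc d j)) p
  dir : X → ℤˣ
  coincide : ∀ (d : RelCWComplex.cell (univ : Set X) 2) (j : Fin (numArcs d)) (t : unitInterval),
    t = 0 ∨ t = 1 → ∀ e : RelCWComplex.cell (univ : Set X) 1,
    RelCWComplex.map (C := (univ : Set X)) 2 d (arc d j t) ∈
      RelCWComplex.openCell (C := (univ : Set X)) 1 e →
    ∀ᶠ y in 𝓝[sphere 0 1] (arc d j t),
      (y ∈ posSide d j ↔
        0 < ((dir (RelCWComplex.map (C := (univ : Set X)) 2 d (arc d j t)) : ℤ) : ℝ) *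
          (edgeCoord e (RelCWComplex.map (C := (univ : Set X)) 2 d y) -
            edgeCoord e (RelCWComplex.map (C := (univ : Set X)) 2 d (arc d j t))))

variable (X) in
/-- There are `n` pairwise disjoint regular cocycles whose union does not separate. -/
def HasNonseparatingCocycles [CWComplex (univ : Set X)] (n : ℕ) : Prop :=
  ∃ C : Fin n → RegularCocycle X,
    (Pairwise fun i j => Disjoint (C i).carrier (C j).carrier) ∧
      IsConnected (⋃ i, (C i).carrier)ᶜ

end Lackenby

end

/-!
# Disjoint regular cocycles and surjections onto free groups

Both directions go through *homomorphisms on paths* (`PathHom`): functions that send a path in `X`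
to an element of a group `G`, multiplicatively and invariantly under homotopy, that is, functors
from the fundamental groupoid to `G`. Those with values in a free group are compared with families
of cocycles along the 1-cells, where a cocycle is seen as finitely many signed marks.

*From cocycles to a surjection.* Given disjoint cocycles `C i`, label the points of each 1-cell by a
step function with values in the free group which is multiplied by the `i`-th generator, or its
inverse, on crossing `C i` in, or against, its transverse direction. Inside a 2-cell the arcs match
the crossings on the boundary in pairs that are not linked and carry inverse letters, so the word
read around the 2-cell is trivial (`IsStepOn.eq_of_noncrossing`, `word_eq_one_of_family`). A
labelling that is trivial around each 2-cell is the gluing data of a principal bundle with discrete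
fibre (`CechData`), and its holonomy is a `PathHom` with the given values on the 1-cells
(`exists_pathHom_of_word_eq_one`). If the complement of the cocycles is connected, then all its
points on the 1-skeleton are joined to a base point by paths of trivial value
(`reachedRegion_of_notMem`). Hence a short piece of a 1-cell crossing `C i` once closes up to a loop
whose value is the `i`-th generator or its inverse (`exists_loop_of_isStepOn`), and the map is onto.

*From a surjection to cocycles.* A surjection onto a free group extends to a `PathHom` `F`
(`exists_pathHom_of_monoidHom`). Spell the value of `F` on each 1-cell as a word, and mark one point
in the 1-cell for each letter (`exists_isMarking`). The word around each 2-cell is trivial, so its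
letters cancel in pairs that are not linked (`IsMarking.exists_isNoncrossing`). Joining the letters
of each pair by an arc, the arcs being disjoint, gives a `ChordSystem`; its components, the
*tracks*, are regular cocycles (`ChordSystem.regularCocycle`), each belonging to one generator.

It remains to choose `n` tracks that together do not separate. If a union of tracks separates, then
the characteristic function mod 2 of a part of its complement is a step function along the 1-cells
which jumps by the same amount at all points of a track, and a sum of tracks is a coboundary over
`ZMod 2`. So tracks which are linearly independent modulo coboundaries do not separate
(`ChordSystem.hasNonseparatingCocycles_of_linearIndependent`). A function `φ` on the generators
gives a function on the tracks. If the latter is a coboundary, then the homomorphism to `ZMod 2`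
that `φ` defines vanishes on the image of `F` (`PathHom.exists_isFlat`, `IsFlat.val_eq`), which is
everything, so `φ = 0`. Thus functions on the generators embed into the space of functions on the
tracks modulo coboundaries, whose dimension is then at least `n`, and `n` of the tracks are linearly
independent in it (`exists_linearIndependent_mkQ_single`).
-/

noncomputable section

set_option linter.unusedSectionVars false

namespace Lackenby

/-! ### Homomorphisms from the fundamental groupoid -/

/-- A function that is locally constant along a preconnected set is constant on it. -/
lemma eq_of_isPreconnected_of_eventually_eq {α β : Type*} [TopologicalSpace α] {S : Set α}
    (hS : IsPreconnected S) {φ : α → β} (h : ∀ x ∈ S, ∀ᶠ y in 𝓝[S] x, φ y = φ x)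
    {x y : α} (hx : x ∈ S) (hy : y ∈ S) : φ x = φ y := by
  have : PreconnectedSpace S := Subtype.preconnectedSpace hS
  have hl : IsLocallyConstant (fun z : S => φ z) := by
    rw [IsLocallyConstant.iff_eventually_eq]
    rintro ⟨z, hz⟩
    have := h z hz
    rw [nhdsWithin_eq_map_subtype_coe hz, Filter.eventually_map] at this
    exact this
  exact hl.apply_eq_of_isPreconnected isPreconnected_univ (mem_univ (⟨x, hx⟩ : S))
    (mem_univ (⟨y, hy⟩ : S))

/-- A homomorphism from the fundamental groupoid of `X` to the group `G`, as a function on paths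
that is multiplicative and invariant under homotopy relative to the ends.  Only its values at
continuous functions matter. -/
structure PathHom (X G : Type*) [TopologicalSpace X] [Group G] where
  val : (unitInterval → X) → G
  trans : ∀ {x y z : X} (p : Path x y) (q : Path y z), val (p.trans q) = val p * val q
  homotopic : ∀ {x y : X} {p q : Path x y}, p.Homotopic q → val p = val q

namespace PathHom

variable {X G : Type*} [TopologicalSpace X] [Group G] (F : PathHom X G)
variable {E : Type*} [NormedAddCommGroup E] [NormedSpace ℝ E]

lemma val_refl (x : X) : F.val (Path.refl x) = 1 := by
  have := F.trans (Path.refl x) (Path.refl x)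
  rw [Path.refl_trans_refl] at this
  simpa using this

lemma val_const (x : X) : F.val (fun _ => x) = 1 := F.val_refl x

/-- The value at the image under `f` of the straight segment from `x` to `y`. -/
def seg (f : E → X) (x y : E) : G := F.val (fun t => f (AffineMap.lineMap x y (t : ℝ)))

/-- The value at a path that factors through a convex set depends on its ends only. -/
lemma val_comp_eq {S : Set E} (hS : Convex ℝ S) {f : E → X} (hf : ContinuousOn f S)
    {p q : unitInterval → E} (hp : Continuous p) (hq : Continuous q) (hpS : ∀ t, p t ∈ S)
    (hqS : ∀ t, q t ∈ S) (h0 : p 0 = q 0) (h1 : p 1 = q 1) :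
    F.val (fun t => f (p t)) = F.val (fun t => f (q t)) := by
  have : ContractibleSpace S := hS.contractibleSpace ⟨_, hpS 0⟩
  let g : C(S, X) := ⟨S.domRestrict f, hf.domRestrict⟩
  let P : Path (⟨p 0, hpS 0⟩ : S) ⟨p 1, hpS 1⟩ :=
    ⟨⟨fun t => ⟨p t, hpS t⟩, hp.subtype_mk _⟩, rfl, rfl⟩
  let Q : Path (⟨p 0, hpS 0⟩ : S) ⟨p 1, hpS 1⟩ :=
    ⟨⟨fun t => ⟨q t, hqS t⟩, hq.subtype_mk _⟩, Subtype.ext h0.symm, Subtype.ext h1.symm⟩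
  exact F.homotopic ((SimplyConnectedSpace.paths_homotopic P Q).map g)

lemma val_comp_eq_seg {S : Set E} (hS : Convex ℝ S) {f : E → X} (hf : ContinuousOn f S)
    {p : unitInterval → E} (hp : Continuous p) (hpS : ∀ t, p t ∈ S) :
    F.val (fun t => f (p t)) = F.seg f (p 0) (p 1) := by
  refine F.val_comp_eq hS hf hp ?_ hpS ?_ (by simp) (by simp)
  · exact AffineMap.lineMap_continuous.comp continuous_subtype_val
  · intro t
    exact hS.lineMap_mem (hpS 0) (hpS 1) t.2

lemma seg_self (f : E → X) (x : E) : F.seg f x x = 1 := by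
  simp only [seg, AffineMap.lineMap_same_apply]
  exact F.val_const _

lemma seg_trans {S : Set E} (hS : Convex ℝ S) {f : E → X} (hf : ContinuousOn f S) {x y z : E}
    (hx : x ∈ S) (hy : y ∈ S) (hz : z ∈ S) : F.seg f x y * F.seg f y z = F.seg f x z := by
  have hc : ∀ a b : E, Continuous fun t : unitInterval => (AffineMap.lineMap a b (t : ℝ) : E) :=
    fun a b => AffineMap.lineMap_continuous.comp continuous_subtype_val
  let seg' : ∀ a b : E, Path a b := fun a b => ⟨⟨_, hc a b⟩, by simp, by simp⟩
  have hm : ∀ {a b : E}, a ∈ S → b ∈ S → ∀ t, seg' a b t ∈ S := fun ha hb t =>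
    hS.lineMap_mem ha hb t.2
  have hfc : ∀ {a b : E}, a ∈ S → b ∈ S → Continuous fun t => f (seg' a b t) := fun ha hb =>
    hf.comp_continuous (seg' _ _).continuous (hm ha hb)
  let P : Path (f x) (f y) := ⟨⟨_, hfc hx hy⟩, by simp, by simp⟩
  let Q : Path (f y) (f z) := ⟨⟨_, hfc hy hz⟩, by simp, by simp⟩
  have key : F.val (P.trans Q) = F.val (fun t => f (((seg' x y).trans (seg' y z)) t)) := by
    congr 1
    funext t
    simp only [Path.trans_apply]
    split_ifs <;> rfl
  have hmem : ∀ t, ((seg' x y).trans (seg' y z)) t ∈ S := by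
    intro t
    simp only [Path.trans_apply]
    split_ifs
    exacts [hm hx hy _, hm hy hz _]
  have h2 := F.val_comp_eq_seg hS hf ((seg' x y).trans (seg' y z)).continuous hmem
  rw [Path.source, Path.target] at h2
  rw [← h2, ← key, F.trans]
  rfl

lemma seg_symm {S : Set E} (hS : Convex ℝ S) {f : E → X} (hf : ContinuousOn f S) {x y : E}
    (hx : x ∈ S) (hy : y ∈ S) : F.seg f y x = (F.seg f x y)⁻¹ := by
  rw [eq_inv_iff_mul_eq_one, F.seg_trans hS hf hy hx hy, F.seg_self]

lemma seg_comp {E' : Type*} [NormedAddCommGroup E'] [NormedSpace ℝ E'] {S : Set E}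
    (hS : Convex ℝ S) {f : E → X} (hf : ContinuousOn f S) {T : Set E'} (hT : Convex ℝ T)
    {g : E' → E} (hg : ContinuousOn g T) (hgS : MapsTo g T S) {x y : E'} (hx : x ∈ T)
    (hy : y ∈ T) : F.seg (fun z => f (g z)) x y = F.seg f (g x) (g y) := by
  have hc : Continuous fun t : unitInterval => (AffineMap.lineMap x y (t : ℝ) : E') :=
    AffineMap.lineMap_continuous.comp continuous_subtype_val
  have := F.val_comp_eq_seg hS hf (p := fun t : unitInterval => g (AffineMap.lineMap x y (t : ℝ)))
    (hg.comp_continuous hc fun t => hT.lineMap_mem hx hy t.2)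
    (fun t => hgS (hT.lineMap_mem hx hy t.2))
  simpa [seg] using this

lemma seg_congr {S : Set E} (hS : Convex ℝ S) {f g : E → X} (h : EqOn f g S) {x y : E}
    (hx : x ∈ S) (hy : y ∈ S) : F.seg f x y = F.seg g x y := by
  unfold seg
  congr 1
  funext t
  exact h (hS.lineMap_mem hx hy t.2)

/-- The two ways around a square. -/
lemma seg_square {f : ℝ × ℝ → X} {a b c d : ℝ} (hab : a ≤ b) (hcd : c ≤ d)
    (hf : ContinuousOn f (Icc a b ×ˢ Icc c d)) :
    F.seg (fun s => f (s, c)) a b * F.seg (fun t => f (b, t)) c d =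
      F.seg (fun t => f (a, t)) c d * F.seg (fun s => f (s, d)) a b := by
  have hS : Convex ℝ (Icc a b ×ˢ Icc c d) := (convex_Icc a b).prod (convex_Icc c d)
  have ha := left_mem_Icc.2 hab
  have hb := right_mem_Icc.2 hab
  have hc := left_mem_Icc.2 hcd
  have hd := right_mem_Icc.2 hcd
  rw [F.seg_comp hS hf (convex_Icc a b) (g := fun s => (s, c)) (by fun_prop)
      (fun s hs => ⟨hs, hc⟩) ha hb,
    F.seg_comp hS hf (convex_Icc a b) (g := fun s => (s, d)) (by fun_prop)
      (fun s hs => ⟨hs, hd⟩) ha hb,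
    F.seg_comp hS hf (convex_Icc c d) (g := fun s => (a, s)) (by fun_prop)
      (fun s hs => ⟨ha, hs⟩) hc hd,
    F.seg_comp hS hf (convex_Icc c d) (g := fun s => (b, s)) (by fun_prop)
      (fun s hs => ⟨hb, hs⟩) hc hd,
    F.seg_trans hS hf ⟨ha, hc⟩ ⟨hb, hc⟩ ⟨hb, hd⟩, F.seg_trans hS hf ⟨ha, hc⟩ ⟨ha, hd⟩ ⟨hb, hd⟩]

/-- If short pieces of a path have their values in `h s * H * (h t)⁻¹`, then so has the path. -/
lemma seg_mem_of_locally {γ : ℝ → X} {a b : ℝ} (hab : a ≤ b) (hγ : ContinuousOn γ (Icc a b))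
    (h : ℝ → G) (H : Subgroup G)
    (loc : ∀ t ∈ Icc a b, ∀ᶠ s in 𝓝[Icc a b] t, (h t)⁻¹ * F.seg γ t s * h s ∈ H) :
    (h a)⁻¹ * F.seg γ a b * h b ∈ H := by
  have ha := left_mem_Icc.2 hab
  have key := eq_of_isPreconnected_of_eventually_eq (isPreconnected_Icc (a := a) (b := b))
    (φ := fun s => ((h a)⁻¹ * F.seg γ a s * h s ∈ H)) ?_ ha (right_mem_Icc.2 hab)
  · rw [← key, F.seg_self]
    simp
  · intro t ht
    filter_upwards [loc t ht, self_mem_nhdsWithin] with s hs hsI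
    rw [← F.seg_trans (convex_Icc a b) hγ ha ht hsI]
    have : (h a)⁻¹ * (F.seg γ a t * F.seg γ t s) * h s =
      ((h a)⁻¹ * F.seg γ a t * h t) * ((h t)⁻¹ * F.seg γ t s * h s) := by group
    rw [this]
    exact propext (H.mul_mem_cancel_right hs)

lemma val_eq_seg {x y : X} (p : Path x y) : F.val p = F.seg p.extend 0 1 := by
  unfold seg
  congr 1
  funext t
  simp [AffineMap.lineMap_apply]

end PathHom

section Cech

variable {X G ι : Type*} [TopologicalSpace X] [Group G]

/-- An open cover of `X` with a `G`-valued function on each member, such that on overlaps the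
functions differ locally by a constant (on the right).  It describes a principal `G`-bundle over `X`
for the discrete group `G`, whose fibres are identified with `G` in an arbitrary way. -/
structure CechData (X G ι : Type*) [TopologicalSpace X] [Group G] where
  U : ι → Set X
  isOpen : ∀ i, IsOpen (U i)
  h : ι → X → G
  index : X → ι
  mem_index : ∀ x, x ∈ U (index x)
  loc : ∀ i j x, x ∈ U i → x ∈ U j →
    ∀ᶠ y in 𝓝 x, (h i y)⁻¹ * h j y = (h i x)⁻¹ * h j x

namespace CechData

variable (D : CechData X G ι)

/-- `Λ` describes a lift of `γ` to the bundle. -/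
def IsLift {T : Type*} [TopologicalSpace T] (γ : T → X) (Λ : T → G) : Prop :=
  ∀ t, ∀ i, γ t ∈ D.U i → ∀ᶠ s in 𝓝 t, Λ s * D.h i (γ s) = Λ t * D.h i (γ t)

variable {T : Type*} [TopologicalSpace T]

lemma isLift_of_exists {γ : T → X} (hγ : Continuous γ) {Λ : T → G}
    (h : ∀ t, ∃ i, γ t ∈ D.U i ∧ ∀ᶠ s in 𝓝 t, Λ s * D.h i (γ s) = Λ t * D.h i (γ t)) :
    D.IsLift γ Λ := by
  intro t j hj
  obtain ⟨i, hi, he⟩ := h t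
  filter_upwards [he, hγ.continuousAt.eventually (D.loc i j _ hi hj)] with s h1 h2
  calc Λ s * D.h j (γ s) = (Λ s * D.h i (γ s)) * ((D.h i (γ s))⁻¹ * D.h j (γ s)) := by group
    _ = _ := by rw [h1, h2]; group

lemma IsLift.comp {D : CechData X G ι} {γ : T → X} {Λ : T → G} (h : D.IsLift γ Λ) {S : Type*}
    [TopologicalSpace S] {f : S → T} (hf : Continuous f) :
    D.IsLift (fun s => γ (f s)) (fun s => Λ (f s)) :=
  fun s i hi => hf.continuousAt.eventually (h (f s) i hi)

lemma IsLift.inv_mul_eq {D : CechData X G ι} [PreconnectedSpace T] {γ : T → X} {Λ Λ' : T → G}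
    (h : D.IsLift γ Λ) (h' : D.IsLift γ Λ') (s t : T) :
    (Λ s)⁻¹ * Λ t = (Λ' s)⁻¹ * Λ' t := by
  have := eq_of_isPreconnected_of_eventually_eq (isPreconnected_univ (α := T))
    (φ := fun s => Λ s * (Λ' s)⁻¹) ?_ (mem_univ s) (mem_univ t)
  · have e : Λ t = (Λ s * (Λ' s)⁻¹) * Λ' t := by
      rw [this]
      group
    rw [e]
    group
  · intro t _
    rw [nhdsWithin_univ]
    have hi := D.mem_index (γ t)
    filter_upwards [h t _ hi, h' t _ hi] with s h1 h2
    calc Λ s * (Λ' s)⁻¹ = (Λ s * D.h (D.index (γ t)) (γ s)) *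
        (Λ' s * D.h (D.index (γ t)) (γ s))⁻¹ := by group
      _ = _ := by rw [h1, h2]; group

/-- The bundle described by `D`. -/
def core [TopologicalSpace G] [DiscreteTopology G] : FiberBundleCore ι X G where
  baseSet := D.U
  isOpen_baseSet := D.isOpen
  indexAt := D.index
  mem_baseSet_at := D.mem_index
  coordChange i j x v := v * ((D.h i x)⁻¹ * D.h j x)
  coordChange_self i x _ v := by simp
  continuousOn_coordChange i j := by
    rintro ⟨x, v⟩ ⟨⟨hi, hj⟩, -⟩
    apply ContinuousAt.continuousWithinAt
    have hev : (fun p : X × G => p.2 * ((D.h i p.1)⁻¹ * D.h j p.1)) =ᶠ[𝓝 (x, v)]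
        fun p => p.2 * ((D.h i x)⁻¹ * D.h j x) := by
      filter_upwards [continuous_fst.continuousAt.eventually (D.loc i j x hi hj)] with p hp
      rw [hp]
    refine ContinuousAt.congr ?_ hev.symm
    exact (continuous_of_discreteTopology (f := fun g : G => g * ((D.h i x)⁻¹ * D.h j x))).comp
      continuous_snd |>.continuousAt
  coordChange_comp i j k x _ v := by group

lemma exists_isLift [SimplyConnectedSpace T] [LocallyPathConnectedSpace T] {γ : T → X}
    (hγ : Continuous γ) : ∃ Λ, D.IsLift γ Λ := by
  let _ : TopologicalSpace G := ⊥
  have : DiscreteTopology G := ⟨rfl⟩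
  let Z := D.core
  have cov : IsCoveringMap Z.proj := FiberBundle.isCoveringMap
  obtain ⟨t₀⟩ : Nonempty T := inferInstance
  obtain ⟨L, ⟨-, hL⟩, -⟩ := cov.existsUnique_continuousMap_lifts ⟨γ, hγ⟩ t₀
    (⟨γ t₀, (1 : G)⟩ : Z.TotalSpace) rfl
  have hp : ∀ t, (L t).1 = γ t := fun t => congrFun hL t
  have hcoord : ∀ i (z : Z.TotalSpace), (Z.localTriv i z).2 =
    (show G from z.2) * ((D.h (D.index z.1) z.1)⁻¹ * D.h i z.1) := fun i z => rfl
  refine ⟨fun t => (show G from (L t).2) * (D.h (D.index (γ t)) (γ t))⁻¹, ?_⟩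
  intro t i hi
  have hmem : L t ∈ (Z.localTriv i).source := by
    rw [(Z.localTriv i).mem_source]
    change (L t).1 ∈ D.U i
    rwa [hp]
  have hc : ContinuousAt (fun s => (Z.localTriv i (L s)).2) t := by
    have h1 : ContinuousAt (Z.localTriv i) (L t) :=
      (Z.localTriv i).toOpenPartialHomeomorph.continuousAt hmem
    exact (continuous_snd.continuousAt).comp (h1.comp L.continuous.continuousAt)
  have := hc.eventually (mem_nhds_discrete.2 (mem_singleton (Z.localTriv i (L t)).2))
  filter_upwards [this] with s hs
  replace hs : (Z.localTriv i (L s)).2 = (Z.localTriv i (L t)).2 := hs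
  rw [hcoord, hcoord, hp, hp] at hs
  change (show G from (L s).2) * _ * _ = (show G from (L t).2) * _ * _
  rw [mul_assoc, mul_assoc]
  exact hs

lemma exists_isLift_unitInterval {γ : unitInterval → X} (hγ : Continuous γ) :
    ∃ Λ, D.IsLift γ Λ := by
  obtain ⟨Λ, hΛ⟩ := D.exists_isLift (T := ℝ) (γ := fun t => γ (projIcc 0 1 zero_le_one t))
    (hγ.comp continuous_projIcc)
  exact ⟨_, by simpa using hΛ.comp (f := fun t : unitInterval => (t : ℝ)) (by fun_prop)⟩

lemma exists_isLift_square {γ : unitInterval × unitInterval → X} (hγ : Continuous γ) :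
    ∃ Λ, D.IsLift γ Λ := by
  obtain ⟨Λ, hΛ⟩ := D.exists_isLift (T := ℝ × ℝ)
    (γ := fun t => γ (projIcc 0 1 zero_le_one t.1, projIcc 0 1 zero_le_one t.2))
    (hγ.comp ((continuous_projIcc.comp continuous_fst).prodMk
      (continuous_projIcc.comp continuous_snd)))
  have := hΛ.comp
    (f := fun t : unitInterval × unitInterval => ((t.1 : ℝ), (t.2 : ℝ))) (by fun_prop)
  exact ⟨_, by simpa using this⟩

open Classical in
/-- The holonomy of the bundle described by `D`. -/
def holonomyFun (γ : unitInterval → X) : G :=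
  if h : ∃ Λ, D.IsLift γ Λ then (h.choose 0)⁻¹ * h.choose 1 else 1

lemma holonomyFun_eq {γ : unitInterval → X} {Λ : unitInterval → G} (h : D.IsLift γ Λ) :
    D.holonomyFun γ = (Λ 0)⁻¹ * Λ 1 := by
  have hex : ∃ Λ, D.IsLift γ Λ := ⟨Λ, h⟩
  rw [holonomyFun, dif_pos hex]
  exact hex.choose_spec.inv_mul_eq h 0 1

/-- The holonomy of the bundle described by `D`. -/
def holonomy : PathHom X G where
  val := D.holonomyFun
  trans {x y z} p q := by
    obtain ⟨Λ, hΛ⟩ := D.exists_isLift_unitInterval (p.trans q).continuous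
    have h1 := hΛ.comp (f := fun t : unitInterval =>
      (⟨t / 2, by constructor <;> linarith [t.2.1, t.2.2]⟩ : unitInterval)) (by fun_prop)
    have h2 := hΛ.comp (f := fun t : unitInterval =>
      (⟨(t + 1) / 2, by constructor <;> linarith [t.2.1, t.2.2]⟩ : unitInterval)) (by fun_prop)
    have e1 : ∀ t : unitInterval,
        p.trans q ⟨t / 2, by constructor <;> linarith [t.2.1, t.2.2]⟩ = p t := by
      intro t
      have : (t : ℝ) / 2 ≤ 1 / 2 := by linarith [t.2.2]
      rw [Path.trans_apply, dif_pos this]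
      congr 1
      ext
      dsimp
      ring
    have e2 : ∀ t : unitInterval,
        p.trans q ⟨(t + 1) / 2, by constructor <;> linarith [t.2.1, t.2.2]⟩ = q t := by
      intro t
      by_cases ht : (t : ℝ) = 0
      · have ht' : t = 0 := Subtype.ext ht
        subst ht'
        rw [Path.trans_apply, dif_pos (by simp)]
        have : (⟨2 * ((((0 : unitInterval) : ℝ) + 1) / 2), by norm_num⟩ : unitInterval) = 1 := by
          ext; norm_num
        simp only [this]
        simp
      · have h0 : 0 < (t : ℝ) := lt_of_le_of_ne t.2.1 (Ne.symm ht)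
        rw [Path.trans_apply, dif_neg (by dsimp; linarith)]
        congr 1
        ext
        dsimp
        ring
    simp only [e1] at h1
    simp only [e2] at h2
    rw [D.holonomyFun_eq hΛ, D.holonomyFun_eq h1, D.holonomyFun_eq h2]
    have a0 : (⟨((0 : unitInterval) : ℝ) / 2, by norm_num⟩ : unitInterval) = 0 := by ext; simp
    have a1 : (⟨(((1 : unitInterval) : ℝ) + 1) / 2, by norm_num⟩ : unitInterval) = 1 := by
      ext; simp
    have a2 : (⟨(((0 : unitInterval) : ℝ) + 1) / 2, by norm_num⟩ : unitInterval) =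
      ⟨((1 : unitInterval) : ℝ) / 2, by norm_num⟩ := by ext; simp
    rw [a0, a1, a2]
    group
  homotopic {x y p q} := by
    rintro ⟨H⟩
    obtain ⟨Λ, hΛ⟩ := D.exists_isLift_square H.continuous
    have hp := hΛ.comp (f := fun t : unitInterval => ((0 : unitInterval), t)) (by fun_prop)
    have hq := hΛ.comp (f := fun t : unitInterval => ((1 : unitInterval), t)) (by fun_prop)
    have hl := hΛ.comp (f := fun t : unitInterval => (t, (0 : unitInterval))) (by fun_prop)
    have hr := hΛ.comp (f := fun t : unitInterval => (t, (1 : unitInterval))) (by fun_prop)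
    have hconst : ∀ w : X, D.IsLift (fun _ : unitInterval => w) (fun _ => 1) :=
      fun w t i hi => Filter.Eventually.of_forall fun s => rfl
    have el : ∀ t, H (t, 0) = x := H.source
    have er : ∀ t, H (t, 1) = y := H.target
    simp only [ContinuousMap.HomotopyWith.apply_zero, el, er,
      ContinuousMap.HomotopyWith.apply_one] at hp hq hl hr
    have h1 := hl.inv_mul_eq (hconst x) 0 1
    have h2 := hr.inv_mul_eq (hconst y) 0 1
    simp only [inv_one, mul_one, inv_mul_eq_one] at h1 h2
    change D.holonomyFun (p : unitInterval → X) = D.holonomyFun (q : unitInterval → X)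
    rw [D.holonomyFun_eq (γ := p) hp, D.holonomyFun_eq (γ := q) hq]
    rw [h1, h2]

lemma holonomy_val_eq {γ : unitInterval → X} {Λ : unitInterval → G} (h : D.IsLift γ Λ) :
    D.holonomy.val γ = (Λ 0)⁻¹ * Λ 1 := D.holonomyFun_eq h

end CechData

end Cech

section FundamentalGroup

variable {X G : Type*} [TopologicalSpace X] [Group G]

/-- The restriction of a groupoid homomorphism to the loops at `b`.  The inverse is there because
the product in `FundamentalGroup` composes paths in the opposite order. -/
def PathHom.toMonoidHom (F : PathHom X G) (b : X) : FundamentalGroup X b →* G where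
  toFun p := (Quotient.lift (fun q : Path b b => (F.val q)⁻¹)
    (fun _ _ h => congrArg _ (F.homotopic h)) p.toPath)
  map_one' := by
    change (F.val (Path.refl b))⁻¹ = 1
    rw [F.val_refl, inv_one]
  map_mul' p q := by
    induction p using Path.Homotopic.Quotient.ind with | mk p =>
    induction q using Path.Homotopic.Quotient.ind with | mk q =>
    change (F.val (q.trans p))⁻¹ = (F.val p)⁻¹ * (F.val q)⁻¹
    rw [F.trans, mul_inv_rev]

lemma PathHom.toMonoidHom_apply (F : PathHom X G) {b : X} (p : Path b b) :
    F.toMonoidHom b (FundamentalGroup.fromPath (Path.Homotopic.Quotient.mk p)) = (F.val p)⁻¹ := rfl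

/-- A homomorphism from the fundamental group extends to the groupoid. -/
lemma exists_pathHom_of_monoidHom [PathConnectedSpace X] {b : X} (f : FundamentalGroup X b →* G) :
    ∃ F : PathHom X G, ∀ b' g, g ∈ f.range → ∃ p : Path b' b', F.val p = g := by
  classical
  let c : ∀ x, Path.Homotopic.Quotient b x := fun x =>
    Path.Homotopic.Quotient.mk (PathConnectedSpace.somePath b x)
  let w : ∀ {x y : X}, Path.Homotopic.Quotient x y → G := fun {x y} p =>
    (f (FundamentalGroup.fromPath (((c x).trans p).trans (c y).symm)))⁻¹
  let v : (unitInterval → X) → G := fun γ => if h : Continuous γ then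
    w (Path.Homotopic.Quotient.mk (⟨⟨γ, h⟩, rfl, rfl⟩ : Path (γ 0) (γ 1))) else 1
  have hv' : ∀ (γ : C(unitInterval, X)) (x y : X) (h0 : γ 0 = x) (h1 : γ 1 = y),
      v γ = w (Path.Homotopic.Quotient.mk (⟨γ, h0, h1⟩ : Path x y)) := by
    rintro γ x y rfl rfl
    exact dif_pos γ.continuous
  have hv : ∀ {x y : X} (p : Path x y), v p = w (Path.Homotopic.Quotient.mk p) :=
    fun {x y} p => hv' p.toContinuousMap x y p.source p.target
  have hcancel : ∀ {x y z : X} (p : Path.Homotopic.Quotient x y)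
      (q : Path.Homotopic.Quotient y z), p.symm.trans (p.trans q) = q := by
    intro x y z p q
    rw [← Path.Homotopic.Quotient.trans_assoc]
    simp
  have hcancel' : ∀ {x y z : X} (p : Path.Homotopic.Quotient x y)
      (q : Path.Homotopic.Quotient x z), p.trans (p.symm.trans q) = q := by
    intro x y z p q
    rw [← Path.Homotopic.Quotient.trans_assoc]
    simp
  have hw : ∀ {x y z : X} (p : Path.Homotopic.Quotient x y) (q : Path.Homotopic.Quotient y z),
      w (p.trans q) = w p * w q := by
    intro x y z p q
    change (f _)⁻¹ = (f _)⁻¹ * (f _)⁻¹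
    rw [← mul_inv_rev, ← map_mul]
    congr 2
    change (((c x).trans (p.trans q)).trans (c z).symm) =
      (((c x).trans p).trans (c y).symm).trans (((c y).trans q).trans (c z).symm)
    simp [hcancel]
  refine ⟨⟨v, fun p q => ?_, fun {x y p q} h => ?_⟩, fun b' g hg => ?_⟩
  · rw [hv, hv, hv, Path.Homotopic.Quotient.mk_trans, hw]
  · rw [hv, hv, Path.Homotopic.Quotient.eq.2 h]
  · obtain ⟨a, ha⟩ := (f.range.inv_mem hg)
    obtain ⟨p, hp⟩ := Path.Homotopic.Quotient.mk_surjective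
      ((((c b').symm.trans a.toPath).trans (c b')))
    refine ⟨p, ?_⟩
    change v p = g
    rw [hv, hp]
    change (f _)⁻¹ = g
    rw [inv_eq_iff_eq_inv, ← ha]
    congr 1
    change (((c b').trans (((c b').symm.trans a.toPath).trans (c b'))).trans (c b').symm) = a.toPath
    simp [hcancel']

end FundamentalGroup

/-! ### Cells of a 2-complex -/

section Cells

variable {X : Type*} [TopologicalSpace X] [CWComplex (univ : Set X)]

/-- The cells of dimension `n`. -/
abbrev Cell (X : Type*) [TopologicalSpace X] [CWComplex (univ : Set X)] (n : ℕ) :=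
  RelCWComplex.cell (univ : Set X) n

/-- The characteristic map of a cell. -/
abbrev chi (n : ℕ) (c : Cell X n) : (Fin n → ℝ) → X := RelCWComplex.map (C := (univ : Set X)) n c

/-- The point that is the 0-cell `v`. -/
def vert (v : Cell X 0) : X := chi 0 v 0

/-- The characteristic map of the 1-cell `e`, as a function on `[-1, 1]`. -/
def edgePt (e : Cell X 1) (t : ℝ) : X := chi 1 e (fun _ => t)

lemma closedCell_zero (v : Cell X 0) :
    RelCWComplex.closedCell (C := (univ : Set X)) 0 v = {vert v} := by
  rw [RelCWComplex.closedCell_zero_eq_singleton]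
  congr 2
  exact Subsingleton.elim _ _

lemma openCell_zero (v : Cell X 0) :
    RelCWComplex.openCell (C := (univ : Set X)) 0 v = {vert v} := by
  rw [RelCWComplex.openCell_zero_eq_singleton]
  congr 2
  exact Subsingleton.elim _ _

lemma fin_one_eq_const (z : Fin 1 → ℝ) : z = fun _ => z 0 := by
  funext i
  rw [Subsingleton.elim i 0]

lemma norm_fin_one (t : ℝ) : ‖(fun _ => t : Fin 1 → ℝ)‖ = |t| := by
  rw [pi_norm_const, Real.norm_eq_abs]

lemma const_mem_ball_iff {t : ℝ} : (fun _ => t : Fin 1 → ℝ) ∈ ball 0 1 ↔ t ∈ Ioo (-1) 1 := by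
  rw [mem_ball_zero_iff, norm_fin_one, abs_lt, mem_Ioo]

lemma const_mem_closedBall_iff {t : ℝ} :
    (fun _ => t : Fin 1 → ℝ) ∈ closedBall 0 1 ↔ t ∈ Icc (-1) 1 := by
  rw [mem_closedBall_zero_iff, norm_fin_one, abs_le, mem_Icc]

lemma chi_continuousOn (n : ℕ) (c : Cell X n) : ContinuousOn (chi n c) (closedBall 0 1) :=
  RelCWComplex.continuousOn n c

lemma chi_injOn (n : ℕ) (c : Cell X n) : InjOn (chi n c) (ball 0 1) := by
  have := (RelCWComplex.map (C := (univ : Set X)) n c).injOn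
  rwa [RelCWComplex.source_eq] at this

lemma edgePt_continuousOn (e : Cell X 1) : ContinuousOn (edgePt e) (Icc (-1) 1) :=
  (chi_continuousOn 1 e).comp (by fun_prop) fun _ ht => const_mem_closedBall_iff.2 ht

lemma edgePt_mem_openCell (e : Cell X 1) {t : ℝ} (ht : t ∈ Ioo (-1) 1) :
    edgePt e t ∈ RelCWComplex.openCell (C := (univ : Set X)) 1 e :=
  mem_image_of_mem _ (const_mem_ball_iff.2 ht)

lemma mem_openCell_one_iff {e : Cell X 1} {x : X} :
    x ∈ RelCWComplex.openCell (C := (univ : Set X)) 1 e ↔ ∃ t ∈ Ioo (-1) 1, x = edgePt e t := by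
  constructor
  · rintro ⟨z, hz, rfl⟩
    rw [fin_one_eq_const z] at hz ⊢
    exact ⟨z 0, const_mem_ball_iff.1 hz, rfl⟩
  · rintro ⟨t, ht, rfl⟩
    exact edgePt_mem_openCell e ht

lemma edgeCoord_edgePt (e : Cell X 1) {t : ℝ} (ht : t ∈ Ioo (-1) 1) :
    edgeCoord e (edgePt e t) = t := by
  unfold edgeCoord edgePt
  rw [(RelCWComplex.map (C := (univ : Set X)) 1 e).left_inv]
  rw [RelCWComplex.source_eq]
  exact const_mem_ball_iff.2 ht

lemma edgeCoord_continuousOn (e : Cell X 1) :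
    ContinuousOn (edgeCoord e) (RelCWComplex.openCell (C := (univ : Set X)) 1 e) := by
  have h : (RelCWComplex.map (C := (univ : Set X)) 1 e).target =
      RelCWComplex.openCell (C := (univ : Set X)) 1 e := by
    rw [← PartialEquiv.image_source_eq_target, RelCWComplex.source_eq]
    rfl
  have := RelCWComplex.continuousOn_symm (C := (univ : Set X)) 1 e
  rw [h] at this
  exact (continuous_apply 0).comp_continuousOn this

lemma cell_eq_of_chi_eq {n m : ℕ} {c : Cell X n} {c' : Cell X m} {z : Fin n → ℝ}
    {z' : Fin m → ℝ} (hz : z ∈ ball 0 1) (hz' : z' ∈ ball 0 1) (h : chi n c z = chi m c' z') :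
    (⟨n, c⟩ : Σ n, Cell X n) = ⟨m, c'⟩ := by
  by_contra hne
  exact (RelCWComplex.disjoint_openCell_of_ne hne).le_bot
    ⟨mem_image_of_mem (chi n c) hz, h ▸ mem_image_of_mem (chi m c') hz'⟩

lemma vert_injective : Function.Injective (vert : Cell X 0 → X) := by
  intro v w h
  have := cell_eq_of_chi_eq (z := 0) (z' := 0) (by simp) (by simp) h
  simpa using this

lemma edgePt_injective {e e' : Cell X 1} {t t' : ℝ} (ht : t ∈ Ioo (-1) 1) (ht' : t' ∈ Ioo (-1) 1)
    (h : edgePt e t = edgePt e' t') : e = e' ∧ t = t' := by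
  have h1 := cell_eq_of_chi_eq (const_mem_ball_iff.2 ht) (const_mem_ball_iff.2 ht') h
  obtain rfl : e = e' := by simpa using h1
  exact ⟨rfl, by rw [← edgeCoord_edgePt e ht, h, edgeCoord_edgePt e ht']⟩

lemma disc_injective {d d' : Cell X 2} {z z' : Fin 2 → ℝ} (hz : z ∈ ball 0 1)
    (hz' : z' ∈ ball 0 1) (h : chi 2 d z = chi 2 d' z') : d = d' ∧ z = z' := by
  have h1 := cell_eq_of_chi_eq hz hz' h
  obtain rfl : d = d' := by simpa using h1
  exact ⟨rfl, chi_injOn 2 d hz hz' h⟩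

lemma vert_ne_edgePt {v : Cell X 0} {e : Cell X 1} {t : ℝ} (ht : t ∈ Ioo (-1) 1) :
    vert v ≠ edgePt e t := by
  intro h
  have := cell_eq_of_chi_eq (z := 0) (by simp) (const_mem_ball_iff.2 ht) h
  simpa using congrArg Sigma.fst this

lemma disc_ne_vert {d : Cell X 2} {v : Cell X 0} {z : Fin 2 → ℝ} (hz : z ∈ ball 0 1) :
    chi 2 d z ≠ vert v := by
  intro h
  have := cell_eq_of_chi_eq (z' := 0) hz (by simp) h
  simpa using congrArg Sigma.fst this

lemma disc_ne_edgePt {d : Cell X 2} {e : Cell X 1} {t : ℝ} {z : Fin 2 → ℝ} (hz : z ∈ ball 0 1)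
    (ht : t ∈ Ioo (-1) 1) : chi 2 d z ≠ edgePt e t := by
  intro h
  have := cell_eq_of_chi_eq hz (const_mem_ball_iff.2 ht) h
  simpa using congrArg Sigma.fst this

lemma exists_vert_eq_edgePt (e : Cell X 1) :
    (∃ v, edgePt e (-1) = vert v) ∧ ∃ v, edgePt e 1 = vert v := by
  obtain ⟨x, y, h⟩ := CWComplex.exists_cellFrontier_one_eq e
  rw [closedCell_zero, closedCell_zero] at h
  have key : ∀ t : ℝ, |t| = 1 → ∃ v, edgePt e t = vert v := by
    intro t ht
    have : edgePt e t ∈ RelCWComplex.cellFrontier (C := (univ : Set X)) 1 e :=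
      mem_image_of_mem _ (by rw [mem_sphere_zero_iff_norm, norm_fin_one, ht])
    rw [h] at this
    rcases this with h | h
    exacts [⟨x, h⟩, ⟨y, h⟩]
  exact ⟨key _ (by simp), key _ (by simp)⟩

variable (X) in
/-- The 1-skeleton. -/
def oneSkel : Set X := {x | (∃ v, x = vert v) ∨ ∃ e, ∃ t ∈ Ioo (-1 : ℝ) 1, x = edgePt e t}

lemma vert_mem_oneSkel (v : Cell X 0) : vert v ∈ oneSkel X := Or.inl ⟨v, rfl⟩

lemma edgePt_mem_oneSkel (e : Cell X 1) {t : ℝ} (ht : t ∈ Icc (-1) 1) :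
    edgePt e t ∈ oneSkel X := by
  rcases eq_or_lt_of_le ht.1 with rfl | h1
  · exact Or.inl (exists_vert_eq_edgePt e).1
  rcases eq_or_lt_of_le ht.2 with rfl | h2
  · exact Or.inl (exists_vert_eq_edgePt e).2
  exact Or.inr ⟨e, t, ⟨h1, h2⟩, rfl⟩

lemma disc_notMem_oneSkel {d : Cell X 2} {z : Fin 2 → ℝ} (hz : z ∈ ball 0 1) :
    chi 2 d z ∉ oneSkel X := by
  rintro (⟨v, h⟩ | ⟨e, t, ht, h⟩)
  · exact disc_ne_vert hz h
  · exact disc_ne_edgePt hz ht h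

lemma ball_union_sphere_of_mem_closedBall {n : ℕ} {z : Fin n → ℝ} (hz : z ∈ closedBall 0 1) :
    z ∈ ball (0 : Fin n → ℝ) 1 ∨ z ∈ sphere (0 : Fin n → ℝ) 1 := by
  rw [← ball_union_sphere] at hz
  exact hz

lemma exists_chi (x : X) :
    ∃ c : Σ n, Cell X n, ∃ z ∈ ball (0 : Fin c.1 → ℝ) 1, x = chi c.1 c.2 z := by
  have h : x ∈ ⋃ (n : ℕ) (j : Cell X n), RelCWComplex.openCell (C := (univ : Set X)) n j := by
    rw [CWComplex.iUnion_openCell_eq_complex]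
    trivial
  simp only [mem_iUnion] at h
  obtain ⟨n, c, z, hz, rfl⟩ := h
  exact ⟨⟨n, c⟩, z, hz, rfl⟩

/-- The characteristic map of a 2-cell sends the boundary circle to the 1-skeleton. -/
lemma sphere_mem_oneSkel {d : Cell X 2} {z : Fin 2 → ℝ}
    (hz : z ∈ sphere (0 : Fin 2 → ℝ) 1) : chi 2 d z ∈ oneSkel X := by
  obtain ⟨I, hI⟩ := CWComplex.mapsTo (C := (univ : Set X)) 2 d
  have := hI hz
  simp only [mem_iUnion] at this
  obtain ⟨m, hm, c, -, w, hw, hwz⟩ := this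
  change _ = chi 2 d z at hwz
  rw [← hwz]
  interval_cases m
  · left
    refine ⟨c, ?_⟩
    rw [Subsingleton.elim w 0]
    rfl
  · rw [fin_one_eq_const w] at hw ⊢
    exact edgePt_mem_oneSkel c (const_mem_closedBall_iff.1 hw)

lemma eventually_mem_of_isOpen {U : Set X} (hU : IsOpen U) {n : ℕ} {c : Cell X n}
    {z : Fin n → ℝ} (hz : z ∈ closedBall 0 1) (h : chi n c z ∈ U) :
    ∀ᶠ y in 𝓝[closedBall 0 1] z, chi n c y ∈ U :=
  (chi_continuousOn n c z hz).eventually (hU.mem_nhds h)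


variable [T2Space X]

/-- Openness is tested on the closed cells. -/
lemma isOpen_of_forall_cell {U : Set X}
    (h : ∀ (n : ℕ) (c : Cell X n), ∀ z ∈ closedBall (0 : Fin n → ℝ) 1, chi n c z ∈ U →
      ∀ᶠ y in 𝓝[closedBall 0 1] z, chi n c y ∈ U) : IsOpen U := by
  rw [← isClosed_compl_iff, CWComplex.closed (univ : Set X) Uᶜ (subset_univ _)]
  intro n c
  have hK : IsCompact (closedBall 0 1 ∩ (chi n c) ⁻¹' Uᶜ) := by
    refine (isCompact_closedBall 0 1).of_isClosed_subset ?_ inter_subset_left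
    rw [isClosed_iff_frequently]
    intro z hz
    have hzc : z ∈ closedBall (0 : Fin n → ℝ) 1 :=
      isClosed_closedBall.mem_of_frequently_of_tendsto (hz.mono fun _ hy => hy.1)
        Filter.tendsto_id
    refine ⟨hzc, fun hzU => ?_⟩
    have := h n c z hzc hzU
    rw [eventually_nhdsWithin_iff] at this
    exact hz (this.mono fun y hy hy' => hy'.2 (hy hy'.1))
  have := (hK.image_of_continuousOn ((chi_continuousOn n c).mono inter_subset_left)).isClosed
  convert this using 1
  ext x
  constructor
  · rintro ⟨hx, z, hz, rfl⟩
    exact ⟨z, ⟨hz, hx⟩, rfl⟩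
  · rintro ⟨z, ⟨hz, hx⟩, rfl⟩
    exact ⟨hx, z, hz, rfl⟩

/-- Continuity on a finite union of closed cells is tested on the cells. -/
lemma continuousOn_of_forall_cell {Y ι : Type*} [TopologicalSpace Y] [Finite ι]
    (c : ι → Σ n, Cell X n) {U S : Set X} {f : X → Y}
    (hS : S ⊆ ⋃ i, chi (c i).1 (c i).2 '' closedBall 0 1) (hSU : S ⊆ U)
    (h : ∀ i, ContinuousOn (fun z => f (chi (c i).1 (c i).2 z))
      (closedBall 0 1 ∩ chi (c i).1 (c i).2 ⁻¹' U)) : ContinuousOn f S := by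
  intro x hx
  have hmono : 𝓝[S] x ≤ 𝓝[⋃ i, (U ∩ chi (c i).1 (c i).2 '' closedBall 0 1)] x :=
    nhdsWithin_mono _ (by rw [← inter_iUnion]; exact subset_inter hSU hS)
  refine Filter.Tendsto.mono_left ?_ hmono
  rw [nhdsWithin_iUnion, Filter.tendsto_iSup]
  intro i
  set g := chi (c i).1 (c i).2
  set D := closedBall (0 : Fin (c i).1 → ℝ) 1
  have hg : ContinuousOn g D := chi_continuousOn _ _
  intro V hV
  obtain ⟨W, hWV, hWo, hWx⟩ := mem_nhds_iff.1 hV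
  obtain ⟨O, hO, hOe⟩ := continuousOn_iff'.1 (h i) W hWo
  have hc : IsClosed (g '' (D \ O)) :=
    (((isCompact_closedBall _ _).diff hO).image_of_continuousOn (hg.mono sdiff_subset)).isClosed
  have hxn : x ∉ g '' (D \ O) := by
    rintro ⟨z, ⟨hzD, hzO⟩, hzx⟩
    have : z ∈ O ∩ (D ∩ g ⁻¹' U) := by
      rw [← hOe]
      exact ⟨by change f (g z) ∈ W; rwa [hzx], hzD, by change g z ∈ U; rw [hzx]; exact hSU hx⟩
    exact hzO this.1
  change ∀ᶠ y in 𝓝[U ∩ g '' D] x, f y ∈ V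
  filter_upwards [self_mem_nhdsWithin, mem_nhdsWithin_of_mem_nhds (hc.isOpen_compl.mem_nhds hxn)]
    with y hy hy'
  obtain ⟨hyU, z, hzD, rfl⟩ := hy
  have hzO : z ∈ O := by
    by_contra hzO
    exact hy' ⟨z, ⟨hzD, hzO⟩, rfl⟩
  have : z ∈ (fun z => f (g z)) ⁻¹' W ∩ (D ∩ g ⁻¹' U) := by
    rw [hOe]
    exact ⟨hzO, hzD, hyU⟩
  exact hWV this.1

/-- A predicate that is constant along every closed cell is constant. -/
lemma eq_of_forall_cell [ConnectedSpace X] {P : X → Prop}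
    (h : ∀ (n : ℕ) (c : Cell X n), ∀ z ∈ closedBall (0 : Fin n → ℝ) 1,
      ∀ z' ∈ closedBall (0 : Fin n → ℝ) 1, P (chi n c z) → P (chi n c z')) {x y : X}
    (hx : P x) : P y := by
  have hopen : ∀ Q : X → Prop, (∀ (n : ℕ) (c : Cell X n), ∀ z ∈ closedBall (0 : Fin n → ℝ) 1,
      ∀ z' ∈ closedBall (0 : Fin n → ℝ) 1, Q (chi n c z) → Q (chi n c z')) →
      IsOpen {x | Q x} := by
    intro Q hQ
    refine isOpen_of_forall_cell fun n c z hz hzQ => ?_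
    filter_upwards [self_mem_nhdsWithin] with w hw
    exact hQ n c z hz w hw hzQ
  have h1 := hopen P h
  have h2 := hopen (fun x => ¬ P x) fun n c z hz z' hz' hn hp => hn (h n c z' hz' z hz hp)
  have hclopen : IsClopen {x | P x} := ⟨⟨h2⟩, h1⟩
  have hu := hclopen.eq_univ ⟨x, hx⟩
  exact hu.ge (mem_univ y)

lemma pathConnectedSpace [ConnectedSpace X] : PathConnectedSpace X := by
  obtain ⟨x⟩ : Nonempty X := inferInstance
  have key : ∀ y, Joined x y := fun y => by
    refine eq_of_forall_cell (P := Joined x) ?_ (Joined.refl x)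
    intro n c z hz z' hz' h
    refine h.trans ?_
    have := ((convex_closedBall (0 : Fin n → ℝ) 1).isPathConnected ⟨z, hz⟩).image'
      (chi_continuousOn n c)
    exact (this.joinedIn _ (mem_image_of_mem _ hz) _ (mem_image_of_mem _ hz')).joined
  exact ⟨⟨x⟩, fun a b => (key a).symm.trans (key b)⟩

end Cells

namespace FiniteTwoComplex

variable {X : Type*} [TopologicalSpace X] [CWComplex (univ : Set X)]

lemma cell_le (K : FiniteTwoComplex X) {n : ℕ} (c : Cell X n) : n ≤ 2 := by
  by_contra h
  exact (K.isEmpty_cell n (not_le.1 h)).false c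

lemma finite_cell (K : FiniteTwoComplex X) (n : ℕ) : Finite (Cell X n) :=
  haveI := K.finite
  RelCWComplex.FiniteType.finite_cell n

lemma finite_sigma (K : FiniteTwoComplex X) : Finite (Σ n, Cell X n) := by
  have := K.finite_cell
  refine Finite.of_surjective
    (fun p : Σ n : Fin 3, Cell X n => (⟨p.1, p.2⟩ : Σ n, Cell X n)) ?_
  rintro ⟨n, c⟩
  exact ⟨⟨⟨n, Nat.lt_succ_of_le (K.cell_le c)⟩, c⟩, rfl⟩

lemma mem_cases (K : FiniteTwoComplex X) (x : X) :
    x ∈ oneSkel X ∨ ∃ d, ∃ z ∈ ball (0 : Fin 2 → ℝ) 1, x = chi 2 d z := by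
  have h : x ∈ ⋃ (n : ℕ) (j : Cell X n), RelCWComplex.openCell (C := (univ : Set X)) n j := by
    rw [CWComplex.iUnion_openCell_eq_complex]
    trivial
  simp only [mem_iUnion] at h
  obtain ⟨n, c, hx⟩ := h
  have hn := K.cell_le c
  interval_cases n
  · rw [openCell_zero] at hx
    exact Or.inl (Or.inl ⟨c, hx⟩)
  · exact Or.inl (Or.inr ⟨c, mem_openCell_one_iff.1 hx⟩)
  · obtain ⟨z, hz, rfl⟩ := hx
    exact Or.inr ⟨c, z, hz, rfl⟩

lemma exists_vert [ConnectedSpace X] (K : FiniteTwoComplex X) : Nonempty (Cell X 0) := by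
  obtain ⟨x⟩ : Nonempty X := inferInstance
  have hs : (oneSkel X).Nonempty := by
    rcases K.mem_cases x with h | ⟨d, z, hz, rfl⟩
    · exact ⟨x, h⟩
    · exact ⟨_, sphere_mem_oneSkel (d := d) (z := fun _ => 1)
        (by rw [mem_sphere_zero_iff_norm, pi_norm_const]; simp)⟩
  obtain ⟨y, ⟨v, -⟩ | ⟨e, -⟩⟩ := hs
  · exact ⟨v⟩
  · exact ⟨(exists_vert_eq_edgePt e).1.choose⟩

end FiniteTwoComplex

/-! ### Boundary paths of 2-cells -/

section BoundaryPath

/-- An increasing bijection between open intervals extends continuously to the ends. -/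
lemma exists_extension_of_strictMonoOn {β : ℝ → ℝ} {a b : ℝ} (hab : a < b)
    (hβ : StrictMonoOn β (Ioo a b)) (hb : BijOn β (Ioo a b) (Ioo (-1) 1)) :
    ∃ β' : ℝ → ℝ, EqOn β' β (Ioo a b) ∧ ContinuousOn β' (Icc a b) ∧ StrictMonoOn β' (Icc a b) ∧
      β' a = -1 ∧ β' b = 1 := by
  let β' : ℝ → ℝ := fun s => if s ≤ a then -1 else if b ≤ s then 1 else β s
  have ha' : β' a = -1 := if_pos le_rfl
  have hb' : β' b = 1 := by
    change (if _ then _ else _) = _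
    rw [if_neg (not_le.2 hab), if_pos le_rfl]
  have heq : EqOn β' β (Ioo a b) := fun s hs => by
    change (if _ then _ else _) = _
    rw [if_neg (not_le.2 hs.1), if_neg (not_le.2 hs.2)]
  have hmono : StrictMonoOn β' (Icc a b) := by
    intro x hx y hy hxy
    rcases eq_or_lt_of_le hx.1 with rfl | hx1
    · rw [ha']
      rcases eq_or_lt_of_le hy.2 with rfl | hy2
      · rw [hb']; norm_num
      · rw [heq ⟨hxy, hy2⟩]
        exact (hb.mapsTo ⟨hxy, hy2⟩).1
    · rcases eq_or_lt_of_le hy.2 with rfl | hy2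
      · rw [hb', heq ⟨hx1, hxy⟩]
        exact (hb.mapsTo ⟨hx1, hxy⟩).2
      · rw [heq ⟨hx1, hxy.trans hy2⟩, heq ⟨hx1.trans hxy, hy2⟩]
        exact hβ ⟨hx1, hxy.trans hy2⟩ ⟨hx1.trans hxy, hy2⟩ hxy
  have himage : β' '' Icc a b = Icc (-1) 1 := by
    apply subset_antisymm
    · rintro _ ⟨s, hs, rfl⟩
      exact ⟨ha' ▸ hmono.monotoneOn (left_mem_Icc.2 hab.le) hs hs.1,
        hb' ▸ hmono.monotoneOn hs (right_mem_Icc.2 hab.le) hs.2⟩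
    · intro y hy
      rcases eq_or_lt_of_le hy.1 with rfl | h1
      · exact ⟨a, left_mem_Icc.2 hab.le, ha'⟩
      rcases eq_or_lt_of_le hy.2 with rfl | h2
      · exact ⟨b, right_mem_Icc.2 hab.le, hb'⟩
      obtain ⟨s, hs, rfl⟩ := hb.surjOn ⟨h1, h2⟩
      exact ⟨s, Ioo_subset_Icc_self hs, heq hs⟩
  refine ⟨β', heq, ?_, hmono, ha', hb'⟩
  have : OrdConnected (β' '' Icc a b) := himage ▸ ordConnected_Icc
  rw [continuousOn_iff_continuous_domRestrict]
  exact continuous_subtype_val.comp (hmono.orderIso β' (Icc a b)).continuous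

variable {X : Type*} [TopologicalSpace X] [CWComplex (univ : Set X)] {d : Cell X 2}
  (B : BoundaryPath d)

namespace BoundaryPath

variable {B}

lemma exists_nat_or_mem_Ioo {L : ℕ} {s : ℝ} (hs : s ∈ Icc 0 (L : ℝ)) :
    (∃ j : ℕ, j ≤ L ∧ s = j) ∨ ∃ j : Fin L, s ∈ Ioo (j : ℝ) ((j : ℝ) + 1) := by
  have h1 := Nat.floor_le hs.1
  have h2 := Nat.lt_floor_add_one s
  rcases eq_or_lt_of_le h1 with h | h
  · exact Or.inl ⟨⌊s⌋₊, Nat.floor_le_of_le hs.2, h.symm⟩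
  · refine Or.inr ⟨⟨⌊s⌋₊, ?_⟩, h, h2⟩
    have : ((⌊s⌋₊ : ℕ) : ℝ) < L := h.trans_le hs.2
    exact_mod_cast this

lemma Icc_subset (j : Fin B.length) :
    Icc (j : ℝ) ((j : ℝ) + 1) ⊆ Icc 0 (B.length : ℝ) := by
  have : ((j : ℕ) : ℝ) + 1 ≤ B.length := by exact_mod_cast j.2
  exact Icc_subset_Icc (Nat.cast_nonneg _) this

lemma length_pos (j : Fin B.length) : 0 < B.length := (Nat.zero_le _).trans_lt j.2

lemma param_mem_sphere (hL : 0 < B.length) {s : ℝ} (hs : s ∈ Icc 0 (B.length : ℝ)) :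
    B.param s ∈ sphere (0 : Fin 2 → ℝ) 1 := by
  rcases eq_or_lt_of_le hs.2 with rfl | h
  · rw [B.param_closed]
    exact (B.bijOn_param hL).mapsTo ⟨le_rfl, by exact_mod_cast hL⟩
  · exact (B.bijOn_param hL).mapsTo ⟨hs.1, h⟩

lemma exists_param_eq (hL : 0 < B.length) {z : Fin 2 → ℝ} (hz : z ∈ sphere (0 : Fin 2 → ℝ) 1) :
    ∃ s ∈ Ico 0 (B.length : ℝ), B.param s = z := (B.bijOn_param hL).surjOn hz

lemma param_eq_param (hL : 0 < B.length) {s s' : ℝ} (hs : s ∈ Icc 0 (B.length : ℝ))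
    (hs' : s' ∈ Icc 0 (B.length : ℝ)) (h : B.param s = B.param s') :
    s = s' ∨ (s = 0 ∧ s' = B.length) ∨ (s = B.length ∧ s' = 0) := by
  have h0 : (0 : ℝ) ∈ Ico 0 (B.length : ℝ) := ⟨le_rfl, by exact_mod_cast hL⟩
  have inj := (B.bijOn_param hL).injOn
  rcases eq_or_lt_of_le hs.2 with rfl | h1 <;> rcases eq_or_lt_of_le hs'.2 with rfl | h2
  · exact Or.inl rfl
  · rw [B.param_closed] at h
    exact Or.inr (Or.inr ⟨rfl, (inj h0 ⟨hs'.1, h2⟩ h).symm⟩)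
  · rw [B.param_closed] at h
    exact Or.inr (Or.inl ⟨inj ⟨hs.1, h1⟩ h0 h, rfl⟩)
  · exact Or.inl (inj ⟨hs.1, h1⟩ ⟨hs'.1, h2⟩ h)

/-- `param` is a quotient map onto the circle. -/
lemma eventually_exists_param (hL : 0 < B.length) {s : ℝ}
    {O : Set ℝ} (hO : IsOpen O)
    (h : ∀ s' ∈ Icc 0 (B.length : ℝ), B.param s' = B.param s → s' ∈ O) :
    ∀ᶠ z in 𝓝[sphere 0 1] (B.param s), ∃ s' ∈ O ∩ Icc 0 (B.length : ℝ), B.param s' = z := by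
  have hc : IsClosed (B.param '' (Icc 0 (B.length : ℝ) \ O)) :=
    ((isCompact_Icc.diff hO).image_of_continuousOn
      (B.continuousOn_param.mono sdiff_subset)).isClosed
  have hn : B.param s ∉ B.param '' (Icc 0 (B.length : ℝ) \ O) := by
    rintro ⟨s', ⟨hs', hn⟩, he⟩
    exact hn (h s' hs' he)
  filter_upwards [self_mem_nhdsWithin, mem_nhdsWithin_of_mem_nhds (hc.isOpen_compl.mem_nhds hn)]
    with z hz hz'
  obtain ⟨s', hs', rfl⟩ := exists_param_eq hL hz
  refine ⟨s', ⟨?_, Ico_subset_Icc_self hs'⟩, rfl⟩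
  by_contra hsO
  exact hz' ⟨s', ⟨Ico_subset_Icc_self hs', hsO⟩, rfl⟩

lemma eventually_exists_param_of_mem_Ioo {s : ℝ} (hs : s ∈ Ioo 0 (B.length : ℝ))
    {p : ℝ → Prop} (h : ∀ᶠ s' in 𝓝 s, p s') :
    ∀ᶠ z in 𝓝[sphere 0 1] (B.param s), ∃ s' ∈ Ioo 0 (B.length : ℝ), p s' ∧ B.param s' = z := by
  have hL : 0 < B.length := by exact_mod_cast hs.1.trans hs.2
  obtain ⟨O, hOp, hO, hsO⟩ := _root_.eventually_nhds_iff.1 (h.and (isOpen_Ioo.mem_nhds hs))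
  refine (eventually_exists_param hL (s := s) hO ?_).mono ?_
  · intro s' hs' he
    rcases param_eq_param hL hs' (Ioo_subset_Icc_self hs) he with rfl | ⟨-, h2⟩ | ⟨-, h2⟩
    · exact hsO
    · exact absurd h2 hs.2.ne
    · exact absurd h2 hs.1.ne'
  · rintro z ⟨s', hs', rfl⟩
    exact ⟨s', (hOp s' hs'.1).2, (hOp s' hs'.1).1, rfl⟩

lemma continuousOn_disc_param :
    ContinuousOn (fun t => chi 2 d (B.param t)) (Icc 0 (B.length : ℝ)) := by
  rcases Nat.eq_zero_or_pos B.length with h0 | hL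
  · have : Icc 0 (B.length : ℝ) = {0} := by rw [h0]; simp
    rw [this]
    exact continuousOn_singleton _ _
  · exact (chi_continuousOn 2 d).comp B.continuousOn_param
      fun s hs => sphere_subset_closedBall (param_mem_sphere hL hs)

variable [T2Space X]

variable (B) in
/-- Each of the paths in the boundary of a 2-cell runs monotonically over its 1-cell. -/
lemma exists_coord (j : Fin B.length) : ∃ ε : ℝ, (ε = 1 ∨ ε = -1) ∧ ∃ β : ℝ → ℝ,
    ContinuousOn β (Icc (j : ℝ) (j + 1)) ∧ StrictMonoOn (fun s => ε * β s) (Icc (j : ℝ) (j + 1)) ∧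
    β j = -ε ∧ β (j + 1) = ε ∧
    ∀ s ∈ Icc (j : ℝ) (j + 1), chi 2 d (B.param s) = edgePt (B.edge j) (β s) := by
  obtain ⟨a, ha⟩ : ∃ a : ℝ, a = ((j : ℕ) : ℝ) := ⟨_, rfl⟩
  rw [← ha]
  have hab : a < a + 1 := by linarith
  let g : ℝ → X := fun t => chi 2 d (B.param t)
  have hg : ContinuousOn g (Icc a (a + 1)) :=
    continuousOn_disc_param.mono (ha ▸ Icc_subset j)
  have hbij := B.bijOn_edge j
  rw [← ha] at hbij
  let β₀ : ℝ → ℝ := fun s => edgeCoord (B.edge j) (g s)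
  have hβ₀ : ContinuousOn β₀ (Ioo a (a + 1)) :=
    (edgeCoord_continuousOn _).comp (hg.mono Ioo_subset_Icc_self) hbij.mapsTo
  have hedge : BijOn (edgeCoord (B.edge j))
      (RelCWComplex.openCell (C := (univ : Set X)) 1 (B.edge j)) (Ioo (-1) 1) := by
    refine ⟨?_, ?_, ?_⟩
    · intro x hx
      obtain ⟨t, ht, rfl⟩ := mem_openCell_one_iff.1 hx
      rwa [edgeCoord_edgePt _ ht]
    · intro x hx y hy h
      obtain ⟨t, ht, rfl⟩ := mem_openCell_one_iff.1 hx
      obtain ⟨t', ht', rfl⟩ := mem_openCell_one_iff.1 hy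
      rw [edgeCoord_edgePt _ ht, edgeCoord_edgePt _ ht'] at h
      rw [h]
    · intro t ht
      exact ⟨_, edgePt_mem_openCell _ ht, edgeCoord_edgePt _ ht⟩
  have hβbij : BijOn β₀ (Ioo a (a + 1)) (Ioo (-1) 1) := hedge.comp hbij
  have hβg : ∀ s ∈ Ioo a (a + 1), g s = edgePt (B.edge j) (β₀ s) := by
    intro s hs
    obtain ⟨t, ht, he⟩ := mem_openCell_one_iff.1 (hbij.mapsTo hs)
    change g s = edgePt _ (edgeCoord _ (g s))
    change g s = _ at he
    rw [he, edgeCoord_edgePt _ ht]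
  have hfin : ∀ ε : ℝ, (ε = 1 ∨ ε = -1) → StrictMonoOn (fun s => ε * β₀ s) (Ioo a (a + 1)) →
      ∃ β : ℝ → ℝ, ContinuousOn β (Icc a (a + 1)) ∧
        StrictMonoOn (fun s => ε * β s) (Icc a (a + 1)) ∧ β a = -ε ∧ β (a + 1) = ε ∧
        ∀ s ∈ Icc a (a + 1), g s = edgePt (B.edge j) (β s) := by
    intro ε hε hmono
    have hεε : ε * ε = 1 := by rcases hε with rfl | rfl <;> norm_num
    have hb : BijOn (fun s => ε * β₀ s) (Ioo a (a + 1)) (Ioo (-1) 1) := by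
      refine BijOn.comp (g := fun t => ε * t) (t := Ioo (-1) 1) ?_ hβbij
      refine ⟨?_, ?_, ?_⟩
      · intro t ht
        rcases hε with rfl | rfl
        · simpa using ht
        · exact ⟨by linarith [ht.2], by linarith [ht.1]⟩
      · intro x _ y _ h
        have : ε * (ε * x) = ε * (ε * y) := congrArg _ h
        rwa [← mul_assoc, ← mul_assoc, hεε, one_mul, one_mul] at this
      · intro t ht
        refine ⟨ε * t, ?_, by change ε * (ε * t) = t; rw [← mul_assoc, hεε, one_mul]⟩
        rcases hε with rfl | rfl
        · simpa using ht
        · exact ⟨by linarith [ht.2], by linarith [ht.1]⟩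
    obtain ⟨β', heq, hc, hm, h1, h2⟩ := exists_extension_of_strictMonoOn hab hmono hb
    refine ⟨fun s => ε * β' s, continuousOn_const.mul hc, ?_, by simp [h1], by simp [h2], ?_⟩
    · simpa [← mul_assoc, hεε] using hm
    · have hIcc : Icc a (a + 1) ⊆ closure (Ioo a (a + 1)) := by rw [closure_Ioo hab.ne]
      have hmaps : ∀ s ∈ Icc a (a + 1), β' s ∈ Icc (-1) 1 := fun s hs =>
        ⟨h1 ▸ hm.monotoneOn (left_mem_Icc.2 hab.le) hs hs.1,
          h2 ▸ hm.monotoneOn hs (right_mem_Icc.2 hab.le) hs.2⟩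
      have hcomp : ContinuousOn (fun s => edgePt (B.edge j) (ε * β' s)) (Icc a (a + 1)) := by
        refine (edgePt_continuousOn _).comp (continuousOn_const.mul hc) fun s hs => ?_
        have := hmaps s hs
        rcases hε with rfl | rfl
        · simpa using this
        · exact ⟨by linarith [this.2], by linarith [this.1]⟩
      refine EqOn.of_subset_closure ?_ hg hcomp Ioo_subset_Icc_self hIcc
      intro s hs
      change g s = edgePt _ (ε * β' s)
      rw [hβg s hs, heq hs, ← mul_assoc, hεε, one_mul]
  rcases hβ₀.strictMonoOn_of_injOn_Ioo hab hβbij.injOn with h | h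
  · exact ⟨1, Or.inl rfl, hfin 1 (Or.inl rfl) (by simpa using h)⟩
  · refine ⟨-1, Or.inr rfl, hfin (-1) (Or.inr rfl) ?_⟩
    intro x hx y hy hxy
    have := h hx hy hxy
    dsimp only
    linarith

variable (B) in
/-- The direction, `1` or `-1`, in which the `j`-th boundary path runs over its 1-cell. -/
def sign (j : Fin B.length) : ℝ := (B.exists_coord j).choose

variable (B) in
/-- The coordinate on its 1-cell of the `j`-th boundary path. -/
def coord (j : Fin B.length) : ℝ → ℝ := (B.exists_coord j).choose_spec.2.choose

variable (j : Fin B.length)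

lemma sign_eq : B.sign j = 1 ∨ B.sign j = -1 := (B.exists_coord j).choose_spec.1

lemma coord_continuousOn : ContinuousOn (B.coord j) (Icc (j : ℝ) (j + 1)) :=
  (B.exists_coord j).choose_spec.2.choose_spec.1

lemma coord_strictMonoOn : StrictMonoOn (fun s => B.sign j * B.coord j s) (Icc (j : ℝ) (j + 1)) :=
  (B.exists_coord j).choose_spec.2.choose_spec.2.1

lemma coord_left : B.coord j j = - B.sign j :=
  (B.exists_coord j).choose_spec.2.choose_spec.2.2.1

lemma coord_right : B.coord j (j + 1) = B.sign j :=
  (B.exists_coord j).choose_spec.2.choose_spec.2.2.2.1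

lemma disc_param_eq {s : ℝ} (hs : s ∈ Icc (j : ℝ) (j + 1)) :
    chi 2 d (B.param s) = edgePt (B.edge j) (B.coord j s) :=
  (B.exists_coord j).choose_spec.2.choose_spec.2.2.2.2 s hs

lemma coord_lt_iff {s s' : ℝ} (hs : s ∈ Icc (j : ℝ) (j + 1)) (hs' : s' ∈ Icc (j : ℝ) (j + 1)) :
    B.sign j * B.coord j s < B.sign j * B.coord j s' ↔ s < s' :=
  (coord_strictMonoOn j).lt_iff_lt hs hs'

lemma coord_mem_Icc {s : ℝ} (hs : s ∈ Icc (j : ℝ) (j + 1)) : B.coord j s ∈ Icc (-1) 1 := by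
  have h1 := (coord_strictMonoOn (B := B) j).monotoneOn (left_mem_Icc.2 (by linarith)) hs hs.1
  have h2 := (coord_strictMonoOn (B := B) j).monotoneOn hs (right_mem_Icc.2 (by linarith)) hs.2
  rw [coord_left] at h1
  rw [coord_right] at h2
  rcases sign_eq (B := B) j with h | h <;> rw [h] at h1 h2 <;> constructor <;> linarith

lemma coord_mem_Ioo {s : ℝ} (hs : s ∈ Ioo (j : ℝ) (j + 1)) : B.coord j s ∈ Ioo (-1) 1 := by
  have h1 := (coord_lt_iff (B := B) j (left_mem_Icc.2 (by linarith))
    (Ioo_subset_Icc_self hs)).2 hs.1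
  have h2 := (coord_lt_iff (B := B) j (Ioo_subset_Icc_self hs)
    (right_mem_Icc.2 (by linarith))).2 hs.2
  rw [coord_left] at h1
  rw [coord_right] at h2
  rcases sign_eq (B := B) j with h | h <;> rw [h] at h1 h2 <;> constructor <;> linarith

lemma exists_vert_eq_param (hL : 0 < B.length) {j : ℕ} (hj : j ≤ B.length) :
    ∃ v, chi 2 d (B.param j) = vert v := by
  have key : ∀ i : Fin B.length, ∀ t : ℝ, (t = 1 ∨ t = -1) →
      ∃ v, edgePt (B.edge i) t = vert v := by
    rintro i t (rfl | rfl)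
    exacts [(exists_vert_eq_edgePt _).2, (exists_vert_eq_edgePt _).1]
  rcases Nat.lt_or_ge j B.length with h | h
  · let i : Fin B.length := ⟨j, h⟩
    have e := disc_param_eq (B := B) i (left_mem_Icc.2 (by linarith))
    rw [coord_left] at e
    obtain ⟨v, hv⟩ := key i (-B.sign i) (by
      rcases sign_eq (B := B) i with h | h <;> rw [h] <;> simp)
    exact ⟨v, e.trans hv⟩
  · obtain ⟨m, rfl⟩ : ∃ m, j = m + 1 := ⟨j - 1, by omega⟩
    let i : Fin B.length := ⟨m, by omega⟩
    have e := disc_param_eq (B := B) i (right_mem_Icc.2 (by linarith))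
    rw [coord_right] at e
    obtain ⟨v, hv⟩ := key i (B.sign i) (sign_eq i)
    refine ⟨v, ?_⟩
    rw [← hv, ← e]
    push_cast
    rfl

end BoundaryPath

end BoundaryPath

/-! ### Labels along boundary paths, and collars of subsets of the 1-skeleton -/

section Potential

variable {X : Type*} [TopologicalSpace X] [CWComplex (univ : Set X)] [T2Space X] {d : Cell X 2}
  {G : Type*} [Group G]

namespace BoundaryPath

/-- A function `η e` on each 1-cell `e` describes the change of a `G`-valued quantity along `e`. Here
it is summed up over the first `k` boundary paths of a 2-cell. -/
def word (B : BoundaryPath d) (η : Cell X 1 → ℝ → G) : ℕ → G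
  | 0 => 1
  | k + 1 => if h : k < B.length then
      word B η k * (η (B.edge ⟨k, h⟩) (B.coord ⟨k, h⟩ k))⁻¹ *
        η (B.edge ⟨k, h⟩) (B.coord ⟨k, h⟩ (k + 1)) else word B η k

/-- The total change of the quantity described by `η` along the boundary path, up to time `s`. -/
def pot (B : BoundaryPath d) (η : Cell X 1 → ℝ → G) (s : ℝ) : G :=
  if h : ⌊s⌋₊ < B.length then
    B.word η ⌊s⌋₊ * (η (B.edge ⟨_, h⟩) (B.coord ⟨_, h⟩ (⌊s⌋₊ : ℕ)))⁻¹ *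
      η (B.edge ⟨_, h⟩) (B.coord ⟨_, h⟩ s) else B.word η B.length

variable {B : BoundaryPath d} {η : Cell X 1 → ℝ → G}

lemma word_succ (j : Fin B.length) : B.word η (j + 1) =
    B.word η j * (η (B.edge j) (B.coord j j))⁻¹ * η (B.edge j) (B.coord j (j + 1)) := by
  rw [word, dif_pos j.2]

lemma pot_natCast {k : ℕ} (hk : k ≤ B.length) : B.pot η k = B.word η k := by
  unfold pot
  simp only [Nat.floor_natCast]
  split_ifs with h
  · rw [inv_mul_cancel_right]
  · rw [le_antisymm hk (not_lt.1 h)]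

lemma pot_eq (j : Fin B.length) {s : ℝ} (hs : s ∈ Icc (j : ℝ) (j + 1)) :
    B.pot η s = B.word η j * (η (B.edge j) (B.coord j j))⁻¹ * η (B.edge j) (B.coord j s) := by
  rcases eq_or_lt_of_le hs.2 with h | h
  · have : s = ((j + 1 : ℕ) : ℝ) := by rw [h]; push_cast; rfl
    rw [this, pot_natCast (Nat.succ_le_of_lt j.2), word_succ]
    push_cast
    rfl
  · have hf : ⌊s⌋₊ = j := (Nat.floor_eq_iff ((Nat.cast_nonneg _).trans hs.1)).2 ⟨hs.1, h⟩
    unfold pot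
    simp only [hf, j.2, dite_true]

lemma pot_zero : B.pot η 0 = 1 := by
  have := pot_natCast (B := B) (η := η) (k := 0) (Nat.zero_le _)
  rw [Nat.cast_zero] at this
  rw [this]
  rfl

/-- A `PathHom` whose values along the 1-cells are given by `η` has values along the boundary of a
2-cell given by `pot`. -/
lemma seg_param_eq (F : PathHom X G)
    (hF : ∀ e, ∀ c ∈ Icc (-1 : ℝ) 1, ∀ c' ∈ Icc (-1 : ℝ) 1,
      F.seg (edgePt e) c c' = (η e c)⁻¹ * η e c') {s s' : ℝ}
    (hs : s ∈ Icc 0 (B.length : ℝ)) (hs' : s' ∈ Icc 0 (B.length : ℝ)) :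
    F.seg (fun t => chi 2 d (B.param t)) s s' = (B.pot η s)⁻¹ * B.pot η s' := by
  set γ : ℝ → X := fun t => chi 2 d (B.param t)
  have hγ : ContinuousOn γ (Icc 0 (B.length : ℝ)) := continuousOn_disc_param
  have hconv : Convex ℝ (Icc (0 : ℝ) (B.length : ℝ)) := convex_Icc _ _
  -- within one boundary path
  have hj : ∀ (j : Fin B.length), ∀ t ∈ Icc (j : ℝ) (j + 1), ∀ t' ∈ Icc (j : ℝ) (j + 1),
      F.seg γ t t' = (B.pot η t)⁻¹ * B.pot η t' := by
    intro j t ht t' ht'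
    have h1 : F.seg γ t t' = F.seg (fun t => edgePt (B.edge j) (B.coord j t)) t t' :=
      F.seg_congr (convex_Icc _ _) (fun u hu => disc_param_eq j hu) ht ht'
    rw [h1, F.seg_comp (convex_Icc (-1) 1) (edgePt_continuousOn _) (convex_Icc (j : ℝ) (j + 1))
      (coord_continuousOn j) (fun u hu => coord_mem_Icc j hu) ht ht',
      hF _ _ (coord_mem_Icc j ht) _ (coord_mem_Icc j ht'), pot_eq j ht, pot_eq j ht']
    group
  have h0 : ∀ k : ℕ, k ≤ B.length → F.seg γ 0 k = B.pot η k := by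
    intro k
    induction k with
    | zero => intro _; rw [Nat.cast_zero, F.seg_self, pot_zero]
    | succ k ih =>
      intro hk
      let j : Fin B.length := ⟨k, hk⟩
      have hkI : (k : ℝ) ∈ Icc 0 (B.length : ℝ) :=
        ⟨Nat.cast_nonneg _, by exact_mod_cast (Nat.lt_of_succ_le hk).le⟩
      have hkI' : ((k + 1 : ℕ) : ℝ) ∈ Icc 0 (B.length : ℝ) :=
        ⟨Nat.cast_nonneg _, by exact_mod_cast hk⟩
      rw [← F.seg_trans hconv hγ ⟨le_rfl, by positivity⟩ hkI hkI',
        ih (Nat.lt_of_succ_le hk).le,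
        hj j k (left_mem_Icc.2 (by linarith)) ((k + 1 : ℕ) : ℝ)
          (by push_cast; exact right_mem_Icc.2 (by linarith)), mul_inv_cancel_left]
  have h00 : ∀ t ∈ Icc 0 (B.length : ℝ), F.seg γ 0 t = B.pot η t := by
    intro t ht
    rcases exists_nat_or_mem_Ioo ht with ⟨k, hk, rfl⟩ | ⟨j, htj⟩
    · exact h0 k hk
    · have hjI : ((j : ℕ) : ℝ) ∈ Icc 0 (B.length : ℝ) :=
        Icc_subset j (left_mem_Icc.2 (by linarith))
      rw [← F.seg_trans hconv hγ ⟨le_rfl, by positivity⟩ hjI ht, h0 j j.2.le,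
        hj j _ (left_mem_Icc.2 (by linarith)) t (Ioo_subset_Icc_self htj), mul_inv_cancel_left]
  have hz : (0 : ℝ) ∈ Icc 0 (B.length : ℝ) := ⟨le_rfl, by positivity⟩
  rw [← F.seg_trans hconv hγ hs hz hs', F.seg_symm hconv hγ hz hs, h00 s hs, h00 s' hs']

lemma word_congr {η' : Cell X 1 → ℝ → G} (h : ∀ e, η e (-1) = η' e (-1))
    (h' : ∀ e, η e 1 = η' e 1) (k : ℕ) : B.word η k = B.word η' k := by
  induction k with
  | zero => rfl
  | succ k ih =>
    unfold word
    split_ifs with hk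
    · have key : ∀ e, ∀ c : ℝ, (c = 1 ∨ c = -1) → η e c = η' e c := by
        rintro e c (rfl | rfl)
        exacts [h' e, h e]
      have hs := sign_eq (B := B) ⟨k, hk⟩
      have h1 := coord_left (B := B) ⟨k, hk⟩
      have h2 := coord_right (B := B) ⟨k, hk⟩
      dsimp only at h1 h2
      rw [ih, h1, h2, key _ (-B.sign ⟨k, hk⟩), key _ (B.sign ⟨k, hk⟩) hs]
      rcases hs with h | h <;> rw [h] <;> simp
    · exact ih

end BoundaryPath

end Potential

section Collar

variable {X : Type*} [TopologicalSpace X] [CWComplex (univ : Set X)]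

/-- A subset of the 1-skeleton, thickened into the 2-cells by adding the radii that end on it,
without the centres. -/
def collar (S : Set X) : Set X :=
  S ∪ {x | ∃ d, ∃ z ∈ ball (0 : Fin 2 → ℝ) 1, z ≠ 0 ∧ x = chi 2 d z ∧ chi 2 d (‖z‖⁻¹ • z) ∈ S}

lemma normalize_mem_sphere {z : Fin 2 → ℝ} (hz : z ≠ 0) :
    ‖z‖⁻¹ • z ∈ sphere (0 : Fin 2 → ℝ) 1 := by
  rw [mem_sphere_zero_iff_norm, norm_smul, norm_inv, norm_norm,
    inv_mul_cancel₀ (norm_ne_zero_iff.2 hz)]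

lemma normalize_of_mem_sphere {z : Fin 2 → ℝ} (hz : z ∈ sphere (0 : Fin 2 → ℝ) 1) :
    ‖z‖⁻¹ • z = z := by
  rw [mem_sphere_zero_iff_norm.1 hz, inv_one, one_smul]

lemma disc_mem_collar_iff {S : Set X} (hS : S ⊆ oneSkel X) {d : Cell X 2} {z : Fin 2 → ℝ}
    (hz : z ∈ closedBall (0 : Fin 2 → ℝ) 1) :
    chi 2 d z ∈ collar S ↔ z ≠ 0 ∧ chi 2 d (‖z‖⁻¹ • z) ∈ S := by
  rcases ball_union_sphere_of_mem_closedBall hz with hb | hs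
  · constructor
    · rintro (h | ⟨d', z', hz', h0, he, h⟩)
      · exact absurd (hS h) (disc_notMem_oneSkel hb)
      · obtain ⟨rfl, rfl⟩ := disc_injective hb hz' he
        exact ⟨h0, h⟩
    · rintro ⟨h0, h⟩
      exact Or.inr ⟨d, z, hb, h0, rfl, h⟩
  · rw [normalize_of_mem_sphere hs]
    constructor
    · rintro (h | ⟨d', z', hz', -, he, -⟩)
      · exact ⟨ne_of_mem_sphere hs one_ne_zero, h⟩
      · exact absurd (he ▸ sphere_mem_oneSkel hs) (disc_notMem_oneSkel hz')
    · exact fun h => Or.inl h.2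

lemma mem_collar_of_mem_oneSkel {S : Set X} {x : X} (hx : x ∈ oneSkel X) (h : x ∈ collar S) :
    x ∈ S := by
  rcases h with h | ⟨d, z, hz, -, rfl, -⟩
  · exact h
  · exact absurd hx (disc_notMem_oneSkel hz)

variable [T2Space X]

lemma isClosed_oneSkel_diff (K : FiniteTwoComplex X) {S : Set X}
    (h : ∀ e, ∀ t ∈ Icc (-1 : ℝ) 1, edgePt e t ∈ S →
      ∀ᶠ t' in 𝓝[Icc (-1) 1] t, edgePt e t' ∈ S) : IsClosed (oneSkel X \ S) := by
  have := K.finite_cell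
  have he : oneSkel X \ S = (vert '' {v | vert v ∉ S}) ∪
      ⋃ e, edgePt e '' (Icc (-1) 1 ∩ edgePt e ⁻¹' Sᶜ) := by
    ext x
    constructor
    · rintro ⟨⟨v, rfl⟩ | ⟨e, t, ht, rfl⟩, hx⟩
      · exact Or.inl ⟨v, hx, rfl⟩
      · exact Or.inr (mem_iUnion.2 ⟨e, t, ⟨Ioo_subset_Icc_self ht, hx⟩, rfl⟩)
    · rintro (⟨v, hv, rfl⟩ | hx)
      · exact ⟨vert_mem_oneSkel v, hv⟩
      · obtain ⟨e, t, ⟨ht, htS⟩, rfl⟩ := mem_iUnion.1 hx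
        exact ⟨edgePt_mem_oneSkel e ht, htS⟩
  rw [he]
  refine (Set.toFinite _).isClosed.union (isClosed_iUnion_of_finite fun e => ?_)
  have hc : IsCompact (Icc (-1) 1 ∩ edgePt e ⁻¹' Sᶜ) := by
    refine isCompact_Icc.of_isClosed_subset ?_ inter_subset_left
    rw [isClosed_iff_frequently]
    intro t ht
    have htI : t ∈ Icc (-1 : ℝ) 1 :=
      isClosed_Icc.mem_of_frequently_of_tendsto (ht.mono fun _ hy => hy.1) Filter.tendsto_id
    refine ⟨htI, fun htS => ?_⟩
    have := h e t htI htS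
    rw [eventually_nhdsWithin_iff] at this
    exact ht (this.mono fun y hy hy' => hy'.2 (hy hy'.1))
  exact (hc.image_of_continuousOn ((edgePt_continuousOn e).mono inter_subset_left)).isClosed

/-- The collar of a relatively open subset of the 1-skeleton is open in the complex. -/
lemma isOpen_collar (K : FiniteTwoComplex X) {S : Set X} (hS : S ⊆ oneSkel X)
    (h : ∀ e, ∀ t ∈ Icc (-1 : ℝ) 1, edgePt e t ∈ S →
      ∀ᶠ t' in 𝓝[Icc (-1) 1] t, edgePt e t' ∈ S) : IsOpen (collar S) := by
  have hcl := isClosed_oneSkel_diff K h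
  refine isOpen_of_forall_cell fun n c z hz hzU => ?_
  have hn := K.cell_le c
  interval_cases n
  · filter_upwards with y
    rwa [Subsingleton.elim y z]
  · rw [fin_one_eq_const z] at hz hzU ⊢
    have htI := const_mem_closedBall_iff.1 hz
    have h1 := h c _ htI (mem_collar_of_mem_oneSkel (edgePt_mem_oneSkel c htI) hzU)
    have ht : Filter.Tendsto (fun y : Fin 1 → ℝ => y 0) (𝓝[closedBall 0 1] (fun _ => z 0))
        (𝓝[Icc (-1) 1] (z 0)) := by
      refine tendsto_nhdsWithin_of_tendsto_nhds_of_eventually_within _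
        (((continuous_apply 0).tendsto (fun _ => z 0 : Fin 1 → ℝ)).mono_left nhdsWithin_le_nhds) ?_
      filter_upwards [self_mem_nhdsWithin] with y hy
      rw [fin_one_eq_const y] at hy
      exact const_mem_closedBall_iff.1 hy
    filter_upwards [ht.eventually h1] with y hy
    rw [fin_one_eq_const y]
    exact Or.inl hy
  · rw [disc_mem_collar_iff hS hz] at hzU
    have hcont : ContinuousAt (fun y : Fin 2 → ℝ => ‖y‖⁻¹ • y) z :=
      (continuousAt_id.norm.inv₀ (norm_ne_zero_iff.2 hzU.1)).smul continuousAt_id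
    have hne : ∀ᶠ y in 𝓝 z, y ≠ 0 := isOpen_ne.mem_nhds hzU.1
    have h1 : ∀ᶠ w in 𝓝[closedBall 0 1] (‖z‖⁻¹ • z), chi 2 c w ∈ (oneSkel X \ S)ᶜ :=
      eventually_mem_of_isOpen hcl.isOpen_compl
        (sphere_subset_closedBall (normalize_mem_sphere hzU.1)) (fun hh => hh.2 hzU.2)
    have ht : Filter.Tendsto (fun y : Fin 2 → ℝ => ‖y‖⁻¹ • y) (𝓝 z)
        (𝓝[closedBall 0 1] (‖z‖⁻¹ • z)) := by
      refine tendsto_nhdsWithin_of_tendsto_nhds_of_eventually_within _ hcont ?_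
      filter_upwards [hne] with y hy
      exact sphere_subset_closedBall (normalize_mem_sphere hy)
    filter_upwards [mem_nhdsWithin_of_mem_nhds hne, mem_nhdsWithin_of_mem_nhds (ht.eventually h1),
      self_mem_nhdsWithin] with y hy hy' hyI
    rw [disc_mem_collar_iff hS hyI]
    refine ⟨hy, ?_⟩
    by_contra hyS
    exact hy' ⟨sphere_mem_oneSkel (normalize_mem_sphere hy), hyS⟩

lemma isOpen_image_disc (K : FiniteTwoComplex X) (d : Cell X 2) {O : Set (Fin 2 → ℝ)}
    (hO : IsOpen O) : IsOpen (chi 2 d '' (ball 0 1 ∩ O)) := by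
  refine isOpen_of_forall_cell fun n c z hz hzU => ?_
  obtain ⟨w, ⟨hwb, hwO⟩, he⟩ := hzU
  have hn := K.cell_le c
  interval_cases n
  · exfalso
    rw [Subsingleton.elim z 0] at he
    exact disc_ne_vert hwb he
  · exfalso
    rw [fin_one_eq_const z] at he hz
    have hm : chi 1 c (fun _ => z 0) ∈ oneSkel X :=
      edgePt_mem_oneSkel c (const_mem_closedBall_iff.1 hz)
    rw [← he] at hm
    exact disc_notMem_oneSkel hwb hm
  · rcases ball_union_sphere_of_mem_closedBall hz with hb | hs
    · obtain ⟨rfl, rfl⟩ := disc_injective hwb hb he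
      filter_upwards [mem_nhdsWithin_of_mem_nhds ((isOpen_ball.inter hO).mem_nhds ⟨hb, hwO⟩)]
        with y hy
      exact ⟨y, hy, rfl⟩
    · exact absurd (he ▸ sphere_mem_oneSkel hs) (disc_notMem_oneSkel hwb)

lemma eventually_disc (K : FiniteTwoComplex X) {d : Cell X 2} {z : Fin 2 → ℝ}
    (hz : z ∈ ball (0 : Fin 2 → ℝ) 1) {p : (Fin 2 → ℝ) → Prop} (h : ∀ᶠ y in 𝓝 z, p y) :
    ∀ᶠ x in 𝓝 (chi 2 d z), ∃ y ∈ ball (0 : Fin 2 → ℝ) 1, p y ∧ x = chi 2 d y := by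
  obtain ⟨O, hOp, hO, hzO⟩ := _root_.eventually_nhds_iff.1 h
  filter_upwards [(isOpen_image_disc K d hO).mem_nhds ⟨z, ⟨hz, hzO⟩, rfl⟩]
  rintro _ ⟨y, ⟨hyb, hyO⟩, rfl⟩
  exact ⟨y, hyb, hOp y hyO, rfl⟩

lemma eventually_disc_normalize (K : FiniteTwoComplex X) {d : Cell X 2} {z : Fin 2 → ℝ}
    (hz : z ∈ ball (0 : Fin 2 → ℝ) 1) (h0 : z ≠ 0) {p : (Fin 2 → ℝ) → Prop}
    (h : ∀ᶠ w in 𝓝[sphere 0 1] (‖z‖⁻¹ • z), p w) :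
    ∀ᶠ x in 𝓝 (chi 2 d z), ∃ y ∈ ball (0 : Fin 2 → ℝ) 1, p (‖y‖⁻¹ • y) ∧ x = chi 2 d y := by
  refine eventually_disc K hz ?_
  have ht : Filter.Tendsto (fun y : Fin 2 → ℝ => ‖y‖⁻¹ • y) (𝓝 z)
      (𝓝[sphere 0 1] (‖z‖⁻¹ • z)) := by
    refine tendsto_nhdsWithin_of_tendsto_nhds_of_eventually_within _
      ((continuousAt_id.norm.inv₀ (norm_ne_zero_iff.2 h0)).smul continuousAt_id) ?_
    filter_upwards [isOpen_ne.mem_nhds h0] with y hy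
    exact normalize_mem_sphere hy
  exact ht.eventually h

end Collar

/-! ### A homomorphism from labels on the 1-cells -/

section Labels

variable {X : Type*} [TopologicalSpace X] [CWComplex (univ : Set X)] {G : Type*} [Group G]

lemma exists_mem_of_mem_collar {S S' : Set X} (hS : S ⊆ oneSkel X) (hS' : S' ⊆ oneSkel X) {x : X}
    (h : x ∈ collar S) (h' : x ∈ collar S') : ∃ y ∈ S, y ∈ S' := by
  rcases h with h | ⟨d, z, hz, h0, rfl, h⟩
  · exact ⟨x, h, mem_collar_of_mem_oneSkel (hS h) h'⟩
  · exact ⟨_, h, ((disc_mem_collar_iff hS' (ball_subset_closedBall hz)).1 h').2⟩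

lemma collar_mono {S S' : Set X} (h : S ⊆ S') : collar S ⊆ collar S' := by
  rintro x (hx | ⟨d, z, hz, h0, he, hx⟩)
  · exact Or.inl (h hx)
  · exact Or.inr ⟨d, z, hz, h0, he, h hx⟩

lemma exists_singleton_of_mem_collar {S : Set X} {x : X} (h : x ∈ collar S) :
    ∃ y ∈ S, x ∈ collar {y} := by
  rcases h with h | ⟨d, z, hz, h0, he, hx⟩
  · exact ⟨x, h, Or.inl rfl⟩
  · exact ⟨_, hx, Or.inr ⟨d, z, hz, h0, he, rfl⟩⟩

lemma edgePt_mem_image_iff {e e' : Cell X 1} {I : Set ℝ} (hI : I ⊆ Ioo (-1) 1) {t : ℝ}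
    (ht : t ∈ Icc (-1 : ℝ) 1) : edgePt e' t ∈ edgePt e '' I ↔ e' = e ∧ t ∈ I := by
  constructor
  · rintro ⟨u, hu, he⟩
    rcases eq_or_lt_of_le ht.1 with rfl | h1
    · obtain ⟨v, hv⟩ := (exists_vert_eq_edgePt e').1
      exact absurd (he.trans hv).symm (vert_ne_edgePt (hI hu))
    rcases eq_or_lt_of_le ht.2 with rfl | h2
    · obtain ⟨v, hv⟩ := (exists_vert_eq_edgePt e').2
      exact absurd (he.trans hv).symm (vert_ne_edgePt (hI hu))
    obtain ⟨rfl, rfl⟩ := edgePt_injective (hI hu) ⟨h1, h2⟩ he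
    exact ⟨rfl, hu⟩
  · rintro ⟨rfl, h⟩
    exact mem_image_of_mem _ h

lemma image_edgePt_subset {e : Cell X 1} {I : Set ℝ} (hI : I ⊆ Ioo (-1) 1) :
    edgePt e '' I ⊆ oneSkel X := by
  rintro _ ⟨t, ht, rfl⟩
  exact edgePt_mem_oneSkel e (Ioo_subset_Icc_self (hI ht))

lemma isOpen_collar_image [T2Space X] (K : FiniteTwoComplex X) (e : Cell X 1) {I : Set ℝ}
    (hI : I ⊆ Ioo (-1) 1) (hIo : IsOpen I) : IsOpen (collar (edgePt e '' I)) := by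
  refine isOpen_collar K (image_edgePt_subset hI) fun e' t ht h => ?_
  obtain ⟨rfl, htI⟩ := (edgePt_mem_image_iff hI ht).1 h
  filter_upwards [mem_nhdsWithin_of_mem_nhds (hIo.mem_nhds htI)] with t' ht'
  exact mem_image_of_mem _ ht'

/-- The part of the 1-skeleton within `δ` of the 0-cell `v`. -/
def star (δ : ℝ) (v : Cell X 0) : Set X :=
  {x | x = vert v ∨ ∃ e, ∃ t ∈ Ioo (-1 : ℝ) 1, x = edgePt e t ∧
    ((t < -1 + δ ∧ edgePt e (-1) = vert v) ∨ (1 - δ < t ∧ edgePt e 1 = vert v))}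

lemma star_subset (δ : ℝ) (v : Cell X 0) : star δ v ⊆ oneSkel X := by
  rintro x (rfl | ⟨e, t, ht, rfl, -⟩)
  · exact vert_mem_oneSkel v
  · exact edgePt_mem_oneSkel e (Ioo_subset_Icc_self ht)

lemma edgePt_mem_star_iff {δ : ℝ} (hδ : 0 < δ) (hδ1 : δ ≤ 1) {v : Cell X 0} {e : Cell X 1} {t : ℝ}
    (ht : t ∈ Icc (-1 : ℝ) 1) : edgePt e t ∈ star δ v ↔
      ((t < -1 + δ ∧ edgePt e (-1) = vert v) ∨ (1 - δ < t ∧ edgePt e 1 = vert v)) := by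
  have hv : ∀ w : Cell X 0, vert w ∈ star δ v ↔ vert w = vert v := by
    intro w
    constructor
    · rintro (h | ⟨e', t', ht', h, -⟩)
      · exact h
      · exact absurd h (vert_ne_edgePt ht')
    · exact fun h => Or.inl h
  rcases eq_or_lt_of_le ht.1 with rfl | h1
  · obtain ⟨w, hw⟩ := (exists_vert_eq_edgePt e).1
    rw [hw, hv]
    constructor
    · exact fun h => Or.inl ⟨by linarith, h⟩
    · rintro (h | h)
      · exact h.2
      · linarith [h.1]
  rcases eq_or_lt_of_le ht.2 with rfl | h2
  · obtain ⟨w, hw⟩ := (exists_vert_eq_edgePt e).2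
    rw [hw, hv]
    constructor
    · exact fun h => Or.inr ⟨by linarith, h⟩
    · rintro (h | h)
      · linarith [h.1]
      · exact h.2
  constructor
  · rintro (h | ⟨e', t', ht', h, h'⟩)
    · exact absurd h.symm (vert_ne_edgePt ⟨h1, h2⟩)
    · obtain ⟨rfl, rfl⟩ := edgePt_injective ⟨h1, h2⟩ ht' h
      exact h'
  · exact fun h => Or.inr ⟨e, t, ⟨h1, h2⟩, rfl, h⟩

lemma isOpen_collar_star [T2Space X] (K : FiniteTwoComplex X) {δ : ℝ} (hδ : 0 < δ) (hδ1 : δ ≤ 1)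
    (v : Cell X 0) : IsOpen (collar (star δ v)) := by
  refine isOpen_collar K (star_subset δ v) fun e t ht h => ?_
  rw [edgePt_mem_star_iff hδ hδ1 ht] at h
  rcases h with ⟨h, hv⟩ | ⟨h, hv⟩
  · filter_upwards [self_mem_nhdsWithin, mem_nhdsWithin_of_mem_nhds (isOpen_Iio.mem_nhds h)]
      with t' ht' h'
    exact (edgePt_mem_star_iff hδ hδ1 ht').2 (Or.inl ⟨h', hv⟩)
  · filter_upwards [self_mem_nhdsWithin, mem_nhdsWithin_of_mem_nhds (isOpen_Ioi.mem_nhds h)]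
      with t' ht' h'
    exact (edgePt_mem_star_iff hδ hδ1 ht').2 (Or.inr ⟨h', hv⟩)

open Classical in
/-- The value `(η e t)⁻¹` at the points of the radii that end at `edgePt e t`. -/
def edgeGauge (η : Cell X 1 → ℝ → G) (e : Cell X 1) (x : X) : G :=
  if h : ∃ t ∈ Ioo (-1 : ℝ) 1, x ∈ collar {edgePt e t} then (η e h.choose)⁻¹ else 1

lemma edgeGauge_eq {η : Cell X 1 → ℝ → G} {e : Cell X 1} {x : X} {t : ℝ} (ht : t ∈ Ioo (-1 : ℝ) 1)
    (hx : x ∈ collar {edgePt e t}) : edgeGauge η e x = (η e t)⁻¹ := by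
  have h : ∃ t ∈ Ioo (-1 : ℝ) 1, x ∈ collar {edgePt e t} := ⟨t, ht, hx⟩
  rw [edgeGauge, dif_pos h]
  have hs : ∀ u ∈ Ioo (-1 : ℝ) 1, {edgePt e u} ⊆ oneSkel X := fun u hu =>
    singleton_subset_iff.2 (edgePt_mem_oneSkel e (Ioo_subset_Icc_self hu))
  obtain ⟨y, rfl, h2⟩ := exists_mem_of_mem_collar (hs _ h.choose_spec.1) (hs _ ht)
    h.choose_spec.2 hx
  rw [(edgePt_injective h.choose_spec.1 ht h2).2]

/-- The labelling `η` of the 1-cells, trivial around every 2-cell, determines a bundle.  It is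
trivialized over the thickened stars of the 0-cells, over the thickened open 1-cells and over the
open 2-cells. -/
def labelCover (δ : ℝ) : Cell X 0 ⊕ (Cell X 1 ⊕ Cell X 2) → Set X
  | .inl v => collar (star δ v)
  | .inr (.inl e) => collar (edgePt e '' Ioo (-1) 1)
  | .inr (.inr d) => chi 2 d '' ball 0 1

lemma exists_mem_labelCover (K : FiniteTwoComplex X) {δ : ℝ} (x : X) :
    ∃ i, x ∈ labelCover δ i := by
  rcases K.mem_cases x with (⟨v, rfl⟩ | ⟨e, t, ht, rfl⟩) | ⟨d, z, hz, rfl⟩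
  · exact ⟨.inl v, Or.inl (Or.inl rfl)⟩
  · exact ⟨.inr (.inl e), Or.inl (mem_image_of_mem _ ht)⟩
  · exact ⟨.inr (.inr d), mem_image_of_mem _ hz⟩

variable [T2Space X]

open Classical in
/-- The value `(pot s)⁻¹` at the points of the radius of the 2-cell `d` that ends at `param s`. -/
def discGauge (K : FiniteTwoComplex X) (η : Cell X 1 → ℝ → G) (d : Cell X 2) (x : X) : G :=
  if h : ∃ s ∈ Icc (0 : ℝ) (K.boundary d).length, 0 < (K.boundary d).length ∧
      ∃ z ∈ ball (0 : Fin 2 → ℝ) 1, x = chi 2 d z ∧ (K.boundary d).param s = ‖z‖⁻¹ • z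
  then ((K.boundary d).pot η h.choose)⁻¹ else 1

lemma pot_eq_of_param_eq {d : Cell X 2} {B : BoundaryPath d} {η : Cell X 1 → ℝ → G}
    (hw : B.word η B.length = 1) (hL : 0 < B.length) {s s' : ℝ} (hs : s ∈ Icc 0 (B.length : ℝ))
    (hs' : s' ∈ Icc 0 (B.length : ℝ)) (h : B.param s = B.param s') : B.pot η s = B.pot η s' := by
  rcases BoundaryPath.param_eq_param hL hs hs' h with rfl | ⟨rfl, rfl⟩ | ⟨rfl, rfl⟩
  · rfl
  · rw [BoundaryPath.pot_zero, BoundaryPath.pot_natCast le_rfl, hw]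
  · rw [BoundaryPath.pot_zero, BoundaryPath.pot_natCast le_rfl, hw]

lemma discGauge_eq {K : FiniteTwoComplex X} {η : Cell X 1 → ℝ → G} {d : Cell X 2}
    (hw : (K.boundary d).word η (K.boundary d).length = 1) {s : ℝ}
    (hL : 0 < (K.boundary d).length) (hs : s ∈ Icc (0 : ℝ) (K.boundary d).length)
    {z : Fin 2 → ℝ} (hz : z ∈ ball (0 : Fin 2 → ℝ) 1) (h : (K.boundary d).param s = ‖z‖⁻¹ • z) :
    discGauge K η d (chi 2 d z) = ((K.boundary d).pot η s)⁻¹ := by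
  have hex : ∃ s ∈ Icc (0 : ℝ) (K.boundary d).length, 0 < (K.boundary d).length ∧
      ∃ z' ∈ ball (0 : Fin 2 → ℝ) 1, chi 2 d z = chi 2 d z' ∧
        (K.boundary d).param s = ‖z'‖⁻¹ • z' := ⟨s, hs, hL, z, hz, rfl, h⟩
  rw [discGauge, dif_pos hex]
  obtain ⟨hs', -, z', hz', he, h'⟩ := hex.choose_spec
  obtain ⟨-, rfl⟩ := disc_injective hz hz' he
  rw [pot_eq_of_param_eq hw hL hs' hs (h'.trans h.symm)]

/-- The fibre coordinates over the sets of `labelCover`. -/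
def labelGauge (K : FiniteTwoComplex X) (η : Cell X 1 → ℝ → G) :
    Cell X 0 ⊕ (Cell X 1 ⊕ Cell X 2) → X → G
  | .inl _ => fun _ => 1
  | .inr (.inl e) => edgeGauge η e
  | .inr (.inr d) => discGauge K η d

lemma isOpen_labelCover (K : FiniteTwoComplex X) {δ : ℝ} (hδ : 0 < δ) (hδ1 : δ ≤ 1)
    (i : Cell X 0 ⊕ (Cell X 1 ⊕ Cell X 2)) : IsOpen (labelCover (X := X) δ i) := by
  rcases i with v | e | d
  · exact isOpen_collar_star K hδ hδ1 v
  · exact isOpen_collar_image K e Subset.rfl isOpen_Ioo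
  · have := isOpen_image_disc K d isOpen_univ
    rwa [inter_univ] at this

section loc

variable {K : FiniteTwoComplex X} {η : Cell X 1 → ℝ → G} {δ : ℝ}

/-- The potential is constant near the times at which the boundary path is close to a 0-cell. -/
lemma pot_eventually_eq {d : Cell X 2} {B : BoundaryPath d} (hδ : 0 < δ)
    (hl : ∀ e c, c < -1 + δ → η e c = 1) (hr : ∀ e c, 1 - δ < c → η e c = η e 1)
    {s : ℝ} (hs : s ∈ Icc 0 (B.length : ℝ))
    (h : ∀ j : Fin B.length, s ∈ Ioo (j : ℝ) (j + 1) →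
      B.coord j s < -1 + δ ∨ 1 - δ < B.coord j s) :
    ∀ᶠ s' in 𝓝[Icc 0 (B.length : ℝ)] s, B.pot η s' = B.pot η s := by
  -- on one boundary path, the claim holds at every time at which the coordinate is near an end
  have key : ∀ j : Fin B.length, ∀ t ∈ Icc (j : ℝ) (j + 1),
      (B.coord j t < -1 + δ ∨ 1 - δ < B.coord j t) →
      ∀ᶠ s' in 𝓝[Icc (j : ℝ) (j + 1)] t, B.pot η s' = B.pot η t := by
    intro j t ht h
    have hc := BoundaryPath.coord_continuousOn (B := B) j t ht
    rcases h with h | h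
    · filter_upwards [self_mem_nhdsWithin, hc.eventually (isOpen_Iio.mem_nhds h)] with s' hs' h'
      rw [BoundaryPath.pot_eq j hs', BoundaryPath.pot_eq j ht, hl _ _ h, hl _ _ h']
    · filter_upwards [self_mem_nhdsWithin, hc.eventually (isOpen_Ioi.mem_nhds h)] with s' hs' h'
      rw [BoundaryPath.pot_eq j hs', BoundaryPath.pot_eq j ht, hr _ _ h, hr _ _ h']
  have hends : ∀ j : Fin B.length, ∀ c : ℝ, (c = B.sign j ∨ c = - B.sign j) →
      (c < -1 + δ ∨ 1 - δ < c) := by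
    rintro j c (rfl | rfl) <;> rcases BoundaryPath.sign_eq (B := B) j with h | h <;> rw [h]
    · exact Or.inr (by linarith)
    · exact Or.inl (by linarith)
    · exact Or.inl (by linarith)
    · exact Or.inr (by linarith)
  rcases BoundaryPath.exists_nat_or_mem_Ioo hs with ⟨k, hk, rfl⟩ | ⟨j, hj⟩
  · have hright : ∀ᶠ s' in 𝓝 ((k : ℕ) : ℝ), s' ∈ Icc 0 (B.length : ℝ) → (k : ℝ) ≤ s' →
        B.pot η s' = B.pot η k := by
      rcases Nat.lt_or_ge k B.length with hk' | hk'
      · have := key ⟨k, hk'⟩ k (left_mem_Icc.2 (by simp)) (hends ⟨k, hk'⟩ _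
          (Or.inr (BoundaryPath.coord_left _)))
        rw [eventually_nhdsWithin_iff] at this
        filter_upwards [this, isOpen_Iio.mem_nhds (show (k : ℝ) < k + 1 by linarith)]
          with s' h1 h2 _ h3
        exact h1 ⟨h3, le_of_lt h2⟩
      · filter_upwards with s' h1 h2
        have : (B.length : ℝ) ≤ k := by exact_mod_cast hk'
        rw [le_antisymm (h1.2.trans this) h2]
    have hleft : ∀ᶠ s' in 𝓝 ((k : ℕ) : ℝ), s' ∈ Icc 0 (B.length : ℝ) → s' ≤ (k : ℝ) →
        B.pot η s' = B.pot η k := by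
      rcases Nat.eq_zero_or_pos k with rfl | hk'
      · filter_upwards with s' h1 h2
        rw [Nat.cast_zero] at h2 ⊢
        rw [le_antisymm h2 h1.1]
      · obtain ⟨m, rfl⟩ : ∃ m, k = m + 1 := ⟨k - 1, by omega⟩
        have := key ⟨m, hk⟩ ((m : ℝ) + 1) (right_mem_Icc.2 (by simp)) (hends ⟨m, hk⟩ _
          (Or.inl (BoundaryPath.coord_right _)))
        rw [eventually_nhdsWithin_iff] at this
        push_cast
        filter_upwards [this, isOpen_Ioi.mem_nhds (show (m : ℝ) < m + 1 by linarith)]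
          with s' h1 h2 _ h3
        exact h1 ⟨le_of_lt h2, h3⟩
    rw [eventually_nhdsWithin_iff]
    filter_upwards [hleft, hright] with s' h1 h2 hI
    rcases le_total s' k with h | h
    exacts [h1 hI h, h2 hI h]
  · have := key j s (Ioo_subset_Icc_self hj) (h j hj)
    have hN : Icc (j : ℝ) (j + 1) ∈ 𝓝 s := Icc_mem_nhds hj.1 hj.2
    rw [nhdsWithin_eq_nhds.2 hN] at this
    exact this.filter_mono nhdsWithin_le_nhds

lemma labelGauge_loc_edge_vert (K : FiniteTwoComplex X) (hl : ∀ e c, c < -1 + δ → η e c = 1)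
    (hr : ∀ e c, 1 - δ < c → η e c = η e 1) (hδ : 0 < δ) (hδ1 : δ ≤ 1)
    {e : Cell X 1} {v : Cell X 0} {x : X} (he : x ∈ collar (edgePt e '' Ioo (-1) 1))
    (hv : x ∈ collar (star δ v)) : ∀ᶠ y in 𝓝 x, edgeGauge η e y = edgeGauge η e x := by
  obtain ⟨_, ⟨t, ht, rfl⟩, hx⟩ := exists_singleton_of_mem_collar he
  have hts : edgePt e t ∈ star δ v := by
    obtain ⟨y, rfl, hy⟩ := exists_mem_of_mem_collar (singleton_subset_iff.2
      (edgePt_mem_oneSkel e (Ioo_subset_Icc_self ht))) (star_subset δ v) hx hv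
    exact hy
  have key : ∀ I : Set ℝ, IsOpen I → I ⊆ Ioo (-1) 1 → t ∈ I → (∀ u ∈ I, η e u = η e t) →
      ∀ᶠ y in 𝓝 x, edgeGauge η e y = edgeGauge η e x := by
    intro I hI hIs htI hη
    filter_upwards [(isOpen_collar_image K e hIs hI).mem_nhds
      (collar_mono (singleton_subset_iff.2 (mem_image_of_mem _ htI)) hx)] with y hy
    obtain ⟨_, ⟨u, hu, rfl⟩, hy'⟩ := exists_singleton_of_mem_collar hy
    rw [edgeGauge_eq (hIs hu) hy', edgeGauge_eq ht hx, hη u hu]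
  rcases (edgePt_mem_star_iff hδ hδ1 (Ioo_subset_Icc_self ht)).1 hts with ⟨h, -⟩ | ⟨h, -⟩
  · refine key (Ioo (-1) 1 ∩ Iio (-1 + δ)) (isOpen_Ioo.inter isOpen_Iio) inter_subset_left
      ⟨ht, h⟩ fun u hu => ?_
    rw [hl e u hu.2, hl e t h]
  · refine key (Ioo (-1) 1 ∩ Ioi (1 - δ)) (isOpen_Ioo.inter isOpen_Ioi) inter_subset_left
      ⟨ht, h⟩ fun u hu => ?_
    rw [hr e u hu.2, hr e t h]

lemma labelGauge_loc_disc_vert (hl : ∀ e c, c < -1 + δ → η e c = 1)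
    (hr : ∀ e c, 1 - δ < c → η e c = η e 1) (hδ : 0 < δ) (hδ1 : δ ≤ 1)
    (hw : ∀ d, (K.boundary d).word η (K.boundary d).length = 1)
    {d : Cell X 2} {v : Cell X 0} {z : Fin 2 → ℝ} (hz : z ∈ ball (0 : Fin 2 → ℝ) 1)
    (hv : chi 2 d z ∈ collar (star δ v)) :
    ∀ᶠ y in 𝓝 (chi 2 d z), discGauge K η d y = discGauge K η d (chi 2 d z) := by
  set B := K.boundary d
  obtain ⟨h0, hzv⟩ := (disc_mem_collar_iff (star_subset δ v) (ball_subset_closedBall hz)).1 hv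
  rcases Nat.eq_zero_or_pos B.length with hL0 | hL
  · have : discGauge K η d = fun _ => 1 := by
      funext x
      rw [discGauge, dif_neg]
      rintro ⟨s, -, h, -⟩
      exact absurd hL0 h.ne'
    rw [this]
    exact Filter.Eventually.of_forall fun _ => rfl
  obtain ⟨s, hs, hsz⟩ := BoundaryPath.exists_param_eq (B := B) hL (normalize_mem_sphere h0)
  have hsI := Ico_subset_Icc_self hs
  have hloc : ∀ t ∈ Icc 0 (B.length : ℝ), B.param t = B.param s →
      ∀ᶠ t' in 𝓝[Icc 0 (B.length : ℝ)] t, B.pot η t' = B.pot η t := by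
    intro t ht hts
    refine pot_eventually_eq hδ hl hr ht fun j hj => ?_
    have hm : edgePt (B.edge j) (B.coord j t) ∈ star δ v := by
      rw [← BoundaryPath.disc_param_eq j (Ioo_subset_Icc_self hj), hts, hsz]
      exact hzv
    rcases (edgePt_mem_star_iff hδ hδ1
      (BoundaryPath.coord_mem_Icc j (Ioo_subset_Icc_self hj))).1 hm with ⟨h, -⟩ | ⟨h, -⟩
    exacts [Or.inl h, Or.inr h]
  have hpot : ∀ t ∈ Icc 0 (B.length : ℝ), B.param t = B.param s → B.pot η t = B.pot η s :=
    fun t ht hts => pot_eq_of_param_eq (hw d) hL ht hsI hts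
  have hev : ∀ᶠ w in 𝓝[sphere 0 1] (B.param s), ∃ s' ∈ Icc 0 (B.length : ℝ),
      B.param s' = w ∧ B.pot η s' = B.pot η s := by
    let O : Set ℝ := interior {t | t ∈ Icc 0 (B.length : ℝ) → B.pot η t = B.pot η s}
    refine (BoundaryPath.eventually_exists_param hL (s := s) (O := O) isOpen_interior ?_).mono ?_
    · intro t ht hts
      rw [mem_interior_iff_mem_nhds]
      have := hloc t ht hts
      rw [eventually_nhdsWithin_iff, hpot t ht hts] at this
      exact this
    · rintro w ⟨s', ⟨hs'O, hs'⟩, rfl⟩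
      exact ⟨s', hs', rfl, interior_subset hs'O hs'⟩
  rw [hsz] at hev
  filter_upwards [eventually_disc_normalize K hz h0 hev]
  rintro y ⟨z', hz', ⟨s', hs', h1, h2⟩, rfl⟩
  rw [discGauge_eq (hw d) hL hs' hz' h1, discGauge_eq (hw d) hL hsI hz hsz, h2]

lemma labelGauge_loc_disc_edge (hw : ∀ d, (K.boundary d).word η (K.boundary d).length = 1)
    {d : Cell X 2} {e : Cell X 1} {z : Fin 2 → ℝ} (hz : z ∈ ball (0 : Fin 2 → ℝ) 1)
    (he : chi 2 d z ∈ collar (edgePt e '' Ioo (-1) 1)) :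
    ∀ᶠ y in 𝓝 (chi 2 d z), (discGauge K η d y)⁻¹ * edgeGauge η e y =
      (discGauge K η d (chi 2 d z))⁻¹ * edgeGauge η e (chi 2 d z) := by
  set B := K.boundary d
  obtain ⟨h0, t, ht, hte⟩ := (disc_mem_collar_iff (image_edgePt_subset Subset.rfl)
    (ball_subset_closedBall hz)).1 he
  have hL : 0 < B.length := by
    rcases Nat.eq_zero_or_pos B.length with hL0 | hL
    · obtain ⟨v, hv⟩ := B.constant hL0
      have := hv (normalize_mem_sphere h0)
      rw [closedCell_zero] at this
      exact absurd (hte.trans this).symm (vert_ne_edgePt ht)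
    · exact hL
  obtain ⟨s, hs, hsz⟩ := BoundaryPath.exists_param_eq (B := B) hL (normalize_mem_sphere h0)
  obtain ⟨j, hj⟩ : ∃ j : Fin B.length, s ∈ Ioo (j : ℝ) (j + 1) := by
    rcases BoundaryPath.exists_nat_or_mem_Ioo (Ico_subset_Icc_self hs) with ⟨k, hk, rfl⟩ | h
    · obtain ⟨v, hv⟩ := BoundaryPath.exists_vert_eq_param hL hk
      rw [hsz] at hv
      exact absurd (hte.trans hv).symm (vert_ne_edgePt ht)
    · exact h
  have key : ∀ s' ∈ Ioo (j : ℝ) (j + 1), ∀ z' ∈ ball (0 : Fin 2 → ℝ) 1, z' ≠ 0 →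
      B.param s' = ‖z'‖⁻¹ • z' → B.edge j = e →
      (discGauge K η d (chi 2 d z'))⁻¹ * edgeGauge η e (chi 2 d z') =
        B.word η j * (η (B.edge j) (B.coord j j))⁻¹ := by
    intro s' hs' z' hz' h0' h hje
    have hsI := Ioo_subset_Icc_self hs'
    have hmem : chi 2 d z' ∈ collar {edgePt e (B.coord j s')} := by
      rw [disc_mem_collar_iff (singleton_subset_iff.2
        (edgePt_mem_oneSkel e (BoundaryPath.coord_mem_Icc j hsI))) (ball_subset_closedBall hz')]
      refine ⟨h0', ?_⟩
      rw [← h, mem_singleton_iff, ← hje]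
      exact BoundaryPath.disc_param_eq j hsI
    rw [discGauge_eq (hw d) hL (BoundaryPath.Icc_subset j hsI) hz' h,
      edgeGauge_eq (BoundaryPath.coord_mem_Ioo j hs') hmem, inv_inv, BoundaryPath.pot_eq j hsI, hje]
    group
  have hje : B.edge j = e := by
    have h1 := BoundaryPath.disc_param_eq (B := B) j (Ioo_subset_Icc_self hj)
    rw [hsz] at h1
    exact (edgePt_injective (BoundaryPath.coord_mem_Ioo j hj) ht (h1.symm.trans hte.symm)).1
  have hsI : s ∈ Ioo 0 (B.length : ℝ) :=
    ⟨(Nat.cast_nonneg _).trans_lt hj.1, hs.2⟩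
  have hev := BoundaryPath.eventually_exists_param_of_mem_Ioo hsI (isOpen_Ioo.mem_nhds hj)
  rw [hsz] at hev
  have hne : ∀ᶠ y in 𝓝 z, y ≠ 0 := isOpen_ne.mem_nhds h0
  filter_upwards [eventually_disc_normalize K hz h0 hev, eventually_disc K hz hne]
  rintro _ ⟨z', hz', ⟨s', -, h1, h2⟩, rfl⟩ ⟨z'', hz'', h3, h4⟩
  obtain ⟨-, rfl⟩ := disc_injective hz' hz'' h4
  rw [key s' h1 z' hz' h3 h2 hje, key s hj z hz h0 hsz hje]

lemma labelGauge_loc (hl : ∀ e c, c < -1 + δ → η e c = 1)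
    (hr : ∀ e c, 1 - δ < c → η e c = η e 1) (hδ : 0 < δ) (hδ1 : δ ≤ 1)
    (hw : ∀ d, (K.boundary d).word η (K.boundary d).length = 1)
    (i j : Cell X 0 ⊕ (Cell X 1 ⊕ Cell X 2)) (x : X) (hi : x ∈ labelCover δ i)
    (hj : x ∈ labelCover δ j) : ∀ᶠ y in 𝓝 x, (labelGauge K η i y)⁻¹ * labelGauge K η j y =
      (labelGauge K η i x)⁻¹ * labelGauge K η j x := by
  have symm : ∀ i j : Cell X 0 ⊕ (Cell X 1 ⊕ Cell X 2),
      (∀ᶠ y in 𝓝 x, (labelGauge K η i y)⁻¹ * labelGauge K η j y =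
        (labelGauge K η i x)⁻¹ * labelGauge K η j x) →
      ∀ᶠ y in 𝓝 x, (labelGauge K η j y)⁻¹ * labelGauge K η i y =
        (labelGauge K η j x)⁻¹ * labelGauge K η i x := by
    intro i j h
    filter_upwards [h] with y hy
    have := congrArg (·⁻¹) hy
    simpa [mul_inv_rev] using this
  have self : ∀ i : Cell X 0 ⊕ (Cell X 1 ⊕ Cell X 2),
      ∀ᶠ y in 𝓝 x, (labelGauge K η i y)⁻¹ * labelGauge K η i y =
        (labelGauge K η i x)⁻¹ * labelGauge K η i x := by
    intro i
    filter_upwards with y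
    simp
  have ve : ∀ v e, x ∈ labelCover δ (.inl v) → x ∈ labelCover δ (.inr (.inl e)) →
      ∀ᶠ y in 𝓝 x, (labelGauge K η (.inl v) y)⁻¹ * labelGauge K η (.inr (.inl e)) y =
      (labelGauge K η (.inl v) x)⁻¹ * labelGauge K η (.inr (.inl e)) x := by
    intro v e h1 h2
    filter_upwards [labelGauge_loc_edge_vert K hl hr hδ hδ1 h2 h1] with y hy
    simp only [labelGauge, hy]
  have vd : ∀ v d, x ∈ labelCover δ (.inl v) → x ∈ labelCover δ (.inr (.inr d)) →
      ∀ᶠ y in 𝓝 x, (labelGauge K η (.inl v) y)⁻¹ * labelGauge K η (.inr (.inr d)) y =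
      (labelGauge K η (.inl v) x)⁻¹ * labelGauge K η (.inr (.inr d)) x := by
    rintro v d h1 ⟨z, hz, rfl⟩
    filter_upwards [labelGauge_loc_disc_vert hl hr hδ hδ1 hw hz h1] with y hy
    simp only [labelGauge]
    rw [hy]
  have de : ∀ d e, x ∈ labelCover δ (.inr (.inr d)) → x ∈ labelCover δ (.inr (.inl e)) →
      ∀ᶠ y in 𝓝 x, (labelGauge K η (.inr (.inr d)) y)⁻¹ * labelGauge K η (.inr (.inl e)) y =
      (labelGauge K η (.inr (.inr d)) x)⁻¹ * labelGauge K η (.inr (.inl e)) x := by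
    rintro d e ⟨z, hz, rfl⟩ h2
    exact labelGauge_loc_disc_edge hw hz h2
  rcases i with v | e | d <;> rcases j with v' | e' | d'
  · simp [labelGauge]
  · exact ve v e' hi hj
  · exact vd v d' hi hj
  · exact symm _ _ (ve v' e hj hi)
  · obtain ⟨_, ⟨t, ht, rfl⟩, t', ht', h⟩ := exists_mem_of_mem_collar
      (image_edgePt_subset Subset.rfl) (image_edgePt_subset Subset.rfl) hi hj
    obtain ⟨rfl, -⟩ := edgePt_injective ht' ht h
    exact self _
  · exact symm _ _ (de d' e hj hi)
  · exact symm _ _ (vd v' d hj hi)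
  · exact de d e' hi hj
  · obtain ⟨z, hz, rfl⟩ := hi
    obtain ⟨z', hz', h⟩ := hj
    obtain ⟨rfl, -⟩ := disc_injective hz' hz h
    exact self _

end loc

/-- A labelling of the 1-cells that is trivial around every 2-cell is realized by a homomorphism on
the fundamental groupoid. -/
theorem exists_pathHom_of_word_eq_one (K : FiniteTwoComplex X) {η : Cell X 1 → ℝ → G} {δ : ℝ}
    (hδ : 0 < δ) (hδ1 : δ ≤ 1) (hl : ∀ e c, c < -1 + δ → η e c = 1)
    (hr : ∀ e c, 1 - δ < c → η e c = η e 1)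
    (hw : ∀ d, (K.boundary d).word η (K.boundary d).length = 1) :
    ∃ F : PathHom X G, ∀ e, ∀ c ∈ Icc (-1 : ℝ) 1, ∀ c' ∈ Icc (-1 : ℝ) 1,
      F.seg (edgePt e) c c' = (η e c)⁻¹ * η e c' := by
  let D : CechData X G (Cell X 0 ⊕ (Cell X 1 ⊕ Cell X 2)) :=
    { U := labelCover δ
      isOpen := isOpen_labelCover K hδ hδ1
      h := labelGauge K η
      index := fun x => (exists_mem_labelCover K x).choose
      mem_index := fun x => (exists_mem_labelCover K x).choose_spec
      loc := labelGauge_loc hl hr hδ hδ1 hw }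
  refine ⟨D.holonomy, fun e c hc c' hc' => ?_⟩
  have hline : Continuous fun t : unitInterval => (AffineMap.lineMap c c' (t : ℝ) : ℝ) :=
    AffineMap.lineMap_continuous.comp continuous_subtype_val
  have hmem : ∀ t : unitInterval, (AffineMap.lineMap c c' (t : ℝ) : ℝ) ∈ Icc (-1 : ℝ) 1 :=
    fun t => (convex_Icc (-1 : ℝ) 1).lineMap_mem hc hc' t.2
  have hcont : Continuous fun t : unitInterval => edgePt e (AffineMap.lineMap c c' (t : ℝ)) :=
    (edgePt_continuousOn e).comp_continuous hline hmem
  have hlift : D.IsLift (fun t : unitInterval => edgePt e (AffineMap.lineMap c c' (t : ℝ)))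
      (fun t => η e (AffineMap.lineMap c c' (t : ℝ))) := by
    refine D.isLift_of_exists hcont fun t => ?_
    set u : ℝ := AffineMap.lineMap c c' (t : ℝ)
    have hu : u ∈ Icc (-1 : ℝ) 1 := hmem t
    rcases eq_or_lt_of_le hu.1 with h1 | h1
    · obtain ⟨v, hv⟩ := (exists_vert_eq_edgePt e).1
      refine ⟨.inl v, Or.inl ?_, ?_⟩
      · rw [← h1, hv]
        exact Or.inl rfl
      · filter_upwards [hline.continuousAt.eventually
          (isOpen_Iio.mem_nhds (show u < -1 + δ by linarith))] with s hs
        change _ * 1 = _ * 1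
        rw [hl e _ hs, hl e u (by linarith)]
    rcases eq_or_lt_of_le hu.2 with h2 | h2
    · obtain ⟨v, hv⟩ := (exists_vert_eq_edgePt e).2
      refine ⟨.inl v, Or.inl ?_, ?_⟩
      · rw [h2, hv]
        exact Or.inl rfl
      · filter_upwards [hline.continuousAt.eventually
          (isOpen_Ioi.mem_nhds (show 1 - δ < u by linarith))] with s hs
        change _ * 1 = _ * 1
        rw [hr e _ hs, hr e u (by linarith)]
    · refine ⟨.inr (.inl e), Or.inl (mem_image_of_mem _ ⟨h1, h2⟩), ?_⟩
      filter_upwards [hline.continuousAt.eventually (isOpen_Ioo.mem_nhds (⟨h1, h2⟩ :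
        u ∈ Ioo (-1 : ℝ) 1))] with s hs
      change _ * edgeGauge η e _ = _ * edgeGauge η e _
      rw [edgeGauge_eq hs (Or.inl rfl), edgeGauge_eq ⟨h1, h2⟩ (Or.inl rfl), mul_inv_cancel,
        mul_inv_cancel]
  have := D.holonomy_val_eq hlift
  simpa [PathHom.seg] using this

end Labels

/-! ### Step functions with marks -/

section Step

/-- The involution `σ` pairs off the elements of the set `T` of real numbers without crossings. -/
structure IsNoncrossing (T : Set ℝ) (σ : ℝ → ℝ) : Prop where
  mem : ∀ t ∈ T, σ t ∈ T
  invol : ∀ t ∈ T, σ (σ t) = t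
  ne : ∀ t ∈ T, σ t ≠ t
  cross : ∀ t ∈ T, ∀ u ∈ T, t < u → u < σ t → t < σ u ∧ σ u < σ t

variable {G : Type*} [Group G]

/-- On the set `I`, the function `η` is locally constant off the set `M` of marks, and at a mark `m`
in the interior of `I` its value gets multiplied by `g m` on the right. -/
structure IsStepOn (I M : Set ℝ) (g η : ℝ → G) : Prop where
  loc : ∀ c ∈ I, c ∉ M → ∀ᶠ c' in 𝓝[I] c, η c' = η c
  jump : ∀ m ∈ M, m ∈ interior I → ∀ᶠ p in 𝓝[<] m ×ˢ 𝓝[>] m, η p.2 = η p.1 * g m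

lemma IsStepOn.eq_of_disjoint {I M : Set ℝ} {g η : ℝ → G} (h : IsStepOn I M g η) {a b : ℝ}
    (hab : a ≤ b) (hI : Icc a b ⊆ I) (hM : ∀ m ∈ M, m ∉ Icc a b) : η a = η b := by
  refine eq_of_isPreconnected_of_eventually_eq isPreconnected_Icc (fun c hc => ?_)
    (left_mem_Icc.2 hab) (right_mem_Icc.2 hab)
  exact (h.loc c (hI hc) fun hm => hM c hm hc).filter_mono (nhdsWithin_mono _ hI)

lemma exists_isStepOn (M : Finset ℝ) (g : ℝ → G) :
    ∃ η : ℝ → G, IsStepOn univ M g η ∧ ∀ c, (∀ m ∈ M, c ≤ m) → η c = 1 := by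
  induction M using Finset.induction_on_max with
  | empty => exact ⟨fun _ => 1, ⟨by simp, by simp⟩, by simp⟩
  | insert m S hm ih =>
    obtain ⟨η, hη, h1⟩ := ih
    refine ⟨fun c => if c ≤ m then η c else η c * g m, ⟨?_, ?_⟩, ?_⟩
    · intro c _ hc
      rw [nhdsWithin_univ]
      simp only [Finset.coe_insert, mem_insert_iff, not_or, Finset.mem_coe] at hc
      have := hη.loc c trivial hc.2
      rw [nhdsWithin_univ] at this
      rcases lt_or_gt_of_ne hc.1 with h | h
      · filter_upwards [this, isOpen_Iio.mem_nhds h] with c' h2 h3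
        rw [if_pos (le_of_lt h3), if_pos h.le, h2]
      · filter_upwards [this, isOpen_Ioi.mem_nhds h] with c' h2 h3
        rw [if_neg (not_le.2 h3), if_neg (not_le.2 h), h2]
    · intro m' hm' _
      simp only [Finset.coe_insert, mem_insert_iff, Finset.mem_coe] at hm'
      rcases hm' with rfl | hm'
      · have := hη.loc m' trivial fun h => (hm m' h).false
        rw [nhdsWithin_univ] at this
        filter_upwards [((this.filter_mono nhdsWithin_le_nhds).and self_mem_nhdsWithin).prod_mk
          ((this.filter_mono nhdsWithin_le_nhds).and self_mem_nhdsWithin)] with p hp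
        obtain ⟨⟨ha, hb⟩, hc, hd⟩ := hp
        rw [if_neg (not_le.2 hd), if_pos (le_of_lt hb), ha, hc]
      · have hlt := hm m' hm'
        have hev : ∀ᶠ c in 𝓝 m', c < m := isOpen_Iio.mem_nhds hlt
        filter_upwards [hη.jump m' hm' (by simp), (hev.filter_mono
          (nhdsWithin_le_nhds (s := Iio m'))).prod_mk
          (hev.filter_mono (nhdsWithin_le_nhds (s := Ioi m')))] with p hp hp'
        rw [if_pos hp'.1.le, if_pos hp'.2.le, hp]
    · intro c hc
      beta_reduce
      rw [if_pos (hc m (Finset.mem_insert_self _ _))]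
      exact h1 c fun m' hm' => hc m' (Finset.mem_insert_of_mem hm')

lemma eventually_isolated {T : Set ℝ} (hT : T.Finite) (m : ℝ) :
    ∀ᶠ ε in 𝓝[>] (0 : ℝ), ∀ t ∈ T, t ≠ m → t < m - ε ∨ m + ε < t := by
  have hfin : ∀ t ∈ T, ∀ᶠ ε in 𝓝[>] (0 : ℝ), t ≠ m → t < m - ε ∨ m + ε < t := by
    intro t _
    by_cases htm : t = m
    · simp [htm]
    have : 0 < |t - m| := abs_pos.2 (sub_ne_zero.2 htm)
    filter_upwards [Ioo_mem_nhdsGT this] with ε hε _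
    rcases lt_or_gt_of_ne htm with h | h
    · rw [abs_of_neg (by linarith)] at hε
      exact Or.inl (by linarith [hε.2])
    · rw [abs_of_pos (by linarith)] at hε
      exact Or.inr (by linarith [hε.2])
  exact (hT.eventually_all).2 hfin

lemma tendsto_sub_add_nhdsGT_zero (m : ℝ) :
    Filter.Tendsto (fun ε : ℝ => (m - ε, m + ε)) (𝓝[>] 0) (𝓝[<] m ×ˢ 𝓝[>] m) := by
  refine Filter.Tendsto.prodMk ?_ ?_
  · refine tendsto_nhdsWithin_of_tendsto_nhds_of_eventually_within _ ?_ ?_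
    · have : Filter.Tendsto (fun ε : ℝ => m - ε) (𝓝 0) (𝓝 (m - 0)) :=
        (continuous_const.sub continuous_id).tendsto 0
      rw [sub_zero] at this
      exact this.mono_left nhdsWithin_le_nhds
    · filter_upwards [self_mem_nhdsWithin] with ε hε
      exact sub_lt_self _ (mem_Ioi.1 hε)
  · refine tendsto_nhdsWithin_of_tendsto_nhds_of_eventually_within _ ?_ ?_
    · have : Filter.Tendsto (fun ε : ℝ => m + ε) (𝓝 0) (𝓝 (m + 0)) :=
        (continuous_const.add continuous_id).tendsto 0
      rw [add_zero] at this
      exact this.mono_left nhdsWithin_le_nhds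
    · filter_upwards [self_mem_nhdsWithin] with ε hε
      exact lt_add_of_pos_right _ (mem_Ioi.1 hε)

lemma IsStepOn.eventually_jump {I M : Set ℝ} {g P : ℝ → G} (hP : IsStepOn I M g P) {m : ℝ}
    (hm : m ∈ M) (hmI : m ∈ interior I) :
    ∀ᶠ ε in 𝓝[>] (0 : ℝ), P (m + ε) = P (m - ε) * g m :=
  (tendsto_sub_add_nhdsGT_zero m).eventually (hP.jump m hm hmI)

/-- A step function whose marks are paired off without crossings, with inverse jumps at paired marks,
takes the same value at both ends. -/
lemma IsStepOn.eq_of_noncrossing {I T : Set ℝ} {g P : ℝ → G} (hP : IsStepOn I T g P)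
    (hT : T.Finite) {σ : ℝ → ℝ} (hσ : IsNoncrossing T σ) (hg : ∀ t ∈ T, g (σ t) = (g t)⁻¹)
    (n : ℕ) :
    ∀ s s' : ℝ, s ≤ s' → Icc s s' ⊆ I → s ∉ T → s' ∉ T → (T ∩ Ioo s s').ncard ≤ n →
      (∀ t ∈ T, t ∈ Ioo s s' → σ t ∈ Ioo s s') → P s = P s' := by
  obtain ⟨hσT, hσσ, hσne, hcross⟩ := hσ
  induction n with
  | zero =>
    intro s s' hss hI hs hs' hn _
    have hempty : T ∩ Ioo s s' = ∅ := by
      rw [← Set.ncard_eq_zero (hT.inter_of_left _)]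
      exact Nat.le_zero.1 hn
    refine hP.eq_of_disjoint hss hI fun m hm hmI => ?_
    rcases eq_or_lt_of_le hmI.1 with rfl | h1
    · exact hs hm
    rcases eq_or_lt_of_le hmI.2 with rfl | h2
    · exact hs' hm
    exact (hempty.subset ⟨hm, h1, h2⟩ : m ∈ (∅ : Set ℝ))
  | succ n ih =>
    intro s s' hss hI hs hs' hn hcl
    rcases (T ∩ Ioo s s').eq_empty_or_nonempty with hempty | hne
    · exact ih s s' hss hI hs hs' (by rw [hempty]; simp) hcl
    obtain ⟨t₁, ⟨ht₁, h1⟩, hmin⟩ := (hT.inter_of_left (Ioo s s')).exists_minimalFor id _ hne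
    replace hmin : ∀ t ∈ T, t ∈ Ioo s s' → t₁ ≤ t := by
      intro t ht hts
      by_contra hlt
      exact hlt (hmin ⟨ht, hts⟩ (not_le.1 hlt).le)
    set t₂ := σ t₁
    have ht₂ : t₂ ∈ T := hσT _ ht₁
    have h2 : t₂ ∈ Ioo s s' := hcl _ ht₁ h1
    have h12 : t₁ < t₂ := lt_of_le_of_ne (hmin _ ht₂ h2) (hσne _ ht₁).symm
    have hiso := fun m => eventually_isolated hT m
    have hjump : ∀ m ∈ T, m ∈ Ioo s s' →
        ∀ᶠ ε in 𝓝[>] (0 : ℝ), P (m + ε) = P (m - ε) * g m := fun m hm hms =>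
      hP.eventually_jump hm (interior_mono hI (by rw [interior_Icc]; exact hms))
    have hsmall : ∀ a b : ℝ, a < b → ∀ᶠ ε in 𝓝[>] (0 : ℝ), ε < b - a := fun a b hab =>
      mem_nhdsWithin_of_mem_nhds (isOpen_Iio.mem_nhds (sub_pos.2 hab))
    have hpos : ∀ᶠ ε in 𝓝[>] (0 : ℝ), ε ∈ Ioi 0 := self_mem_nhdsWithin
    obtain ⟨ε, hε0, i1, i2, j1, j2, e1, e2, e3⟩ := (hpos.and ((hiso t₁).and ((hiso t₂).and
      ((hjump t₁ ht₁ h1).and ((hjump t₂ ht₂ h2).and ((hsmall s t₁ h1.1).and ((hsmall t₁ ((t₁ + t₂) / 2) (by linarith)).and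
        (hsmall t₂ s' h2.2)))))))).exists
    have hε : 0 < ε := hε0
    have k0 : P s = P (t₁ - ε) := by
      refine hP.eq_of_disjoint (by linarith) ((Icc_subset_Icc le_rfl (by linarith [h1.2])).trans hI)
        fun m hm hmI => ?_
      have hms : m ≠ s := fun h => hs (h ▸ hm)
      have := hmin m hm ⟨lt_of_le_of_ne hmI.1 hms.symm, by linarith [hmI.2, h1.2]⟩
      linarith [hmI.2]
    have nT : ∀ t : ℝ, (t < t₁ - ε ∨ t₁ + ε < t ∨ t = t₁) ∧ (t < t₂ - ε ∨ t₂ + ε < t ∨ t = t₂) ∨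
        t ∉ T := by
      intro t
      by_cases ht : t ∈ T
      · left
        constructor
        · by_cases h : t = t₁
          · exact Or.inr (Or.inr h)
          · rcases i1 t ht h with h | h
            exacts [Or.inl h, Or.inr (Or.inl h)]
        · by_cases h : t = t₂
          · exact Or.inr (Or.inr h)
          · rcases i2 t ht h with h | h
            exacts [Or.inl h, Or.inr (Or.inl h)]
      · exact Or.inr ht
    have n1 : t₁ + ε ∉ T := by
      rcases nT (t₁ + ε) with ⟨h | h | h, -⟩ | h
      · linarith
      · linarith
      · linarith
      · exact h
    have n2 : t₂ - ε ∉ T := by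
      rcases nT (t₂ - ε) with ⟨-, h | h | h⟩ | h
      · linarith
      · linarith
      · linarith
      · exact h
    have n3 : t₂ + ε ∉ T := by
      rcases nT (t₂ + ε) with ⟨-, h | h | h⟩ | h
      · linarith
      · linarith
      · linarith
      · exact h
    have hcard : ∀ A : Set ℝ, A ⊆ T ∩ Ioo s s' → t₁ ∉ A → A.ncard ≤ n := by
      intro A hA h
      have : A.ncard < (T ∩ Ioo s s').ncard :=
        Set.ncard_lt_ncard (ssubset_of_subset_of_ne hA fun he => h (he ▸ ⟨ht₁, h1⟩))
          (hT.inter_of_left _)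
      omega
    have k1 : P (t₁ + ε) = P (t₂ - ε) := by
      refine ih _ _ (by linarith)
        ((Icc_subset_Icc (by linarith [h1.1]) (by linarith [h2.2])).trans hI) n1 n2
        (hcard _ (inter_subset_inter_right _
          (Ioo_subset_Ioo (by linarith [h1.1]) (by linarith [h2.2]))) fun h => ?_) ?_
      · linarith [h.2.1]
      · intro t ht hts
        have hc := hcross t₁ ht₁ t ht (by linarith [hts.1]) (by
          change t < t₂
          linarith [hts.2])
        have hlt : σ t < t₂ := hc.2
        rcases i1 _ (hσT t ht) hc.1.ne' with h | h
        · linarith [hc.1]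
        rcases i2 _ (hσT t ht) hc.2.ne with h' | h'
        · exact ⟨h, h'⟩
        · linarith
    have k2 : P (t₂ + ε) = P s' := by
      refine ih _ _ (by linarith)
        ((Icc_subset_Icc (by linarith [h2.1]) le_rfl).trans hI) n3 hs'
        (hcard _ (inter_subset_inter_right _
          (Ioo_subset_Ioo (by linarith [h2.1]) le_rfl)) fun h => ?_) ?_
      · linarith [h.2.1]
      · intro t ht hts
        have hin := hcl t ht ⟨by linarith [hts.1, h2.1], hts.2⟩
        refine ⟨?_, hin.2⟩
        have hm := hmin _ (hσT t ht) hin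
        have hne1 : σ t ≠ t₁ := by
          intro h
          have : t = t₂ := by rw [← hσσ t ht, h]
          linarith [hts.1]
        have hne2 : σ t ≠ t₂ := by
          intro h
          have h3 : σ (σ t) = t₁ := by rw [h]; exact hσσ t₁ ht₁
          rw [hσσ t ht] at h3
          linarith [hts.1]
        rcases i2 _ (hσT t ht) hne2 with h | h
        · exfalso
          have hlt : t₁ < σ t := lt_of_le_of_ne hm hne1.symm
          have := (hcross t₁ ht₁ _ (hσT t ht) hlt (by change σ t < t₂; linarith)).2
          rw [hσσ t ht] at this
          change t < t₂ at this
          linarith [hts.1]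
        · exact h
    rw [k0, ← k2, j2, ← k1, j1, hg t₁ ht₁]
    group

end Step

section PotStep

variable {X : Type*} [TopologicalSpace X] [CWComplex (univ : Set X)] [T2Space X] {d : Cell X 2}
  {G : Type*} [Group G] {B : BoundaryPath d}

/-- The times at which the boundary path of a 2-cell passes a mark; `M e` are the coordinates of the
marks on the 1-cell `e`. -/
def BoundaryPath.marks (B : BoundaryPath d) (M : Cell X 1 → Set ℝ) : Set ℝ :=
  {s | ∃ j : Fin B.length, s ∈ Ioo (j : ℝ) (j + 1) ∧ B.coord j s ∈ M (B.edge j)}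

open Classical in
/-- The jump at a mark on the boundary path: the jump on the 1-cell if the path runs over it in the
positive direction, and its inverse otherwise. -/
def BoundaryPath.letter (B : BoundaryPath d) (g : Cell X 1 → ℝ → G) (s : ℝ) : G :=
  if h : ∃ j : Fin B.length, s ∈ Ioo (j : ℝ) (j + 1) then
    if B.sign h.choose = 1 then g (B.edge h.choose) (B.coord h.choose s)
    else (g (B.edge h.choose) (B.coord h.choose s))⁻¹ else 1

lemma BoundaryPath.index_unique {L : ℕ} {i j : Fin L} {s : ℝ} (hi : s ∈ Ioo (i : ℝ) (i + 1))
    (hj : s ∈ Ioo (j : ℝ) (j + 1)) : i = j := by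
  have h1 : ((i : ℕ) : ℝ) < (j : ℕ) + 1 := hi.1.trans hj.2
  have h2 : ((j : ℕ) : ℝ) < (i : ℕ) + 1 := hj.1.trans hi.2
  ext
  have h3 : (i : ℕ) < (j : ℕ) + 1 := by exact_mod_cast h1
  have h4 : (j : ℕ) < (i : ℕ) + 1 := by exact_mod_cast h2
  omega

lemma BoundaryPath.letter_eq {g : Cell X 1 → ℝ → G} {s : ℝ} {j : Fin B.length}
    (hs : s ∈ Ioo (j : ℝ) (j + 1)) : B.letter g s = if B.sign j = 1 then
      g (B.edge j) (B.coord j s) else (g (B.edge j) (B.coord j s))⁻¹ := by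
  have h : ∃ j : Fin B.length, s ∈ Ioo (j : ℝ) (j + 1) := ⟨j, hs⟩
  have hj : h.choose = j := BoundaryPath.index_unique h.choose_spec hs
  rw [BoundaryPath.letter, dif_pos h, hj]

lemma BoundaryPath.marks_subset {M : Cell X 1 → Set ℝ} :
    B.marks M ⊆ Ioo 0 (B.length : ℝ) := by
  rintro s ⟨j, hj, -⟩
  have := BoundaryPath.Icc_subset j (right_mem_Icc.2 (by linarith))
  exact ⟨(Nat.cast_nonneg _).trans_lt hj.1, hj.2.trans_le this.2⟩

lemma BoundaryPath.marks_finite {M : Cell X 1 → Set ℝ} (hM : ∀ e, (M e).Finite) :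
    (B.marks M).Finite := by
  have : B.marks M ⊆ ⋃ j : Fin B.length, (Ioo (j : ℝ) (j + 1) ∩ B.coord j ⁻¹' M (B.edge j)) := by
    rintro s ⟨j, hj, h⟩
    exact mem_iUnion.2 ⟨j, hj, h⟩
  refine (Set.finite_iUnion fun j => ?_).subset this
  refine Set.Finite.of_finite_image ((hM (B.edge j)).subset ?_) (f := B.coord j) ?_
  · rintro _ ⟨s, hs, rfl⟩
    exact hs.2
  · intro s hs s' hs' h
    exact (BoundaryPath.coord_strictMonoOn (B := B) j).injOn (Ioo_subset_Icc_self hs.1)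
      (Ioo_subset_Icc_self hs'.1) (by simp [h])

/-- The jump of a step function on a 1-cell, seen along the boundary path. -/
lemma BoundaryPath.eventually_coord_jump {j : Fin B.length} {I M : Set ℝ} {g η : ℝ → G}
    (hη : IsStepOn I M g η) {m : ℝ} (hj : m ∈ Ioo (j : ℝ) (j + 1)) (hm : B.coord j m ∈ M)
    (hmI : B.coord j m ∈ interior I) : ∀ᶠ p in 𝓝[<] m ×ˢ 𝓝[>] m, η (B.coord j p.2) =
      η (B.coord j p.1) * if B.sign j = 1 then g (B.coord j m) else (g (B.coord j m))⁻¹ := by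
  have hc : ContinuousAt (B.coord j) m :=
    (coord_continuousOn j).continuousAt (Icc_mem_nhds hj.1 hj.2)
  have hjump := hη.jump _ hm hmI
  have hmI := Ioo_subset_Icc_self hj
  have hIoo : ∀ᶠ s in 𝓝 m, s ∈ Ioo (j : ℝ) (j + 1) := isOpen_Ioo.mem_nhds hj
  have hside : ∀ S S' : Set ℝ, (∀ s ∈ Ioo (j : ℝ) (j + 1), s ∈ S → B.coord j s ∈ S') →
      Filter.Tendsto (B.coord j) (𝓝[S] m) (𝓝[S'] (B.coord j m)) := by
    intro S S' h
    refine tendsto_nhdsWithin_of_tendsto_nhds_of_eventually_within _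
      (hc.tendsto.mono_left nhdsWithin_le_nhds) ?_
    rw [eventually_nhdsWithin_iff]
    exact hIoo.mono h
  have hlt : ∀ s ∈ Ioo (j : ℝ) (j + 1), s < m → 0 < B.sign j * (B.coord j m - B.coord j s) := by
    intro s hs h
    have := (coord_lt_iff (B := B) j (Ioo_subset_Icc_self hs) hmI).2 h
    linarith
  have hgt : ∀ s ∈ Ioo (j : ℝ) (j + 1), m < s → 0 < B.sign j * (B.coord j s - B.coord j m) := by
    intro s hs h
    have := (coord_lt_iff (B := B) j hmI (Ioo_subset_Icc_self hs)).2 h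
    linarith
  rcases sign_eq (B := B) j with hs | hs <;> rw [hs] at hlt hgt
  · have t1 := hside (Iio m) (Iio (B.coord j m)) fun s hs h => mem_Iio.2 (by linarith [hlt s hs h])
    have t2 := hside (Ioi m) (Ioi (B.coord j m)) fun s hs h => mem_Ioi.2 (by linarith [hgt s hs h])
    filter_upwards [(t1.prodMap t2).eventually hjump] with p hp
    rw [if_pos hs]
    exact hp
  · have t1 := hside (Iio m) (Ioi (B.coord j m)) fun s hs h => mem_Ioi.2 (by linarith [hlt s hs h])
    have t2 := hside (Ioi m) (Iio (B.coord j m)) fun s hs h => mem_Iio.2 (by linarith [hgt s hs h])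
    filter_upwards [Filter.tendsto_prod_swap.eventually ((t2.prodMap t1).eventually hjump)] with p hp
    rw [if_neg (by rw [hs]; norm_num)]
    have hp' : η (B.coord j p.1) = η (B.coord j p.2) * g (B.coord j m) := hp
    rw [hp', mul_inv_cancel_right]

lemma BoundaryPath.isStepOn_pot {M : Cell X 1 → Set ℝ} {g η : Cell X 1 → ℝ → G}
    (hη : ∀ e, IsStepOn univ (M e) (g e) (η e)) {δ : ℝ} (hδ : 0 < δ)
    (hl : ∀ e c, c < -1 + δ → η e c = 1) (hr : ∀ e c, 1 - δ < c → η e c = η e 1) :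
    IsStepOn (Icc 0 (B.length : ℝ)) (B.marks M) (B.letter g) (B.pot η) := by
  constructor
  · intro s hs hsM
    by_cases h : ∃ j : Fin B.length, s ∈ Ioo (j : ℝ) (j + 1)
    · obtain ⟨j, hj⟩ := h
      have hc : ContinuousAt (B.coord j) s :=
        (coord_continuousOn j).continuousAt (Icc_mem_nhds hj.1 hj.2)
      have := (hη (B.edge j)).loc (B.coord j s) trivial fun h => hsM ⟨j, hj, h⟩
      rw [nhdsWithin_univ] at this
      refine Filter.Eventually.filter_mono nhdsWithin_le_nhds ?_
      filter_upwards [hc.eventually this, isOpen_Ioo.mem_nhds hj] with s' h1 h2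
      rw [pot_eq j (Ioo_subset_Icc_self h2), pot_eq j (Ioo_subset_Icc_self hj), h1]
    · exact pot_eventually_eq hδ hl hr hs fun j hj => absurd ⟨j, hj⟩ h
  · rintro m ⟨j, hj, hm⟩ -
    have hjump := eventually_coord_jump (hη (B.edge j)) hj hm (by simp)
    have hpot : ∀ᶠ p in 𝓝[<] m ×ˢ 𝓝[>] m,
        B.pot η p.1 = B.word η j * (η (B.edge j) (B.coord j j))⁻¹ * η (B.edge j) (B.coord j p.1) ∧
        B.pot η p.2 = B.word η j * (η (B.edge j) (B.coord j j))⁻¹ *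
          η (B.edge j) (B.coord j p.2) := by
      have hev : ∀ᶠ s in 𝓝 m, s ∈ Ioo (j : ℝ) (j + 1) := isOpen_Ioo.mem_nhds hj
      filter_upwards [(hev.filter_mono (nhdsWithin_le_nhds (s := Iio m))).prod_mk
        (hev.filter_mono (nhdsWithin_le_nhds (s := Ioi m)))] with p hp
      exact ⟨pot_eq j (Ioo_subset_Icc_self hp.1), pot_eq j (Ioo_subset_Icc_self hp.2)⟩
    filter_upwards [hjump, hpot] with p h1 h2
    rw [letter_eq hj, h2.1, h2.2, h1]
    simp only [mul_assoc]

end PotStep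

/-! ### Regular cocycles in a disc -/

section Graph

variable {X : Type*} [TopologicalSpace X] [CWComplex (univ : Set X)] {d : Cell X 2}

lemma RegularGraph.disc_mem_carrier_iff (Γ : RegularGraph X) {z : Fin 2 → ℝ}
    (hz : z ∈ closedBall (0 : Fin 2 → ℝ) 1) :
    chi 2 d z ∈ Γ.carrier ↔ ∃ j, z ∈ range (Γ.arc d j) := by
  have := Γ.preimage_eq d
  rw [Set.ext_iff] at this
  have h := this z
  rw [mem_iUnion] at h
  exact ⟨fun hc => h.1 ⟨hz, hc⟩, fun hc => (h.2 hc).2⟩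

lemma RegularGraph.arc_mem_closedBall (Γ : RegularGraph X) (j : Fin (Γ.numArcs d))
    (t : unitInterval) : Γ.arc d j t ∈ closedBall (0 : Fin 2 → ℝ) 1 := by
  have := (Γ.preimage_eq d).symm.subset (mem_iUnion.2 ⟨j, t, rfl⟩)
  exact this.1

lemma RegularGraph.arc_mem_carrier (Γ : RegularGraph X) (j : Fin (Γ.numArcs d))
    (t : unitInterval) : chi 2 d (Γ.arc d j t) ∈ Γ.carrier :=
  (Γ.disc_mem_carrier_iff (Γ.arc_mem_closedBall j t)).2 ⟨j, t, rfl⟩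

lemma RegularGraph.vert_notMem (Γ : RegularGraph X) (v : Cell X 0) : vert v ∉ Γ.carrier := by
  intro h
  refine Set.disjoint_left.1 (Γ.disjoint_vertex v) h ?_
  rw [closedCell_zero]
  rfl

lemma RegularGraph.eq_of_mem_range (Γ : RegularGraph X) {j k : Fin (Γ.numArcs d)} {z : Fin 2 → ℝ}
    (hj : z ∈ range (Γ.arc d j)) (hk : z ∈ range (Γ.arc d k)) : j = k := by
  by_contra h
  exact Set.disjoint_left.1 (Γ.arc_disjoint d h) hj hk

variable [T2Space X]

lemma RegularGraph.exists_mem_Ioo (Γ : RegularGraph X) (B : BoundaryPath d) {s : ℝ}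
    (hL : 0 < B.length)
    (hs : s ∈ Icc 0 (B.length : ℝ)) (h : chi 2 d (B.param s) ∈ Γ.carrier) :
    ∃ j : Fin B.length, s ∈ Ioo (j : ℝ) (j + 1) := by
  rcases BoundaryPath.exists_nat_or_mem_Ioo hs with ⟨j, hj, rfl⟩ | h'
  · obtain ⟨v, hv⟩ := BoundaryPath.exists_vert_eq_param (B := B) hL hj
    rw [hv] at h
    exact absurd h (Γ.vert_notMem v)
  · exact h'

lemma mem_Ioo_of_mem_Ioo_fin {L : ℕ} {j : Fin L} {s : ℝ} (hs : s ∈ Ioo (j : ℝ) (j + 1)) :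
    s ∈ Ioo 0 (L : ℝ) := by
  have h : ((j : ℕ) : ℝ) + 1 ≤ L := by exact_mod_cast j.2
  exact ⟨(Nat.cast_nonneg _).trans_lt hs.1, hs.2.trans_le h⟩

/-- The boundary circle, parametrized by `B.param`, meets the arc `j` of `Γ` at the times `s` and
`t` only. -/
structure RegularGraph.ArcEnds (Γ : RegularGraph X) (B : BoundaryPath d) (j : Fin (Γ.numArcs d))
    (s t : ℝ) : Prop where
  left_mem : s ∈ Ioo 0 (B.length : ℝ)
  right_mem : t ∈ Ioo 0 (B.length : ℝ)
  ne : s ≠ t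
  mem_range_iff : ∀ r ∈ Icc 0 (B.length : ℝ), B.param r ∈ range (Γ.arc d j) ↔ r = s ∨ r = t

lemma RegularGraph.ArcEnds.symm {Γ : RegularGraph X} {B : BoundaryPath d} {j : Fin (Γ.numArcs d)}
    {s t : ℝ} (h : Γ.ArcEnds B j s t) : Γ.ArcEnds B j t s :=
  ⟨h.right_mem, h.left_mem, h.ne.symm, fun r hr => (h.mem_range_iff r hr).trans or_comm⟩

lemma RegularGraph.ArcEnds.left_mem_range {Γ : RegularGraph X} {B : BoundaryPath d}
    {j : Fin (Γ.numArcs d)} {s t : ℝ} (h : Γ.ArcEnds B j s t) :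
    B.param s ∈ range (Γ.arc d j) :=
  (h.mem_range_iff s (Ioo_subset_Icc_self h.left_mem)).2 (Or.inl rfl)

lemma RegularGraph.exists_arcEnds (Γ : RegularGraph X) (B : BoundaryPath d) {s : ℝ}
    (hL : 0 < B.length) (hs : s ∈ Icc 0 (B.length : ℝ))
    (h : chi 2 d (B.param s) ∈ Γ.carrier) : ∃ j t, Γ.ArcEnds B j s t := by
  have hsph := BoundaryPath.param_mem_sphere hL hs
  obtain ⟨j, x, hx⟩ := (Γ.disc_mem_carrier_iff (sphere_subset_closedBall hsph)).1 h
  have hx01 := (Γ.arc_mem_sphere_iff d j x).1 (hx ▸ hsph)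
  have hend : ∀ ε : unitInterval, ε = 0 ∨ ε = 1 → ∃ t ∈ Ioo 0 (B.length : ℝ),
      B.param t = Γ.arc d j ε := by
    intro ε hε
    have hε' := (Γ.arc_mem_sphere_iff d j ε).2 hε
    obtain ⟨t, ht, hte⟩ := BoundaryPath.exists_param_eq (B := B) hL hε'
    obtain ⟨k, hk⟩ := Γ.exists_mem_Ioo B hL (Ico_subset_Icc_self ht)
      (by rw [hte]; exact Γ.arc_mem_carrier j ε)
    exact ⟨t, mem_Ioo_of_mem_Ioo_fin hk, hte⟩
  have hinj : ∀ r ∈ Icc 0 (B.length : ℝ), ∀ t ∈ Ioo 0 (B.length : ℝ), B.param r = B.param t →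
      r = t := by
    intro r hr t ht h
    rcases BoundaryPath.param_eq_param hL hr (Ioo_subset_Icc_self ht) h with h | h | h
    · exact h
    · exact absurd h.2 ht.2.ne
    · exact absurd h.2 ht.1.ne'
  have hs' : s ∈ Ioo 0 (B.length : ℝ) := by
    obtain ⟨k, hk⟩ := Γ.exists_mem_Ioo B hL hs h
    exact mem_Ioo_of_mem_Ioo_fin hk
  have key : ∀ y : unitInterval, (y = 0 ∨ y = 1) → y ≠ x → (∀ r, r = 0 ∨ r = 1 → r = x ∨ r = y) →
      ∃ t, Γ.ArcEnds B j s t := by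
    intro y hy hyx hall
    obtain ⟨t, ht, hte⟩ := hend y hy
    refine ⟨t, hs', ht, ?_, ?_⟩
    · rintro rfl
      exact hyx (Γ.arc_injective d j (hte.symm.trans hx.symm))
    · intro r hr
      constructor
      · rintro ⟨u, hu⟩
        have hu01 := (Γ.arc_mem_sphere_iff d j u).1 (hu ▸ BoundaryPath.param_mem_sphere hL hr)
        rcases hall u hu01 with rfl | rfl
        · exact Or.inl (hinj r hr s hs' (hu.symm.trans hx))
        · exact Or.inr (hinj r hr t ht (hu.symm.trans hte.symm))
      · rintro (rfl | rfl)
        exacts [⟨x, hx⟩, ⟨y, hte.symm⟩]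
  rcases hx01 with rfl | rfl
  · obtain ⟨t, ht⟩ := key 1 (Or.inr rfl) one_ne_zero fun r hr => hr
    exact ⟨j, t, ht⟩
  · obtain ⟨t, ht⟩ := key 0 (Or.inl rfl) zero_ne_one fun r hr => hr.symm
    exact ⟨j, t, ht⟩

lemma RegularGraph.exists_edgePt_mem (Γ : RegularGraph X) (K : FiniteTwoComplex X) :
    ∃ e, ∃ c ∈ Ioo (-1 : ℝ) 1, edgePt e c ∈ Γ.carrier := by
  have hskel : ∀ x ∈ oneSkel X, x ∈ Γ.carrier → ∃ e, ∃ c ∈ Ioo (-1 : ℝ) 1,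
      edgePt e c ∈ Γ.carrier := by
    intro x hx hxΓ
    rcases hx with hx | hx
    · obtain ⟨v, rfl⟩ := hx
      exact absurd hxΓ (Γ.vert_notMem v)
    · obtain ⟨e, c, hc, rfl⟩ := hx
      exact ⟨e, c, hc, hxΓ⟩
  obtain ⟨x, hx⟩ := Γ.nonempty
  rcases K.mem_cases x with h | ⟨d, z, hz, rfl⟩
  · exact hskel x h hx
  · obtain ⟨j, -⟩ := (Γ.disc_mem_carrier_iff (ball_subset_closedBall hz)).1 hx
    exact hskel _ (sphere_mem_oneSkel ((Γ.arc_mem_sphere_iff d j 0).2 (Or.inl rfl)))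
      (Γ.arc_mem_carrier j 0)

end Graph

section Side

variable {X : Type*} [TopologicalSpace X] [CWComplex (univ : Set X)] {d : Cell X 2}

lemma RegularCocycle.mem_posSide_iff (C : RegularCocycle X) {j : Fin (C.numArcs d)}
    {S : Set (Fin 2 → ℝ)} (hS : IsPreconnected S)
    (hSD : S ⊆ closedBall 0 1 \ range (C.arc d j)) {x y : Fin 2 → ℝ} (hx : x ∈ S) (hy : y ∈ S) :
    x ∈ C.posSide d j ↔ y ∈ C.posSide d j := by
  obtain ⟨p, -, hp⟩ := C.posSide_eq d j
  have h : connectedComponentIn (closedBall 0 1 \ range (C.arc d j)) x =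
      connectedComponentIn (closedBall 0 1 \ range (C.arc d j)) y :=
    connectedComponentIn_eq (hS.subset_connectedComponentIn hx hSD hy)
  rw [hp]
  constructor
  · intro hxp
    rw [connectedComponentIn_eq hxp, h]
    exact mem_connectedComponentIn (hSD hy)
  · intro hyp
    rw [connectedComponentIn_eq hyp, ← h]
    exact mem_connectedComponentIn (hSD hx)

variable [T2Space X] {C : RegularCocycle X} {j : Fin (C.numArcs d)} {B : BoundaryPath d} {s t : ℝ}

/-- In terms of the parameter of the boundary path, the positive side of an arc lies, near an end of
the arc, in the direction given by `C.dir` and by the direction of the boundary path. -/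
lemma RegularGraph.ArcEnds.eventually_mem_posSide (h : C.ArcEnds B j s t) {k : Fin B.length}
    (hk : s ∈ Ioo (k : ℝ) (k + 1)) : ∀ᶠ r in 𝓝 s, (B.param r ∈ C.posSide d j ↔
      0 < ((C.dir (chi 2 d (B.param s)) : ℤ) : ℝ) * B.sign k * (r - s)) := by
  have hL := BoundaryPath.length_pos k
  obtain ⟨ε, hε⟩ := h.left_mem_range
  have hε01 := (C.arc_mem_sphere_iff d j ε).1
    (hε ▸ BoundaryPath.param_mem_sphere hL (Ioo_subset_Icc_self h.left_mem))
  have hval : ∀ r ∈ Ioo (k : ℝ) (k + 1), edgeCoord (B.edge k) (chi 2 d (B.param r)) =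
      B.coord k r := by
    intro r hr
    rw [BoundaryPath.disc_param_eq k (Ioo_subset_Icc_self hr),
      edgeCoord_edgePt _ (BoundaryPath.coord_mem_Ioo k hr)]
  have hco := C.coincide d j ε hε01 (B.edge k) (by
    rw [hε]
    change chi 2 d (B.param s) ∈ _
    rw [BoundaryPath.disc_param_eq k (Ioo_subset_Icc_self hk)]
    exact edgePt_mem_openCell _ (BoundaryPath.coord_mem_Ioo k hk))
  rw [hε] at hco
  have hIoo : ∀ᶠ r in 𝓝 s, r ∈ Ioo 0 (B.length : ℝ) := isOpen_Ioo.mem_nhds h.left_mem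
  have htend : Filter.Tendsto B.param (𝓝 s) (𝓝[sphere 0 1] (B.param s)) :=
    tendsto_nhdsWithin_of_tendsto_nhds_of_eventually_within _
      (B.continuousOn_param.continuousAt (Icc_mem_nhds h.left_mem.1 h.left_mem.2))
      (hIoo.mono fun r hr => BoundaryPath.param_mem_sphere hL (Ioo_subset_Icc_self hr))
  filter_upwards [htend.eventually hco, isOpen_Ioo.mem_nhds hk] with r hr hrk
  have e1 := hval r hrk
  have e2 := hval s hk
  unfold chi at e1 e2 ⊢
  rw [hr, e1, e2]
  have hlt := BoundaryPath.coord_lt_iff (B := B) k (Ioo_subset_Icc_self hk)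
    (Ioo_subset_Icc_self hrk)
  have hgt := BoundaryPath.coord_lt_iff (B := B) k (Ioo_subset_Icc_self hrk)
    (Ioo_subset_Icc_self hk)
  rcases Int.units_eq_one_or (C.dir (RelCWComplex.map (C := (univ : Set X)) 2 d (B.param s)))
    with hd | hd <;> rcases BoundaryPath.sign_eq (B := B) k with hs | hs <;>
    rw [hd, hs] <;> rw [hs] at hlt hgt <;> push_cast
  · constructor <;> intro h'
    · linarith [hlt.1 (by linarith)]
    · linarith [hlt.2 (by linarith)]
  · constructor <;> intro h'
    · linarith [hgt.1 (by linarith)]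
    · linarith [hgt.2 (by linarith)]
  · constructor <;> intro h'
    · linarith [hgt.1 (by linarith)]
    · linarith [hgt.2 (by linarith)]
  · constructor <;> intro h'
    · linarith [hlt.1 (by linarith)]
    · linarith [hlt.2 (by linarith)]

lemma RegularGraph.ArcEnds.mem_posSide_right (h : C.ArcEnds B j s t) {m : ℤˣ}
    (hm : ∀ᶠ r in 𝓝 s, (B.param r ∈ C.posSide d j ↔ 0 < ((m : ℤ) : ℝ) * (r - s))) {r : ℝ}
    (hr : s < r) (hrL : r ≤ B.length) (hrt : t ∉ Ioc s r) :
    B.param r ∈ C.posSide d j ↔ m = 1 := by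
  have hL : 0 < B.length := by
    have := h.left_mem.1.trans h.left_mem.2
    exact_mod_cast this
  have hsub : Ioc s r ⊆ Icc 0 (B.length : ℝ) := fun u hu =>
    ⟨h.left_mem.1.le.trans hu.1.le, hu.2.trans hrL⟩
  have hpre : IsPreconnected (B.param '' Ioc s r) :=
    isPreconnected_Ioc.image _ (B.continuousOn_param.mono hsub)
  have hsub' : B.param '' Ioc s r ⊆ closedBall 0 1 \ range (C.arc d j) := by
    rintro _ ⟨u, hu, rfl⟩
    refine ⟨sphere_subset_closedBall (BoundaryPath.param_mem_sphere hL (hsub hu)), fun h' => ?_⟩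
    rcases (h.mem_range_iff u (hsub hu)).1 h' with rfl | rfl
    · exact hu.1.false
    · exact hrt hu
  obtain ⟨u, hu, hur⟩ := ((hm.filter_mono (nhdsWithin_le_nhds (s := Ioi s))).and
    (Ioc_mem_nhdsGT hr)).exists
  rw [C.mem_posSide_iff hpre hsub' (mem_image_of_mem _ (right_mem_Ioc.2 hr))
    (mem_image_of_mem _ hur), hu]
  have := sub_pos.2 hur.1
  rcases Int.units_eq_one_or m with rfl | rfl
  · simpa using hur.1
  · simp only [Units.val_neg, Units.val_one, Int.cast_neg, Int.cast_one]
    constructor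
    · intro; linarith
    · intro h'; exact absurd h' (by decide)

lemma RegularGraph.ArcEnds.mem_posSide_left (h : C.ArcEnds B j s t) {m : ℤˣ}
    (hm : ∀ᶠ r in 𝓝 s, (B.param r ∈ C.posSide d j ↔ 0 < ((m : ℤ) : ℝ) * (r - s))) {r : ℝ}
    (hr : r < s) (hrL : 0 ≤ r) (hrt : t ∉ Ico r s) :
    B.param r ∈ C.posSide d j ↔ m = -1 := by
  have hL : 0 < B.length := by
    have := h.left_mem.1.trans h.left_mem.2
    exact_mod_cast this
  have hsub : Ico r s ⊆ Icc 0 (B.length : ℝ) := fun u hu =>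
    ⟨hrL.trans hu.1, hu.2.le.trans h.left_mem.2.le⟩
  have hpre : IsPreconnected (B.param '' Ico r s) :=
    isPreconnected_Ico.image _ (B.continuousOn_param.mono hsub)
  have hsub' : B.param '' Ico r s ⊆ closedBall 0 1 \ range (C.arc d j) := by
    rintro _ ⟨u, hu, rfl⟩
    refine ⟨sphere_subset_closedBall (BoundaryPath.param_mem_sphere hL (hsub hu)), fun h' => ?_⟩
    rcases (h.mem_range_iff u (hsub hu)).1 h' with rfl | rfl
    · exact hu.2.false
    · exact hrt hu
  obtain ⟨u, hu, hur⟩ := ((hm.filter_mono (nhdsWithin_le_nhds (s := Iio s))).and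
    (Ico_mem_nhdsLT hr)).exists
  rw [C.mem_posSide_iff hpre hsub' (mem_image_of_mem _ (left_mem_Ico.2 hr))
    (mem_image_of_mem _ hur), hu]
  have := sub_neg.2 hur.2
  rcases Int.units_eq_one_or m with rfl | rfl
  · simp only [Units.val_one, Int.cast_one, one_mul]
    constructor
    · intro; linarith
    · intro h'; exact absurd h' (by decide)
  · simpa using hur.2

/-- A point of the boundary circle off the ends of an arc lies on the positive side or not according
to whether it lies between the ends; accordingly the two ends of the arc turn in opposite
directions. -/
lemma RegularGraph.ArcEnds.mem_posSide_iff (h : C.ArcEnds B j s t) (hst : s < t) {m m' : ℤˣ}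
    (hm : ∀ᶠ r in 𝓝 s, (B.param r ∈ C.posSide d j ↔ 0 < ((m : ℤ) : ℝ) * (r - s)))
    (hm' : ∀ᶠ r in 𝓝 t, (B.param r ∈ C.posSide d j ↔ 0 < ((m' : ℤ) : ℝ) * (r - t))) :
    m' = -m ∧ ∀ r ∈ Icc 0 (B.length : ℝ), r ≠ s → r ≠ t →
      (B.param r ∈ C.posSide d j ↔ (r ∈ Ioo s t ↔ m = 1)) := by
  have hmid : ∀ r ∈ Ioo s t, (B.param r ∈ C.posSide d j ↔ m = 1) := fun r hr =>
    h.mem_posSide_right hm hr.1 (hr.2.trans h.right_mem.2).le fun h' => absurd h'.2 (not_le.2 hr.2)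
  have hmm : m' = -m := by
    have h1 := hmid ((s + t) / 2) ⟨by linarith, by linarith⟩
    have h2 := h.symm.mem_posSide_left hm' (r := (s + t) / 2) (by linarith)
      (by linarith [h.left_mem.1, h.right_mem.1]) (fun h' => by linarith [h'.1])
    rw [h1] at h2
    rcases Int.units_eq_one_or m with rfl | rfl
    · exact h2.1 rfl
    · rcases Int.units_eq_one_or m' with rfl | rfl
      · simp
      · exact absurd (h2.2 rfl) (by decide)
  refine ⟨hmm, fun r hr hrs hrt => ?_⟩
  rcases lt_or_gt_of_ne hrs with h1 | h1
  · rw [h.mem_posSide_left hm h1 hr.1 fun h' => absurd h'.2 (not_lt.2 hst.le)]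
    have : r ∉ Ioo s t := fun h' => absurd h'.1 (not_lt.2 h1.le)
    rcases Int.units_eq_one_or m with rfl | rfl
    · simpa using this
    · simpa using fun h' => this h'
  rcases lt_or_gt_of_ne hrt with h2 | h2
  · rw [hmid r ⟨h1, h2⟩]
    simp [h1, h2]
  · rw [h.symm.mem_posSide_right hm' h2 hr.2 fun h' => absurd h'.1 (not_lt.2 hst.le), hmm]
    have : r ∉ Ioo s t := fun h' => absurd h'.2 (not_lt.2 h2.le)
    rcases Int.units_eq_one_or m with rfl | rfl
    · simpa using this
    · simpa using fun h' => this h'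

end Side

/-! ### Families of disjoint cocycles -/

section Family

variable {X : Type*} [TopologicalSpace X] [CWComplex (univ : Set X)] {ι : Type*}
  (C : ι → RegularCocycle X)

/-- The coordinates on the 1-cell `e` of the vertices of a family of cocycles. -/
def markCoords (e : Cell X 1) : Set ℝ :=
  {c | c ∈ Ioo (-1) 1 ∧ ∃ i, edgePt e c ∈ (C i).carrier}

open Classical in
/-- The generator, or its inverse, that a path crossing the cocycle `C i` along the 1-cell `e`
contributes: the generator of index `i` if the transverse orientation is that of `e`. -/
def crossing (e : Cell X 1) (c : ℝ) : FreeGroup ι :=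
  if h : ∃ i, edgePt e c ∈ (C i).carrier then
    FreeGroup.of h.choose ^ ((C h.choose).dir (edgePt e c) : ℤ) else 1

variable {C}

lemma crossing_eq (hdisj : Pairwise fun i j => Disjoint (C i).carrier (C j).carrier)
    {e : Cell X 1} {c : ℝ} {i : ι} (hi : edgePt e c ∈ (C i).carrier) :
    crossing C e c = FreeGroup.of i ^ ((C i).dir (edgePt e c) : ℤ) := by
  have h : ∃ i, edgePt e c ∈ (C i).carrier := ⟨i, hi⟩
  have hc : h.choose = i := by
    by_contra hne
    exact Set.disjoint_left.1 (hdisj hne) h.choose_spec hi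
  rw [crossing, dif_pos h, hc]

lemma finite_markCoords [Finite ι] (e : Cell X 1) : (markCoords C e).Finite := by
  refine Set.Finite.of_finite_image (f := edgePt e)
    ((Set.finite_iUnion fun i => (C i).finite_vertices e).subset ?_) ?_
  · rintro _ ⟨c, ⟨hc, i, hi⟩, rfl⟩
    exact mem_iUnion.2 ⟨i, hi, edgePt_mem_openCell e hc⟩
  · exact fun c hc c' hc' h => (edgePt_injective hc.1 hc'.1 h).2

variable [T2Space X] {d : Cell X 2} {B : BoundaryPath d}

lemma mem_marks_iff {s : ℝ} (hL : 0 < B.length) (hs : s ∈ Icc 0 (B.length : ℝ)) :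
    s ∈ B.marks (markCoords C) ↔ ∃ i, chi 2 d (B.param s) ∈ (C i).carrier := by
  constructor
  · rintro ⟨k, hk, -, i, hi⟩
    refine ⟨i, ?_⟩
    rwa [BoundaryPath.disc_param_eq k (Ioo_subset_Icc_self hk)]
  · rintro ⟨i, hi⟩
    obtain ⟨k, hk⟩ := (C i).exists_mem_Ioo B hL hs hi
    refine ⟨k, hk, BoundaryPath.coord_mem_Ioo k hk, i, ?_⟩
    rwa [← BoundaryPath.disc_param_eq k (Ioo_subset_Icc_self hk)]

lemma RegularGraph.ArcEnds.mem_marks {i : ι} {j : Fin ((C i).numArcs d)} {s t : ℝ}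
    (h : (C i).ArcEnds B j s t) : s ∈ B.marks (markCoords C) := by
  have hL : 0 < B.length := by
    have := h.left_mem.1.trans h.left_mem.2
    exact_mod_cast this
  rw [mem_marks_iff hL (Ioo_subset_Icc_self h.left_mem)]
  obtain ⟨x, hx⟩ := h.left_mem_range
  exact ⟨i, hx ▸ (C i).arc_mem_carrier j x⟩

lemma exists_arcEnds_of_mem_marks {s : ℝ} (hs : s ∈ B.marks (markCoords C)) :
    ∃ t i j, (C i).ArcEnds B j s t := by
  have hs' := BoundaryPath.marks_subset hs
  have hL : 0 < B.length := by
    have := hs'.1.trans hs'.2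
    exact_mod_cast this
  obtain ⟨i, hi⟩ := (mem_marks_iff hL (Ioo_subset_Icc_self hs')).1 hs
  obtain ⟨j, t, h⟩ := (C i).exists_arcEnds B hL (Ioo_subset_Icc_self hs') hi
  exact ⟨t, i, j, h⟩

lemma arc_eq_of_mem_range (hdisj : Pairwise fun i j => Disjoint (C i).carrier (C j).carrier)
    {i i' : ι} {j : Fin ((C i).numArcs d)} {j' : Fin ((C i').numArcs d)} {z : Fin 2 → ℝ}
    (h : z ∈ range ((C i).arc d j)) (h' : z ∈ range ((C i').arc d j')) :
    (⟨i, j⟩ : Σ i, Fin ((C i).numArcs d)) = ⟨i', j'⟩ := by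
  have hi : i = i' := by
    by_contra hne
    obtain ⟨x, rfl⟩ := h
    obtain ⟨y, hy⟩ := h'
    refine Set.disjoint_left.1 (hdisj hne) ((C i).arc_mem_carrier j x) ?_
    rw [← hy]
    exact (C i').arc_mem_carrier j' y
  subst hi
  rw [(C i).eq_of_mem_range h h']

lemma RegularGraph.ArcEnds.unique
    (hdisj : Pairwise fun i j => Disjoint (C i).carrier (C j).carrier)
    {i i' : ι} {j : Fin ((C i).numArcs d)} {j' : Fin ((C i').numArcs d)} {s t t' : ℝ}
    (h : (C i).ArcEnds B j s t) (h' : (C i').ArcEnds B j' s t') : t = t' := by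
  have he := arc_eq_of_mem_range hdisj h.left_mem_range h'.left_mem_range
  obtain rfl : i = i' := congrArg Sigma.fst he
  obtain rfl : j = j' := by simpa using he
  rcases (h'.mem_range_iff t (Ioo_subset_Icc_self h.right_mem)).1 h.symm.left_mem_range with h1 | h1
  · exact absurd h1.symm h.ne
  · exact h1

/-- The letter at an end of an arc is a generator or its inverse according to the side on which the
positive side of the arc lies. -/
lemma RegularGraph.ArcEnds.exists_letter_eq
    (hdisj : Pairwise fun i j => Disjoint (C i).carrier (C j).carrier)
    {i : ι} {j : Fin ((C i).numArcs d)} {s t : ℝ} (h : (C i).ArcEnds B j s t) :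
    ∃ m : ℤˣ, B.letter (crossing C) s = FreeGroup.of i ^ (m : ℤ) ∧
      ∀ᶠ r in 𝓝 s, (B.param r ∈ (C i).posSide d j ↔ 0 < ((m : ℤ) : ℝ) * (r - s)) := by
  obtain ⟨k, hk, -⟩ := h.mem_marks
  have hev := h.eventually_mem_posSide hk
  have hi : edgePt (B.edge k) (B.coord k s) ∈ (C i).carrier := by
    rw [← BoundaryPath.disc_param_eq k (Ioo_subset_Icc_self hk)]
    obtain ⟨x, hx⟩ := h.left_mem_range
    exact hx ▸ (C i).arc_mem_carrier j x
  rw [BoundaryPath.disc_param_eq k (Ioo_subset_Icc_self hk)] at hev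
  rw [BoundaryPath.letter_eq hk, crossing_eq hdisj hi]
  set u := (C i).dir (edgePt (B.edge k) (B.coord k s))
  rcases BoundaryPath.sign_eq (B := B) k with hs | hs
  · refine ⟨u, by rw [if_pos hs], ?_⟩
    rw [hs, mul_one] at hev
    exact hev
  · refine ⟨-u, by rw [if_neg (by rw [hs]; norm_num)]; simp, ?_⟩
    rw [hs] at hev
    filter_upwards [hev] with r hr
    rw [hr]
    simp

/-- If the marks `s` and `t` are the ends of an arc, then their letters are inverse, and two points
of the boundary circle off the arc are on the same side if and only if the arc does not separate
their parameters. -/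
lemma RegularGraph.ArcEnds.letter_eq_inv_and_iff
    (hdisj : Pairwise fun i j => Disjoint (C i).carrier (C j).carrier)
    {i : ι} {j : Fin ((C i).numArcs d)} {s t : ℝ} (h : (C i).ArcEnds B j s t) (hst : s < t) :
    B.letter (crossing C) t = (B.letter (crossing C) s)⁻¹ ∧
      ∀ r ∈ Icc 0 (B.length : ℝ), r ≠ s → r ≠ t → ∀ r' ∈ Icc 0 (B.length : ℝ), r' ≠ s → r' ≠ t →
      ((B.param r ∈ (C i).posSide d j ↔ B.param r' ∈ (C i).posSide d j) ↔
        (r ∈ Ioo s t ↔ r' ∈ Ioo s t)) := by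
  obtain ⟨m, hm, hms⟩ := h.exists_letter_eq hdisj
  obtain ⟨m', hm', hms'⟩ := h.symm.exists_letter_eq hdisj
  obtain ⟨rfl, hside⟩ := h.mem_posSide_iff hst hms hms'
  refine ⟨by rw [hm, hm']; simp, fun r hr h1 h2 r' hr' h1' h2' => ?_⟩
  rw [hside r hr h1 h2, hside r' hr' h1' h2']
  tauto

/-- The arcs pair the marks on the boundary of a 2-cell without crossings, and paired marks have
inverse letters. -/
lemma exists_noncrossing (hdisj : Pairwise fun i j => Disjoint (C i).carrier (C j).carrier)
    (B : BoundaryPath d) : ∃ σ : ℝ → ℝ, IsNoncrossing (B.marks (markCoords C)) σ ∧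
      ∀ t ∈ B.marks (markCoords C), (∃ i j, (C i).ArcEnds B j t (σ t)) ∧
        B.letter (crossing C) (σ t) = (B.letter (crossing C) t)⁻¹ := by
  choose! σ hσ using fun s hs => exists_arcEnds_of_mem_marks (C := C) (B := B) (s := s) hs
  have hmem : ∀ t ∈ B.marks (markCoords C), σ t ∈ B.marks (markCoords C) := by
    intro t ht
    obtain ⟨i, j, h⟩ := hσ t ht
    exact h.symm.mem_marks
  refine ⟨σ, ⟨hmem, ?_, ?_, ?_⟩, fun t ht => ⟨hσ t ht, ?_⟩⟩
  · intro t ht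
    obtain ⟨i, j, h⟩ := hσ t ht
    obtain ⟨i', j', h'⟩ := hσ _ (hmem t ht)
    exact h'.unique hdisj h.symm
  · intro t ht
    obtain ⟨i, j, h⟩ := hσ t ht
    exact h.ne.symm
  · intro t ht u hu htu hut
    obtain ⟨i, j, h⟩ := hσ t ht
    obtain ⟨i', j', h'⟩ := hσ u hu
    have hne : ∀ r ∈ Icc 0 (B.length : ℝ), r ≠ t → r ≠ σ t →
        B.param r ∉ range ((C i).arc d j) := by
      intro r hr h1 h2 h3
      rcases (h.mem_range_iff r hr).1 h3 with h3 | h3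
      exacts [h1 h3, h2 h3]
    have hnu := hne u (Ioo_subset_Icc_self h'.left_mem) htu.ne' hut.ne
    have hsub : range ((C i').arc d j') ⊆ closedBall 0 1 \ range ((C i).arc d j) := by
      rintro _ ⟨x, rfl⟩
      refine ⟨(C i').arc_mem_closedBall j' x, fun hx => hnu ?_⟩
      have he := arc_eq_of_mem_range hdisj hx ⟨x, rfl⟩
      obtain rfl : i = i' := congrArg Sigma.fst he
      obtain rfl : j = j' := by simpa using he
      exact h'.left_mem_range
    have hσu : B.param (σ u) ∉ range ((C i).arc d j) := (hsub h'.symm.left_mem_range).2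
    have hs1 : σ u ≠ t := fun h1 => hσu (h1 ▸ h.left_mem_range)
    have hs2 : σ u ≠ σ t := fun h1 => hσu (h1 ▸ h.symm.left_mem_range)
    have hside := (C i).mem_posSide_iff
      (isPreconnected_range ((C i').arc d j').continuous) hsub h'.left_mem_range
        h'.symm.left_mem_range
    have := ((h.letter_eq_inv_and_iff hdisj (htu.trans hut)).2 u (Ioo_subset_Icc_self h'.left_mem)
      htu.ne' hut.ne (σ u) (Ioo_subset_Icc_self h'.right_mem) hs1 hs2).1 hside
    exact this.1 ⟨htu, hut⟩
  · obtain ⟨i, j, h⟩ := hσ t ht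
    rcases lt_or_gt_of_ne h.ne with hlt | hlt
    · exact (h.letter_eq_inv_and_iff hdisj hlt).1
    · rw [(h.symm.letter_eq_inv_and_iff hdisj hlt).1, inv_inv]

variable [Finite ι] {η : Cell X 1 → ℝ → FreeGroup ι} {δ : ℝ}

lemma word_eq_one_of_family (hdisj : Pairwise fun i j => Disjoint (C i).carrier (C j).carrier)
    (hη : ∀ e, IsStepOn univ (markCoords C e) (crossing C e) (η e)) (hδ : 0 < δ)
    (hl : ∀ e c, c < -1 + δ → η e c = 1) (hr : ∀ e c, 1 - δ < c → η e c = η e 1)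
    (B : BoundaryPath d) : B.word η B.length = 1 := by
  obtain ⟨σ, hσ, hinv⟩ := exists_noncrossing hdisj B
  rw [← BoundaryPath.pot_natCast le_rfl, ← BoundaryPath.pot_zero (B := B) (η := η)]
  exact ((BoundaryPath.isStepOn_pot hη hδ hl hr).eq_of_noncrossing
    (BoundaryPath.marks_finite finite_markCoords) hσ (fun t ht => (hinv t ht).2) _ 0 _ (Nat.cast_nonneg _) le_rfl
    (fun h => (BoundaryPath.marks_subset h).1.false)
    (fun h => (BoundaryPath.marks_subset h).2.false) le_rfl
    fun t ht _ => BoundaryPath.marks_subset (hσ.mem t ht)).symm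

/-- The potential is constant on the intersection of the boundary circle with a component of the
complement of the arcs. -/
lemma pot_eq_of_isPreconnected (hdisj : Pairwise fun i j => Disjoint (C i).carrier (C j).carrier)
    (hη : ∀ e, IsStepOn univ (markCoords C e) (crossing C e) (η e)) (hδ : 0 < δ)
    (hl : ∀ e c, c < -1 + δ → η e c = 1) (hr : ∀ e c, 1 - δ < c → η e c = η e 1)
    (B : BoundaryPath d) (hL : 0 < B.length) {S : Set (Fin 2 → ℝ)} (hS : IsPreconnected S)
    (hSD : ∀ z ∈ S, z ∈ closedBall 0 1 ∧ ∀ i, chi 2 d z ∉ (C i).carrier) {s s' : ℝ}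
    (hs : s ∈ Icc 0 (B.length : ℝ)) (hs' : s' ∈ Icc 0 (B.length : ℝ)) (hsS : B.param s ∈ S)
    (hs'S : B.param s' ∈ S) : B.pot η s = B.pot η s' := by
  wlog hss : s ≤ s' generalizing s s'
  · exact (this hs' hs hs'S hsS (le_of_not_ge hss)).symm
  obtain ⟨σ, hσ, hinv⟩ := exists_noncrossing hdisj B
  have hn : s ∉ B.marks (markCoords C) := fun h => by
    obtain ⟨i, hi⟩ := (mem_marks_iff hL hs).1 h
    exact (hSD _ hsS).2 i hi
  have hn' : s' ∉ B.marks (markCoords C) := fun h => by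
    obtain ⟨i, hi⟩ := (mem_marks_iff hL hs').1 h
    exact (hSD _ hs'S).2 i hi
  refine (BoundaryPath.isStepOn_pot hη hδ hl hr).eq_of_noncrossing
    (BoundaryPath.marks_finite finite_markCoords) hσ (fun t ht => (hinv t ht).2) _ s s' hss
    (Icc_subset_Icc hs.1 hs'.2) hn hn' le_rfl fun t ht hts => ?_
  obtain ⟨i, j, h⟩ := (hinv t ht).1
  have hside := (C i).mem_posSide_iff hS (j := j) (fun z hz => ⟨(hSD z hz).1, fun hz' =>
    (hSD z hz).2 i (((C i).disc_mem_carrier_iff (hSD z hz).1).2 ⟨j, hz'⟩)⟩) hsS hs'S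
  have n1 : s ≠ t := fun h => hn (h ▸ ht)
  have n2 : s ≠ σ t := fun h => hn (h ▸ hσ.mem t ht)
  have n3 : s' ≠ t := fun h => hn' (h ▸ ht)
  have n4 : s' ≠ σ t := fun h => hn' (h ▸ hσ.mem t ht)
  rcases lt_or_gt_of_ne h.ne with hlt | hlt
  · have := ((h.letter_eq_inv_and_iff hdisj hlt).2 s hs n1 n2 s' hs' n3 n4).1 hside
    refine ⟨hts.1.trans hlt, ?_⟩
    by_contra hge
    exact absurd (this.2 ⟨hts.2, lt_of_le_of_ne (not_lt.1 hge) n4⟩).1 (not_lt.2 hts.1.le)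
  · have := ((h.symm.letter_eq_inv_and_iff hdisj hlt).2 s hs n2 n1 s' hs' n4 n3).1 hside
    refine ⟨?_, hlt.trans hts.2⟩
    by_contra hge
    exact absurd (this.1 ⟨lt_of_le_of_ne (not_lt.1 hge) n2.symm, hts.1⟩).2 (not_lt.2 hts.2.le)

end Family

/-! ### Non-separating cocycles give a surjection -/

section Paths

variable {X G : Type*} [TopologicalSpace X] [Group G] (F : PathHom X G)

lemma PathHom.val_symm {x y : X} (p : Path x y) : F.val p.symm = (F.val p)⁻¹ := by
  have h := F.trans p p.symm
  rw [F.homotopic (p := p.trans p.symm) (q := Path.refl x)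
    ⟨(Path.Homotopy.reflTransSymm p).symm⟩, F.val_refl] at h
  exact (inv_eq_of_mul_eq_one_right h.symm).symm

lemma PathHom.exists_path_seg {f : ℝ → X} {S : Set ℝ} (hS : Convex ℝ S) (hf : ContinuousOn f S)
    {s s' : ℝ} (hs : s ∈ S) (hs' : s' ∈ S) :
    ∃ p : Path (f s) (f s'), F.val p = F.seg f s s' ∧ range p ⊆ f '' S := by
  have hmem : ∀ t : unitInterval, AffineMap.lineMap s s' (t : ℝ) ∈ S := fun t =>
    hS.segment_subset hs hs' (by rw [segment_eq_image_lineMap]; exact ⟨t, t.2, rfl⟩)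
  refine ⟨{ toFun := fun t => f (AffineMap.lineMap s s' (t : ℝ))
            continuous_toFun := hf.comp_continuous (by fun_prop) hmem
            source' := by simp
            target' := by simp }, rfl, ?_⟩
  rintro _ ⟨t, rfl⟩
  exact ⟨_, hmem t, rfl⟩

end Paths

section LocallyConstant

variable {X : Type*} [TopologicalSpace X] [CWComplex (univ : Set X)] [T2Space X]

/-- A function on a connected subset `W` that is constant near each point of each closed cell is
constant. -/
lemma eq_of_isPreconnected_of_forall_cell {W : Set X} (hW : IsPreconnected W) {β : Type*} {φ : X → β}
    (h : ∀ (n : ℕ) (c : Cell X n), ∀ z ∈ closedBall (0 : Fin n → ℝ) 1, chi n c z ∈ W →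
      ∀ᶠ y in 𝓝[closedBall 0 1] z, chi n c y ∈ W ∧ φ (chi n c y) = φ (chi n c z))
    {x y : X} (hx : x ∈ W) (hy : y ∈ W) : φ x = φ y := by
  refine eq_of_isPreconnected_of_eventually_eq hW (fun x hx => ?_) hx hy
  have hO : IsOpen {y | y ∈ W ∧ φ y = φ x} := by
    refine isOpen_of_forall_cell fun n c z hz hzU => ?_
    filter_upwards [h n c z hz hzU.1] with y hy
    exact ⟨hy.1, hy.2.trans hzU.2⟩
  filter_upwards [mem_nhdsWithin_of_mem_nhds (hO.mem_nhds ⟨hx, rfl⟩)] with y hy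
  exact hy.2

lemma IsStepOn.eventually_eq {G : Type*} [Group G] {I M : Set ℝ} {g η : ℝ → G}
    (h : IsStepOn I M g η) (hM : M.Finite) {c : ℝ} (hc : c ∈ I) (hcM : c ∉ M) :
    ∀ᶠ c' in 𝓝[I] c, c' ∉ M ∧ η c' = η c :=
  (Filter.Eventually.filter_mono nhdsWithin_le_nhds
    (hM.isClosed.isOpen_compl.mem_nhds hcM)).and (h.loc c hc hcM)

end LocallyConstant

section Surjection

variable {X : Type*} [TopologicalSpace X] [CWComplex (univ : Set X)] [T2Space X] {ι : Type*}
  [Finite ι] {C : ι → RegularCocycle X} {η : Cell X 1 → ℝ → FreeGroup ι} {δ : ℝ}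

lemma exists_margin (K : FiniteTwoComplex X) (C : ι → RegularCocycle X) :
    ∃ δ : ℝ, 0 < δ ∧ δ ≤ 1 ∧ ∀ e, ∀ m ∈ markCoords C e, -1 + δ ≤ m ∧ m ≤ 1 - δ := by
  have := K.finite_cell 1
  have h : ∀ e, ∀ᶠ δ in 𝓝[>] (0 : ℝ), ∀ m ∈ markCoords C e, -1 + δ ≤ m ∧ m ≤ 1 - δ := by
    intro e
    refine (finite_markCoords e).eventually_all.2 fun m hm => ?_
    have h1 : 0 < min (m + 1) (1 - m) := lt_min (by linarith [hm.1.1]) (by linarith [hm.1.2])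
    filter_upwards [Ioo_mem_nhdsGT h1] with δ hδ
    have h2 := lt_min_iff.1 hδ.2
    exact ⟨by linarith, by linarith⟩
  obtain ⟨δ, hδ, h⟩ := ((Filter.eventually_of_mem (Ioc_mem_nhdsGT (zero_lt_one' ℝ))
    fun _ h => h).and (Filter.eventually_all.2 h)).exists
  exact ⟨δ, hδ.1, hδ.2, h⟩

/-- Step functions on the 1-cells, starting at `1`, that record the crossings with the cocycles. -/
lemma exists_labelling (K : FiniteTwoComplex X) (C : ι → RegularCocycle X) :
    ∃ (δ : ℝ) (η : Cell X 1 → ℝ → FreeGroup ι), 0 < δ ∧ δ ≤ 1 ∧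
      (∀ e, IsStepOn univ (markCoords C e) (crossing C e) (η e)) ∧
      (∀ e c, c < -1 + δ → η e c = 1) ∧ (∀ e c, 1 - δ < c → η e c = η e 1) := by
  obtain ⟨δ, hδ, hδ1, hm⟩ := exists_margin K C
  have h : ∀ e, ∃ η : ℝ → FreeGroup ι, IsStepOn univ (markCoords C e) (crossing C e) η ∧
      ∀ c, (∀ m ∈ markCoords C e, c ≤ m) → η c = 1 := by
    intro e
    obtain ⟨η, hη, h1⟩ := exists_isStepOn (finite_markCoords (C := C) e).toFinset (crossing C e)
    rw [Set.Finite.coe_toFinset] at hη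
    exact ⟨η, hη, fun c hc => h1 c fun m hm => hc m ((Set.Finite.mem_toFinset _).1 hm)⟩
  choose η hη h1 using h
  refine ⟨δ, η, hδ, hδ1, hη, fun e c hc => h1 e c fun m hme => (hc.trans_le (hm e m hme).1).le,
    fun e c hc => ?_⟩
  rcases le_total c 1 with h | h
  · exact (hη e).eq_of_disjoint h (subset_univ _) fun m hme hm' => by
      linarith [(hm e m hme).2, hm'.1]
  · exact ((hη e).eq_of_disjoint h (subset_univ _) fun m hme hm' => by
      linarith [(hm e m hme).2, hm'.1]).symm

variable (F : PathHom X (FreeGroup ι))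

/-- The points of the 1-skeleton that are reached from `b₀` by a path on which `F` is trivial. -/
def TriviallyReached (b₀ x : X) : Prop := x ∈ oneSkel X ∧ ∃ γ : Path b₀ x, F.val γ = 1

variable {F}

lemma TriviallyReached.seg {b₀ : X} {f : ℝ → X} {S : Set ℝ} (hS : Convex ℝ S)
    (hf : ContinuousOn f S) {s s' : ℝ} (hs : s ∈ S) (hs' : s' ∈ S) (hF : F.seg f s s' = 1)
    (h : TriviallyReached F b₀ (f s)) (hskel : f s' ∈ oneSkel X) :
    TriviallyReached F b₀ (f s') := by
  obtain ⟨-, γ, hγ⟩ := h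
  obtain ⟨p, hp, -⟩ := F.exists_path_seg hS hf hs hs'
  exact ⟨hskel, γ.trans p, by rw [F.trans, hγ, one_mul, hp, hF]⟩

variable (F C)

open Classical in
/-- The points of the complement of the cocycles that are connected, within the complement and
within a single closed 2-cell, to a point of the 1-skeleton reached from `b₀` by a path on which `F`
is trivial. -/
def ReachedRegion (b₀ x : X) : Prop :=
  TriviallyReached F b₀ x ∨ ∃ (d : Cell X 2) (z w : Fin 2 → ℝ) (S : Set (Fin 2 → ℝ)),
    z ∈ ball 0 1 ∧ chi 2 d z = x ∧ IsPreconnected S ∧ z ∈ S ∧ w ∈ S ∧ w ∈ sphere 0 1 ∧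
    (∀ y ∈ S, y ∈ closedBall 0 1 ∧ ∀ i, chi 2 d y ∉ (C i).carrier) ∧
    TriviallyReached F b₀ (chi 2 d w)

variable {F C}

lemma reachedRegion_oneSkel {b₀ x : X} (hx : x ∈ oneSkel X) :
    ReachedRegion C F b₀ x ↔ TriviallyReached F b₀ x := by
  refine ⟨?_, Or.inl⟩
  rintro (h | ⟨d, z, w, S, hz, rfl, -⟩)
  · exact h
  · exact absurd hx (disc_notMem_oneSkel hz)

variable (C η δ F) in
/-- The family `C` of disjoint cocycles, the step functions `η` on the 1-cells that jump where they
cross the cocycles and are constant at distance less than `δ` from the ends, and a homomorphism `F`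
on paths that is given on the 1-cells by `η`. -/
structure IsLabelling : Prop where
  disjoint : Pairwise fun i j => Disjoint (C i).carrier (C j).carrier
  isStepOn : ∀ e, IsStepOn univ (markCoords C e) (crossing C e) (η e)
  pos : 0 < δ
  left : ∀ e c, c < -1 + δ → η e c = 1
  right : ∀ e c, 1 - δ < c → η e c = η e 1
  seg_eq : ∀ e, ∀ c ∈ Icc (-1 : ℝ) 1, ∀ c' ∈ Icc (-1 : ℝ) 1,
    F.seg (edgePt e) c c' = (η e c)⁻¹ * η e c'

/-- Two boundary points of a 2-cell that are joined in it off the cocycles have equal labels, since no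
pair of matched marks is separated by them. -/
lemma triviallyReached_of_isPreconnected (h𝓛 : IsLabelling C η δ F)
    (K : FiniteTwoComplex X) {b₀ : X} {d : Cell X 2}
    {S : Set (Fin 2 → ℝ)} (hS : IsPreconnected S)
    (hSD : ∀ z ∈ S, z ∈ closedBall 0 1 ∧ ∀ i, chi 2 d z ∉ (C i).carrier) {w w' : Fin 2 → ℝ}
    (hw : w ∈ S) (hw' : w' ∈ S) (hws : w ∈ sphere (0 : Fin 2 → ℝ) 1)
    (hws' : w' ∈ sphere (0 : Fin 2 → ℝ) 1) (h : TriviallyReached F b₀ (chi 2 d w)) :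
    TriviallyReached F b₀ (chi 2 d w') := by
  set B := K.boundary d
  rcases Nat.eq_zero_or_pos B.length with hL | hL
  · obtain ⟨v, hv⟩ := B.constant hL
    have h1 := hv hws
    have h2 := hv hws'
    rw [closedCell_zero, mem_singleton_iff] at h1 h2
    have : chi 2 d w' = chi 2 d w := h2.trans h1.symm
    rwa [this]
  · obtain ⟨s, hs, rfl⟩ := BoundaryPath.exists_param_eq (B := B) hL hws
    obtain ⟨s', hs', rfl⟩ := BoundaryPath.exists_param_eq (B := B) hL hws'
    replace hs := Ico_subset_Icc_self hs
    replace hs' := Ico_subset_Icc_self hs'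
    refine TriviallyReached.seg (f := fun t => chi 2 d (B.param t)) (convex_Icc 0 (B.length : ℝ))
      BoundaryPath.continuousOn_disc_param hs hs' ?_ h (sphere_mem_oneSkel hws')
    rw [BoundaryPath.seg_param_eq F h𝓛.seg_eq hs hs',
      pot_eq_of_isPreconnected h𝓛.disjoint h𝓛.isStepOn h𝓛.pos h𝓛.left h𝓛.right B hL hS hSD hs hs'
        hw hw', inv_mul_cancel]

lemma reachedRegion_of_isPreconnected (h𝓛 : IsLabelling C η δ F)
    (K : FiniteTwoComplex X) {b₀ : X} {d : Cell X 2}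
    {S : Set (Fin 2 → ℝ)} (hS : IsPreconnected S)
    (hSD : ∀ z ∈ S, z ∈ closedBall 0 1 ∧ ∀ i, chi 2 d z ∉ (C i).carrier) {y z : Fin 2 → ℝ}
    (hy : y ∈ S) (hz : z ∈ S) (h : ReachedRegion C F b₀ (chi 2 d y)) :
    ReachedRegion C F b₀ (chi 2 d z) := by
  -- a point `w` of the circle that can be joined to `y`
  obtain ⟨w, S', hw, hS', hyS', hwS', hSD', hreach⟩ : ∃ w S', w ∈ sphere (0 : Fin 2 → ℝ) 1 ∧
      IsPreconnected S' ∧ y ∈ S' ∧ w ∈ S' ∧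
      (∀ y ∈ S', y ∈ closedBall 0 1 ∧ ∀ i, chi 2 d y ∉ (C i).carrier) ∧
      TriviallyReached F b₀ (chi 2 d w) := by
    rcases ball_union_sphere_of_mem_closedBall (hSD y hy).1 with hyb | hys
    · rcases h with h | ⟨d', y', w, S', hy', he, h1, h2, h3, h4, h5, h6⟩
      · exact absurd h.1 (disc_notMem_oneSkel hyb)
      · obtain ⟨rfl, rfl⟩ := disc_injective hy' hyb he
        exact ⟨w, S', h4, h1, h2, h3, h5, h6⟩
    · exact ⟨y, S, hys, hS, hy, hy, hSD,
        (reachedRegion_oneSkel (sphere_mem_oneSkel hys)).1 h⟩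
  have hSS : IsPreconnected (S ∪ S') := IsPreconnected.union y hy hyS' hS hS'
  have hSSD : ∀ z ∈ S ∪ S', z ∈ closedBall 0 1 ∧ ∀ i, chi 2 d z ∉ (C i).carrier := by
    rintro z (hz | hz)
    exacts [hSD z hz, hSD' z hz]
  rcases ball_union_sphere_of_mem_closedBall (hSD z hz).1 with hzb | hzs
  · exact Or.inr ⟨d, z, w, S ∪ S', hzb, rfl, hSS, Or.inl hz, Or.inr hwS', hw, hSSD, hreach⟩
  · exact Or.inl (triviallyReached_of_isPreconnected h𝓛 K hSS hSSD
      (Or.inr hwS') (Or.inl hz) hw hzs hreach)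

/-- If the complement of the cocycles is connected then each of its points lies in a reached region,
because being in one is a locally constant property on the complement. -/
lemma reachedRegion_of_notMem (h𝓛 : IsLabelling C η δ F)
    (K : FiniteTwoComplex X)
    (hW : IsPreconnected (⋃ i, (C i).carrier)ᶜ) {b₀ : X} (hb : b₀ ∈ oneSkel X)
    (hbW : b₀ ∈ (⋃ i, (C i).carrier)ᶜ) {x : X} (hx : x ∈ (⋃ i, (C i).carrier)ᶜ) :
    ReachedRegion C F b₀ x := by
  have hb0 : ReachedRegion C F b₀ b₀ := Or.inl ⟨hb, Path.refl b₀, F.val_refl b₀⟩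
  refine (eq_of_isPreconnected_of_forall_cell hW (φ := ReachedRegion C F b₀) ?_ hbW hx).mp hb0
  intro n c z hz hzW
  have hn := K.cell_le c
  have hWi : ∀ y, y ∈ (⋃ i, (C i).carrier)ᶜ ↔ ∀ i, y ∉ (C i).carrier := by simp
  rw [hWi] at hzW
  interval_cases n
  · refine Filter.Eventually.of_forall fun y => ?_
    rw [Subsingleton.elim y z, hWi]
    exact ⟨hzW, rfl⟩
  · obtain ⟨t, rfl⟩ : ∃ t, z = fun _ => t := ⟨z 0, fin_one_eq_const z⟩
    have ht : t ∈ Icc (-1 : ℝ) 1 := const_mem_closedBall_iff.1 hz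
    have htM : t ∉ markCoords C c := fun h => by
      obtain ⟨-, i, hi⟩ := h
      exact hzW i hi
    have hnotM : ∀ t' ∈ Icc (-1 : ℝ) 1, t' ∉ markCoords C c → ∀ i, edgePt c t' ∉ (C i).carrier := by
      intro t' ht' hM i hi
      rcases eq_or_lt_of_le ht'.1 with rfl | h1
      · obtain ⟨v, hv⟩ := (exists_vert_eq_edgePt c).1
        rw [hv] at hi
        exact (C i).vert_notMem v hi
      rcases eq_or_lt_of_le ht'.2 with rfl | h2
      · obtain ⟨v, hv⟩ := (exists_vert_eq_edgePt c).2
        rw [hv] at hi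
        exact (C i).vert_notMem v hi
      exact hM ⟨⟨h1, h2⟩, i, hi⟩
    have hev := (h𝓛.isStepOn c).eventually_eq (finite_markCoords c) (mem_univ t) htM
    rw [nhdsWithin_univ] at hev
    have hcont : Filter.Tendsto (fun y : Fin 1 → ℝ => y 0) (𝓝 fun _ => t) (𝓝 t) :=
      (continuous_apply (0 : Fin 1)).tendsto (fun _ => t)
    filter_upwards [mem_nhdsWithin_of_mem_nhds (hcont.eventually hev), self_mem_nhdsWithin]
      with y hy hyb
    obtain ⟨t', rfl⟩ : ∃ t, y = fun _ => t := ⟨y 0, fin_one_eq_const y⟩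
    have ht' : t' ∈ Icc (-1 : ℝ) 1 := const_mem_closedBall_iff.1 hyb
    have h1 : η c t' = η c t := hy.2
    refine ⟨(hWi _).2 (hnotM t' ht' hy.1), propext ?_⟩
    change ReachedRegion C F b₀ (edgePt c t') ↔ ReachedRegion C F b₀ (edgePt c t)
    rw [reachedRegion_oneSkel (edgePt_mem_oneSkel c ht'),
      reachedRegion_oneSkel (edgePt_mem_oneSkel c ht)]
    exact ⟨fun h => h.seg (convex_Icc _ _) (edgePt_continuousOn c) ht' ht
        (by rw [h𝓛.seg_eq c t' ht' t ht, h1, inv_mul_cancel]) (edgePt_mem_oneSkel c ht),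
      fun h => h.seg (convex_Icc _ _) (edgePt_continuousOn c) ht ht'
        (by rw [h𝓛.seg_eq c t ht t' ht', h1, inv_mul_cancel]) (edgePt_mem_oneSkel c ht')⟩
  · have hclosed : IsClosed (⋃ a : Σ i, Fin ((C i).numArcs c), range ((C a.1).arc c a.2)) :=
      isClosed_iUnion_of_finite fun a => (isCompact_range ((C a.1).arc c a.2).continuous).isClosed
    have hmem : ∀ y ∈ closedBall (0 : Fin 2 → ℝ) 1, (∀ i, chi 2 c y ∉ (C i).carrier) ↔
        y ∈ (⋃ a : Σ i, Fin ((C i).numArcs c), range ((C a.1).arc c a.2))ᶜ := by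
      intro y hy
      simp only [(C _).disc_mem_carrier_iff hy, mem_compl_iff, mem_iUnion, Sigma.exists, not_exists]
    obtain ⟨ε, hε, hball⟩ := Metric.isOpen_iff.1 hclosed.isOpen_compl z ((hmem z hz).1 hzW)
    have hSD : ∀ y ∈ ball z ε ∩ closedBall 0 1,
        y ∈ closedBall 0 1 ∧ ∀ i, chi 2 c y ∉ (C i).carrier := fun y hy =>
      ⟨hy.2, (hmem y hy.2).2 (hball hy.1)⟩
    have hpre : IsPreconnected (ball z ε ∩ closedBall (0 : Fin 2 → ℝ) 1) :=
      ((convex_ball z ε).inter (convex_closedBall 0 1)).isPreconnected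
    have hzS : z ∈ ball z ε ∩ closedBall (0 : Fin 2 → ℝ) 1 := ⟨mem_ball_self hε, hz⟩
    filter_upwards [mem_nhdsWithin_of_mem_nhds (ball_mem_nhds z hε), self_mem_nhdsWithin]
      with y hy hyb
    have hyS : y ∈ ball z ε ∩ closedBall (0 : Fin 2 → ℝ) 1 := ⟨hy, hyb⟩
    exact ⟨(hWi _).2 (hSD y hyS).2, propext
      ⟨reachedRegion_of_isPreconnected h𝓛 K hpre hSD hyS hzS,
       reachedRegion_of_isPreconnected h𝓛 K hpre hSD hzS hyS⟩⟩

/-- The loop crosses the `i`-th cocycle once, between two points of a 1-cell close to the crossing,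
and returns along paths of trivial value. -/
lemma exists_loop_of_isStepOn (h𝓛 : IsLabelling C η δ F)
    (K : FiniteTwoComplex X) {b₀ : X}
    (hreach : ∀ x ∈ (⋃ i, (C i).carrier)ᶜ, ReachedRegion C F b₀ x) (i : ι) :
    ∃ p : Path b₀ b₀, ∃ m : ℤˣ, F.val p = FreeGroup.of i ^ (m : ℤ) := by
  obtain ⟨e, c, hc, hi⟩ := (C i).exists_edgePt_mem K
  have hcM : c ∈ markCoords C e := ⟨hc, i, hi⟩
  have hjump := (h𝓛.isStepOn e).jump c hcM (by simp)
  have hIoo : ∀ᶠ c' in 𝓝 c, c' ∈ Ioo (-1 : ℝ) 1 := isOpen_Ioo.mem_nhds hc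
  have hM : ∀ᶠ c' in 𝓝 c, c' ∉ markCoords C e \ {c} :=
    (((finite_markCoords e).subset sdiff_subset).isClosed.isOpen_compl).mem_nhds (by simp)
  have hl : ∀ᶠ c' in 𝓝[<] c, c' ∈ Ioo (-1 : ℝ) 1 ∧ c' ∉ markCoords C e := by
    filter_upwards [mem_nhdsWithin_of_mem_nhds hIoo, mem_nhdsWithin_of_mem_nhds hM,
      self_mem_nhdsWithin] with c' h1 h2 h3
    exact ⟨h1, fun h => h2 ⟨h, (ne_of_lt h3)⟩⟩
  have hr : ∀ᶠ c' in 𝓝[>] c, c' ∈ Ioo (-1 : ℝ) 1 ∧ c' ∉ markCoords C e := by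
    filter_upwards [mem_nhdsWithin_of_mem_nhds hIoo, mem_nhdsWithin_of_mem_nhds hM,
      self_mem_nhdsWithin] with c' h1 h2 h3
    exact ⟨h1, fun h => h2 ⟨h, (ne_of_gt h3)⟩⟩
  obtain ⟨⟨a, a'⟩, ⟨ha, ha'⟩, hg⟩ := ((hl.prod_mk hr).and hjump).exists
  have hT : ∀ a, a ∈ Ioo (-1 : ℝ) 1 ∧ a ∉ markCoords C e → TriviallyReached F b₀ (edgePt e a) := by
    rintro a ⟨h1, h2⟩
    refine (reachedRegion_oneSkel (edgePt_mem_oneSkel e (Ioo_subset_Icc_self h1))).1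
      (hreach _ ?_)
    rw [mem_compl_iff, mem_iUnion]
    exact fun h => h2 ⟨h1, h⟩
  obtain ⟨-, γ, hγ⟩ := hT a ha
  obtain ⟨-, γ', hγ'⟩ := hT a' ha'
  obtain ⟨p, hp, -⟩ := F.exists_path_seg (convex_Icc (𝕜 := ℝ) (-1 : ℝ) 1)
    (edgePt_continuousOn e) (Ioo_subset_Icc_self ha.1) (Ioo_subset_Icc_self ha'.1)
  have h2 : η e a' = η e a * crossing C e c := hg
  rw [h𝓛.seg_eq e a (Ioo_subset_Icc_self ha.1) a' (Ioo_subset_Icc_self ha'.1), h2,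
    crossing_eq h𝓛.disjoint hi, inv_mul_cancel_left] at hp
  refine ⟨(γ.trans p).trans γ'.symm, (C i).dir (edgePt e c), ?_⟩
  rw [F.trans, F.trans, F.val_symm, hγ, hγ', hp, one_mul, inv_one, mul_one]

end Surjection

/-- Disjoint cocycles that together do not separate give a surjection onto a free group. -/
theorem exists_surjective_of_nonseparating {X : Type*} [TopologicalSpace X] [T2Space X]
    [ConnectedSpace X] [CWComplex (univ : Set X)] (K : FiniteTwoComplex X) (b : X) {n : ℕ}
    (h : HasNonseparatingCocycles X n) :
    ∃ f : FundamentalGroup X b →* FreeGroup (Fin n), Function.Surjective f := by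
  obtain ⟨C, hdisj, hW⟩ := h
  obtain ⟨δ, η, hδ, hδ1, hη, hl, hr⟩ := exists_labelling K C
  obtain ⟨F, hF⟩ := exists_pathHom_of_word_eq_one K hδ hδ1 hl hr fun d =>
    word_eq_one_of_family hdisj hη hδ hl hr _
  obtain ⟨v⟩ := K.exists_vert
  have hbW : vert v ∈ (⋃ i, (C i).carrier)ᶜ := by
    rw [mem_compl_iff, mem_iUnion]
    rintro ⟨i, hi⟩
    exact (C i).vert_notMem v hi
  have h𝓛 : IsLabelling C η δ F := ⟨hdisj, hη, hδ, hl, hr, hF⟩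
  have hreach := fun x hx => reachedRegion_of_notMem h𝓛 K hW.isPreconnected
    (vert_mem_oneSkel v) hbW (x := x) hx
  have htop : (F.toMonoidHom (vert v)).range = ⊤ := by
    rw [eq_top_iff, ← FreeGroup.closure_range_of, Subgroup.closure_le]
    rintro _ ⟨i, rfl⟩
    obtain ⟨p, m, hp⟩ := exists_loop_of_isStepOn h𝓛 K hreach i
    have hmem : (FreeGroup.of i ^ (m : ℤ))⁻¹ ∈ (F.toMonoidHom (vert v)).range := by
      rw [← hp, ← F.toMonoidHom_apply]
      exact ⟨_, rfl⟩
    rcases Int.units_eq_one_or m with rfl | rfl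
    · simpa using hmem
    · simpa using hmem
  have := pathConnectedSpace (X := X)
  refine ⟨F.toMonoidHom b, fun g => ?_⟩
  obtain ⟨q⟩ := PathConnectedSpace.joined b (vert v)
  obtain ⟨x, hx⟩ : (F.val q)⁻¹ * g * F.val q ∈ (F.toMonoidHom (vert v)).range := htop ▸ trivial
  obtain ⟨p, rfl⟩ : ∃ p : Path (vert v) (vert v),
      FundamentalGroup.fromPath (Path.Homotopic.Quotient.mk p) = x := by
    obtain ⟨p, hp⟩ := Quotient.exists_rep (FundamentalGroup.toPath x)
    exact ⟨p, hp⟩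
  rw [F.toMonoidHom_apply] at hx
  refine ⟨FundamentalGroup.fromPath (Path.Homotopic.Quotient.mk ((q.trans p).trans q.symm)), ?_⟩
  rw [F.toMonoidHom_apply, F.trans, F.trans, F.val_symm, mul_inv_rev, mul_inv_rev, hx]
  group

/-! ### Homomorphisms that are gradients on the 1-cells -/

section Radial

variable {X : Type*} [TopologicalSpace X] [CWComplex (univ : Set X)] [T2Space X]

/-- The union of the closed cells of dimension at most `n`. -/
def skel (X : Type*) [TopologicalSpace X] [CWComplex (univ : Set X)] (n : ℕ) : Set X :=
  ⋃ c : {c : Σ m, Cell X m // c.1 ≤ n}, chi c.1.1 c.1.2 '' closedBall 0 1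

/-- The point at time `t` of the radial path from `z` to the unit sphere. -/
def radialPt {n : ℕ} (z : Fin n → ℝ) (t : ℝ) : Fin n → ℝ := (1 - t + t * ‖z‖⁻¹) • z

lemma radialPt_zero {n : ℕ} (z : Fin n → ℝ) : radialPt z 0 = z := by simp [radialPt]

lemma radialPt_one {n : ℕ} (z : Fin n → ℝ) : radialPt z 1 = ‖z‖⁻¹ • z := by simp [radialPt]

lemma radialPt_of_mem_sphere {n : ℕ} {z : Fin n → ℝ} (hz : z ∈ sphere (0 : Fin n → ℝ) 1) (t : ℝ) :
    radialPt z t = z := by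
  rw [mem_sphere_zero_iff_norm] at hz
  simp [radialPt, hz]

lemma radialPt_mem {n : ℕ} {z : Fin n → ℝ} (hz : z ∈ closedBall (0 : Fin n → ℝ) 1) (h0 : z ≠ 0)
    {t : ℝ} (ht : t ∈ Icc (0 : ℝ) 1) : radialPt z t ∈ closedBall (0 : Fin n → ℝ) 1 := by
  have hpos : 0 < ‖z‖ := norm_pos_iff.2 h0
  rw [mem_closedBall_zero_iff] at hz ⊢
  have h1 : 0 ≤ 1 - t + t * ‖z‖⁻¹ :=
    add_nonneg (by linarith [ht.2]) (mul_nonneg ht.1 (inv_nonneg.2 hpos.le))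
  rw [radialPt, norm_smul, Real.norm_of_nonneg h1, add_mul, mul_assoc, inv_mul_cancel₀ hpos.ne']
  nlinarith [ht.1, ht.2]

lemma radialPt_continuousOn (n : ℕ) : ContinuousOn
    (fun q : (Fin n → ℝ) × ℝ => radialPt q.1 q.2) {q | q.1 ≠ 0} := by
  have h1 : ContinuousOn (fun q : (Fin n → ℝ) × ℝ => ‖q.1‖⁻¹) {q | q.1 ≠ 0} :=
    ContinuousOn.inv₀ (by fun_prop) fun q hq => norm_ne_zero_iff.2 hq
  have h2 : ContinuousOn (fun q : (Fin n → ℝ) × ℝ => 1 - q.2 + q.2 * ‖q.1‖⁻¹) {q | q.1 ≠ 0} :=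
    ContinuousOn.add (by fun_prop) (ContinuousOn.mul (by fun_prop) h1)
  exact h2.smul (by fun_prop)

open Classical in
/-- The path that moves a point of an open `n`-cell, other than its centre, radially to the
frontier of the cell, and does not move the other points.  It is constant at the centres too. -/
def radial (n : ℕ) (x : X) (t : ℝ) : X :=
  if h : ∃ (c : Cell X n) (z : Fin n → ℝ), z ∈ ball 0 1 ∧ z ≠ 0 ∧ x = chi n c z then
    chi n h.choose (radialPt h.choose_spec.choose t) else x

lemma chi_ne_of_mem_sphere {n : ℕ} {c c' : Cell X n} {z z' : Fin n → ℝ}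
    (hz : z ∈ sphere (0 : Fin n → ℝ) 1) (hz' : z' ∈ ball (0 : Fin n → ℝ) 1) :
    chi n c z ≠ chi n c' z' := by
  intro h
  have h1 : chi n c z ∈ RelCWComplex.cellFrontier (C := (univ : Set X)) n c := ⟨z, hz, rfl⟩
  have h2 : chi n c' z' ∈ RelCWComplex.openCell (C := (univ : Set X)) n c' := ⟨z', hz', rfl⟩
  have h3 := RelCWComplex.cellFrontier_subset_skeletonLT (C := (univ : Set X)) n c h1
  rw [h] at h3
  exact Set.disjoint_left.1 (RelCWComplex.disjoint_skeletonLT_openCell (C := (univ : Set X)) le_rfl)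
    h3 h2

lemma radial_chi {n : ℕ} {c : Cell X n} {z : Fin n → ℝ} (hz : z ∈ closedBall (0 : Fin n → ℝ) 1)
    (h0 : z ≠ 0) (t : ℝ) : radial n (chi n c z) t = chi n c (radialPt z t) := by
  rcases ball_union_sphere_of_mem_closedBall hz with hzb | hzs
  · have h : ∃ (c' : Cell X n) (z' : Fin n → ℝ), z' ∈ ball 0 1 ∧ z' ≠ 0 ∧
        chi n c z = chi n c' z' := ⟨c, z, hzb, h0, rfl⟩
    have hs := h.choose_spec.choose_spec
    have hc : c = h.choose := by
      have := cell_eq_of_chi_eq hzb hs.1 hs.2.2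
      simpa using this
    have hz' : z = h.choose_spec.choose := by
      refine chi_injOn n c hzb hs.1 (hs.2.2.trans ?_)
      congr 1
      rw [← hc]
    rw [radial, dif_pos h, ← hz']
    congr 1
    rw [← hc]
  · rw [radialPt_of_mem_sphere hzs, radial, dif_neg]
    rintro ⟨c', z', hz', -, he⟩
    exact chi_ne_of_mem_sphere hzs hz' he

lemma radial_of_lt {m n : ℕ} (hmn : m < n) {c : Cell X m} {z : Fin m → ℝ}
    (hz : z ∈ closedBall (0 : Fin m → ℝ) 1) (t : ℝ) : radial n (chi m c z) t = chi m c z := by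
  rw [radial, dif_neg]
  rintro ⟨c', z', hz', -, he⟩
  have h1 : chi m c z ∈ RelCWComplex.closedCell (C := (univ : Set X)) m c := ⟨z, hz, rfl⟩
  have h2 : chi n c' z' ∈ RelCWComplex.openCell (C := (univ : Set X)) n c' := ⟨z', hz', rfl⟩
  have h3 := RelCWComplex.closedCell_subset_skeletonLT (C := (univ : Set X)) m c h1
  rw [he] at h3
  exact Set.disjoint_left.1 (RelCWComplex.disjoint_skeletonLT_openCell (C := (univ : Set X))
    (by exact_mod_cast hmn)) h3 h2

/-- The centres of the `n`-cells. -/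
def centres (X : Type*) [TopologicalSpace X] [CWComplex (univ : Set X)] (n : ℕ) : Set X :=
  range fun c : Cell X n => chi n c 0

lemma chi_mem_centres_iff {n : ℕ} {c : Cell X n} {z : Fin n → ℝ}
    (hz : z ∈ closedBall (0 : Fin n → ℝ) 1) : chi n c z ∈ centres X n ↔ z = 0 := by
  constructor
  · rintro ⟨c', h⟩
    rcases ball_union_sphere_of_mem_closedBall hz with hzb | hzs
    · have h0 : (0 : Fin n → ℝ) ∈ ball (0 : Fin n → ℝ) 1 := mem_ball_self one_pos
      have := cell_eq_of_chi_eq h0 hzb h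
      obtain rfl : c' = c := by simpa using this
      exact (chi_injOn n c' h0 hzb h).symm
    · exact absurd h.symm (chi_ne_of_mem_sphere hzs (mem_ball_self one_pos))
  · rintro rfl
    exact ⟨c, rfl⟩

/-- Pushing radially out of the `n`-cells is continuous, off their centres, on the union of the cells
of dimension at most `n`. -/
lemma radial_continuousOn (K : FiniteTwoComplex X) (n : ℕ) :
    ContinuousOn (fun q : X × ℝ => radial n q.1 q.2)
      ((skel X n \ centres X n) ×ˢ Icc (0 : ℝ) 1) := by
  have := K.finite_sigma
  -- as a map to the space of paths
  let Φ : X → unitInterval → X := fun x t => radial n x t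
  have hcell : ∀ m ≤ n, ∀ c : Cell X m, ContinuousOn (fun q : (Fin m → ℝ) × ℝ =>
      radial n (chi m c q.1) q.2) ((closedBall 0 1 ∩ chi m c ⁻¹' (centres X n)ᶜ) ×ˢ Icc 0 1) := by
    intro m hm c
    rcases hm.lt_or_eq with hlt | rfl
    · refine ContinuousOn.congr (f := fun q => chi m c q.1) ?_ fun q hq =>
        radial_of_lt hlt hq.1.1 q.2
      exact (chi_continuousOn m c).comp continuousOn_fst fun q hq => hq.1.1
    · have hne : ∀ q : (Fin m → ℝ) × ℝ,
          q ∈ (closedBall 0 1 ∩ chi m c ⁻¹' (centres X m)ᶜ) ×ˢ Icc (0 : ℝ) 1 → q.1 ≠ 0 :=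
        fun q hq h => hq.1.2 ((chi_mem_centres_iff hq.1.1).2 h)
      refine ContinuousOn.congr (f := fun q => chi m c (radialPt q.1 q.2)) ?_ fun q hq =>
        radial_chi hq.1.1 (hne q hq) q.2
      exact (chi_continuousOn m c).comp ((radialPt_continuousOn m).mono hne) fun q hq =>
        radialPt_mem hq.1.1 (hne q hq) hq.2
  have hΦc : ∀ m ≤ n, ∀ c : Cell X m, ∀ z ∈ closedBall (0 : Fin m → ℝ) 1,
      chi m c z ∈ (centres X n)ᶜ → Continuous (Φ (chi m c z)) := by
    intro m hm c z hz hzc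
    exact (hcell m hm c).comp_continuous (f := fun t : unitInterval => (z, (t : ℝ)))
      (by fun_prop) fun t => ⟨⟨hz, hzc⟩, t.2⟩
  classical
  let Ψ : X → C(unitInterval, X) := fun x =>
    if h : Continuous (Φ x) then ⟨Φ x, h⟩ else ContinuousMap.const _ x
  have hΨ : ∀ m ≤ n, ∀ c : Cell X m, ∀ z ∈ closedBall (0 : Fin m → ℝ) 1,
      chi m c z ∈ (centres X n)ᶜ → ∀ t : unitInterval,
      Ψ (chi m c z) t = radial n (chi m c z) t := by
    intro m hm c z hz hzc t
    simp only [Ψ, dif_pos (hΦc m hm c z hz hzc)]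
    rfl
  have hΨc : ContinuousOn Ψ (skel X n \ centres X n) := by
    refine continuousOn_of_forall_cell (fun c : {c : Σ m, Cell X m // c.1 ≤ n} => c.1)
      (U := (centres X n)ᶜ) sdiff_subset (fun x hx => hx.2) ?_
    rintro ⟨⟨m, c⟩, hm⟩
    rw [continuousOn_iff_continuous_domRestrict]
    refine ContinuousMap.continuous_of_continuous_uncurry _ ?_
    refine ((hcell m hm c).comp_continuous
      (f := fun q : ↥(closedBall 0 1 ∩ chi m c ⁻¹' (centres X n)ᶜ) × unitInterval =>
        ((q.1 : Fin m → ℝ), (q.2 : ℝ))) (by fun_prop) fun q => ⟨q.1.2, q.2.2⟩).congr ?_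
    rintro ⟨⟨z, hz⟩, t⟩
    exact (hΨ m hm c z hz.1 hz.2 t).symm
  have heval : ContinuousOn (fun q : X × ℝ => Ψ q.1 (projIcc 0 1 zero_le_one q.2))
      ((skel X n \ centres X n) ×ˢ Icc (0 : ℝ) 1) := by
    have h1 : ContinuousOn (fun q : X × ℝ => Ψ q.1) ((skel X n \ centres X n) ×ˢ Icc (0 : ℝ) 1) :=
      hΨc.comp continuousOn_fst fun q hq => hq.1
    have h2 : Continuous fun q : X × ℝ => projIcc (0 : ℝ) 1 zero_le_one q.2 :=
      continuous_projIcc.comp continuous_snd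
    exact continuous_eval.comp_continuousOn (h1.prodMk h2.continuousOn)
  refine heval.congr ?_
  rintro ⟨x, t⟩ ⟨hx, ht⟩
  obtain ⟨⟨⟨m, c⟩, hm⟩, z, hz, rfl⟩ := mem_iUnion.1 hx.1
  simp only [projIcc_of_mem zero_le_one ht]
  exact (hΨ m hm c z hz hx.2 ⟨t, ht⟩).symm

lemma radial_zero (n : ℕ) (x : X) : radial n x 0 = x := by
  by_cases h : ∃ (c : Cell X n) (z : Fin n → ℝ), z ∈ ball 0 1 ∧ z ≠ 0 ∧ x = chi n c z
  · obtain ⟨c, z, hz, h0, rfl⟩ := h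
    rw [radial_chi (ball_subset_closedBall hz) h0, radialPt_zero]
  · rw [radial, dif_neg h]

lemma mem_skel {n m : ℕ} (hm : m ≤ n) (c : Cell X m) {z : Fin m → ℝ}
    (hz : z ∈ closedBall (0 : Fin m → ℝ) 1) : chi m c z ∈ skel X n :=
  mem_iUnion.2 ⟨⟨⟨m, c⟩, hm⟩, z, hz, rfl⟩

lemma exists_of_mem_skel {n : ℕ} {x : X} (hx : x ∈ skel X n) :
    ∃ m ≤ n, ∃ (c : Cell X m), ∃ z ∈ closedBall (0 : Fin m → ℝ) 1, chi m c z = x := by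
  obtain ⟨⟨⟨m, c⟩, hm⟩, z, hz, h⟩ := mem_iUnion.1 hx
  exact ⟨m, hm, c, z, hz, h⟩

lemma radial_one_mem_skel {n : ℕ} {x : X} (hx : x ∈ skel X (n + 1)) (hc : x ∉ centres X (n + 1)) :
    radial (n + 1) x 1 ∈ skel X n := by
  obtain ⟨m, hm, c, z, hz, rfl⟩ := exists_of_mem_skel hx
  rcases hm.lt_or_eq with hlt | rfl
  · rw [radial_of_lt hlt hz]
    exact mem_skel (by omega) c hz
  · have h0 : z ≠ 0 := fun h => hc ((chi_mem_centres_iff hz).2 h)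
    rw [radial_chi hz h0, radialPt_one]
    have h1 : ‖z‖⁻¹ • z ∈ sphere (0 : Fin (n + 1) → ℝ) 1 := by
      rw [mem_sphere_zero_iff_norm, norm_smul, norm_inv, norm_norm,
        inv_mul_cancel₀ (norm_ne_zero_iff.2 h0)]
    obtain ⟨I, hI⟩ := CWComplex.cellFrontier_subset_finite_closedCell (C := (univ : Set X)) (n + 1) c
    have h2 := hI ⟨_, h1, rfl⟩
    simp only [mem_iUnion] at h2
    obtain ⟨m, hm, j, -, y, hy, hyx⟩ := h2
    have h3 : chi m j y = chi (n + 1) c (‖z‖⁻¹ • z) := hyx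
    rw [← h3]
    exact mem_skel (by omega) j hy

lemma chi_ne_chi {m n : ℕ} (hmn : m ≤ n) {c' : Cell X m} {c : Cell X n}
    (hne : (⟨m, c'⟩ : Σ n, Cell X n) ≠ ⟨n, c⟩) {z' : Fin m → ℝ} {z : Fin n → ℝ}
    (hz' : z' ∈ closedBall (0 : Fin m → ℝ) 1) (hz : z ∈ ball (0 : Fin n → ℝ) 1) :
    chi m c' z' ≠ chi n c z := by
  rcases ball_union_sphere_of_mem_closedBall hz' with h | h
  · exact fun he => hne (cell_eq_of_chi_eq h hz he)
  · rcases hmn.lt_or_eq with hlt | rfl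
    · intro he
      have h1 : chi m c' z' ∈ RelCWComplex.closedCell (C := (univ : Set X)) m c' := ⟨z', hz', rfl⟩
      have h2 : chi n c z ∈ RelCWComplex.openCell (C := (univ : Set X)) n c := ⟨z, hz, rfl⟩
      have h3 := RelCWComplex.closedCell_subset_skeletonLT (C := (univ : Set X)) m c' h1
      rw [he] at h3
      exact Set.disjoint_left.1 (RelCWComplex.disjoint_skeletonLT_openCell (C := (univ : Set X))
        (by exact_mod_cast hlt)) h3 h2
    · exact chi_ne_of_mem_sphere h hz

/-- Open `n`-cells are open in the union of the cells of dimension at most `n`. -/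
lemma eventually_mem_openCell (K : FiniteTwoComplex X) {n : ℕ} {c : Cell X n} {z : Fin n → ℝ}
    (hz : z ∈ ball (0 : Fin n → ℝ) 1) : ∀ᶠ x in 𝓝[skel X n] (chi n c z), x ∈ chi n c '' ball 0 1 := by
  have := K.finite_sigma
  have hclosed : IsClosed ((⋃ c' : {c' : Σ m, Cell X m // c'.1 ≤ n ∧ c' ≠ ⟨n, c⟩},
      chi c'.1.1 c'.1.2 '' closedBall 0 1) ∪ chi n c '' sphere 0 1) := by
    refine IsClosed.union (isClosed_iUnion_of_finite fun c' => ?_) ?_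
    · exact ((isCompact_closedBall _ _).image_of_continuousOn (chi_continuousOn _ _)).isClosed
    · exact ((isCompact_sphere _ _).image_of_continuousOn
        ((chi_continuousOn _ _).mono sphere_subset_closedBall)).isClosed
  have hmem : chi n c z ∈ ((⋃ c' : {c' : Σ m, Cell X m // c'.1 ≤ n ∧ c' ≠ ⟨n, c⟩},
      chi c'.1.1 c'.1.2 '' closedBall 0 1) ∪ chi n c '' sphere 0 1)ᶜ := by
    rintro (h | ⟨y, hy, h⟩)
    · obtain ⟨⟨⟨m, c'⟩, hm, hne⟩, y, hy, h⟩ := mem_iUnion.1 h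
      exact chi_ne_chi hm hne hy hz h
    · exact chi_ne_of_mem_sphere hy hz h
  filter_upwards [mem_nhdsWithin_of_mem_nhds (hclosed.isOpen_compl.mem_nhds hmem),
    self_mem_nhdsWithin] with x hx hxs
  obtain ⟨m, hm, c', y, hy, rfl⟩ := exists_of_mem_skel hxs
  by_cases he : (⟨m, c'⟩ : Σ n, Cell X n) = ⟨n, c⟩
  · obtain rfl : m = n := congrArg Sigma.fst he
    obtain rfl : c' = c := by simpa using he
    rcases ball_union_sphere_of_mem_closedBall hy with h | h
    · exact ⟨y, h, rfl⟩
    · exact (hx (Or.inr ⟨y, h, rfl⟩)).elim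
  · exact (hx (Or.inl (mem_iUnion.2 ⟨⟨⟨m, c'⟩, hm, he⟩, y, hy, rfl⟩))).elim

end Radial

section Flat

variable {X : Type*} [TopologicalSpace X] [CWComplex (univ : Set X)] [T2Space X]
  {G : Type*} [Group G]

/-- On each closed cell, `F` is the coboundary of the function `h`. -/
def IsFlat (F : PathHom X G) (h : X → G) : Prop :=
  ∀ (m : ℕ) (c : Cell X m), ∀ z ∈ closedBall (0 : Fin m → ℝ) 1,
    ∀ z' ∈ closedBall (0 : Fin m → ℝ) 1,
    F.seg (chi m c) z z' = (h (chi m c z))⁻¹ * h (chi m c z')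

variable {F : PathHom X G} {h : X → G}

lemma PathHom.seg_eq_of_locally {γ : ℝ → X} {a b : ℝ} (hab : a ≤ b)
    (hγ : ContinuousOn γ (Icc a b))
    (hloc : ∀ t ∈ Icc a b, ∃ p : ℝ → Prop, (∀ᶠ u in 𝓝[Icc a b] t, p u) ∧
      ∀ s s', s ≤ s' → Icc s s' ⊆ Icc a b → (∀ u ∈ Icc s s', p u) →
        F.seg γ s s' = (h (γ s))⁻¹ * h (γ s')) :
    F.seg γ a b = (h (γ a))⁻¹ * h (γ b) := by
  have key := F.seg_mem_of_locally hab hγ (fun t => (h (γ t))⁻¹) ⊥ fun t ht => by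
    obtain ⟨p, hp, hps⟩ := hloc t ht
    obtain ⟨ε, hε, hball⟩ := Metric.mem_nhdsWithin_iff.1 hp
    filter_upwards [mem_nhdsWithin_of_mem_nhds (ball_mem_nhds t hε), self_mem_nhdsWithin]
      with s hs hsI
    rw [Subgroup.mem_bot]
    have hconv : ∀ u, u ∈ Icc (min s t) (max s t) → p u := by
      intro u hu
      refine hball ⟨?_, (le_min hsI.1 ht.1).trans hu.1, hu.2.trans (max_le hsI.2 ht.2)⟩
      exact (convex_ball t ε).ordConnected.uIcc_subset hs (mem_ball_self hε)
        (by rwa [uIcc])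
    rcases le_total t s with hts | hts
    · rw [min_eq_right hts, max_eq_left hts] at hconv
      rw [hps t s hts (Icc_subset_Icc ht.1 hsI.2) hconv]
      group
    · rw [min_eq_left hts, max_eq_right hts] at hconv
      rw [F.seg_symm (convex_Icc a b) hγ hsI ht, hps s t hts (Icc_subset_Icc hsI.1 ht.2) hconv]
      group
  rw [Subgroup.mem_bot] at key
  calc F.seg γ a b = (h (γ a))⁻¹ * ((h (γ a))⁻¹⁻¹ * F.seg γ a b * (h (γ b))⁻¹) * h (γ b) := by group
    _ = _ := by rw [key, mul_one]

lemma IsFlat.seg_eq_of_openCell (hF : IsFlat F h) {n : ℕ} {c : Cell X n} {γ : ℝ → X} {a b : ℝ}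
    (hab : a ≤ b) (hγ : ContinuousOn γ (Icc a b)) (hc : MapsTo γ (Icc a b) (chi n c '' ball 0 1)) :
    F.seg γ a b = (h (γ a))⁻¹ * h (γ b) := by
  set ζ := fun t => (RelCWComplex.map (C := (univ : Set X)) n c).symm (γ t)
  have hζ : ∀ t ∈ Icc a b, ζ t ∈ ball 0 1 ∧ chi n c (ζ t) = γ t := by
    intro t ht
    obtain ⟨z, hz, hzt⟩ := hc ht
    have hsrc : z ∈ (RelCWComplex.map (C := (univ : Set X)) n c).source := by
      rwa [RelCWComplex.source_eq n c]
    have : ζ t = z := by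
      simp only [ζ]
      rw [← hzt]
      exact (RelCWComplex.map (C := (univ : Set X)) n c).left_inv hsrc
    rw [this]
    exact ⟨hz, hzt⟩
  have hcont : ContinuousOn ζ (Icc a b) := by
    refine (RelCWComplex.continuousOn_symm (C := (univ : Set X)) n c).comp hγ fun t ht => ?_
    obtain ⟨z, hz, hzt⟩ := hc ht
    rw [← hzt]
    exact (RelCWComplex.map (C := (univ : Set X)) n c).map_source
      (by rwa [RelCWComplex.source_eq n c])
  have ha := left_mem_Icc.2 hab
  have hb := right_mem_Icc.2 hab
  rw [F.seg_congr (convex_Icc a b) (g := fun t => chi n c (ζ t)) (fun t ht => (hζ t ht).2.symm)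
    ha hb, F.seg_comp (convex_closedBall 0 1) (chi_continuousOn n c) (convex_Icc a b) hcont
      (fun t ht => ball_subset_closedBall (hζ t ht).1) ha hb,
    hF n c _ (ball_subset_closedBall (hζ a ha).1) _ (ball_subset_closedBall (hζ b hb).1),
    (hζ a ha).2, (hζ b hb).2]

lemma IsFlat.seg_radial (hF : IsFlat F h) {n : ℕ} {x : X} (hx : x ∈ skel X n)
    (hc : x ∉ centres X n) : F.seg (radial n x) 0 1 = (h x)⁻¹ * h (radial n x 1) := by
  obtain ⟨m, hm, c, z, hz, rfl⟩ := exists_of_mem_skel hx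
  rcases hm.lt_or_eq with hlt | rfl
  · rw [radial_of_lt hlt hz, inv_mul_cancel]
    have : radial n (chi m c z) = fun _ => chi m c z := funext (radial_of_lt hlt hz)
    rw [this]
    exact F.val_const _
  · have h0 : z ≠ 0 := fun h => hc ((chi_mem_centres_iff hz).2 h)
    have he : radial m (chi m c z) = fun t => chi m c (radialPt z t) := funext (radial_chi hz h0)
    have hcont : ContinuousOn (radialPt z) (Icc (0 : ℝ) 1) :=
      (radialPt_continuousOn m).comp (f := fun t : ℝ => (z, t)) (by fun_prop) fun _ _ => h0
    rw [he, F.seg_comp (convex_closedBall 0 1) (chi_continuousOn m c) (convex_Icc (0 : ℝ) 1) hcont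
      (fun t ht => radialPt_mem hz h0 ht) (by simp) (by simp), hF m c _
        (radialPt_mem hz h0 (by simp)) _ (radialPt_mem hz h0 (by simp)), radialPt_zero]

/-- A path in the `n`-skeleton is treated locally: near the centre of an `n`-cell it lies in an open
cell, elsewhere it can be pushed radially into the `(n - 1)`-skeleton. -/
lemma IsFlat.seg_eq_of_mapsTo_skel (hF : IsFlat F h) (K : FiniteTwoComplex X) (n : ℕ) :
    ∀ {γ : ℝ → X} {a b : ℝ}, a ≤ b → ContinuousOn γ (Icc a b) → MapsTo γ (Icc a b) (skel X n) →
      F.seg γ a b = (h (γ a))⁻¹ * h (γ b) := by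
  induction n with
  | zero =>
    intro γ a b hab hγ hs
    refine F.seg_eq_of_locally hab hγ fun t ht => ?_
    obtain ⟨m, hm, c, z, hz, he⟩ := exists_of_mem_skel (hs ht)
    obtain rfl : m = 0 := by omega
    have hzb : z ∈ ball (0 : Fin 0 → ℝ) 1 := by rw [Subsingleton.elim z 0]; simp
    refine ⟨fun u => γ u ∈ chi 0 c '' ball 0 1, ?_, fun s s' hss hsub hp =>
      hF.seg_eq_of_openCell hss (hγ.mono hsub) hp⟩
    have := eventually_mem_openCell K (c := c) hzb
    rw [he] at this
    exact (tendsto_nhdsWithin_of_tendsto_nhds_of_eventually_within _ (hγ t ht)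
      (Filter.eventually_of_mem self_mem_nhdsWithin hs)).eventually this
  | succ n ih =>
    intro γ a b hab hγ hs
    refine F.seg_eq_of_locally hab hγ fun t ht => ?_
    have htend : Filter.Tendsto γ (𝓝[Icc a b] t) (𝓝[skel X (n + 1)] (γ t)) :=
      tendsto_nhdsWithin_of_tendsto_nhds_of_eventually_within _ (hγ t ht)
        (Filter.eventually_of_mem self_mem_nhdsWithin hs)
    by_cases hc : γ t ∈ centres X (n + 1)
    · obtain ⟨c, hc⟩ := hc
      have := eventually_mem_openCell K (c := c) (mem_ball_self one_pos)
      change chi (n + 1) c 0 = γ t at hc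
      rw [hc] at this
      exact ⟨fun u => γ u ∈ chi (n + 1) c '' ball 0 1, htend.eventually this,
        fun s s' hss hsub hp => hF.seg_eq_of_openCell hss (hγ.mono hsub) hp⟩
    · have hclosed : IsClosed (centres X (n + 1)) :=
        have := K.finite_cell (n + 1)
        (Set.finite_range _).isClosed
      refine ⟨fun u => γ u ∉ centres X (n + 1), (hγ t ht).eventually
        (hclosed.isOpen_compl.mem_nhds hc), fun s s' hss hsub hp => ?_⟩
      have hs1 := left_mem_Icc.2 hss
      have hs2 := right_mem_Icc.2 hss
      have hcont : ContinuousOn (fun q : ℝ × ℝ => radial (n + 1) (γ q.1) q.2)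
          (Icc s s' ×ˢ Icc (0 : ℝ) 1) :=
        (radial_continuousOn K (n + 1)).comp (f := fun q : ℝ × ℝ => (γ q.1, q.2))
          (((hγ.mono hsub).comp continuousOn_fst fun q hq => hq.1).prodMk continuousOn_snd)
          fun q hq => ⟨⟨hs (hsub hq.1), hp _ hq.1⟩, hq.2⟩
      have hsq := F.seg_square hss zero_le_one hcont
      simp only [radial_zero] at hsq
      have hpush := ih hss (γ := fun u => radial (n + 1) (γ u) 1)
        (hcont.comp (f := fun u => (u, (1 : ℝ))) (by fun_prop) fun u hu => ⟨hu, by simp⟩)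
        fun u hu => radial_one_mem_skel (hs (hsub hu)) (hp u hu)
      change F.seg γ s s' * F.seg (radial (n + 1) (γ s')) 0 1 =
        F.seg (radial (n + 1) (γ s)) 0 1 * _ at hsq
      rw [hpush, hF.seg_radial (hs (hsub hs1)) (hp s hs1), hF.seg_radial (hs (hsub hs2)) (hp s' hs2)]
        at hsq
      rw [← eq_mul_inv_iff_mul_eq] at hsq
      rw [hsq]
      group

/-- A homomorphism on paths that is a coboundary on each cell is a coboundary; in particular it is
trivial on loops. -/
lemma IsFlat.val_eq (hF : IsFlat F h) (K : FiniteTwoComplex X) {x y : X} (p : Path x y) :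
    F.val p = (h x)⁻¹ * h y := by
  rw [F.val_eq_seg, hF.seg_eq_of_mapsTo_skel K 2 zero_le_one p.continuous_extend.continuousOn
    fun t _ => ?_]
  · simp
  · obtain ⟨c, z, hz, he⟩ := exists_chi (p.extend t)
    rw [he]
    exact mem_skel (K.cell_le c.2) c.2 (ball_subset_closedBall hz)

lemma PathHom.seg_chi_one (F : PathHom X G) (e : Cell X 1) {t t' : ℝ} (ht : t ∈ Icc (-1 : ℝ) 1)
    (ht' : t' ∈ Icc (-1 : ℝ) 1) :
    F.seg (chi 1 e) (fun _ => t) (fun _ => t') = F.seg (edgePt e) t t' :=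
  (F.seg_comp (convex_closedBall 0 1) (chi_continuousOn 1 e) (convex_Icc (-1 : ℝ) 1)
    (g := fun t _ => t) (by fun_prop) (fun t ht => const_mem_closedBall_iff.2 ht) ht ht').symm

/-- The value of `F` on the boundary of a 2-cell that is constant is trivial. -/
lemma PathHom.seg_disc_of_length_eq_zero (F : PathHom X G) {d : Cell X 2} (B : BoundaryPath d)
    (hL : B.length = 0) {w w' : Fin 2 → ℝ} (hw : w ∈ sphere (0 : Fin 2 → ℝ) 1)
    (hw' : w' ∈ sphere (0 : Fin 2 → ℝ) 1) : F.seg (chi 2 d) w w' = 1 := by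
  have hrank : 1 < Module.rank ℝ (Fin 2 → ℝ) := by simp
  obtain ⟨q, hq⟩ := (isPathConnected_sphere hrank (0 : Fin 2 → ℝ) zero_le_one).joinedIn w hw w' hw'
  have h1 := F.val_comp_eq_seg (convex_closedBall 0 1) (chi_continuousOn 2 d) q.continuous
    fun t => sphere_subset_closedBall (hq t)
  rw [q.source, q.target] at h1
  obtain ⟨v, hv⟩ := B.constant hL
  have h2 : (fun t => chi 2 d (q t)) = fun _ => vert v := by
    funext t
    have := hv (hq t)
    rwa [closedCell_zero] at this
  rw [← h1, h2]
  exact F.val_const _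

lemma BoundaryPath.pot_eq_of_gauge {d : Cell X 2} {B : BoundaryPath d} (g : X → G) {s : ℝ}
    (hs : s ∈ Icc 0 (B.length : ℝ)) : B.pot (fun e c => g (edgePt e c)) s =
      (g (chi 2 d (B.param 0)))⁻¹ * g (chi 2 d (B.param s)) := by
  have hword : ∀ k ≤ B.length, B.word (fun e c => g (edgePt e c)) k =
      (g (chi 2 d (B.param 0)))⁻¹ * g (chi 2 d (B.param k)) := by
    intro k hk
    induction k with
    | zero => simp [BoundaryPath.word]
    | succ k ih =>
      have h1 := BoundaryPath.word_succ (B := B) (η := fun e c => g (edgePt e c)) ⟨k, hk⟩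
      simp only at h1
      have h2 := BoundaryPath.disc_param_eq (B := B) ⟨k, hk⟩ (s := k) (by simp)
      have h3 := BoundaryPath.disc_param_eq (B := B) ⟨k, hk⟩ (s := (k : ℝ) + 1) (by simp)
      rw [h1, ih (by omega), ← h2, ← h3, mul_inv_cancel_right, Nat.cast_succ]
  rcases BoundaryPath.exists_nat_or_mem_Ioo hs with ⟨j, hj, rfl⟩ | ⟨j, hj⟩
  · rw [BoundaryPath.pot_natCast hj, hword j hj]
  · rw [BoundaryPath.pot_eq j (Ioo_subset_Icc_self hj), hword j j.2.le,
      ← BoundaryPath.disc_param_eq j (Ioo_subset_Icc_self hj),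
      ← BoundaryPath.disc_param_eq j (s := (j : ℝ)) (by simp), mul_inv_cancel_right]

/-- A gauge that describes `F` on the 1-cells also describes it on the boundaries of the 2-cells. -/
lemma PathHom.seg_disc_eq_of_gauge (F : PathHom X G) (K : FiniteTwoComplex X) {g : X → G}
    (hg : ∀ e, ∀ c ∈ Icc (-1 : ℝ) 1, ∀ c' ∈ Icc (-1 : ℝ) 1,
      F.seg (edgePt e) c c' = (g (edgePt e c))⁻¹ * g (edgePt e c')) (d : Cell X 2)
    {w w' : Fin 2 → ℝ} (hw : w ∈ sphere (0 : Fin 2 → ℝ) 1) (hw' : w' ∈ sphere (0 : Fin 2 → ℝ) 1) :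
    F.seg (chi 2 d) w w' = (g (chi 2 d w))⁻¹ * g (chi 2 d w') := by
  set B := K.boundary d
  rcases Nat.eq_zero_or_pos B.length with hL | hL
  · obtain ⟨v, hv⟩ := B.constant hL
    have h1 := hv hw
    have h2 := hv hw'
    rw [closedCell_zero, mem_singleton_iff] at h1 h2
    rw [F.seg_disc_of_length_eq_zero B hL hw hw']
    have : chi 2 d w' = chi 2 d w := h2.trans h1.symm
    rw [this, inv_mul_cancel]
  · obtain ⟨s, hs, rfl⟩ := BoundaryPath.exists_param_eq (B := B) hL hw
    obtain ⟨s', hs', rfl⟩ := BoundaryPath.exists_param_eq (B := B) hL hw'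
    replace hs := Ico_subset_Icc_self hs
    replace hs' := Ico_subset_Icc_self hs'
    rw [← F.seg_comp (convex_closedBall 0 1) (chi_continuousOn 2 d)
      (convex_Icc (0 : ℝ) B.length) B.continuousOn_param
      (fun t ht => sphere_subset_closedBall (BoundaryPath.param_mem_sphere hL ht)) hs hs',
      BoundaryPath.seg_param_eq F hg hs hs', BoundaryPath.pot_eq_of_gauge g hs,
      BoundaryPath.pot_eq_of_gauge g hs']
    group

/-- A homomorphism on paths whose values on the 1-cells are a coboundary is a coboundary. -/
theorem PathHom.exists_isFlat (F : PathHom X G) (K : FiniteTwoComplex X) (p : Cell X 0 → G)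
    (hp : ∀ e v v', edgePt e (-1) = vert v → edgePt e 1 = vert v' →
      F.seg (edgePt e) (-1) 1 = (p v)⁻¹ * p v') :
    ∃ h : X → G, IsFlat F h ∧ ∀ v, h (vert v) = p v := by
  classical
  choose v₀ hv₀ using fun e : Cell X 1 => (exists_vert_eq_edgePt e).1
  choose v₁ hv₁ using fun e : Cell X 1 => (exists_vert_eq_edgePt e).2
  have hseg : ∀ e, ∀ c ∈ Icc (-1 : ℝ) 1, ∀ c' ∈ Icc (-1 : ℝ) 1, F.seg (edgePt e) c c' =
      (F.seg (edgePt e) (-1) c)⁻¹ * F.seg (edgePt e) (-1) c' := by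
    intro e c hc c' hc'
    rw [← F.seg_trans (convex_Icc (-1 : ℝ) 1) (edgePt_continuousOn e)
      (left_mem_Icc.2 (by norm_num)) hc hc', inv_mul_cancel_left]
  obtain ⟨g, hgv, hge⟩ : ∃ g : X → G, (∀ v, g (vert v) = p v) ∧ ∀ e, ∀ c ∈ Icc (-1 : ℝ) 1,
      g (edgePt e c) = p (v₀ e) * F.seg (edgePt e) (-1) c := by
    let g : X → G := fun x => if hv : ∃ v, x = vert v then p hv.choose else
      if he : ∃ (e : Cell X 1) (c : ℝ), c ∈ Ioo (-1 : ℝ) 1 ∧ x = edgePt e c then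
        p (v₀ he.choose) * F.seg (edgePt he.choose) (-1) he.choose_spec.choose else 1
    have hgv : ∀ v, g (vert v) = p v := by
      intro v
      have hv : ∃ v', (vert v : X) = vert v' := ⟨v, rfl⟩
      simp only [g, dif_pos hv]
      rw [← vert_injective hv.choose_spec]
    refine ⟨g, hgv, fun e c hc => ?_⟩
    rcases eq_or_lt_of_le hc.1 with rfl | h1
    · rw [hv₀, hgv, F.seg_self, mul_one]
    rcases eq_or_lt_of_le hc.2 with rfl | h2
    · rw [hv₁, hgv, hp e _ _ (hv₀ e) (hv₁ e), mul_inv_cancel_left]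
    have hv : ¬ ∃ v, edgePt e c = vert v := by
      rintro ⟨v, hv⟩
      exact vert_ne_edgePt ⟨h1, h2⟩ hv.symm
    have he : ∃ (e' : Cell X 1) (c' : ℝ), c' ∈ Ioo (-1 : ℝ) 1 ∧ edgePt e c = edgePt e' c' :=
      ⟨e, c, ⟨h1, h2⟩, rfl⟩
    simp only [g, dif_neg hv, dif_pos he]
    have := edgePt_injective ⟨h1, h2⟩ he.choose_spec.choose_spec.1 he.choose_spec.choose_spec.2
    rw [← this.2, ← this.1]
  have hg : ∀ e, ∀ c ∈ Icc (-1 : ℝ) 1, ∀ c' ∈ Icc (-1 : ℝ) 1,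
      F.seg (edgePt e) c c' = (g (edgePt e c))⁻¹ * g (edgePt e c') := by
    intro e c hc c' hc'
    rw [hge e c hc, hge e c' hc', hseg e c hc c' hc']
    group
  let w₀ : Fin 2 → ℝ := fun _ => 1
  have hw₀ : w₀ ∈ sphere (0 : Fin 2 → ℝ) 1 := by
    rw [mem_sphere_zero_iff_norm]
    simp [w₀]
  let h : X → G := fun x => if hx : ∃ (d : Cell X 2) (z : Fin 2 → ℝ), z ∈ ball 0 1 ∧ x = chi 2 d z
    then g (chi 2 hx.choose w₀) * F.seg (chi 2 hx.choose) w₀ hx.choose_spec.choose else g x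
  have hskel : ∀ x ∈ oneSkel X, h x = g x := by
    intro x hx
    simp only [h]
    rw [dif_neg]
    rintro ⟨d, z, hz, rfl⟩
    exact disc_notMem_oneSkel hz hx
  have hdisc : ∀ d, ∀ z ∈ closedBall (0 : Fin 2 → ℝ) 1,
      h (chi 2 d z) = g (chi 2 d w₀) * F.seg (chi 2 d) w₀ z := by
    intro d z hz
    rcases ball_union_sphere_of_mem_closedBall hz with hzb | hzs
    · have hx : ∃ (d' : Cell X 2) (z' : Fin 2 → ℝ), z' ∈ ball 0 1 ∧ chi 2 d z = chi 2 d' z' :=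
        ⟨d, z, hzb, rfl⟩
      simp only [h, dif_pos hx]
      have := disc_injective hzb hx.choose_spec.choose_spec.1 hx.choose_spec.choose_spec.2
      rw [← this.2, ← this.1]
    · rw [hskel _ (sphere_mem_oneSkel hzs), F.seg_disc_eq_of_gauge K hg d hw₀ hzs,
        mul_inv_cancel_left]
  refine ⟨h, fun m c z hz z' hz' => ?_, fun v => by rw [hskel _ (vert_mem_oneSkel v), hgv]⟩
  have hm := K.cell_le c
  interval_cases m
  · rw [Subsingleton.elim z z', F.seg_self, inv_mul_cancel]
  · obtain ⟨t, rfl⟩ : ∃ t, z = fun _ => t := ⟨z 0, fin_one_eq_const z⟩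
    obtain ⟨t', rfl⟩ : ∃ t, z' = fun _ => t := ⟨z' 0, fin_one_eq_const z'⟩
    have ht := const_mem_closedBall_iff.1 hz
    have ht' := const_mem_closedBall_iff.1 hz'
    rw [F.seg_chi_one c ht ht', hg c t ht t' ht']
    change _ = (h (edgePt c t))⁻¹ * h (edgePt c t')
    rw [hskel _ (edgePt_mem_oneSkel c ht), hskel _ (edgePt_mem_oneSkel c ht')]
  · rw [hdisc c z hz, hdisc c z' hz', ← F.seg_trans (convex_closedBall 0 1) (chi_continuousOn 2 c)
      hz (sphere_subset_closedBall hw₀) hz', F.seg_symm (convex_closedBall 0 1)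
      (chi_continuousOn 2 c) (sphere_subset_closedBall hw₀) hz]
    group

end Flat

/-! ### Cancelling pairs of letters -/

section Product

variable {G : Type*} [Group G]

/-- The change of a step function over an interval is the product of its jumps. -/
lemma IsStepOn.eq_mul_prod {I M : Set ℝ} {g P : ℝ → G} (hP : IsStepOn I M g P) (l : List ℝ) :
    ∀ a b : ℝ, a ≤ b → Icc a b ⊆ I → a ∉ M → b ∉ M → l.SortedLT →
      (∀ x, x ∈ l ↔ x ∈ M ∧ x ∈ Ioo a b) → P b = P a * (l.map g).prod := by
  induction l with
  | nil =>
    intro a b hab hI ha hb _ hl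
    have := hP.eq_of_disjoint hab hI fun m hm hmI => ?_
    · simp [this]
    rcases eq_or_lt_of_le hmI.1 with rfl | h1
    · exact ha hm
    rcases eq_or_lt_of_le hmI.2 with rfl | h2
    · exact hb hm
    exact absurd ((hl m).2 ⟨hm, h1, h2⟩) (by simp)
  | cons m l ih =>
    intro a b hab hI ha hb hsort hl
    have hm := (hl m).1 (by simp)
    have hlt : ∀ x ∈ l, m < x := (List.pairwise_cons.1 hsort.pairwise).1
    have hmI : m ∈ interior I := interior_mono hI (by rw [interior_Icc]; exact hm.2)
    have hpos : ∀ᶠ ε in 𝓝[>] (0 : ℝ), ε ∈ Ioo 0 (min (m - a) (b - m)) :=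
      Ioo_mem_nhdsGT (lt_min (sub_pos.2 hm.2.1) (sub_pos.2 hm.2.2))
    have hfin : (M ∩ Ioo a b).Finite :=
      (List.finite_toSet (m :: l)).subset fun x hx => (hl x).2 hx
    obtain ⟨ε, hε, hiso, hj⟩ := (hpos.and ((eventually_isolated hfin m).and
      (hP.eventually_jump hm.1 hmI))).exists
    have hε1 := (lt_min_iff.1 hε.2).1
    have hε2 := (lt_min_iff.1 hε.2).2
    have hε0 := hε.1
    have hn : ∀ x, x ∈ M → x ∈ Icc (m - ε) (m + ε) → x = m := by
      intro x hx hxI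
      by_contra hne
      rcases hiso x ⟨hx, by linarith [hxI.1], by linarith [hxI.2]⟩ hne with h | h
      · linarith [hxI.1]
      · linarith [hxI.2]
    have h1 : P a = P (m - ε) := by
      refine hP.eq_of_disjoint (by linarith) ((Icc_subset_Icc le_rfl (by linarith)).trans hI)
        fun x hx hxI => ?_
      have hxa : a < x := lt_of_le_of_ne hxI.1 fun h => ha (h ▸ hx)
      rcases List.mem_cons.1 ((hl x).2 ⟨hx, hxa, by linarith [hxI.2]⟩) with rfl | h
      · linarith [hxI.2]
      · linarith [hlt x h, hxI.2]
    have h2 := ih (m + ε) b (by linarith) ((Icc_subset_Icc (by linarith) le_rfl).trans hI)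
      (fun h => by linarith [hn _ h ⟨by linarith, by linarith⟩]) hb
      (List.pairwise_cons.1 hsort.pairwise).2.sortedLT fun x => ?_
    · rw [h2, hj, ← h1, List.map_cons, List.prod_cons, mul_assoc]
    · constructor
      · intro hx
        have hx' := (hl x).1 (List.mem_cons_of_mem _ hx)
        refine ⟨hx'.1, ?_, hx'.2.2⟩
        by_contra hle
        have := hlt x hx
        linarith [hn x hx'.1 ⟨by linarith, by linarith⟩]
      · rintro ⟨hxM, hx⟩
        rcases List.mem_cons.1 ((hl x).2 ⟨hxM, by linarith [hx.1], hx.2⟩) with rfl | h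
        · linarith [hx.1]
        · exact h

lemma IsStepOn.eq_mul_prod_sort {I : Set ℝ} {M : Finset ℝ} {g P : ℝ → G} (hP : IsStepOn I M g P)
    {a b : ℝ} (hab : a ≤ b) (hI : Icc a b ⊆ I) (hM : ∀ m ∈ M, m ∈ Ioo a b) :
    P b = P a * ((M.sort (· ≤ ·)).map g).prod := by
  refine hP.eq_mul_prod _ a b hab hI (fun h => (hM a h).1.false) (fun h => (hM b h).2.false)
    M.sortedLT_sort fun x => ?_
  rw [Finset.mem_sort, Finset.mem_coe]
  exact ⟨fun h => ⟨h, hM x h⟩, fun h => h.1⟩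

end Product

section Pairing

variable {ι : Type*}

lemma FreeGroup_prod_map_mk {α : Type*} (l : List α) (f : α → ι × Bool) :
    (l.map fun x => FreeGroup.mk [f x]).prod = FreeGroup.mk (l.map f) := by
  induction l with
  | nil => rfl
  | cons x l ih => rw [List.map_cons, List.prod_cons, ih, FreeGroup.mul_mk]; rfl

lemma exists_cancelling_pair {α : Type*} {f : α → ι × Bool} {l : List α} (hl : l ≠ [])
    (h : FreeGroup.mk (l.map f) = 1) : ∃ l₁ x y l₂, l = l₁ ++ x :: y :: l₂ ∧
      f y = ((f x).1, !(f x).2) := by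
  classical
  have hred : ¬ FreeGroup.IsReduced (l.map f) := by
    intro hred
    have h1 := hred.reduce_eq
    have h2 : FreeGroup.reduce (l.map f) = FreeGroup.reduce [] :=
      FreeGroup.reduce.sound (h.trans FreeGroup.one_eq_mk)
    rw [h1] at h2
    simp at h2
    exact hl h2
  rw [FreeGroup.IsReduced, List.isChain_map, List.isChain_iff_forall_rel_of_append_cons_cons]
    at hred
  push Not at hred
  obtain ⟨x, y, l₁, l₂, he, h1, h2⟩ := hred
  refine ⟨l₁, x, y, l₂, he, Prod.ext h1.symm ?_⟩
  change (f y).2 = !(f x).2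
  revert h2
  generalize (f x).2 = b
  generalize (f y).2 = b'
  revert b b'
  decide

/-- The letters of a word that is trivial in the free group cancel in pairs without crossings. -/
lemma exists_isNoncrossing_of_mk_eq_one (f : ℝ → ι × Bool) (n : ℕ) : ∀ l : List ℝ,
    l.length ≤ n → l.SortedLT → FreeGroup.mk (l.map f) = 1 →
    ∃ σ, IsNoncrossing {t | t ∈ l} σ ∧ ∀ t ∈ l, f (σ t) = ((f t).1, !(f t).2) := by
  induction n with
  | zero =>
    intro l hl _ _
    obtain rfl : l = [] := List.length_eq_zero_iff.1 (Nat.le_zero.1 hl)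
    exact ⟨id, ⟨by simp, by simp, by simp, by simp⟩, by simp⟩
  | succ n ih =>
    intro l hn hsort h
    by_cases hl : l = []
    · subst hl
      exact ⟨id, ⟨by simp, by simp, by simp, by simp⟩, by simp⟩
    obtain ⟨l₁, x, y, l₂, rfl, hxy⟩ := exists_cancelling_pair hl h
    have hp := hsort.pairwise
    rw [List.pairwise_append] at hp
    obtain ⟨p1, p2, p3⟩ := hp
    rw [List.pairwise_cons, List.pairwise_cons] at p2
    obtain ⟨q1, q2, q3⟩ := p2
    have hlt : x < y := q1 y (by simp)
    have h1 : ∀ t ∈ l₁, t < x := fun t ht => p3 t ht x (by simp)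
    have h2 : ∀ t ∈ l₂, y < t := q2
    have hsort' : (l₁ ++ l₂).SortedLT := by
      refine List.Pairwise.sortedLT (List.pairwise_append.2 ⟨p1, q3, fun a ha b hb => ?_⟩)
      exact p3 a ha b (by simp [hb])
    have hmk : FreeGroup.mk ((l₁ ++ l₂).map f) = 1 := by
      rw [← h]
      simp only [List.map_append, List.map_cons, hxy]
      exact (Quot.sound (FreeGroup.Red.Step.not (L₁ := l₁.map f) (L₂ := l₂.map f)
        (x := (f x).1) (b := (f x).2))).symm
    obtain ⟨σ, hσ, hf⟩ := ih (l₁ ++ l₂) (by simp at hn ⊢; omega) hsort' hmk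
    have hout : ∀ t, t ∈ l₁ ++ l₂ → t < x ∨ y < t := by
      intro t ht
      rcases List.mem_append.1 ht with h | h
      exacts [Or.inl (h1 t h), Or.inr (h2 t h)]
    have hmem : ∀ t, t ∈ l₁ ++ x :: y :: l₂ ↔ t = x ∨ t = y ∨ t ∈ l₁ ++ l₂ := by
      intro t
      simp only [List.mem_append, List.mem_cons]
      tauto
    let τ : ℝ → ℝ := fun t => if t = x then y else if t = y then x else σ t
    have τx : τ x = y := if_pos rfl
    have τy : τ y = x := by simp [τ, hlt.ne']
    have τo : ∀ t, t ∈ l₁ ++ l₂ → τ t = σ t := by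
      intro t ht
      have n1 : t ≠ x := by rintro rfl; rcases hout t ht with h | h <;> linarith
      have n2 : t ≠ y := by rintro rfl; rcases hout t ht with h | h <;> linarith
      simp [τ, n1, n2]
    refine ⟨τ, ⟨?_, ?_, ?_, ?_⟩, ?_⟩
    · intro t ht
      rw [mem_ofPred_eq, hmem] at ht ⊢
      rcases ht with rfl | rfl | ht
      · exact Or.inr (Or.inl τx)
      · exact Or.inl τy
      · rw [τo t ht]
        exact Or.inr (Or.inr (hσ.mem t ht))
    · intro t ht
      rw [mem_ofPred_eq, hmem] at ht
      rcases ht with rfl | rfl | ht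
      · rw [τx, τy]
      · rw [τy, τx]
      · rw [τo t ht, τo _ (hσ.mem t ht), hσ.invol t ht]
    · intro t ht
      rw [mem_ofPred_eq, hmem] at ht
      rcases ht with rfl | rfl | ht
      · rw [τx]; exact hlt.ne'
      · rw [τy]; exact hlt.ne
      · rw [τo t ht]; exact hσ.ne t ht
    · intro t ht u hu htu hut
      rw [mem_ofPred_eq, hmem] at ht hu
      rcases ht with rfl | rfl | ht
      · rw [τx] at hut
        rcases hu with rfl | rfl | hu
        · exact absurd htu (lt_irrefl _)
        · exact absurd hut (lt_irrefl _)
        · rcases hout u hu with h | h <;> linarith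
      · rw [τy] at hut
        linarith
      · rw [τo t ht] at hut ⊢
        have hσt := hout _ (hσ.mem t ht)
        have ht' := hout t ht
        rcases hu with rfl | rfl | hu
        · rw [τx]
          refine ⟨htu.trans hlt, ?_⟩
          rcases hσt with h | h <;> linarith
        · rw [τy]
          refine ⟨?_, hlt.trans hut⟩
          rcases ht' with h | h <;> linarith
        · rw [τo u hu]
          exact hσ.cross t ht u hu htu hut
    · intro t ht
      rw [hmem] at ht
      rcases ht with rfl | rfl | ht
      · rw [τx, hxy]
      · rw [τy, hxy]; simp
      · rw [τo t ht, hf t ht]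

/-- A word spelled out at increasing real numbers. -/
lemma exists_spelling [Nonempty ι] (a : FreeGroup ι) : ∃ (M : Finset ℝ) (f : ℝ → ι × Bool),
    (∀ m ∈ M, m ∈ Ico (0 : ℝ) (1 / 2)) ∧
      a = ((M.sort (· ≤ ·)).map fun c => FreeGroup.mk [f c]).prod := by
  classical
  have : Inhabited (ι × Bool) := ⟨(Classical.arbitrary ι, true)⟩
  let pos : ℕ → ℝ := fun k => 1 / 2 - 1 / ((k : ℝ) + 2)
  have hpos : StrictMono pos := by
    intro k l hkl
    have h1 : (k : ℝ) < l := by exact_mod_cast hkl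
    have h2 : (0 : ℝ) < (k : ℝ) + 2 := by positivity
    have := one_div_lt_one_div_of_lt h2 (by linarith : (k : ℝ) + 2 < l + 2)
    simp only [pos]
    linarith
  have hI : ∀ k, pos k ∈ Ico (0 : ℝ) (1 / 2) := by
    intro k
    have h2 : (0 : ℝ) < (k : ℝ) + 2 := by positivity
    have h3 : 1 / ((k : ℝ) + 2) ≤ 1 / 2 :=
      one_div_le_one_div_of_le (by norm_num) (by linarith [k.cast_nonneg (α := ℝ)])
    have h4 : 0 < 1 / ((k : ℝ) + 2) := by positivity
    exact ⟨by simp only [pos]; linarith, by simp only [pos]; linarith⟩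
  set w := a.toWord
  refine ⟨((List.range w.length).map pos).toFinset,
    fun c => w.getD (Function.invFun pos c) default, ?_, ?_⟩
  · intro m hm
    simp only [List.mem_toFinset, List.mem_map] at hm
    obtain ⟨k, -, rfl⟩ := hm
    exact hI k
  · have hsort : ((List.range w.length).map pos).SortedLT := by
      refine List.Pairwise.sortedLT ?_
      rw [List.pairwise_map]
      exact List.pairwise_lt_range.imp fun h => hpos h
    have hle : ((List.range w.length).map pos).Pairwise (· ≤ ·) :=
      hsort.pairwise.imp fun h => le_of_lt h
    rw [(List.toFinset_sort (· ≤ ·) (hsort.pairwise.imp fun h => ne_of_lt h)).2 hle,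
      FreeGroup_prod_map_mk, List.map_map]
    have hinv : ∀ k, Function.invFun pos (pos k) = k :=
      Function.leftInverse_invFun hpos.injective
    have : (List.range w.length).map ((fun c => w.getD (Function.invFun pos c) default) ∘ pos) =
        w := by
      refine List.ext_getElem (by simp) fun k h1 h2 => ?_
      simp [hinv, h2]
    rw [this]
    exact FreeGroup.mk_toWord.symm

end Pairing

section Marking

variable {X : Type*} [TopologicalSpace X] [CWComplex (univ : Set X)] [T2Space X] {ι : Type*}

/-- Marks `M e` on the 1-cells, and generators or their inverses assigned to them, that spell out the
values of `F` on the 1-cells. -/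
structure IsMarking (F : PathHom X (FreeGroup ι)) (M : Cell X 1 → Finset ℝ)
    (f : Cell X 1 → ℝ → ι × Bool) : Prop where
  mem : ∀ e, ∀ m ∈ M e, m ∈ Ico (0 : ℝ) (1 / 2)
  seg_eq : ∀ e, F.seg (edgePt e) (-1) 1 =
    (((M e).sort (· ≤ ·)).map fun c => FreeGroup.mk [f e c]).prod

lemma exists_isMarking [Nonempty ι] (F : PathHom X (FreeGroup ι)) :
    ∃ M f, IsMarking F M f := by
  choose M f h1 h2 using fun e => exists_spelling (F.seg (edgePt e) (-1) 1)
  exact ⟨M, f, h1, h2⟩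

/-- The exponent of a letter. -/
def letterSign (x : ι × Bool) : ℝ := if x.2 then 1 else -1

variable {F : PathHom X (FreeGroup ι)} {M : Cell X 1 → Finset ℝ} {f : Cell X 1 → ℝ → ι × Bool}
  {d : Cell X 2}

lemma IsMarking.word_eq_one (h : IsMarking F M f) (B : BoundaryPath d)
    {η : Cell X 1 → ℝ → FreeGroup ι}
    (hη : ∀ e, IsStepOn univ (M e) (fun c => FreeGroup.mk [f e c]) (η e))
    (hη1 : ∀ e c, c < 0 → η e c = 1) : B.word η B.length = 1 := by
  have h1 : ∀ e, η e 1 = F.seg (edgePt e) (-1) 1 := by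
    intro e
    rw [(hη e).eq_mul_prod_sort (a := -1) (b := 1) (by norm_num) (subset_univ _) fun m hm =>
      ⟨by linarith [(h.mem e m hm).1], by linarith [(h.mem e m hm).2]⟩, hη1 e _ (by norm_num),
      one_mul, h.seg_eq]
  rw [BoundaryPath.word_congr (η' := fun e c => F.seg (edgePt e) (-1) c) (fun e => by
    rw [hη1 e _ (by norm_num), F.seg_self]) h1]
  rcases Nat.eq_zero_or_pos B.length with hL | hL
  · rw [hL]
    rfl
  have h0 : (0 : ℝ) ∈ Icc 0 (B.length : ℝ) := ⟨le_rfl, Nat.cast_nonneg _⟩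
  have hl : (B.length : ℝ) ∈ Icc 0 (B.length : ℝ) := ⟨Nat.cast_nonneg _, le_rfl⟩
  have hF : ∀ e, ∀ c ∈ Icc (-1 : ℝ) 1, ∀ c' ∈ Icc (-1 : ℝ) 1, F.seg (edgePt e) c c' =
      (F.seg (edgePt e) (-1) c)⁻¹ * F.seg (edgePt e) (-1) c' := by
    intro e c hc c' hc'
    rw [← F.seg_trans (convex_Icc (-1 : ℝ) 1) (edgePt_continuousOn e)
      (left_mem_Icc.2 (by norm_num)) hc hc', inv_mul_cancel_left]
  have h2 := BoundaryPath.seg_param_eq (B := B) F hF h0 hl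
  rw [F.seg_comp (convex_closedBall 0 1) (chi_continuousOn 2 d) (convex_Icc (0 : ℝ) B.length)
    B.continuousOn_param (fun t ht => sphere_subset_closedBall
      (BoundaryPath.param_mem_sphere hL ht)) h0 hl, B.param_closed, F.seg_self,
    BoundaryPath.pot_zero, BoundaryPath.pot_natCast le_rfl] at h2
  simpa using h2.symm

/-- Along the boundary of each 2-cell, the marks cancel in pairs without crossings. -/
lemma IsMarking.exists_isNoncrossing (h : IsMarking F M f) (B : BoundaryPath d) :
    ∃ σ, IsNoncrossing (B.marks fun e => (M e : Set ℝ)) σ ∧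
      ∀ s ∈ B.marks (fun e => (M e : Set ℝ)), ∀ k k' : Fin B.length, s ∈ Ioo (k : ℝ) (k + 1) →
        σ s ∈ Ioo (k' : ℝ) (k' + 1) →
        (f (B.edge k') (B.coord k' (σ s))).1 = (f (B.edge k) (B.coord k s)).1 ∧
        letterSign (f (B.edge k') (B.coord k' (σ s))) * B.sign k' =
          -(letterSign (f (B.edge k) (B.coord k s)) * B.sign k) := by
  classical
  choose η hη hη1 using fun e => exists_isStepOn (M e) (fun c => FreeGroup.mk [f e c])
  have hη0 : ∀ e c, c < 0 → η e c = 1 := fun e c hc =>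
    hη1 e c fun m hm => hc.le.trans (h.mem e m hm).1
  have hstep := BoundaryPath.isStepOn_pot (B := B) hη (δ := 1 / 2) (by norm_num)
    (fun e c hc => hη0 e c (by linarith)) fun e c hc => by
      rcases le_total c 1 with h1 | h1
      · exact (hη e).eq_of_disjoint h1 (subset_univ _) fun m hm hm' => by
          linarith [(h.mem e m hm).2, hm'.1]
      · exact ((hη e).eq_of_disjoint h1 (subset_univ _) fun m hm hm' => by
          linarith [(h.mem e m hm).2, hm'.1]).symm
  have hfin : (B.marks fun e => (M e : Set ℝ)).Finite :=
    BoundaryPath.marks_finite fun e => (M e).finite_toSet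
  by_cases hne : (B.marks fun e => (M e : Set ℝ)).Nonempty
  swap
  · rw [not_nonempty_iff_eq_empty] at hne
    rw [hne]
    exact ⟨id, ⟨by simp, by simp, by simp, by simp⟩, by simp⟩
  obtain ⟨s₀, k₀, -⟩ := hne
  -- the letter that the boundary path contributes at the time `s`
  let ℓ : ℝ → ι × Bool := fun s => if hs : ∃ k : Fin B.length, s ∈ Ioo (k : ℝ) (k + 1) then
    (if B.sign hs.choose = 1 then f (B.edge hs.choose) (B.coord hs.choose s)
      else ((f (B.edge hs.choose) (B.coord hs.choose s)).1,
        !(f (B.edge hs.choose) (B.coord hs.choose s)).2)) else f (B.edge k₀) 0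
  have hℓ : ∀ s, ∀ k : Fin B.length, s ∈ Ioo (k : ℝ) (k + 1) → ℓ s = if B.sign k = 1 then
      f (B.edge k) (B.coord k s) else ((f (B.edge k) (B.coord k s)).1,
        !(f (B.edge k) (B.coord k s)).2) := by
    intro s k hk
    have hs : ∃ k : Fin B.length, s ∈ Ioo (k : ℝ) (k + 1) := ⟨k, hk⟩
    have hk' : hs.choose = k := BoundaryPath.index_unique hs.choose_spec hk
    simp only [ℓ, dif_pos hs, hk']
  have hletter : ∀ s ∈ hfin.toFinset.sort (· ≤ ·),
      B.letter (fun e c => FreeGroup.mk [f e c]) s = FreeGroup.mk [ℓ s] := by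
    intro s hs
    rw [Finset.mem_sort, Set.Finite.mem_toFinset] at hs
    obtain ⟨k, hk, -⟩ := hs
    rw [BoundaryPath.letter_eq hk, hℓ s k hk]
    split_ifs
    · rfl
    · rw [FreeGroup.inv_mk]
      rfl
  have hprod := IsStepOn.eq_mul_prod_sort (M := hfin.toFinset)
    (by rw [Set.Finite.coe_toFinset]; exact hstep) (a := 0) (b := B.length) (Nat.cast_nonneg _)
    subset_rfl fun m hm => BoundaryPath.marks_subset ((Set.Finite.mem_toFinset _).1 hm)
  rw [BoundaryPath.pot_natCast le_rfl, h.word_eq_one B hη hη0, BoundaryPath.pot_zero, one_mul,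
    List.map_congr_left hletter, FreeGroup_prod_map_mk] at hprod
  obtain ⟨σ, hσ, hf⟩ := exists_isNoncrossing_of_mk_eq_one ℓ _ _ le_rfl
    (Finset.sortedLT_sort _) hprod.symm
  have hset : {t | t ∈ hfin.toFinset.sort (· ≤ ·)} = B.marks fun e => (M e : Set ℝ) := by
    ext t
    simp
  rw [hset] at hσ
  refine ⟨σ, hσ, fun s hs k k' hk hk' => ?_⟩
  have h1 := hf s (by rw [Finset.mem_sort, Set.Finite.mem_toFinset]; exact hs)
  rw [hℓ s k hk, hℓ (σ s) k' hk'] at h1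
  generalize f (B.edge k') (B.coord k' (σ s)) = x' at h1 ⊢
  generalize f (B.edge k) (B.coord k s) = x at h1 ⊢
  obtain ⟨i, b⟩ := x
  obtain ⟨i', b'⟩ := x'
  rcases BoundaryPath.sign_eq (B := B) k with hs1 | hs1 <;>
    rcases BoundaryPath.sign_eq (B := B) k' with hs2 | hs2 <;>
    rw [hs1, hs2] at h1 ⊢ <;> norm_num [Prod.ext_iff] at h1 <;> obtain ⟨rfl, h2⟩ := h1 <;>
    refine ⟨rfl, ?_⟩ <;> cases b <;> cases b' <;> simp [letterSign] at h2 ⊢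

end Marking

/-! ### Arcs in a disc with prescribed ends -/

section Pairs

variable {T : Set ℝ} {σ : ℝ → ℝ}

/-- Two pairs of real numbers, with `s < t` and `u < v`, are disjoint and do not interleave. -/
def Unlinked (s t u v : ℝ) : Prop := t < u ∨ v < s ∨ (s < u ∧ v < t) ∨ (u < s ∧ t < v)

lemma IsNoncrossing.unlinked (h : IsNoncrossing T σ) {t u : ℝ} (ht : t ∈ T) (hu : u ∈ T)
    (htσ : t < σ t) (huσ : u < σ u) (hne : u ≠ t) : Unlinked t (σ t) u (σ u) := by
  have n1 : σ u ≠ t := fun he => by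
    have := h.invol u hu
    rw [he] at this
    linarith
  have n2 : u ≠ σ t := fun he => by
    have := h.invol t ht
    rw [← he] at this
    linarith
  have n3 : σ u ≠ σ t := fun he => hne (by rw [← h.invol u hu, he, h.invol t ht])
  rcases lt_or_gt_of_ne hne with h1 | h1
  · rcases lt_or_gt_of_ne n1 with h2 | h2
    · exact Or.inr (Or.inl h2)
    · exact Or.inr (Or.inr (Or.inr ⟨h1, (h.cross u hu t ht h1 h2).2⟩))
  · rcases lt_or_gt_of_ne n2 with h2 | h2
    · exact Or.inr (Or.inr (Or.inl ⟨h1, (h.cross t ht u hu h1 h2).2⟩))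
    · exact Or.inl h2

/-- The pairs obtained from a pair of `σ` by moving both ends slightly inwards or outwards are not
linked with the pairs of `σ`. -/
lemma IsNoncrossing.eventually_unlinked (h : IsNoncrossing T σ) (hT : T.Finite) {t : ℝ} (ht : t ∈ T)
    (htσ : t < σ t) : ∀ᶠ ε in 𝓝[>] (0 : ℝ), t + ε < σ t - ε ∧ t + ε ∉ T ∧ ∀ u ∈ T, u < σ u →
      Unlinked (t + ε) (σ t - ε) u (σ u) ∧ Unlinked (t - ε) (σ t + ε) u (σ u) := by
  have hpos : ∀ᶠ ε in 𝓝[>] (0 : ℝ), ε ∈ Ioo 0 ((σ t - t) / 2) :=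
    Ioo_mem_nhdsGT (by linarith)
  filter_upwards [hpos, eventually_isolated hT t, eventually_isolated hT (σ t)] with ε hε i1 i2
  have hε0 := hε.1
  have hε1 := hε.2
  refine ⟨by linarith, fun hT' => ?_, fun u hu huσ => ?_⟩
  · rcases i1 _ hT' (by linarith) with h | h <;> linarith
  by_cases hne : u = t
  · subst hne
    exact ⟨Or.inr (Or.inr (Or.inr ⟨by linarith, by linarith⟩)),
      Or.inr (Or.inr (Or.inl ⟨by linarith, by linarith⟩))⟩
  have n1 : σ u ≠ t := fun he => by
    have := h.invol u hu
    rw [he] at this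
    linarith
  have n2 : u ≠ σ t := fun he => by
    have := h.invol t ht
    rw [← he] at this
    linarith
  have n3 : σ u ≠ σ t := fun he => hne (by rw [← h.invol u hu, he, h.invol t ht])
  have a1 := i1 u hu hne
  have a2 := i1 _ (h.mem u hu) n1
  have a3 := i2 u hu n2
  have a4 := i2 _ (h.mem u hu) n3
  rcases h.unlinked ht hu htσ huσ hne with h1 | h1 | ⟨h1, h2⟩ | ⟨h1, h2⟩
  · have : σ t + ε < u := by rcases a3 with h | h <;> linarith
    exact ⟨Or.inl (by linarith), Or.inl (by linarith)⟩
  · have : σ u < t - ε := by rcases a2 with h | h <;> linarith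
    exact ⟨Or.inr (Or.inl (by linarith)), Or.inr (Or.inl (by linarith))⟩
  · have b1 : t + ε < u := by rcases a1 with h | h <;> linarith
    have b2 : σ u < σ t - ε := by rcases a4 with h | h <;> linarith
    exact ⟨Or.inr (Or.inr (Or.inl ⟨by linarith, by linarith⟩)),
      Or.inr (Or.inr (Or.inl ⟨by linarith, by linarith⟩))⟩
  · have b1 : u < t - ε := by rcases a1 with h | h <;> linarith
    have b2 : σ t + ε < σ u := by rcases a4 with h | h <;> linarith
    exact ⟨Or.inr (Or.inr (Or.inr ⟨by linarith, by linarith⟩)),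
      Or.inr (Or.inr (Or.inr ⟨by linarith, by linarith⟩))⟩

end Pairs

section Tents

variable {X : Type*} [TopologicalSpace X] [CWComplex (univ : Set X)] {d : Cell X 2}

/-- Polar coordinates on the disc: the point at depth `y` below the point `B.param x` of the
boundary circle, on the radius through it.  The centre is at depth `B.length`. -/
def BoundaryPath.polar (B : BoundaryPath d) (x y : ℝ) : Fin 2 → ℝ :=
  (1 - y / B.length) • B.param (projIcc 0 (B.length : ℝ) (Nat.cast_nonneg _) x)

/-- The depth at `x` of the tent over the interval from `s` to `t`. -/
def tent (s t x : ℝ) : ℝ := min (x - s) (t - x)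

lemma continuous_tent (s t : ℝ) : Continuous (tent s t) := by unfold tent; fun_prop

lemma tent_nonneg {s t x : ℝ} (hx : x ∈ Icc s t) : 0 ≤ tent s t x :=
  le_min (by linarith [hx.1]) (by linarith [hx.2])

lemma Unlinked.tent_ne {s t u v x : ℝ} (h : Unlinked s t u v) (hx : x ∈ Icc s t)
    (hx' : x ∈ Icc u v) : tent s t x ≠ tent u v x := by
  have h1 := hx.1
  have h2 := hx.2
  have h3 := hx'.1
  have h4 := hx'.2
  rcases h with h | h | ⟨h, h'⟩ | ⟨h, h'⟩
  · linarith
  · linarith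
  · exact (min_lt_min (by linarith) (by linarith)).ne'
  · exact (min_lt_min (by linarith) (by linarith)).ne

namespace BoundaryPath

variable {B : BoundaryPath d}

lemma polar_eq {x : ℝ} (hx : x ∈ Icc 0 (B.length : ℝ)) (y : ℝ) :
    B.polar x y = (1 - y / B.length) • B.param x := by
  rw [polar, projIcc_of_mem _ hx]

lemma polar_zero {x : ℝ} (hx : x ∈ Icc 0 (B.length : ℝ)) : B.polar x 0 = B.param x := by
  simp [polar_eq hx]

lemma polar_length (hL : 0 < B.length) (x : ℝ) : B.polar x B.length = 0 := by
  have : (B.length : ℝ) ≠ 0 := by positivity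
  simp [polar, div_self this]

variable (B) in
lemma continuous_polar : Continuous fun q : ℝ × ℝ => B.polar q.1 q.2 := by
  have h : Continuous fun x : ℝ => B.param (projIcc 0 (B.length : ℝ) (Nat.cast_nonneg _) x) :=
    B.continuousOn_param.comp_continuous (continuous_subtype_val.comp continuous_projIcc)
      fun x => (projIcc 0 (B.length : ℝ) (Nat.cast_nonneg _) x).2
  unfold polar
  exact ((continuous_const.sub (continuous_snd.div_const _))).smul (h.comp continuous_fst)

lemma norm_polar (hL : 0 < B.length) {x y : ℝ} (hx : x ∈ Icc 0 (B.length : ℝ))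
    (hy : y ≤ B.length) : ‖B.polar x y‖ = 1 - y / B.length := by
  have hL' : (0 : ℝ) < B.length := by positivity
  have h1 : 0 ≤ 1 - y / B.length := sub_nonneg.2 ((div_le_one hL').2 hy)
  rw [polar_eq hx, norm_smul, mem_sphere_zero_iff_norm.1 (param_mem_sphere hL hx), mul_one,
    Real.norm_of_nonneg h1]

lemma polar_mem_closedBall (hL : 0 < B.length) {x y : ℝ} (hx : x ∈ Icc 0 (B.length : ℝ))
    (hy : y ∈ Icc 0 (B.length : ℝ)) : B.polar x y ∈ closedBall (0 : Fin 2 → ℝ) 1 := by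
  rw [mem_closedBall_zero_iff, norm_polar hL hx hy.2]
  linarith [div_nonneg hy.1 hy.1, div_nonneg hy.1 (Nat.cast_nonneg (α := ℝ) B.length)]

lemma exists_polar_eq (hL : 0 < B.length) {z : Fin 2 → ℝ} (hz : z ∈ closedBall (0 : Fin 2 → ℝ) 1) :
    ∃ x ∈ Ico 0 (B.length : ℝ), ∃ y ∈ Icc 0 (B.length : ℝ), B.polar x y = z := by
  have hL' : (0 : ℝ) < B.length := by positivity
  by_cases h0 : z = 0
  · exact ⟨0, ⟨le_rfl, hL'⟩, B.length, ⟨hL'.le, le_rfl⟩, by rw [polar_length hL, h0]⟩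
  · obtain ⟨x, hx, hxz⟩ := exists_param_eq (B := B) hL (normalize_mem_sphere h0)
    rw [mem_closedBall_zero_iff] at hz
    refine ⟨x, hx, B.length * (1 - ‖z‖), ⟨mul_nonneg hL'.le (by linarith), ?_⟩, ?_⟩
    · nlinarith [norm_nonneg z]
    · rw [polar_eq (Ico_subset_Icc_self hx), hxz, mul_div_cancel_left₀ _ hL'.ne', sub_sub_cancel,
        smul_smul, mul_inv_cancel₀ (norm_ne_zero_iff.2 h0), one_smul]

lemma polar_injective (hL : 0 < B.length) {x y x' y' : ℝ} (hx : x ∈ Ioo 0 (B.length : ℝ))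
    (hx' : x' ∈ Icc 0 (B.length : ℝ)) (hy : y < B.length) (hy' : y' ≤ B.length)
    (h : B.polar x y = B.polar x' y') : x = x' ∧ y = y' := by
  have hL' : (0 : ℝ) < B.length := by positivity
  have hn := congrArg norm h
  rw [norm_polar hL (Ioo_subset_Icc_self hx) hy.le, norm_polar hL hx' hy'] at hn
  have hyy : y = y' := by
    have : y / B.length = y' / B.length := by linarith
    field_simp at this
    exact this
  subst hyy
  refine ⟨?_, rfl⟩
  rw [polar_eq (Ioo_subset_Icc_self hx), polar_eq hx'] at h
  have h1 : 1 - y / B.length ≠ 0 := (sub_pos.2 ((div_lt_one hL').2 hy)).ne'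
  rcases param_eq_param hL (Ioo_subset_Icc_self hx) hx' (smul_right_injective _ h1 h) with h | h | h
  · exact h
  · exact absurd h.1 hx.1.ne'
  · exact absurd h.1 hx.2.ne

variable (B) in
/-- The arc in the disc that joins the points `B.param s` and `B.param t` of the boundary circle. -/
def tentArc (s t : ℝ) : Set (Fin 2 → ℝ) := (fun x => B.polar x (tent s t x)) '' Icc s t

variable (B) in
/-- The closed region of the disc cut off by `tentArc s t`. -/
def tentRegion (s t : ℝ) : Set (Fin 2 → ℝ) :=
  (fun q : ℝ × ℝ => B.polar q.1 q.2) '' {q | q.1 ∈ Icc s t ∧ 0 ≤ q.2 ∧ q.2 ≤ tent s t q.1}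

lemma isPreconnected_tentArc (s t : ℝ) : IsPreconnected (B.tentArc s t) :=
  isPreconnected_Icc.image _
    ((B.continuous_polar.comp (continuous_id.prodMk (continuous_tent s t))).continuousOn)

variable {s t : ℝ}

lemma tent_lt (hs : 0 < s) (ht : t < B.length) {x : ℝ} (hx : x ∈ Icc s t) :
    tent s t x < B.length :=
  (min_le_left _ _).trans_lt (by linarith [hx.2])

lemma mem_Ioo_of_mem_Icc (hs : 0 < s) (ht : t < B.length) {x : ℝ} (hx : x ∈ Icc s t) :
    x ∈ Ioo 0 (B.length : ℝ) := ⟨hs.trans_le hx.1, hx.2.trans_lt ht⟩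

lemma polar_mem_tentArc_iff (hL : 0 < B.length) (hs : 0 < s) (ht : t < B.length) {x y : ℝ}
    (hx : x ∈ Icc 0 (B.length : ℝ)) (hy : y ≤ B.length) :
    B.polar x y ∈ B.tentArc s t ↔ x ∈ Icc s t ∧ y = tent s t x := by
  constructor
  · rintro ⟨x', hx', h⟩
    obtain ⟨rfl, h2⟩ := polar_injective hL (mem_Ioo_of_mem_Icc hs ht hx') hx
      (tent_lt hs ht hx') hy h
    exact ⟨hx', h2.symm⟩
  · rintro ⟨h, rfl⟩
    exact ⟨x, h, rfl⟩

lemma tentArc_subset_closedBall (hL : 0 < B.length) (hs : 0 < s) (ht : t < B.length) :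
    B.tentArc s t ⊆ closedBall 0 1 := by
  rintro _ ⟨x, hx, rfl⟩
  exact polar_mem_closedBall hL (Ioo_subset_Icc_self (mem_Ioo_of_mem_Icc hs ht hx))
    ⟨tent_nonneg hx, (tent_lt hs ht hx).le⟩

lemma left_mem_tentArc (hst : s ≤ t) (hs : 0 < s) (ht : t < B.length) :
    B.param s ∈ B.tentArc s t := by
  refine ⟨s, left_mem_Icc.2 hst, ?_⟩
  have : tent s t s = 0 := by simp [tent, hst]
  simp only [this]
  exact polar_zero ⟨hs.le, hst.trans ht.le⟩

lemma right_mem_tentArc (hst : s ≤ t) (hs : 0 < s) (ht : t < B.length) :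
    B.param t ∈ B.tentArc s t := by
  refine ⟨t, right_mem_Icc.2 hst, ?_⟩
  have : tent s t t = 0 := by simp [tent, hst]
  simp only [this]
  exact polar_zero ⟨hs.le.trans hst, ht.le⟩

lemma param_mem_tentArc_iff (hL : 0 < B.length) (hst : s ≤ t) (hs : 0 < s) (ht : t < B.length)
    {r : ℝ} (hr : r ∈ Icc 0 (B.length : ℝ)) : B.param r ∈ B.tentArc s t ↔ r = s ∨ r = t := by
  constructor
  · rw [← polar_zero hr, polar_mem_tentArc_iff hL hs ht hr (Nat.cast_nonneg _)]
    rintro ⟨h1, h2⟩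
    rcases min_choice (r - s) (t - r) with h | h
    · rw [tent, h] at h2
      exact Or.inl (by linarith)
    · rw [tent, h] at h2
      exact Or.inr (by linarith)
  · rintro (rfl | rfl)
    exacts [left_mem_tentArc hst hs ht, right_mem_tentArc hst hs ht]

lemma disjoint_tentArc (hL : 0 < B.length) (hs : 0 < s) (ht : t < B.length) {u v : ℝ} (hu : 0 < u)
    (hv : v < B.length) (h : Unlinked s t u v) : Disjoint (B.tentArc s t) (B.tentArc u v) := by
  rw [Set.disjoint_left]
  rintro _ ⟨x, hx, rfl⟩ hx'
  obtain ⟨h1, h2⟩ := (polar_mem_tentArc_iff hL hu hv (Ioo_subset_Icc_self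
    (mem_Ioo_of_mem_Icc hs ht hx)) (tent_lt hs ht hx).le).1 hx'
  exact h.tent_ne hx h1 h2

/-- An arc separates the region that it cuts off from the rest of the disc. -/
lemma subset_tentRegion (hL : 0 < B.length) (hst : s ≤ t) (hs : 0 < s) (ht : t < B.length)
    {S : Set (Fin 2 → ℝ)} (hS : IsPreconnected S) (hSD : S ⊆ closedBall 0 1 \ B.tentArc s t)
    {z : Fin 2 → ℝ} (hz : z ∈ S) (hzR : z ∈ B.tentRegion s t) : S ⊆ B.tentRegion s t := by
  have hcl1 : IsClosed (B.tentRegion s t) := by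
    refine (IsCompact.image (f := fun q : ℝ × ℝ => B.polar q.1 q.2) ?_ B.continuous_polar).isClosed
    refine (isCompact_Icc.prod isCompact_Icc : IsCompact (Icc s t ×ˢ Icc 0 (B.length : ℝ)))
      |>.of_isClosed_subset ?_ ?_
    · refine (isClosed_Icc.preimage continuous_fst).inter
        ((isClosed_le continuous_const continuous_snd).inter (isClosed_le continuous_snd ?_))
      exact (continuous_tent s t).comp continuous_fst
    · rintro ⟨x, y⟩ ⟨hx, hy, hy'⟩
      exact ⟨hx, hy, hy'.trans (tent_lt hs ht hx).le⟩
  set R' : Set (Fin 2 → ℝ) := (fun q : ℝ × ℝ => B.polar q.1 q.2) ''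
    ((Icc 0 (B.length : ℝ) ×ˢ Icc 0 (B.length : ℝ)) ∩
      {q | q.1 ≤ s ∨ t ≤ q.1 ∨ tent s t q.1 ≤ q.2})
  have hcl2 : IsClosed R' := by
    refine (IsCompact.image (f := fun q : ℝ × ℝ => B.polar q.1 q.2) ?_ B.continuous_polar).isClosed
    refine (isCompact_Icc.prod isCompact_Icc).inter_right ?_
    exact (isClosed_le continuous_fst continuous_const).union
      ((isClosed_le continuous_const continuous_fst).union
        (isClosed_le ((continuous_tent s t).comp continuous_fst) continuous_snd))
  have hcover : S ⊆ B.tentRegion s t ∪ R' := by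
    intro w hw
    obtain ⟨x, hx, y, hy, rfl⟩ := exists_polar_eq (B := B) hL (hSD hw).1
    by_cases h : x ≤ s ∨ t ≤ x ∨ tent s t x ≤ y
    · exact Or.inr ⟨(x, y), ⟨⟨Ico_subset_Icc_self hx, hy⟩, h⟩, rfl⟩
    · push Not at h
      exact Or.inl ⟨(x, y), ⟨⟨h.1.le, h.2.1.le⟩, hy.1, h.2.2.le⟩, rfl⟩
  have hinter : B.tentRegion s t ∩ R' ⊆ B.tentArc s t := by
    rintro _ ⟨⟨⟨x, y⟩, ⟨hx, hy, hy'⟩, rfl⟩, ⟨⟨x', y'⟩, ⟨⟨hx1, hy1⟩, h⟩, he⟩⟩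
    have := polar_injective hL (mem_Ioo_of_mem_Icc hs ht hx) hx1
      (hy'.trans_lt (tent_lt hs ht hx)) hy1.2 he.symm
    simp only at hx hy hy' hx1 hy1 h this
    obtain ⟨rfl, rfl⟩ := this
    refine ⟨x, hx, ?_⟩
    have : tent s t x = y := by
      rcases h with h | h | h
      · have : x = s := le_antisymm h hx.1
        subst this
        have : tent x t x = 0 := by simp [tent, hst]
        linarith
      · have : x = t := le_antisymm hx.2 h
        subst this
        have : tent s x x = 0 := by simp [tent, hst]
        linarith
      · linarith
    simp only [this]
  rcases isPreconnected_iff_subset_of_disjoint_closed.1 hS _ _ hcl1 hcl2 hcover (by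
    rw [← not_nonempty_iff_eq_empty]
    rintro ⟨w, hw, hw'⟩
    exact (hSD hw).2 (hinter hw')) with h | h
  · exact h
  · exact absurd (hinter ⟨hzR, h hz⟩) (hSD hz).2

lemma param_mem_tentRegion_iff (hL : 0 < B.length) (hs : 0 < s) (ht : t < B.length) {r : ℝ}
    (hr : r ∈ Icc 0 (B.length : ℝ)) : B.param r ∈ B.tentRegion s t ↔ r ∈ Icc s t := by
  constructor
  · rintro ⟨⟨x, y⟩, ⟨hx, hy, hy'⟩, h⟩
    simp only at hx hy hy' h
    rw [← polar_zero hr] at h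
    have := polar_injective hL (mem_Ioo_of_mem_Icc hs ht hx) hr
      (hy'.trans_lt (tent_lt hs ht hx)) (Nat.cast_nonneg _) h
    exact this.1 ▸ hx
  · intro h
    exact ⟨(r, 0), ⟨h, le_rfl, tent_nonneg h⟩, polar_zero hr⟩

/-- The complement of an arc has two components, and the component of a point of the boundary circle
is determined by whether the point lies between the ends of the arc. -/
lemma param_mem_connectedComponentIn_iff (hL : 0 < B.length) (hst : s ≤ t) (hs : 0 < s)
    (ht : t < B.length) {r r' : ℝ} (hr : r ∈ Icc 0 (B.length : ℝ)) (hr' : r' ∈ Icc 0 (B.length : ℝ))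
    (hrs : r ≠ s) (hrt : r ≠ t) (hrs' : r' ≠ s) (hrt' : r' ≠ t) :
    B.param r ∈ connectedComponentIn (closedBall 0 1 \ B.tentArc s t) (B.param r') ↔
      (r ∈ Ioo s t ↔ r' ∈ Ioo s t) := by
  have hmem : ∀ u ∈ Icc 0 (B.length : ℝ), u ≠ s → u ≠ t →
      B.param u ∈ closedBall 0 1 \ B.tentArc s t := by
    intro u hu h1 h2
    refine ⟨sphere_subset_closedBall (param_mem_sphere hL hu), fun h => ?_⟩
    rcases (param_mem_tentArc_iff hL hst hs ht hu).1 h with h | h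
    exacts [h1 h, h2 h]
  have hIoo : ∀ u, u ≠ s → u ≠ t → (u ∈ Ioo s t ↔ u ∈ Icc s t) := fun u h1 h2 =>
    ⟨fun h => Ioo_subset_Icc_self h, fun h =>
      ⟨lt_of_le_of_ne h.1 h1.symm, lt_of_le_of_ne h.2 h2⟩⟩
  constructor
  · intro h
    have hsub := connectedComponentIn_subset (closedBall 0 1 \ B.tentArc s t) (B.param r')
    have hself := mem_connectedComponentIn (hmem r' hr' hrs' hrt')
    rw [hIoo r hrs hrt, hIoo r' hrs' hrt', ← param_mem_tentRegion_iff hL hs ht hr,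
      ← param_mem_tentRegion_iff hL hs ht hr']
    exact ⟨fun h1 => subset_tentRegion hL hst hs ht isPreconnected_connectedComponentIn hsub h h1
      hself, fun h1 => subset_tentRegion hL hst hs ht isPreconnected_connectedComponentIn hsub hself
      h1 h⟩
  · intro h
    have hconn : ∀ S : Set (Fin 2 → ℝ), IsPreconnected S → S ⊆ closedBall 0 1 \ B.tentArc s t →
        B.param r ∈ S → B.param r' ∈ S →
        B.param r ∈ connectedComponentIn (closedBall 0 1 \ B.tentArc s t) (B.param r') :=
      fun S hS hSD h1 h2 => hS.subset_connectedComponentIn h2 hSD h1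
    by_cases hin : r ∈ Ioo s t
    · refine hconn (B.param '' Ioo s t) (isPreconnected_Ioo.image _ (B.continuousOn_param.mono
        fun u hu => ⟨(hs.trans hu.1).le, (hu.2.trans ht).le⟩)) ?_ ⟨r, hin, rfl⟩ ⟨r', h.1 hin, rfl⟩
      rintro _ ⟨u, hu, rfl⟩
      exact hmem u ⟨(hs.trans hu.1).le, (hu.2.trans ht).le⟩ hu.1.ne' hu.2.ne
    · have hin' : r' ∉ Ioo s t := fun h' => hin (h.2 h')
      have hside : ∀ u ∈ Icc 0 (B.length : ℝ), u ≠ s → u ≠ t → u ∉ Ioo s t →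
          u ∈ Ico 0 s ∨ u ∈ Ioc t (B.length : ℝ) := by
        intro u hu h1 h2 h3
        rcases lt_or_gt_of_ne h1 with h | h
        · exact Or.inl ⟨hu.1, h⟩
        rcases lt_or_gt_of_ne h2 with h' | h'
        · exact absurd ⟨h, h'⟩ h3
        · exact Or.inr ⟨h', hu.2⟩
      have hpre : IsPreconnected (B.param '' Ico 0 s ∪ B.param '' Ioc t (B.length : ℝ)) := by
        refine IsPreconnected.union (B.param 0) ⟨0, ⟨le_rfl, hs⟩, rfl⟩
          ⟨B.length, ⟨ht, le_rfl⟩, B.param_closed⟩ ?_ ?_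
        · exact isPreconnected_Ico.image _ (B.continuousOn_param.mono
            fun u hu => ⟨hu.1, (hu.2.trans_le (hst.trans ht.le)).le⟩)
        · exact isPreconnected_Ioc.image _ (B.continuousOn_param.mono
            fun u hu => ⟨((hs.trans_le hst).trans hu.1).le, hu.2⟩)
      refine hconn _ hpre ?_ ?_ ?_
      · rintro _ (⟨u, hu, rfl⟩ | ⟨u, hu, rfl⟩)
        · exact hmem u ⟨hu.1, (hu.2.trans_le (hst.trans ht.le)).le⟩ hu.2.ne
            (hu.2.trans_le hst).ne
        · exact hmem u ⟨((hs.trans_le hst).trans hu.1).le, hu.2⟩ (hst.trans_lt hu.1).ne' hu.1.ne'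
      · exact (hside r hr hrs hrt hin).imp (fun h => ⟨r, h, rfl⟩) fun h => ⟨r, h, rfl⟩
      · exact (hside r' hr' hrs' hrt' hin').imp (fun h => ⟨r', h, rfl⟩) fun h => ⟨r', h, rfl⟩

variable (B) in
/-- The union of the arcs joining the points of `T` that are paired by `σ`. -/
def tents (T : Set ℝ) (σ : ℝ → ℝ) : Set (Fin 2 → ℝ) :=
  ⋃ t ∈ {t | t ∈ T ∧ t < σ t}, B.tentArc t (σ t)

variable {T : Set ℝ} {σ : ℝ → ℝ}

lemma mem_tents_iff {z : Fin 2 → ℝ} :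
    z ∈ B.tents T σ ↔ ∃ t ∈ T, t < σ t ∧ z ∈ B.tentArc t (σ t) := by
  simp [tents, and_assoc]

/-- The two ends of an arc, moved slightly to the same side, can be joined off the arcs. -/
lemma eventually_parallel (hL : 0 < B.length) (hT : T.Finite) (hTI : T ⊆ Ioo 0 (B.length : ℝ))
    (hσ : IsNoncrossing T σ) {t : ℝ} (ht : t ∈ T) (htσ : t < σ t) :
    ∀ᶠ ε in 𝓝[>] (0 : ℝ), t + ε ∉ T ∧ Disjoint (B.tentArc (t + ε) (σ t - ε)) (B.tents T σ) ∧
      Disjoint (B.tentArc (t - ε) (σ t + ε)) (B.tents T σ) := by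
  have ht0 := (hTI ht).1
  have htL := (hTI (hσ.mem t ht)).2
  have hpos : ∀ᶠ ε in 𝓝[>] (0 : ℝ), ε ∈ Ioo 0 (min t (B.length - σ t)) :=
    Ioo_mem_nhdsGT (lt_min ht0 (by linarith))
  filter_upwards [hpos, hσ.eventually_unlinked hT ht htσ] with ε hε h
  have hε0 := hε.1
  have hε1 := lt_min_iff.1 hε.2
  refine ⟨h.2.1, ?_, ?_⟩
  · rw [Set.disjoint_right]
    intro z hz
    obtain ⟨u, hu, huσ, hzu⟩ := mem_tents_iff.1 hz
    exact Set.disjoint_right.1 (disjoint_tentArc hL (by linarith) (by linarith) (hTI hu).1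
      (hTI (hσ.mem u hu)).2 (h.2.2 u hu huσ).1) hzu
  · rw [Set.disjoint_right]
    intro z hz
    obtain ⟨u, hu, huσ, hzu⟩ := mem_tents_iff.1 hz
    exact Set.disjoint_right.1 (disjoint_tentArc hL (by linarith) (by linarith) (hTI hu).1
      (hTI (hσ.mem u hu)).2 (h.2.2 u hu huσ).2) hzu

/-- Every point of the disc off the arcs can be joined, off the arcs, to a point of the boundary
circle: by a segment to the centre and a radius, or by a segment towards the innermost arc around it
and then parallel to that arc. -/
lemma exists_joined_param (hL : 0 < B.length) (hT : T.Finite) (hTI : T ⊆ Ioo 0 (B.length : ℝ))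
    (hσ : IsNoncrossing T σ) {z : Fin 2 → ℝ} (hz : z ∈ closedBall (0 : Fin 2 → ℝ) 1)
    (hzA : z ∉ B.tents T σ) : ∃ r ∈ Icc 0 (B.length : ℝ), r ∉ T ∧ ∃ S : Set (Fin 2 → ℝ),
      IsPreconnected S ∧ S ⊆ closedBall 0 1 \ B.tents T σ ∧ z ∈ S ∧ B.param r ∈ S := by
  obtain ⟨x, hx, y, hy, rfl⟩ := exists_polar_eq (B := B) hL hz
  replace hx := Ico_subset_Icc_self hx
  have hL0 : (0 : ℝ) ≤ B.length := Nat.cast_nonneg _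
  have hvert : ∀ x a b : ℝ, IsPreconnected (B.polar x '' Icc a b) := fun x a b =>
    isPreconnected_Icc.image _
      (B.continuous_polar.comp (continuous_const.prodMk continuous_id)).continuousOn
  have hoff : ∀ u ∈ T, u < σ u → x ∈ Icc u (σ u) → y ≠ tent u (σ u) x := by
    intro u hu huσ hxu h
    exact hzA (mem_tents_iff.2 ⟨u, hu, huσ, (polar_mem_tentArc_iff hL (hTI hu).1
      (hTI (hσ.mem u hu)).2 hx hy.2).2 ⟨hxu, h⟩⟩)
  have hfin : {t | t ∈ T ∧ t < σ t ∧ x ∈ Icc t (σ t) ∧ y < tent t (σ t) x}.Finite :=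
    hT.subset fun t ht => ht.1
  rcases {t | t ∈ T ∧ t < σ t ∧ x ∈ Icc t (σ t) ∧ y < tent t (σ t) x}.eq_empty_or_nonempty with
    hempty | hne
  · refine ⟨0, ⟨le_rfl, hL0⟩, fun h => (hTI h).1.false,
      B.polar x '' Icc y B.length ∪ B.polar 0 '' Icc 0 B.length, ?_, ?_,
      Or.inl ⟨y, ⟨le_rfl, hy.2⟩, rfl⟩, Or.inr ⟨0, ⟨le_rfl, hL0⟩, polar_zero ⟨le_rfl, hL0⟩⟩⟩
    · exact IsPreconnected.union 0 ⟨B.length, ⟨hy.2, le_rfl⟩, polar_length hL x⟩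
        ⟨B.length, ⟨hL0, le_rfl⟩, polar_length hL 0⟩ (hvert _ _ _) (hvert _ _ _)
    · rintro _ (⟨y', hy', rfl⟩ | ⟨y', hy', rfl⟩)
      · refine ⟨polar_mem_closedBall hL hx ⟨hy.1.trans hy'.1, hy'.2⟩, fun h => ?_⟩
        obtain ⟨u, hu, huσ, hz'⟩ := mem_tents_iff.1 h
        obtain ⟨h1, h2⟩ := (polar_mem_tentArc_iff hL (hTI hu).1 (hTI (hσ.mem u hu)).2 hx hy'.2).1 hz'
        exact eq_empty_iff_forall_notMem.1 hempty u ⟨hu, huσ, h1,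
          lt_of_le_of_ne (h2 ▸ hy'.1) (hoff u hu huσ h1)⟩
      · refine ⟨polar_mem_closedBall hL ⟨le_rfl, hL0⟩ hy', fun h => ?_⟩
        obtain ⟨u, hu, huσ, hz'⟩ := mem_tents_iff.1 h
        obtain ⟨h1, -⟩ := (polar_mem_tentArc_iff hL (hTI hu).1 (hTI (hσ.mem u hu)).2
          ⟨le_rfl, hL0⟩ hy'.2).1 hz'
        linarith [h1.1, (hTI hu).1]
  · obtain ⟨t, ⟨ht, htσ, hxt, hyt⟩, hmin⟩ := hfin.exists_minimalFor (fun t => tent t (σ t) x) _ hne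
    have hpos : ∀ᶠ ε in 𝓝[>] (0 : ℝ), ε ∈ Ioo 0 (tent t (σ t) x - y) :=
      Ioo_mem_nhdsGT (by linarith)
    obtain ⟨ε, hε, hεT, hdis, -⟩ := (hpos.and (eventually_parallel hL hT hTI hσ ht htσ)).exists
    have hε0 := hε.1
    have hε1 := hε.2
    have htent : tent (t + ε) (σ t - ε) x = tent t (σ t) x - ε := by
      rw [tent, tent, ← min_sub_sub_right]
      congr 1 <;> ring
    have hl : tent t (σ t) x ≤ x - t := min_le_left _ _
    have hr : tent t (σ t) x ≤ σ t - x := min_le_right _ _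
    have ht0 := (hTI ht).1
    have htL := (hTI (hσ.mem t ht)).2
    have hy0 := hy.1
    refine ⟨t + ε, ⟨by linarith, by linarith⟩, hεT,
      B.polar x '' Icc y (tent t (σ t) x - ε) ∪ B.tentArc (t + ε) (σ t - ε), ?_, ?_,
      Or.inl ⟨y, ⟨le_rfl, by linarith⟩, rfl⟩,
      Or.inr (left_mem_tentArc (by linarith) (by linarith) (by linarith))⟩
    · refine IsPreconnected.union (B.polar x (tent t (σ t) x - ε)) ⟨_, ⟨by linarith, le_rfl⟩, rfl⟩
        ⟨x, ⟨by linarith, by linarith⟩, by simp only [htent]⟩ (hvert _ _ _)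
        (isPreconnected_tentArc _ _)
    · rintro w (⟨y', hy', rfl⟩ | hw)
      · have hy'L : y' ≤ B.length := by linarith [hy'.2]
        refine ⟨polar_mem_closedBall hL hx ⟨hy.1.trans hy'.1, hy'L⟩, fun h => ?_⟩
        obtain ⟨u, hu, huσ, hz'⟩ := mem_tents_iff.1 h
        obtain ⟨h1, h2⟩ := (polar_mem_tentArc_iff hL (hTI hu).1 (hTI (hσ.mem u hu)).2 hx hy'L).1 hz'
        have hlt : tent u (σ u) x < tent t (σ t) x := by linarith [hy'.2]
        have hle := hmin (j := u) ⟨hu, huσ, h1, lt_of_le_of_ne (h2 ▸ hy'.1) (hoff u hu huσ h1)⟩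
          hlt.le
        exact absurd hle (not_le.2 hlt)
      · exact ⟨tentArc_subset_closedBall hL (by linarith) (by linarith) hw,
          Set.disjoint_left.1 hdis hw⟩

end BoundaryPath

end Tents

/-! ### Systems of chords and the cocycles they form -/

section TentPath

variable {X : Type*} [TopologicalSpace X] [CWComplex (univ : Set X)] {d : Cell X 2}

variable (B : BoundaryPath d) in
/-- The parametrization of `B.tentArc s t` by the unit interval. -/
def BoundaryPath.tentPath (s t : ℝ) : C(unitInterval, Fin 2 → ℝ) where
  toFun u := B.polar (AffineMap.lineMap s t (u : ℝ)) (tent s t (AffineMap.lineMap s t (u : ℝ)))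
  continuous_toFun := by
    have h : Continuous fun u : unitInterval => (AffineMap.lineMap s t (u : ℝ) : ℝ) := by fun_prop
    exact B.continuous_polar.comp (h.prodMk ((continuous_tent s t).comp h))

variable {B : BoundaryPath d} {s t : ℝ}

namespace BoundaryPath

lemma lineMap_mem_Icc (hst : s ≤ t) (u : unitInterval) :
    (AffineMap.lineMap s t (u : ℝ) : ℝ) ∈ Icc s t := by
  rw [← segment_eq_Icc hst, segment_eq_image_lineMap]
  exact ⟨u, u.2, rfl⟩

lemma range_tentPath (hst : s ≤ t) : range (B.tentPath s t) = B.tentArc s t := by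
  ext z
  constructor
  · rintro ⟨u, rfl⟩
    exact ⟨_, lineMap_mem_Icc hst u, rfl⟩
  · rintro ⟨x, hx, rfl⟩
    rw [← segment_eq_Icc hst, segment_eq_image_lineMap] at hx
    obtain ⟨u, hu, rfl⟩ := hx
    exact ⟨⟨u, hu⟩, rfl⟩

lemma tentPath_injective (hL : 0 < B.length) (hst : s < t) (hs : 0 < s) (ht : t < B.length) :
    Function.Injective (B.tentPath s t) := by
  intro u u' h
  have h1 := lineMap_mem_Icc hst.le u
  have h2 := lineMap_mem_Icc hst.le u'
  have := (polar_injective hL (mem_Ioo_of_mem_Icc hs ht h1)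
    (Ioo_subset_Icc_self (mem_Ioo_of_mem_Icc hs ht h2)) (tent_lt hs ht h1) (tent_lt hs ht h2).le h).1
  exact Subtype.ext (AffineMap.lineMap_injective ℝ hst.ne this)

lemma tentPath_zero (hst : s ≤ t) (hs : 0 < s) (ht : t < B.length) :
    B.tentPath s t 0 = B.param s := by
  have h : tent s t s = 0 := by simp [tent, hst]
  change B.polar _ _ = _
  simp only [Icc.coe_zero, AffineMap.lineMap_apply_zero, h]
  exact polar_zero ⟨hs.le, hst.trans ht.le⟩

lemma tentPath_one (hst : s ≤ t) (hs : 0 < s) (ht : t < B.length) :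
    B.tentPath s t 1 = B.param t := by
  have h : tent s t t = 0 := by simp [tent, hst]
  change B.polar _ _ = _
  simp only [Icc.coe_one, AffineMap.lineMap_apply_one, h]
  exact polar_zero ⟨hs.le.trans hst, ht.le⟩

lemma tentPath_mem_sphere_iff (hL : 0 < B.length) (hst : s < t) (hs : 0 < s) (ht : t < B.length)
    (u : unitInterval) : B.tentPath s t u ∈ sphere (0 : Fin 2 → ℝ) 1 ↔ u = 0 ∨ u = 1 := by
  constructor
  · intro h
    obtain ⟨r, hr, hru⟩ := exists_param_eq (B := B) hL h
    have hmem : B.param r ∈ B.tentArc s t := by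
      rw [hru, ← range_tentPath hst.le]
      exact ⟨u, rfl⟩
    have hinj := tentPath_injective hL hst hs ht
    rcases (param_mem_tentArc_iff hL hst.le hs ht (Ico_subset_Icc_self hr)).1 hmem with rfl | rfl
    · exact Or.inl (hinj (hru.symm.trans (tentPath_zero hst.le hs ht).symm))
    · exact Or.inr (hinj (hru.symm.trans (tentPath_one hst.le hs ht).symm))
  · rintro (rfl | rfl)
    · rw [tentPath_zero hst.le hs ht]
      exact param_mem_sphere hL ⟨hs.le, (hst.trans ht).le⟩
    · rw [tentPath_one hst.le hs ht]
      exact param_mem_sphere hL ⟨(hs.trans hst).le, ht.le⟩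

end BoundaryPath

end TentPath

section ChordSystem

variable {X : Type*} [TopologicalSpace X] [CWComplex (univ : Set X)] [T2Space X]

/-- The sign with which the boundary path `B`, at the time `s`, crosses the point through which it
passes in the direction given by `dir`. -/
def BoundaryPath.turn {d : Cell X 2} (B : BoundaryPath d) (dir : X → ℤˣ) (s : ℝ) : ℝ :=
  open Classical in
  if h : ∃ k : Fin B.length, s ∈ Ioo (k : ℝ) (k + 1) then
    ((dir (chi 2 d (B.param s)) : ℤ) : ℝ) * B.sign h.choose else 1

lemma BoundaryPath.turn_eq {d : Cell X 2} {B : BoundaryPath d} {dir : X → ℤˣ} {s : ℝ}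
    {k : Fin B.length} (hk : s ∈ Ioo (k : ℝ) (k + 1)) :
    B.turn dir s = ((dir (chi 2 d (B.param s)) : ℤ) : ℝ) * B.sign k := by
  have h : ∃ k : Fin B.length, s ∈ Ioo (k : ℝ) (k + 1) := ⟨k, hk⟩
  have hc : h.choose = k := BoundaryPath.index_unique h.choose_spec hk
  rw [turn, dif_pos h, hc]

lemma BoundaryPath.turn_eq_one_or {d : Cell X 2} (B : BoundaryPath d) (dir : X → ℤˣ) (s : ℝ) :
    B.turn dir s = 1 ∨ B.turn dir s = -1 := by
  by_cases h : ∃ k : Fin B.length, s ∈ Ioo (k : ℝ) (k + 1)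
  · obtain ⟨k, hk⟩ := h
    rw [turn_eq hk]
    rcases Int.units_eq_one_or (dir (chi 2 d (B.param s))) with h1 | h1 <;>
      rcases sign_eq (B := B) k with h2 | h2 <;> rw [h1, h2] <;> norm_num
  · exact Or.inl (by rw [turn, dif_neg h])

/-- Finitely many points on the open 1-cells with transverse directions there, and for each 2-cell a
pairing without crossings of the times at which its boundary path passes these points, such that
paired times have opposite turns. -/
structure ChordSystem (K : FiniteTwoComplex X) where
  marks : Cell X 1 → Finset ℝ
  marks_mem : ∀ e, ∀ m ∈ marks e, m ∈ Ioo (-1 : ℝ) 1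
  dir : X → ℤˣ
  mate : Cell X 2 → ℝ → ℝ
  isNoncrossing : ∀ d, IsNoncrossing ((K.boundary d).marks fun e => (marks e : Set ℝ)) (mate d)
  turn_mate : ∀ d, ∀ s ∈ (K.boundary d).marks fun e => (marks e : Set ℝ),
    (K.boundary d).turn dir (mate d s) = -(K.boundary d).turn dir s

namespace ChordSystem

variable {K : FiniteTwoComplex X} (Q : ChordSystem K)

/-- The times at which the boundary path of `d` passes a marked point. -/
def times (d : Cell X 2) : Set ℝ := (K.boundary d).marks fun e => (Q.marks e : Set ℝ)

/-- The marked points. -/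
def points : Set X := {x | ∃ e, ∃ c ∈ Q.marks e, x = edgePt e c}

/-- The point through which the boundary path of `d` passes at the time `s`. -/
def bdPt (K : FiniteTwoComplex X) (d : Cell X 2) (s : ℝ) : X := chi 2 d ((K.boundary d).param s)

/-- A set of marked points that with one end of a chord contains the other. -/
structure IsSaturated (P : Set X) : Prop where
  subset : P ⊆ Q.points
  mate : ∀ d, ∀ s ∈ Q.times d, bdPt K d s ∈ P → bdPt K d (Q.mate d s) ∈ P

/-- The times at which the boundary path of `d` passes a point of `P`. -/
def timesIn (P : Set X) (d : Cell X 2) : Set ℝ := {s | s ∈ Q.times d ∧ bdPt K d s ∈ P}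

/-- The arcs in the disc of the 2-cell `d` whose ends lie over `P`. -/
def arcs (P : Set X) (d : Cell X 2) : Set (Fin 2 → ℝ) :=
  (K.boundary d).tents (Q.timesIn P d) (Q.mate d)

/-- The graph with vertex set `P` formed by the chords with ends in `P`. -/
def graph (P : Set X) : Set X := P ∪ ⋃ d, chi 2 d '' Q.arcs P d

variable {Q} {P : Set X} {d : Cell X 2}

lemma times_subset : Q.times d ⊆ Ioo 0 ((K.boundary d).length : ℝ) := BoundaryPath.marks_subset

lemma finite_times (d : Cell X 2) : (Q.times d).Finite :=
  BoundaryPath.marks_finite fun e => (Q.marks e).finite_toSet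

lemma length_pos {s : ℝ} (hs : s ∈ Q.times d) : 0 < (K.boundary d).length := by
  have := (times_subset hs).1.trans (times_subset hs).2
  exact_mod_cast this

lemma edgePt_mem_points_iff {e : Cell X 1} {c : ℝ} (hc : c ∈ Ioo (-1 : ℝ) 1) :
    edgePt e c ∈ Q.points ↔ c ∈ Q.marks e := by
  constructor
  · rintro ⟨e', c', hc', h⟩
    obtain ⟨rfl, rfl⟩ := edgePt_injective hc (Q.marks_mem e' c' hc') h
    exact hc'
  · exact fun h => ⟨e, c, h, rfl⟩

lemma points_subset_oneSkel : Q.points ⊆ oneSkel X := by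
  rintro _ ⟨e, c, hc, rfl⟩
  exact edgePt_mem_oneSkel e (Ioo_subset_Icc_self (Q.marks_mem e c hc))

lemma vert_notMem_points (v : Cell X 0) : vert v ∉ Q.points := by
  rintro ⟨e, c, hc, h⟩
  exact vert_ne_edgePt (Q.marks_mem e c hc) h

lemma bdPt_mem_points {s : ℝ} (hs : s ∈ Q.times d) : bdPt K d s ∈ Q.points := by
  obtain ⟨k, hk, hm⟩ := hs
  rw [bdPt, BoundaryPath.disc_param_eq k (Ioo_subset_Icc_self hk)]
  exact ⟨_, _, hm, rfl⟩

lemma mem_times_iff {s : ℝ} (hL : 0 < (K.boundary d).length)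
    (hs : s ∈ Icc 0 ((K.boundary d).length : ℝ)) : s ∈ Q.times d ↔ bdPt K d s ∈ Q.points := by
  refine ⟨bdPt_mem_points, fun h => ?_⟩
  rcases BoundaryPath.exists_nat_or_mem_Ioo hs with ⟨j, hj, rfl⟩ | ⟨k, hk⟩
  · obtain ⟨v, hv⟩ := BoundaryPath.exists_vert_eq_param (B := K.boundary d) hL hj
    rw [bdPt, hv] at h
    exact absurd h (vert_notMem_points v)
  · refine ⟨k, hk, ?_⟩
    rw [bdPt, BoundaryPath.disc_param_eq k (Ioo_subset_Icc_self hk)] at h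
    exact (edgePt_mem_points_iff (BoundaryPath.coord_mem_Ioo k hk)).1 h

lemma exists_time (hP : P ⊆ Q.points) {z : Fin 2 → ℝ} (hz : z ∈ sphere (0 : Fin 2 → ℝ) 1)
    (h : chi 2 d z ∈ P) : ∃ s ∈ Q.timesIn P d, (K.boundary d).param s = z := by
  rcases Nat.eq_zero_or_pos (K.boundary d).length with hL | hL
  · obtain ⟨v, hv⟩ := (K.boundary d).constant hL
    have h1 := hv hz
    rw [closedCell_zero, mem_singleton_iff] at h1
    have h2 : chi 2 d z = vert v := h1
    rw [h2] at h
    exact absurd (hP h) (vert_notMem_points v)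
  · obtain ⟨s, hs, rfl⟩ := BoundaryPath.exists_param_eq (B := K.boundary d) hL hz
    exact ⟨s, ⟨(mem_times_iff hL (Ico_subset_Icc_self hs)).2 (hP h), h⟩, rfl⟩

lemma IsSaturated.isNoncrossing (hP : Q.IsSaturated P) (d : Cell X 2) :
    IsNoncrossing (Q.timesIn P d) (Q.mate d) where
  mem t ht := ⟨(Q.isNoncrossing d).mem t ht.1, hP.mate d t ht.1 ht.2⟩
  invol t ht := (Q.isNoncrossing d).invol t ht.1
  ne t ht := (Q.isNoncrossing d).ne t ht.1
  cross t ht u hu := (Q.isNoncrossing d).cross t ht.1 u hu.1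

lemma timesIn_subset : Q.timesIn P d ⊆ Ioo 0 ((K.boundary d).length : ℝ) := fun _ hs =>
  times_subset hs.1

lemma finite_timesIn (P : Set X) (d : Cell X 2) : (Q.timesIn P d).Finite :=
  (finite_times d).subset fun _ hs => hs.1

/-- The arcs are properly embedded: they meet the boundary circle in the points over `P`. -/
lemma IsSaturated.mem_arcs_iff_of_mem_sphere (hP : Q.IsSaturated P) {z : Fin 2 → ℝ}
    (hz : z ∈ sphere (0 : Fin 2 → ℝ) 1) : z ∈ Q.arcs P d ↔ chi 2 d z ∈ P := by
  have hN := hP.isNoncrossing d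
  constructor
  · intro h
    obtain ⟨t, ht, htσ, hzt⟩ := BoundaryPath.mem_tents_iff.1 h
    have hL := length_pos ht.1
    obtain ⟨s, hs, rfl⟩ := BoundaryPath.exists_param_eq (B := K.boundary d) hL hz
    rcases (BoundaryPath.param_mem_tentArc_iff hL htσ.le (timesIn_subset ht).1
      (timesIn_subset (hN.mem t ht)).2 (Ico_subset_Icc_self hs)).1 hzt with rfl | rfl
    · exact ht.2
    · exact (hN.mem t ht).2
  · intro h
    obtain ⟨s, hs, rfl⟩ := exists_time hP.subset hz h
    have hσs := hN.mem s hs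
    rcases lt_or_gt_of_ne (hN.ne s hs) with hlt | hlt
    · refine BoundaryPath.mem_tents_iff.2 ⟨_, hσs, by rwa [hN.invol s hs], ?_⟩
      rw [hN.invol s hs]
      exact BoundaryPath.right_mem_tentArc hlt.le (timesIn_subset hσs).1 (timesIn_subset hs).2
    · exact BoundaryPath.mem_tents_iff.2 ⟨s, hs, hlt,
        BoundaryPath.left_mem_tentArc hlt.le (timesIn_subset hs).1 (timesIn_subset hσs).2⟩

lemma IsSaturated.arcs_subset_closedBall (hP : Q.IsSaturated P) (d : Cell X 2) :
    Q.arcs P d ⊆ closedBall 0 1 := by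
  intro z hz
  obtain ⟨t, ht, htσ, hzt⟩ := BoundaryPath.mem_tents_iff.1 hz
  exact BoundaryPath.tentArc_subset_closedBall (length_pos ht.1) (timesIn_subset ht).1
    (timesIn_subset ((hP.isNoncrossing d).mem t ht)).2 hzt

lemma IsSaturated.mem_graph_iff_of_mem_oneSkel (hP : Q.IsSaturated P) {x : X} (hx : x ∈ oneSkel X) :
    x ∈ Q.graph P ↔ x ∈ P := by
  refine ⟨?_, Or.inl⟩
  rintro (h | h)
  · exact h
  obtain ⟨d, z, hz, rfl⟩ := mem_iUnion.1 h
  rcases ball_union_sphere_of_mem_closedBall (hP.arcs_subset_closedBall d hz) with hzb | hzs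
  · exact absurd hx (disc_notMem_oneSkel hzb)
  · exact (hP.mem_arcs_iff_of_mem_sphere hzs).1 hz

lemma IsSaturated.disc_mem_graph_iff (hP : Q.IsSaturated P) {z : Fin 2 → ℝ}
    (hz : z ∈ closedBall (0 : Fin 2 → ℝ) 1) : chi 2 d z ∈ Q.graph P ↔ z ∈ Q.arcs P d := by
  rcases ball_union_sphere_of_mem_closedBall hz with hzb | hzs
  · constructor
    · rintro (h | h)
      · exact absurd (points_subset_oneSkel (hP.subset h)) (disc_notMem_oneSkel hzb)
      obtain ⟨d', z', hz', he⟩ := mem_iUnion.1 h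
      rcases ball_union_sphere_of_mem_closedBall (hP.arcs_subset_closedBall d' hz') with hb | hs
      · obtain ⟨rfl, rfl⟩ := disc_injective hb hzb he
        exact hz'
      · have := sphere_mem_oneSkel (d := d') hs
        rw [he] at this
        exact absurd this (disc_notMem_oneSkel hzb)
    · exact fun h => Or.inr (mem_iUnion.2 ⟨d, z, h, rfl⟩)
  · rw [hP.mem_graph_iff_of_mem_oneSkel (sphere_mem_oneSkel hzs), hP.mem_arcs_iff_of_mem_sphere hzs]

lemma IsSaturated.disjoint_graph (hP : Q.IsSaturated P) {P' : Set X} (hP' : Q.IsSaturated P')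
    (h : Disjoint P P') : Disjoint (Q.graph P) (Q.graph P') := by
  rw [Set.disjoint_left]
  intro x hx hx'
  rcases K.mem_cases x with hs | ⟨d, z, hz, rfl⟩
  · exact Set.disjoint_left.1 h ((hP.mem_graph_iff_of_mem_oneSkel hs).1 hx)
      ((hP'.mem_graph_iff_of_mem_oneSkel hs).1 hx')
  · have hzc := ball_subset_closedBall hz
    obtain ⟨t, ht, htσ, hzt⟩ := BoundaryPath.mem_tents_iff.1 ((hP.disc_mem_graph_iff hzc).1 hx)
    obtain ⟨u, hu, huσ, hzu⟩ := BoundaryPath.mem_tents_iff.1 ((hP'.disc_mem_graph_iff hzc).1 hx')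
    have hne : u ≠ t := by
      rintro rfl
      exact Set.disjoint_left.1 h ht.2 hu.2
    have hun := (Q.isNoncrossing d).unlinked ht.1 hu.1 htσ huσ hne
    exact Set.disjoint_left.1 (BoundaryPath.disjoint_tentArc (length_pos ht.1)
      (timesIn_subset ht).1 (timesIn_subset ((hP.isNoncrossing d).mem t ht)).2
      (timesIn_subset hu).1 (timesIn_subset ((hP'.isNoncrossing d).mem u hu)).2 hun) hzt hzu

lemma graph_iUnion {ι : Type*} (P : ι → Set X) : Q.graph (⋃ i, P i) = ⋃ i, Q.graph (P i) := by
  have harcs : ∀ d, Q.arcs (⋃ i, P i) d = ⋃ i, Q.arcs (P i) d := by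
    intro d
    ext z
    simp only [arcs, BoundaryPath.mem_tents_iff, timesIn, mem_iUnion, mem_ofPred_eq]
    constructor
    · rintro ⟨t, ⟨ht, i, hi⟩, h⟩
      exact ⟨i, t, ⟨ht, hi⟩, h⟩
    · rintro ⟨i, t, ⟨ht, hi⟩, h⟩
      exact ⟨t, ⟨ht, i, hi⟩, h⟩
  simp only [graph, harcs, image_iUnion]
  ext x
  simp only [mem_union, mem_iUnion]
  constructor
  · rintro (⟨i, h⟩ | ⟨d, i, h⟩)
    exacts [⟨i, Or.inl h⟩, ⟨i, Or.inr ⟨d, h⟩⟩]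
  · rintro ⟨i, h | ⟨d, h⟩⟩
    exacts [Or.inl ⟨i, h⟩, Or.inr ⟨d, i, h⟩]

lemma IsSaturated.iUnion {ι : Type*} {P : ι → Set X} (h : ∀ i, Q.IsSaturated (P i)) :
    Q.IsSaturated (⋃ i, P i) where
  subset := iUnion_subset fun i => (h i).subset
  mate d s hs hsP := by
    obtain ⟨i, hi⟩ := mem_iUnion.1 hsP
    exact mem_iUnion.2 ⟨i, (h i).mate d s hs hi⟩

section Cocycle

/-- The left ends of the chords in the 2-cell `d` with ends in `P`. -/
def leftEnds (Q : ChordSystem K) (P : Set X) (d : Cell X 2) : Finset ℝ :=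
  ((finite_timesIn (Q := Q) P d).subset
    (sep_subset (Q.timesIn P d) fun t => t < Q.mate d t)).toFinset

lemma mem_leftEnds {t : ℝ} : t ∈ Q.leftEnds P d ↔ t ∈ Q.timesIn P d ∧ t < Q.mate d t := by
  simp [leftEnds]

/-- The left end of the chord of index `j`. -/
def leftEnd (Q : ChordSystem K) (P : Set X) (d : Cell X 2) (j : Fin (Q.leftEnds P d).card) : ℝ :=
  (Q.leftEnds P d).equivFin.symm j

lemma leftEnd_mem (j : Fin (Q.leftEnds P d).card) : Q.leftEnd P d j ∈ Q.timesIn P d :=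
  (mem_leftEnds.1 ((Q.leftEnds P d).equivFin.symm j).2).1

lemma leftEnd_lt (j : Fin (Q.leftEnds P d).card) :
    Q.leftEnd P d j < Q.mate d (Q.leftEnd P d j) :=
  (mem_leftEnds.1 ((Q.leftEnds P d).equivFin.symm j).2).2

lemma leftEnd_injective : Function.Injective (Q.leftEnd P d) := fun _ _ h =>
  (Q.leftEnds P d).equivFin.symm.injective (Subtype.ext h)

lemma exists_leftEnd_eq {t : ℝ} (ht : t ∈ Q.timesIn P d) (htσ : t < Q.mate d t) :
    ∃ j, Q.leftEnd P d j = t :=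
  ⟨(Q.leftEnds P d).equivFin ⟨t, mem_leftEnds.2 ⟨ht, htσ⟩⟩, by simp [leftEnd]⟩

/-- The regularly embedded graph formed by the chords with ends in `P`. -/
def regularGraph (hP : Q.IsSaturated P) (hne : P.Nonempty) : RegularGraph X where
  carrier := Q.graph P
  nonempty := hne.mono subset_union_left
  disjoint_vertex v := by
    rw [closedCell_zero, Set.disjoint_singleton_right]
    intro h
    exact vert_notMem_points v
      (hP.subset ((hP.mem_graph_iff_of_mem_oneSkel (vert_mem_oneSkel v)).1 h))
  finite_vertices e := by
    refine ((Q.marks e).finite_toSet.image (edgePt e)).subset ?_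
    rintro x ⟨hx, hxe⟩
    obtain ⟨c, hc, rfl⟩ := mem_openCell_one_iff.1 hxe
    have := (hP.mem_graph_iff_of_mem_oneSkel (edgePt_mem_oneSkel e (Ioo_subset_Icc_self hc))).1 hx
    exact ⟨c, (edgePt_mem_points_iff hc).1 (hP.subset this), rfl⟩
  numArcs d := (Q.leftEnds P d).card
  arc d j := (K.boundary d).tentPath (Q.leftEnd P d j) (Q.mate d (Q.leftEnd P d j))
  arc_injective d j := BoundaryPath.tentPath_injective (length_pos (leftEnd_mem j).1) (leftEnd_lt j)
    (timesIn_subset (leftEnd_mem j)).1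
    (timesIn_subset ((hP.isNoncrossing d).mem _ (leftEnd_mem j))).2
  arc_disjoint d j k hjk := by
    beta_reduce
    rw [BoundaryPath.range_tentPath (leftEnd_lt j).le, BoundaryPath.range_tentPath (leftEnd_lt k).le]
    have hN := hP.isNoncrossing d
    exact BoundaryPath.disjoint_tentArc (length_pos (leftEnd_mem j).1)
      (timesIn_subset (leftEnd_mem j)).1 (timesIn_subset (hN.mem _ (leftEnd_mem j))).2
      (timesIn_subset (leftEnd_mem k)).1 (timesIn_subset (hN.mem _ (leftEnd_mem k))).2
      (hN.unlinked (leftEnd_mem j) (leftEnd_mem k) (leftEnd_lt j) (leftEnd_lt k)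
        fun h => hjk (leftEnd_injective h.symm))
  arc_mem_sphere_iff d j := BoundaryPath.tentPath_mem_sphere_iff (length_pos (leftEnd_mem j).1)
    (leftEnd_lt j) (timesIn_subset (leftEnd_mem j)).1
    (timesIn_subset ((hP.isNoncrossing d).mem _ (leftEnd_mem j))).2
  preimage_eq d := by
    ext z
    rw [mem_iUnion]
    constructor
    · rintro ⟨hz, hzg⟩
      obtain ⟨t, ht, htσ, hzt⟩ := BoundaryPath.mem_tents_iff.1 ((hP.disc_mem_graph_iff hz).1 hzg)
      obtain ⟨j, rfl⟩ := exists_leftEnd_eq ht htσ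
      exact ⟨j, by rwa [BoundaryPath.range_tentPath htσ.le]⟩
    · rintro ⟨j, hz⟩
      rw [BoundaryPath.range_tentPath (leftEnd_lt j).le] at hz
      have hzA : z ∈ Q.arcs P d :=
        BoundaryPath.mem_tents_iff.2 ⟨_, leftEnd_mem j, leftEnd_lt j, hz⟩
      have hzc := hP.arcs_subset_closedBall d hzA
      exact ⟨hzc, (hP.disc_mem_graph_iff hzc).2 hzA⟩

/-- A time on the positive side of the chord of index `j`. -/
def sideTime (Q : ChordSystem K) (P : Set X) (d : Cell X 2) (j : Fin (Q.leftEnds P d).card) : ℝ :=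
  open Classical in
  if (K.boundary d).turn Q.dir (Q.leftEnd P d j) = 1 then
    (Q.leftEnd P d j + Q.mate d (Q.leftEnd P d j)) / 2 else 0

lemma sideTime_spec (hP : Q.IsSaturated P) (j : Fin (Q.leftEnds P d).card) :
    Q.sideTime P d j ∈ Icc 0 ((K.boundary d).length : ℝ) ∧
      Q.sideTime P d j ≠ Q.leftEnd P d j ∧ Q.sideTime P d j ≠ Q.mate d (Q.leftEnd P d j) ∧
      (Q.sideTime P d j ∈ Ioo (Q.leftEnd P d j) (Q.mate d (Q.leftEnd P d j)) ↔
        (K.boundary d).turn Q.dir (Q.leftEnd P d j) = 1) := by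
  have h1 := timesIn_subset (leftEnd_mem j)
  have h2 := timesIn_subset ((hP.isNoncrossing d).mem _ (leftEnd_mem j))
  have h3 := leftEnd_lt j
  rw [sideTime]
  split_ifs with h
  · exact ⟨⟨by linarith [h1.1, h2.1], by linarith [h1.2, h2.2]⟩, by linarith, by linarith,
      by simp only [h, iff_true]; exact ⟨by linarith, by linarith⟩⟩
  · refine ⟨⟨le_rfl, Nat.cast_nonneg _⟩, h1.1.ne, h2.1.ne, ?_⟩
    simp only [h, iff_false]
    exact fun h' => by linarith [h'.1, h1.1]

/-- The regular cocycle formed by the chords with ends in `P`. -/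
def regularCocycle (hP : Q.IsSaturated P) (hne : P.Nonempty) : RegularCocycle X where
  toRegularGraph := regularGraph hP hne
  posSide d j := connectedComponentIn
    (closedBall 0 1 \ range ((regularGraph hP hne).arc d j)) ((K.boundary d).param (Q.sideTime P d j))
  posSide_eq d j := by
    obtain ⟨h1, h2, h3, -⟩ := sideTime_spec hP j
    have hL := length_pos (leftEnd_mem j).1
    refine ⟨_, ⟨sphere_subset_closedBall (BoundaryPath.param_mem_sphere hL h1), fun h => ?_⟩, rfl⟩
    rw [show (regularGraph hP hne).arc d j = (K.boundary d).tentPath (Q.leftEnd P d j)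
      (Q.mate d (Q.leftEnd P d j)) from rfl, BoundaryPath.range_tentPath (leftEnd_lt j).le] at h
    rcases (BoundaryPath.param_mem_tentArc_iff hL (leftEnd_lt j).le
      (timesIn_subset (leftEnd_mem j)).1
      (timesIn_subset ((hP.isNoncrossing d).mem _ (leftEnd_mem j))).2 h1).1 h with h | h
    exacts [h2 h, h3 h]
  dir := Q.dir
  coincide d j u hu e he := by
    set t := Q.leftEnd P d j with ht_def
    have ht : t ∈ Q.timesIn P d := leftEnd_mem j
    have htσ : t < Q.mate d t := leftEnd_lt j
    have hL := length_pos ht.1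
    have hσ := (hP.isNoncrossing d).mem t ht
    have ht0 := (timesIn_subset ht).1
    have hσL := (timesIn_subset hσ).2
    obtain ⟨hr0, hr1, hr2, hr3⟩ := sideTime_spec hP j
    have harc : (regularGraph hP hne).arc d j = (K.boundary d).tentPath t (Q.mate d t) := rfl
    -- the end `s` of the chord, and the direction `w` in which the interior of the chord lies from it
    obtain ⟨s, w, hs, hus, hsw, hturn⟩ : ∃ s w : ℝ, s ∈ Q.timesIn P d ∧
        (regularGraph hP hne).arc d j u = (K.boundary d).param s ∧
        (∀ᶠ r in 𝓝 s, (r = s ∨ r ≠ t ∧ r ≠ Q.mate d t) ∧ (r ≠ s →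
          (r ∈ Ioo t (Q.mate d t) ↔ 0 < w * (r - s)))) ∧
        ((w = 1 ∧ s = t) ∨ (w = -1 ∧ s = Q.mate d t)) := by
      rcases hu with rfl | rfl
      · refine ⟨t, 1, ht, ?_, ?_, Or.inl ⟨rfl, rfl⟩⟩
        · rw [harc]
          exact BoundaryPath.tentPath_zero htσ.le ht0 hσL
        · filter_upwards [isOpen_Iio.mem_nhds htσ] with r hr
          refine ⟨?_, fun _ => ?_⟩
          · by_cases h : r = t
            exacts [Or.inl h, Or.inr ⟨h, ne_of_lt hr⟩]
          · rw [one_mul, sub_pos]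
            exact ⟨fun h => h.1, fun h => ⟨h, hr⟩⟩
      · refine ⟨Q.mate d t, -1, hσ, ?_, ?_, Or.inr ⟨rfl, rfl⟩⟩
        · rw [harc]
          exact BoundaryPath.tentPath_one htσ.le ht0 hσL
        · filter_upwards [isOpen_Ioi.mem_nhds htσ] with r hr
          refine ⟨?_, fun _ => ?_⟩
          · by_cases h : r = Q.mate d t
            exacts [Or.inl h, Or.inr ⟨ne_of_gt hr, h⟩]
          · exact ⟨fun h => by linarith [h.2], fun h => ⟨hr, by linarith⟩⟩
    rw [hus] at he ⊢
    obtain ⟨k, hk, -⟩ := hs.1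
    have hval : ∀ r ∈ Ioo (k : ℝ) (k + 1), chi 2 d ((K.boundary d).param r) =
        edgePt ((K.boundary d).edge k) ((K.boundary d).coord k r) := fun r hr =>
      BoundaryPath.disc_param_eq k (Ioo_subset_Icc_self hr)
    obtain rfl : (K.boundary d).edge k = e := by
      have h1 := hval s hk
      unfold chi at h1
      obtain ⟨c, hc, h2⟩ := mem_openCell_one_iff.1 he
      exact (edgePt_injective (BoundaryPath.coord_mem_Ioo k hk) hc (h1.symm.trans h2)).1
    have hcoord : ∀ r ∈ Ioo (k : ℝ) (k + 1), edgeCoord ((K.boundary d).edge k)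
        (chi 2 d ((K.boundary d).param r)) = (K.boundary d).coord k r := by
      intro r hr
      rw [hval r hr, edgeCoord_edgePt _ (BoundaryPath.coord_mem_Ioo k hr)]
    have hev := BoundaryPath.eventually_exists_param_of_mem_Ioo (B := K.boundary d)
      (timesIn_subset hs) (hsw.and (isOpen_Ioo.mem_nhds hk))
    filter_upwards [hev] with y hy
    obtain ⟨r, hrI, ⟨⟨hr, hrw⟩, hrk⟩, rfl⟩ := hy
    have e1 := hcoord r hrk
    have e2 := hcoord s hk
    unfold chi at e1 e2
    rw [e1, e2, harc, BoundaryPath.range_tentPath htσ.le]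
    by_cases hrs : r = s
    · subst hrs
      rw [sub_self, mul_zero]
      refine iff_of_false (fun h => ?_) (lt_irrefl _)
      refine (connectedComponentIn_subset _ _ h).2 ?_
      rw [← BoundaryPath.range_tentPath htσ.le, ← hus]
      exact ⟨u, rfl⟩
    · obtain ⟨hrt, hrσ⟩ := hr.resolve_left hrs
      rw [BoundaryPath.param_mem_connectedComponentIn_iff hL htσ.le ht0 hσL
        (Ioo_subset_Icc_self hrI) hr0 hrt hrσ hr1 hr2, hr3, hrw hrs]
      have hturn' : (K.boundary d).turn Q.dir s = w * (K.boundary d).turn Q.dir t := by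
        rcases hturn with ⟨rfl, rfl⟩ | ⟨rfl, h⟩
        · rw [one_mul]
        · rw [h, Q.turn_mate d t ht.1, neg_one_mul]
      rw [BoundaryPath.turn_eq hk] at hturn'
      have hlt := BoundaryPath.coord_lt_iff (B := K.boundary d) k (Ioo_subset_Icc_self hk)
        (Ioo_subset_Icc_self hrk)
      have hgt := BoundaryPath.coord_lt_iff (B := K.boundary d) k (Ioo_subset_Icc_self hrk)
        (Ioo_subset_Icc_self hk)
      have hw : w = 1 ∨ w = -1 := hturn.imp (fun h => h.1) fun h => h.1
      unfold chi at hturn'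
      set D := ((Q.dir (RelCWComplex.map (C := (univ : Set X)) 2 d ((K.boundary d).param s)) : ℤ) : ℝ)
      set c := (K.boundary d).coord k r
      set c' := (K.boundary d).coord k s
      have hD : 0 < D * (c - c') ↔ 0 < (w * (K.boundary d).turn Q.dir t) * (r - s) := by
        rw [← hturn']
        have hD1 : D = 1 ∨ D = -1 := by
          rcases Int.units_eq_one_or (Q.dir (RelCWComplex.map (C := (univ : Set X)) 2 d
            ((K.boundary d).param s))) with h | h <;> simp [D, h]
        rcases hD1 with h | h <;> rcases BoundaryPath.sign_eq (B := K.boundary d) k with h' | h' <;>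
          rw [h, h'] <;> rw [h'] at hlt hgt <;> constructor <;> intro h''
        · linarith [hlt.1 (by linarith)]
        · linarith [hlt.2 (by linarith)]
        · linarith [hgt.1 (by linarith)]
        · linarith [hgt.2 (by linarith)]
        · linarith [hgt.1 (by linarith)]
        · linarith [hgt.2 (by linarith)]
        · linarith [hlt.1 (by linarith)]
        · linarith [hlt.2 (by linarith)]
      rw [hD]
      rcases (K.boundary d).turn_eq_one_or Q.dir t with h | h
      · rw [h]
        simp
      · rw [h]
        have hne : w * (r - s) ≠ 0 :=
          mul_ne_zero (by rcases hw with rfl | rfl <;> norm_num) (sub_ne_zero.2 hrs)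
        have h1 : (-1 : ℝ) ≠ 1 := by norm_num
        simp only [h1, iff_false, not_lt]
        constructor
        · intro h2
          linarith [lt_of_le_of_ne h2 hne]
        · intro h2
          linarith

end Cocycle

end ChordSystem

end ChordSystem

/-! ### Graphs of chords that do not separate -/

section Step

variable {G : Type*} [Group G]

/-- A function on an interval that is constant on the subintervals without marks is a step function,
with suitable jumps. -/
lemma exists_isStepOn_of_forall_eq {I M : Set ℝ} (hI : I.OrdConnected) (hM : M.Finite) {η : ℝ → G}
    (h : ∀ a b, a ≤ b → Icc a b ⊆ I → (∀ m ∈ M, m ∉ Icc a b) → η a = η b) :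
    ∃ g, IsStepOn I M g η := by
  have hiso : ∀ m, ∃ ε > 0, (∀ t ∈ M, t ≠ m → t < m - ε ∨ m + ε < t) ∧
      (m ∈ interior I → Icc (m - ε) (m + ε) ⊆ I) := by
    intro m
    have hpos : ∀ᶠ ε in 𝓝[>] (0 : ℝ), ε ∈ Ioi 0 := self_mem_nhdsWithin
    have hint : ∀ᶠ ε in 𝓝[>] (0 : ℝ), m ∈ interior I → Icc (m - ε) (m + ε) ⊆ I := by
      by_cases hm : m ∈ interior I
      · obtain ⟨r, hr, hrI⟩ := Metric.nhds_basis_closedBall.mem_iff.1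
          (mem_interior_iff_mem_nhds.1 hm)
        filter_upwards [Ioo_mem_nhdsGT hr] with ε hε _
        refine Subset.trans ?_ hrI
        rw [Real.closedBall_eq_Icc]
        exact Icc_subset_Icc (by linarith [hε.2]) (by linarith [hε.2])
      · simp [hm]
    obtain ⟨ε, h1, h2, h3⟩ := (hpos.and ((eventually_isolated hM m).and hint)).exists
    exact ⟨ε, h1, h2, h3⟩
  choose ε hε hε1 hε2 using hiso
  refine ⟨fun m => (η (m - ε m))⁻¹ * η (m + ε m), ?_, ?_⟩
  · intro c hc hcM
    filter_upwards [self_mem_nhdsWithin, mem_nhdsWithin_of_mem_nhds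
      (Icc_mem_nhds (show c - ε c < c by linarith [hε c]) (show c < c + ε c by linarith [hε c]))]
      with c' hc' hcε
    have hno : ∀ m ∈ M, m ∉ Icc (c - ε c) (c + ε c) := by
      intro m hm hmI
      rcases hε1 c m hm (fun hmc => hcM (hmc ▸ hm)) with h' | h'
      exacts [h'.not_ge hmI.1, h'.not_ge hmI.2]
    rcases le_total c c' with hle | hle
    · exact (h c c' hle (hI.out hc hc') fun m hm hmI =>
        hno m hm ⟨by linarith [hmI.1, hε c], hmI.2.trans hcε.2⟩).symm
    · exact h c' c hle (hI.out hc' hc) fun m hm hmI =>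
        hno m hm ⟨hcε.1.trans hmI.1, by linarith [hmI.2, hε c]⟩
  · intro m hm hmI
    have h1 : ∀ᶠ a in 𝓝[<] m, a ∈ Ioo (m - ε m) m := Ioo_mem_nhdsLT (by linarith [hε m])
    have h2 : ∀ᶠ b in 𝓝[>] m, b ∈ Ioo m (m + ε m) := Ioo_mem_nhdsGT (by linarith [hε m])
    filter_upwards [h1.prod_mk h2] with p hp
    have e1 : η (m - ε m) = η p.1 := by
      refine h _ _ hp.1.1.le (Subset.trans (Icc_subset_Icc le_rfl
        (by linarith [hp.1.2, hε m])) (hε2 m hmI)) fun t ht htI => ?_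
      rcases hε1 m t ht (by rintro rfl; linarith [htI.2, hp.1.2]) with h' | h'
      · exact h'.not_ge htI.1
      · linarith [htI.2, hp.1.2, hε m]
    have e2 : η p.2 = η (m + ε m) := by
      refine h _ _ hp.2.2.le (Subset.trans (Icc_subset_Icc
        (by linarith [hp.2.1, hε m]) le_rfl) (hε2 m hmI)) fun t ht htI => ?_
      rcases hε1 m t ht (by rintro rfl; linarith [htI.1, hp.2.1]) with h' | h'
      · linarith [htI.1, hp.2.1, hε m]
      · exact h'.not_ge htI.2
    rw [e1, e2, mul_inv_cancel_left]

lemma IsStepOn.eq_of_forall_eq_one {I : Set ℝ} {M : Finset ℝ} {g η : ℝ → G}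
    (h : IsStepOn I M g η) (hg : ∀ m ∈ M, g m = 1) {a b : ℝ} (hab : a ≤ b) (hI : Icc a b ⊆ I)
    (ha : a ∉ M) (hb : b ∉ M) : η a = η b := by
  classical
  rw [h.eq_mul_prod ((M.filter (· ∈ Ioo a b)).sort (· ≤ ·)) a b hab hI ha hb
    (Finset.sortedLT_sort _) (by simp), List.prod_eq_one, mul_one]
  intro x hx
  obtain ⟨m, hm, rfl⟩ := List.mem_map.1 hx
  exact hg m (Finset.mem_filter.1 ((Finset.mem_sort _).1 hm)).1

lemma List_prod_map_sort {H : Type*} [CommMonoid H] (M : Finset ℝ) (g : ℝ → H) :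
    ((M.sort (· ≤ ·)).map g).prod = ∏ m ∈ M, g m := by
  rw [← List.prod_toFinset g (Finset.sort_nodup _ _), Finset.sort_toFinset]

end Step

section

variable {X : Type*} [TopologicalSpace X]

/-- The value at a path of the composite with a homomorphism of groups. -/
def PathHom.map {G H : Type*} [Group G] [Group H] (F : PathHom X G) (φ : G →* H) :
    PathHom X H where
  val p := φ (F.val p)
  trans p q := by rw [F.trans, map_mul]
  homotopic h := by rw [F.homotopic h]

variable [CWComplex (univ : Set X)] [T2Space X]

/-- A function on the 0-cells that takes the same value at both ends of each 1-cell is constant. -/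
lemma eq_of_forall_edge [ConnectedSpace X] (K : FiniteTwoComplex X) {G : Type*} [Group G]
    {p : Cell X 0 → G} (hp : ∀ e v v', edgePt e (-1) = vert v → edgePt e 1 = vert v' → p v = p v')
    (v v' : Cell X 0) : p v = p v' := by
  have := pathConnectedSpace (X := X)
  let F : PathHom X G := ⟨fun _ => 1, fun _ _ => (one_mul 1).symm, fun _ => rfl⟩
  obtain ⟨h, hF, hv⟩ := F.exists_isFlat K p fun e v v' h1 h2 => by
    rw [hp e v v' h1 h2, inv_mul_cancel]
    rfl
  have := hF.val_eq K (PathConnectedSpace.somePath (vert v) (vert v'))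
  rw [hv, hv] at this
  exact inv_mul_eq_one.1 this.symm

/-- A family of functions on the open 1-cells comes from a function on the whole space. -/
lemma exists_edge_extension {β : Type*} [Nonempty β] (φ : Cell X 1 → ℝ → β) :
    ∃ Φ : X → β, ∀ e, ∀ c ∈ Ioo (-1 : ℝ) 1, Φ (edgePt e c) = φ e c := by
  classical
  refine ⟨fun x => if h : ∃ q : Cell X 1 × ℝ, q.2 ∈ Ioo (-1 : ℝ) 1 ∧ x = edgePt q.1 q.2 then
    φ h.choose.1 h.choose.2 else Classical.arbitrary β, fun e c hc => ?_⟩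
  have h : ∃ q : Cell X 1 × ℝ, q.2 ∈ Ioo (-1 : ℝ) 1 ∧ edgePt e c = edgePt q.1 q.2 :=
    ⟨(e, c), hc, rfl⟩
  beta_reduce
  rw [dif_pos h]
  obtain ⟨h1, h2⟩ := edgePt_injective hc h.choose_spec.1 h.choose_spec.2
  rw [← h1, ← h2]

end

namespace ChordSystem

variable {X : Type*} [TopologicalSpace X] [CWComplex (univ : Set X)] [T2Space X]
  {K : FiniteTwoComplex X} {Q : ChordSystem K} {P : Set X} {d : Cell X 2}

lemma vert_mem_compl_graph (hP : Q.IsSaturated P) (v : Cell X 0) : vert v ∈ (Q.graph P)ᶜ :=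
  fun h => vert_notMem_points v
    (hP.subset ((hP.mem_graph_iff_of_mem_oneSkel (vert_mem_oneSkel v)).1 h))

variable {G : Type*} [Group G] {ψ : X → G}

/-- A function that is constant along connected subsets of the complement of the graph is, along each
1-cell, a step function whose marks are the vertices of the graph. -/
lemma exists_isStepOn_edgePt (hP : Q.IsSaturated P)
    (hψ : ∀ S : Set X, IsPreconnected S → S ⊆ (Q.graph P)ᶜ → ∀ x ∈ S, ∀ y ∈ S, ψ x = ψ y)
    (e : Cell X 1) : ∃ g, IsStepOn (Icc (-1) 1) {c | c ∈ Q.marks e ∧ edgePt e c ∈ P} g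
      fun c => ψ (edgePt e c) := by
  refine exists_isStepOn_of_forall_eq ordConnected_Icc
    ((Q.marks e).finite_toSet.subset fun c hc => hc.1) fun a b hab hI hM => ?_
  refine hψ (edgePt e '' Icc a b) (isPreconnected_Icc.image _ ((edgePt_continuousOn e).mono hI)) ?_
    _ (mem_image_of_mem _ (left_mem_Icc.2 hab)) _ (mem_image_of_mem _ (right_mem_Icc.2 hab))
  rintro _ ⟨c, hc, rfl⟩ hcg
  rw [hP.mem_graph_iff_of_mem_oneSkel (edgePt_mem_oneSkel e (hI hc))] at hcg
  obtain ⟨e', c', hc', he⟩ := hP.subset hcg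
  have hcI : c ∈ Ioo (-1 : ℝ) 1 := by
    refine ⟨lt_of_le_of_ne (hI hc).1 ?_, lt_of_le_of_ne (hI hc).2 ?_⟩
    · rintro rfl
      obtain ⟨v, hv⟩ := (exists_vert_eq_edgePt e).1
      rw [hv] at hcg
      exact vert_notMem_points v (hP.subset hcg)
    · rintro rfl
      obtain ⟨v, hv⟩ := (exists_vert_eq_edgePt e).2
      rw [hv] at hcg
      exact vert_notMem_points v (hP.subset hcg)
  obtain ⟨rfl, rfl⟩ := edgePt_injective hcI (Q.marks_mem e' c' hc') he
  exact hM c ⟨hc', hcg⟩ hc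

/-- The two ends of a chord of the graph, moved slightly to the same side, are joined off the
graph. -/
lemma eventually_eq_parallel (hP : Q.IsSaturated P)
    (hψ : ∀ S : Set X, IsPreconnected S → S ⊆ (Q.graph P)ᶜ → ∀ x ∈ S, ∀ y ∈ S, ψ x = ψ y)
    {t : ℝ} (ht : t ∈ Q.timesIn P d) (htσ : t < Q.mate d t) : ∀ᶠ ε in 𝓝[>] (0 : ℝ),
      ψ (bdPt K d (t + ε)) = ψ (bdPt K d (Q.mate d t - ε)) ∧
        ψ (bdPt K d (t - ε)) = ψ (bdPt K d (Q.mate d t + ε)) := by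
  have hL := length_pos ht.1
  have h1 := timesIn_subset ht
  have h2 := timesIn_subset ((hP.isNoncrossing d).mem t ht)
  have harc : ∀ u v : ℝ, 0 < u → u ≤ v → v < (K.boundary d).length →
      Disjoint ((K.boundary d).tentArc u v) ((K.boundary d).tents (Q.timesIn P d) (Q.mate d)) →
      ψ (bdPt K d u) = ψ (bdPt K d v) := by
    intro u v hu huv hv hdis
    have hsub := BoundaryPath.tentArc_subset_closedBall hL hu hv
    refine hψ (chi 2 d '' (K.boundary d).tentArc u v)
      ((BoundaryPath.isPreconnected_tentArc u v).image _ ((chi_continuousOn 2 d).mono hsub)) ?_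
      _ (mem_image_of_mem _ (BoundaryPath.left_mem_tentArc huv hu hv))
      _ (mem_image_of_mem _ (BoundaryPath.right_mem_tentArc huv hu hv))
    rintro _ ⟨z, hz, rfl⟩ hzg
    exact Set.disjoint_left.1 hdis hz ((hP.disc_mem_graph_iff (hsub hz)).1 hzg)
  have hpos : ∀ᶠ ε in 𝓝[>] (0 : ℝ), ε ∈ Ioo 0 (min (min t ((K.boundary d).length - Q.mate d t))
      ((Q.mate d t - t) / 2)) :=
    Ioo_mem_nhdsGT (lt_min (lt_min h1.1 (by linarith [h2.2])) (by linarith))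
  filter_upwards [hpos, BoundaryPath.eventually_parallel hL (finite_timesIn P d) timesIn_subset
    (hP.isNoncrossing d) ht htσ] with ε hε h
  obtain ⟨hε0, hε⟩ := hε
  rw [lt_min_iff, lt_min_iff] at hε
  exact ⟨harc _ _ (by linarith [h1.1]) (by linarith) (by linarith [h2.2]) h.2.1,
    harc _ _ (by linarith) (by linarith) (by linarith) h.2.2⟩

/-- A point off the graph is joined off the graph to a point of the 1-skeleton. -/
lemma exists_joined_oneSkel (hP : Q.IsSaturated P) {x : X} (hx : x ∈ (Q.graph P)ᶜ) :
    ∃ S, IsPreconnected S ∧ S ⊆ (Q.graph P)ᶜ ∧ x ∈ S ∧ ∃ y ∈ S, y ∈ oneSkel X := by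
  rcases K.mem_cases x with hs | ⟨d, z, hz, rfl⟩
  · exact ⟨{x}, isPreconnected_singleton, singleton_subset_iff.2 hx, rfl, x, rfl, hs⟩
  have hzc := ball_subset_closedBall hz
  suffices h : ∃ S : Set (Fin 2 → ℝ), IsPreconnected S ∧ S ⊆ closedBall 0 1 \ Q.arcs P d ∧ z ∈ S ∧
      ∃ y ∈ S, y ∈ sphere (0 : Fin 2 → ℝ) 1 by
    obtain ⟨S, h1, h2, h3, y, hy, hys⟩ := h
    refine ⟨chi 2 d '' S, h1.image _ ((chi_continuousOn 2 d).mono fun w hw => (h2 hw).1), ?_,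
      mem_image_of_mem _ h3, _, mem_image_of_mem _ hy, sphere_mem_oneSkel hys⟩
    rintro _ ⟨w, hw, rfl⟩ hwg
    exact (h2 hw).2 ((hP.disc_mem_graph_iff (h2 hw).1).1 hwg)
  rcases Nat.eq_zero_or_pos (K.boundary d).length with hL | hL
  · refine ⟨closedBall 0 1, (convex_closedBall _ _).isPreconnected, fun w hw => ⟨hw, fun h => ?_⟩,
      hzc, fun _ => 1, ?_, ?_⟩
    · obtain ⟨t, ht, -⟩ := BoundaryPath.mem_tents_iff.1 h
      exact (length_pos ht.1).ne' hL
    all_goals simp [pi_norm_const]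
  · obtain ⟨r, hr, -, S, h1, h2, h3, h4⟩ := BoundaryPath.exists_joined_param hL (finite_timesIn P d)
      timesIn_subset (hP.isNoncrossing d) hzc fun h => hx ((hP.disc_mem_graph_iff hzc).2 h)
    exact ⟨S, h1, h2, h3, _, h4, BoundaryPath.param_mem_sphere hL hr⟩

/-- The function `J` takes the same value at both ends of each chord. -/
def IsInvariant (Q : ChordSystem K) {β : Type*} (J : X → β) : Prop :=
  ∀ d, ∀ s ∈ Q.times d, J (bdPt K d (Q.mate d s)) = J (bdPt K d s)

/-- The 1-cochain whose value on a 1-cell is the sum of the values of `J` at its marked points is the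
coboundary of a 0-cochain. -/
def IsCoboundary (Q : ChordSystem K) (J : X → ZMod 2) : Prop :=
  ∃ p : Cell X 0 → ZMod 2, ∀ e v v', edgePt e (-1) = vert v → edgePt e 1 = vert v' →
    p v' = p v + ∑ c ∈ Q.marks e, J (edgePt e c)

/-- If no nonzero invariant function supported on `P` is a coboundary modulo 2, then the graph with
vertex set `P` does not separate. -/
theorem isConnected_compl_graph [ConnectedSpace X] (hP : Q.IsSaturated P)
    (h : ∀ J : X → ZMod 2, Q.IsInvariant J → (∀ x, x ∉ P → J x = 0) → Q.IsCoboundary J →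
      ∀ x ∈ P, J x = 0) : IsConnected (Q.graph P)ᶜ := by
  classical
  obtain ⟨v₀⟩ := K.exists_vert
  have hv₀ := vert_mem_compl_graph hP v₀
  -- the indicator function of the component `C` of a vertex is a step function along the 1-cells
  set C := connectedComponentIn (Q.graph P)ᶜ (vert v₀) with hC
  suffices hsub : (Q.graph P)ᶜ ⊆ C by
    rw [(hsub.antisymm (connectedComponentIn_subset _ _) : (Q.graph P)ᶜ = C)]
    exact isConnected_connectedComponentIn_iff.2 hv₀
  let ψ : X → Multiplicative (ZMod 2) := fun x => Multiplicative.ofAdd (if x ∈ C then 1 else 0)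
  have hψ1 : ∀ x, ψ x = ψ (vert v₀) → x ∈ C := by
    intro x hx
    have h0 : vert v₀ ∈ C := mem_connectedComponentIn hv₀
    by_contra hxC
    simp only [ψ, if_pos h0, if_neg hxC] at hx
    exact absurd (Multiplicative.ofAdd.injective hx) (by decide)
  have hψ : ∀ S : Set X, IsPreconnected S → S ⊆ (Q.graph P)ᶜ → ∀ x ∈ S, ∀ y ∈ S, ψ x = ψ y := by
    have key : ∀ S : Set X, IsPreconnected S → S ⊆ (Q.graph P)ᶜ → ∀ x ∈ S, ∀ y ∈ S, x ∈ C →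
        y ∈ C := by
      intro S hS hSW x hx y hy hxC
      rw [hC, connectedComponentIn_eq hxC]
      exact hS.subset_connectedComponentIn hx hSW hy
    intro S hS hSW x hx y hy
    have : x ∈ C ↔ y ∈ C := ⟨key S hS hSW x hx y hy, key S hS hSW y hy x hx⟩
    simp only [ψ, this]
  choose g hg using exists_isStepOn_edgePt hP hψ
  have hself : ∀ a : Multiplicative (ZMod 2), a⁻¹ = a := by decide
  obtain ⟨Φ, hΦ⟩ := exists_edge_extension g
  -- the jumps at the two ends of a chord agree
  let J : X → Multiplicative (ZMod 2) := fun x => if x ∈ P then Φ x else 1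
  have hjump : ∀ d, ∀ t ∈ Q.timesIn P d, ∀ᶠ ε in 𝓝[>] (0 : ℝ),
      ψ (bdPt K d (t + ε)) = ψ (bdPt K d (t - ε)) * J (bdPt K d t) := by
    intro d t ht
    obtain ⟨k, hk, hm⟩ := ht.1
    have hval : ∀ r ∈ Ioo (k : ℝ) (k + 1), bdPt K d r =
        edgePt ((K.boundary d).edge k) ((K.boundary d).coord k r) := fun r hr =>
      BoundaryPath.disc_param_eq k (Ioo_subset_Icc_self hr)
    have hcI := BoundaryPath.coord_mem_Ioo (B := K.boundary d) k hk
    have htP : edgePt ((K.boundary d).edge k) ((K.boundary d).coord k t) ∈ P := by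
      rw [← hval t hk]
      exact ht.2
    have := BoundaryPath.eventually_coord_jump (hg ((K.boundary d).edge k)) hk ⟨hm, htP⟩
      (by rw [interior_Icc]; exact hcI)
    have hIoo : ∀ᶠ s in 𝓝 t, s ∈ Ioo (k : ℝ) (k + 1) := isOpen_Ioo.mem_nhds hk
    filter_upwards [(tendsto_sub_add_nhdsGT_zero t).eventually (this.and
      ((hIoo.filter_mono (nhdsWithin_le_nhds (s := Iio t))).prod_mk
        (hIoo.filter_mono (nhdsWithin_le_nhds (s := Ioi t)))))] with ε hε
    obtain ⟨h1, h2, h3⟩ := hε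
    rw [hself, ite_self] at h1
    rw [hval _ h2, hval _ h3, hval t hk]
    simp only [J, if_pos htP, hΦ _ _ hcI]
    exact h1
  have hJ : Q.IsInvariant J := by
    have key : ∀ d, ∀ t ∈ Q.timesIn P d, t < Q.mate d t →
        J (bdPt K d (Q.mate d t)) = J (bdPt K d t) := by
      intro d t ht htσ
      obtain ⟨ε, h1, h2, h3⟩ := ((hjump d t ht).and ((hjump d _ ((hP.isNoncrossing d).mem t ht)).and
        (eventually_eq_parallel hP hψ ht htσ))).exists
      rw [← inv_mul_eq_iff_eq_mul, hself] at h1 h2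
      rw [← h1, ← h2, h3.1, h3.2, mul_comm]
    intro d s hs
    by_cases hsP : bdPt K d s ∈ P
    · have hN := hP.isNoncrossing d
      have hs' : s ∈ Q.timesIn P d := ⟨hs, hsP⟩
      rcases lt_or_gt_of_ne (hN.ne s hs') with hlt | hlt
      · have := key d _ (hN.mem s hs') (by rwa [hN.invol s hs'])
        rw [hN.invol s hs'] at this
        exact this.symm
      · exact key d s hs' hlt
    · have hsP' : bdPt K d (Q.mate d s) ∉ P := fun h' => hsP (by
        have := hP.mate d _ ((Q.isNoncrossing d).mem s hs) h'
        rwa [(Q.isNoncrossing d).invol s hs] at this)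
      simp only [J, if_neg hsP, if_neg hsP']
  have hgJ : ∀ e, ∀ c ∈ Q.marks e, edgePt e c ∈ P → g e c = J (edgePt e c) := by
    intro e c hc hcP
    simp only [J, if_pos hcP, hΦ e c (Q.marks_mem e c hc)]
  have hfil : ∀ e, (((Q.marks e).filter fun c => edgePt e c ∈ P : Finset ℝ) : Set ℝ) =
      {c | c ∈ Q.marks e ∧ edgePt e c ∈ P} := fun e => by ext; simp
  have hg' : ∀ e, IsStepOn (Icc (-1) 1) ((Q.marks e).filter fun c => edgePt e c ∈ P : Finset ℝ)
      (g e) fun c => ψ (edgePt e c) := fun e => by rw [hfil]; exact hg e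
  have hcob : Q.IsCoboundary fun x => Multiplicative.toAdd (J x) := by
    refine ⟨fun v => Multiplicative.toAdd (ψ (vert v)), fun e v v' h1 h2 => ?_⟩
    have := (hg' e).eq_mul_prod_sort (a := -1) (b := 1) (by norm_num) subset_rfl
      fun m hm => Q.marks_mem e m (Finset.mem_filter.1 hm).1
    rw [List_prod_map_sort, Finset.prod_filter] at this
    beta_reduce
    rw [← h1, ← h2, this, toAdd_mul, toAdd_prod]
    congr 1
    refine Finset.sum_congr rfl fun c hc => ?_
    split_ifs with hcP
    · rw [hgJ e c hc hcP]
    · simp only [J, if_neg hcP]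
  have hJ1 : ∀ x ∈ P, J x = 1 := fun x hx => Multiplicative.toAdd.injective
    (h (fun x => Multiplicative.toAdd (J x)) (fun d s hs => congrArg _ (hJ d s hs))
      (fun x hx => by simp only [J, if_neg hx]; rfl) hcob x hx)
  have hg1 : ∀ e, ∀ m ∈ (Q.marks e).filter fun c => edgePt e c ∈ P, g e m = 1 := by
    intro e m hm
    rw [Finset.mem_filter] at hm
    rw [hgJ e m hm.1 hm.2, hJ1 _ hm.2]
  -- without jumps, the indicator function is constant
  have hvert : ∀ v, ψ (vert v) = ψ (vert v₀) := fun v => by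
    refine eq_of_forall_edge K (p := fun v => ψ (vert v)) (fun e v v' h1 h2 => ?_) v v₀
    rw [← h1, ← h2]
    have hout : ∀ c, c ∉ Ioo (-1 : ℝ) 1 → c ∉ (Q.marks e).filter fun c => edgePt e c ∈ P :=
      fun c hc hcM => hc (Q.marks_mem e c (Finset.mem_filter.1 hcM).1)
    exact (hg' e).eq_of_forall_eq_one (hg1 e) (by norm_num) subset_rfl (hout _ (by simp))
      (hout _ (by simp))
  intro x hx
  obtain ⟨S, hS, hSW, hxS, y, hyS, hy⟩ := exists_joined_oneSkel hP hx
  refine hψ1 x ((hψ S hS hSW x hxS y hyS).trans ?_)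
  obtain ⟨v, rfl⟩ | ⟨e, c, hc, rfl⟩ := hy
  · exact hvert v
  · obtain ⟨v, hv⟩ := (exists_vert_eq_edgePt e).1
    rw [← hvert v, ← hv]
    refine ((hg' e).eq_of_forall_eq_one (hg1 e) hc.1.le (Icc_subset_Icc le_rfl hc.2.le)
      (fun h' => ?_) fun h' => ?_).symm
    · exact (Q.marks_mem e _ (Finset.mem_filter.1 h').1).1.false
    · exact hSW hyS (Or.inl (Finset.mem_filter.1 h').2)

end ChordSystem

/-! ### A surjection gives non-separating cocycles -/

/-- If `n` is at most the dimension of a quotient of a space of functions on a finite set, then the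
indicator functions of some `n` points have linearly independent images in the quotient. -/
lemma exists_linearIndependent_mkQ_single {k T : Type*} [Field k] [Finite T] [DecidableEq T]
    (B : Submodule k (T → k)) {n : ℕ} (c : (Fin n → k) →ₗ[k] T → k)
    (hc : ∀ φ, c φ ∈ B → φ = 0) :
    ∃ a : Fin n → T, LinearIndependent k fun i => B.mkQ (Pi.single (a i) 1) := by
  obtain ⟨κ, a, ha, hspan, hind⟩ :=
    exists_linearIndependent' k fun t : T => B.mkQ (Pi.single t 1)
  have : Finite κ := Finite.of_injective a ha
  have := Fintype.ofFinite κ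
  have htop : Submodule.span k (range fun t : T => B.mkQ (Pi.single t 1)) = ⊤ := by
    have h1 := (Pi.basisFun k T).span_eq
    have h2 := congrArg (Submodule.map B.mkQ) h1
    rw [Submodule.map_span, ← range_comp, Submodule.map_top, Submodule.range_mkQ] at h2
    rw [← h2]
    congr 2
    funext t
    simp
  have hcard : Module.finrank k ((T → k) ⧸ B) = Fintype.card κ := by
    rw [← finrank_span_eq_card hind, hspan, htop, finrank_top]
  have hinj : Function.Injective (B.mkQ ∘ₗ c) := by
    rw [← LinearMap.ker_eq_bot, LinearMap.ker_eq_bot']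
    intro φ hφ
    refine hc φ ?_
    rwa [LinearMap.comp_apply, Submodule.mkQ_apply, Submodule.Quotient.mk_eq_zero] at hφ
  have hle := LinearMap.finrank_le_finrank_of_injective hinj
  rw [hcard, Module.finrank_fin_fun] at hle
  obtain ⟨i⟩ := Function.Embedding.nonempty_of_card_le (α := Fin n) (β := κ) (by simpa using hle)
  exact ⟨a ∘ i, hind.comp i i.injective⟩

section Track

variable {X : Type*} [TopologicalSpace X] [CWComplex (univ : Set X)] [T2Space X]
  {K : FiniteTwoComplex X}

namespace ChordSystem

/-- The classes of marked points under the relation generated by the chords; they correspond to the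
components of the graph formed by all chords. -/
def Track (Q : ChordSystem K) : Type _ :=
  Quot fun x y : Q.points => ∃ d, ∃ s ∈ Q.times d, (x : X) = bdPt K d s ∧
    (y : X) = bdPt K d (Q.mate d s)

variable {Q : ChordSystem K}

/-- The track through a marked point. -/
def track {x : X} (hx : x ∈ Q.points) : Q.Track := Quot.mk _ ⟨x, hx⟩

lemma exists_track_eq (τ : Q.Track) : ∃ x, ∃ hx : x ∈ Q.points, track hx = τ := by
  obtain ⟨⟨x, hx⟩, h⟩ := Quot.exists_rep τ
  exact ⟨x, hx, h⟩

lemma track_mate {d : Cell X 2} {s : ℝ} (hs : s ∈ Q.times d) :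
    track (bdPt_mem_points ((Q.isNoncrossing d).mem s hs)) = track (bdPt_mem_points hs) :=
  (Quot.sound ⟨d, s, hs, rfl, rfl⟩).symm

lemma IsInvariant.exists_eq_track {β : Type*} {J : X → β} (hJ : Q.IsInvariant J) :
    ∃ j : Q.Track → β, ∀ x, ∀ hx : x ∈ Q.points, j (track hx) = J x := by
  refine ⟨Quot.lift (fun x => J x) ?_, fun x hx => rfl⟩
  rintro ⟨x, hx⟩ ⟨y, hy⟩ ⟨d, s, hs, rfl, rfl⟩
  exact (hJ d s hs).symm

lemma finite_points : Q.points.Finite := by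
  have := K.finite_cell 1
  refine (Set.finite_iUnion fun e => (Q.marks e).finite_toSet.image (edgePt e)).subset ?_
  rintro x ⟨e, c, hc, rfl⟩
  exact mem_iUnion.2 ⟨e, c, hc, rfl⟩

instance : Finite Q.Track := by
  have := finite_points (Q := Q).to_subtype
  exact Finite.of_surjective _ Quot.mk_surjective

/-- The marked points on a track. -/
def trackSet (τ : Q.Track) : Set X := {x | ∃ hx : x ∈ Q.points, track hx = τ}

lemma trackSet_nonempty (τ : Q.Track) : (trackSet τ).Nonempty := exists_track_eq τ

lemma isSaturated_trackSet (τ : Q.Track) : Q.IsSaturated (trackSet τ) where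
  subset _ hx := hx.1
  mate d s hs h := by
    obtain ⟨_, rfl⟩ := h
    exact ⟨_, track_mate hs⟩

lemma disjoint_trackSet {τ τ' : Q.Track} (h : τ ≠ τ') : Disjoint (trackSet τ) (trackSet τ') := by
  rw [Set.disjoint_left]
  rintro x ⟨hx, rfl⟩ ⟨_, h'⟩
  exact h h'

open Classical in
/-- A function on the tracks as a function on `X`, zero off the marked points. -/
def ofTrack (j : Q.Track → ZMod 2) (x : X) : ZMod 2 :=
  if hx : x ∈ Q.points then j (track hx) else 0

lemma ofTrack_apply (j : Q.Track → ZMod 2) {x : X} (hx : x ∈ Q.points) :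
    ofTrack j x = j (track hx) := dif_pos hx

lemma edgePt_mem_points {e : Cell X 1} {c : ℝ} (hc : c ∈ Q.marks e) : edgePt e c ∈ Q.points :=
  ⟨e, c, hc, rfl⟩

/-- The functions on the tracks that are coboundaries modulo 2. -/
def coboundaries (Q : ChordSystem K) : Submodule (ZMod 2) (Q.Track → ZMod 2) where
  carrier := {j | Q.IsCoboundary (ofTrack j)}
  add_mem' := by
    rintro j j' ⟨p, hp⟩ ⟨p', hp'⟩
    refine ⟨p + p', fun e v v' h1 h2 => ?_⟩
    have : ∀ c ∈ Q.marks e, ofTrack (j + j') (edgePt e c) =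
        ofTrack j (edgePt e c) + ofTrack j' (edgePt e c) := fun c hc => by
      simp only [ofTrack_apply _ (edgePt_mem_points hc), Pi.add_apply]
    rw [Pi.add_apply, Pi.add_apply, hp e v v' h1 h2, hp' e v v' h1 h2, Finset.sum_congr rfl this,
      Finset.sum_add_distrib]
    ring
  zero_mem' := by
    refine ⟨0, fun e v v' _ _ => ?_⟩
    rw [Finset.sum_eq_zero fun c hc => ofTrack_apply 0 (edgePt_mem_points hc)]
    rfl
  smul_mem' := by
    rintro a j ⟨p, hp⟩
    refine ⟨a • p, fun e v v' h1 h2 => ?_⟩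
    have : ∀ c ∈ Q.marks e, ofTrack (a • j) (edgePt e c) = a * ofTrack j (edgePt e c) :=
      fun c hc => by simp only [ofTrack_apply _ (edgePt_mem_points hc), Pi.smul_apply, smul_eq_mul]
    rw [Pi.smul_apply, Pi.smul_apply, hp e v v' h1 h2, Finset.sum_congr rfl this,
      ← Finset.mul_sum, smul_eq_mul, smul_eq_mul, mul_add]

open Classical in
/-- Tracks that are linearly independent modulo coboundaries do not separate. -/
theorem hasNonseparatingCocycles_of_linearIndependent [ConnectedSpace X] {n : ℕ}
    (a : Fin n → Q.Track)
    (ha : LinearIndependent (ZMod 2) fun i => Q.coboundaries.mkQ (Pi.single (a i) 1)) :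
    HasNonseparatingCocycles X n := by
  have hinj : Function.Injective a := fun i i' h => ha.injective (by simp only [h])
  refine ⟨fun i => regularCocycle (isSaturated_trackSet (a i)) (trackSet_nonempty (a i)),
    fun i i' hii => (isSaturated_trackSet (a i)).disjoint_graph (isSaturated_trackSet (a i'))
      (disjoint_trackSet (hinj.ne hii)), ?_⟩
  change IsConnected (⋃ i, Q.graph (trackSet (a i)))ᶜ
  rw [← graph_iUnion]
  refine isConnected_compl_graph (.iUnion fun i => isSaturated_trackSet (a i))
    fun J hJ hJP hcob => ?_
  obtain ⟨j, hj⟩ := hJ.exists_eq_track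
  have hjJ : ofTrack j = J := by
    funext x
    by_cases hx : x ∈ Q.points
    · rw [ofTrack_apply j hx, hj]
    · rw [ofTrack, dif_neg hx, hJP]
      intro h
      obtain ⟨i, hi⟩ := mem_iUnion.1 h
      exact hx hi.1
  have hjB : j ∈ Q.coboundaries := by
    change Q.IsCoboundary (ofTrack j)
    rwa [hjJ]
  have hsum : j = ∑ i, j (a i) • Pi.single (a i) (1 : ZMod 2) := by
    funext τ
    rw [Finset.sum_apply]
    by_cases hτ : ∃ i, a i = τ
    · obtain ⟨i, rfl⟩ := hτ
      rw [Finset.sum_eq_single i _ (by simp)]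
      · simp
      · intro i' _ hi'
        simp [hinj.ne hi'.symm]
    · obtain ⟨x, hx, rfl⟩ := exists_track_eq τ
      rw [hj, hJP, Finset.sum_eq_zero]
      · intro i _
        have : track hx ≠ a i := fun h => hτ ⟨i, h.symm⟩
        simp [this]
      · intro h
        obtain ⟨i, _, hi⟩ := mem_iUnion.1 h
        exact hτ ⟨i, hi.symm⟩
  have h0 : ∑ i, j (a i) • Q.coboundaries.mkQ (Pi.single (a i) 1) = 0 := by
    have := (Submodule.Quotient.mk_eq_zero Q.coboundaries).2 hjB
    rw [← Submodule.mkQ_apply, hsum, map_sum] at this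
    simpa only [map_smul] using this
  intro x hx
  obtain ⟨i, hxQ, hi⟩ := mem_iUnion.1 hx
  rw [← hj x hxQ, hi]
  exact Fintype.linearIndependent_iff.1 ha _ h0 i

end ChordSystem

end Track

section Converse

variable {X : Type*} [TopologicalSpace X] [CWComplex (univ : Set X)] [T2Space X]

/-- The chords that join the letters cancelling each other along the boundaries of the 2-cells.  Both
ends of a chord carry the same generator. -/
theorem IsMarking.exists_chordSystem {ι : Type*} [Nonempty ι] {F : PathHom X (FreeGroup ι)}
    {M : Cell X 1 → Finset ℝ} {f : Cell X 1 → ℝ → ι × Bool} (h : IsMarking F M f)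
    (K : FiniteTwoComplex X) : ∃ (Q : ChordSystem K) (idx : X → ι), (∀ e, Q.marks e = M e) ∧
      Q.IsInvariant idx ∧ ∀ e, ∀ c ∈ M e, idx (edgePt e c) = (f e c).1 := by
  have hMI : ∀ e, ∀ m ∈ M e, m ∈ Ioo (-1 : ℝ) 1 := fun e m hm =>
    ⟨by linarith [(h.mem e m hm).1], by linarith [(h.mem e m hm).2]⟩
  obtain ⟨ℓ, hℓ⟩ := exists_edge_extension f
  choose mate hN hmate using fun d => h.exists_isNoncrossing (K.boundary d)
  have hval : ∀ d, ∀ k : Fin (K.boundary d).length, ∀ s ∈ Ioo (k : ℝ) (k + 1),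
      ℓ (chi 2 d ((K.boundary d).param s)) =
        f ((K.boundary d).edge k) ((K.boundary d).coord k s) := fun d k s hs => by
    rw [BoundaryPath.disc_param_eq k (Ioo_subset_Icc_self hs),
      hℓ _ _ (BoundaryPath.coord_mem_Ioo k hs)]
  let dir : X → ℤˣ := fun x => if (ℓ x).2 then 1 else -1
  have hdir : ∀ x, ((dir x : ℤ) : ℝ) = letterSign (ℓ x) := fun x => by
    simp only [dir, letterSign]
    split_ifs <;> simp
  refine ⟨⟨M, hMI, dir, mate, hN, fun d s hs => ?_⟩, fun x => (ℓ x).1, fun e => rfl,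
    fun d s hs => ?_, fun e c hc => congrArg Prod.fst (hℓ e c (hMI e c hc))⟩
  · obtain ⟨k, hk, -⟩ := id hs
    obtain ⟨k', hk', -⟩ := (hN d).mem s hs
    rw [BoundaryPath.turn_eq hk, BoundaryPath.turn_eq hk', hdir, hdir, hval d k s hk,
      hval d k' _ hk']
    exact (hmate d s hs k k' hk hk').2
  · obtain ⟨k, hk, -⟩ := id hs
    obtain ⟨k', hk', -⟩ := (hN d).mem s hs
    change (ℓ (chi 2 d _)).1 = (ℓ (chi 2 d _)).1
    rw [hval d k s hk, hval d k' _ hk']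
    exact (hmate d s hs k k' hk hk').1

/-- A surjection of the fundamental group onto a free group gives as many disjoint cocycles as its
rank, that together do not separate. -/
theorem hasNonseparatingCocycles_of_surjective [ConnectedSpace X] (K : FiniteTwoComplex X) (b : X)
    {n : ℕ} (f : FundamentalGroup X b →* FreeGroup (Fin n)) (hf : Function.Surjective f) :
    HasNonseparatingCocycles X n := by
  classical
  rcases n.eq_zero_or_pos with rfl | hn
  · exact ⟨Fin.elim0, fun i => i.elim0, by simpa using isConnected_univ⟩
  have : Nonempty (Fin n) := ⟨⟨0, hn⟩⟩
  have := pathConnectedSpace (X := X)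
  obtain ⟨F, hF⟩ := exists_pathHom_of_monoidHom f
  obtain ⟨M, l, hM⟩ := exists_isMarking F
  obtain ⟨Q, idx, hQM, hinv, hidx⟩ := hM.exists_chordSystem K
  obtain ⟨i, hi⟩ := hinv.exists_eq_track
  suffices h : ∀ φ, LinearMap.funLeft (ZMod 2) (ZMod 2) i φ ∈ Q.coboundaries → φ = 0 by
    obtain ⟨a, ha⟩ := exists_linearIndependent_mkQ_single Q.coboundaries _ h
    exact ChordSystem.hasNonseparatingCocycles_of_linearIndependent a (by convert ha)
  intro φ hφ
  -- a coboundary means that the homomorphism to `ZMod 2` given by `φ` vanishes on the image of `f`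
  obtain ⟨p, hp⟩ := hφ
  let Φ : FreeGroup (Fin n) →* Multiplicative (ZMod 2) :=
    FreeGroup.lift fun i => Multiplicative.ofAdd (φ i)
  have hself : ∀ a : Multiplicative (ZMod 2), a⁻¹ = a := by decide
  have hΦ : ∀ x : Fin n × Bool, Φ (FreeGroup.mk [x]) = Multiplicative.ofAdd (φ x.1) := by
    rintro ⟨i, b⟩
    cases b <;> simp [Φ, hself]
  obtain ⟨h, hflat, -⟩ := (F.map Φ).exists_isFlat K (fun v => Multiplicative.ofAdd (p v))
    fun e v v' h1 h2 => by
      change Φ (F.seg (edgePt e) (-1) 1) = _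
      rw [hM.seg_eq, map_list_prod, List.map_map, hp e v v' h1 h2, ofAdd_add, inv_mul_cancel_left,
        ofAdd_sum, hQM]
      rw [List_prod_map_sort]
      refine Finset.prod_congr rfl fun c hc => ?_
      rw [Function.comp_apply, hΦ, ChordSystem.ofTrack_apply _
        (ChordSystem.edgePt_mem_points (by rwa [hQM])), LinearMap.funLeft_apply, hi, hidx e c hc]
  funext m
  obtain ⟨q, hq⟩ := hF b (FreeGroup.of m) (hf _)
  have h1 := hflat.val_eq K q
  rw [inv_mul_cancel] at h1
  change Φ (F.val q) = 1 at h1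
  rw [hq] at h1
  simpa [Φ] using h1

end Converse

end Lackenby

end

theorem theorem3p1 {X : Type*} [TopologicalSpace X] [T2Space X] [ConnectedSpace X]
    [Topology.CWComplex (Set.univ : Set X)] (K : Lackenby.FiniteTwoComplex X) (b : X) (n : ℕ) :
    (Lackenby.HasNonseparatingCocycles X n →
      ∃ f : FundamentalGroup X b →* FreeGroup (Fin n), Function.Surjective f) ∧
    ((∀ x : X, ¬ Lackenby.IsLocallySeparating x) →
      (∀ e : Topology.RelCWComplex.cell (Set.univ : Set X) 1, K.valence e ≠ 1) →
      (∃ f : FundamentalGroup X b →* FreeGroup (Fin n), Function.Surjective f) →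
      Lackenby.HasNonseparatingCocycles X n) :=
  ⟨Lackenby.exists_surjective_of_nonseparating K b, fun _ _ ⟨f, hf⟩ =>
    Lackenby.hasNonseparatingCocycles_of_surjective K b f hf⟩
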